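/- Fix $\alpha>0$. Let $\nu_*=(\alpha+1)\,\alpha^{-\alpha/(\alpha+1)}$, and for $\nu\ge\nu_*$ and $\hbar\in\mathbb C\setminus\{0\}$ consider, on the universal cover $\widetilde{\mathbb C^*}$ of $\mathbb C^*$, $$V(y)=\hbar^{-2}\Big(y^{2\alpha}-\nu+\frac1{y^2}\Big),\qquad U(y)=V(y)-\frac1{4y^2},\qquad F=\frac1{\sqrt V}\Big[V-U+\frac{-4V''V+5V'^2}{16V^2}\Big].$$ Add to $\widetilde{\mathbb C^*}$ the boundary points $0$ and $\infty_k$ ($k\in\mathbb Z$): a curve ends at $0$ if $|y|\to0$, and at $\infty_k$ if $|y|\to\infty$ while eventually $\big|\arg y-\tfrac{\arg\hbar}{\alpha+1}-\tfrac{k\pi}{\alpha+1}\big|\le\tfrac{\pi-\varepsilon}{2\alpha+2}$ for some $\varepsilon>0$ (the $k$-th Stokes sector of the variable $x=\hbar^{-1/(\alpha+1)}y$). A piecewise smooth injective curve $\gamma:(0,1)\to\widetilde{\mathbb C^*}\setminus\{V=0\}$ joining two boundary points, with a continuous branch of $\sqrt V$ along it, is called admissible if $\int_0^1|F(\gamma)||\dot\gamma|\,dt<\infty$,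 $\inf_{0<s\le t<1}\operatorname{Re}\int_s^t\sqrt{V(\gamma)}\,\dot\gamma\,d\tau>-\infty$, and $\operatorname{Re}\int_{t_0}^t\sqrt{V(\gamma)}\,\dot\gamma\,d\tau\to+\infty$ as $t\to1^-$. Along it consider the Volterra equation $$z(t)=1+\int_0^tB(t,s)\,F(\gamma(s))\,\dot\gamma(s)\,z(s)\,ds,\qquad B(t,s)=\tfrac12\Big[e^{-2\int_s^t\sqrt{V(\gamma)}\dot\gamma\,d\tau}-1\Big],$$ for continuous $z:[0,1]\to\mathbb C$ (this is the equation satisfied by the ratio of a solution of $\psi''=U\psi$ to the WKB function $\exp\int(\sqrt V-\frac{V'}{4V})dy$). Given a homotopy class, with fixed boundary end-points $x_a$, $x_b$, of curves from $x_a$ to $x_b$ in $\widetilde{\mathbb C^*}\setminus\{V=0\}$, write $z_{a,b}$ for the number $z(1)$, the same for all admissible curves in the class. The classes used here are: * for $z_{\pm1,0}$: curves from $\infty_{\pm1}$ to $0$ homotopic to the ray $\arg y=\pm\frac{\pi}{\alpha+1}$ (equivalently, curves in the sector $0<\pm\arg y\le\frac{\pi}{\alpha+1}$, which contains no zero of $V$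 and lies on one side of all positive zeros of $V$); * for $z_{1,-1}$ (with $\nu>\nu_*$): curves from $\infty_1$ to $\infty_{-1}$ homotopic to a curve inside $|\arg y|<\frac{\pi}{\alpha+1}$ which crosses the positive real axis once, at $y_*=\alpha^{-1/(2\alpha+2)}$, that is, between the two positive zeros of $V$. Proposition. I) There is a constant $K>0$ depending only on $\alpha$ such that for every $C>0$ there is $\delta>0$ (depending on $\alpha,C$) such that for all $\hbar\neq0$ with $|\hbar|<\delta$, $|\arg\hbar|\le C|\hbar|$ and all $\nu\in[\nu_*,\infty)$: each of the two classes of curves from $\infty_{\pm1}$ to $0$ contains an admissible curve which is a finite concatenation of horizontal ($\operatorname{Im}S$ constant) and vertical ($\operatorname{Re}S$ constant) trajectories, $S=\int\sqrt V\,dy$, and along which $\operatorname{Re}S$ is monotone; along every admissible curve of the class the Volterra equation is solvable and all its solutions have one and the same end-point value $z_{\pm1,0}$, which does not depend on the curve; and $$|z_{\pm1,0}-1|\le K|\hbar|.$$ II) For every $\tilde\nu>\nu_*$ there is $K>0$ depending only on $\alpha,\tilde\nu$ such that for every $C>0$ there is $\delta>0$ (depending on $\alpha,C,\tilde\nu$)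 such that for all $\hbar\ne0$ with $|\hbar|<\delta$, $|\arg\hbar|\le C|\hbar|$ and all $\nu\ge\tilde\nu$ the same holds for the class of curves from $\infty_1$ to $\infty_{-1}$, and $$|z_{1,-1}-1|\le K|\hbar|.$$ -/

import Mathlib

open Filter Topology Set MeasureTheory
open scoped ContDiff

noncomputable section

namespace WKB

/-!
The universal cover of the punctured plane is realised as `ℂ`, a point `ζ` standing for the point
`y = exp ζ` with `log |y| = ζ.re` and `arg y = ζ.im`. A function of `y` on the universal cover is a
function of `ζ`.
-/

/-- The derivative `d/dy = exp (-ζ) d/dζ` of a function on the universal cover. -/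
def coverDeriv (f : ℂ → ℂ) (ζ : ℂ) : ℂ :=
  Complex.exp (-ζ) * deriv f ζ

/-- The rescaled reduced potential `V(y) = ħ⁻² (y^(2α) - ν + y⁻²)`. -/
def reducedPotential (α ν : ℝ) (hbar : ℂ) (ζ : ℂ) : ℂ :=
  (hbar ^ 2)⁻¹ * (Complex.exp (2 * α * ζ) - ν + Complex.exp (-2 * ζ))

/-- The rescaled potential `U(y) = ħ⁻² (y^(2α) - ν + y⁻²) - 1 / (4 y²)`. -/
def potential (α ν : ℝ) (hbar : ℂ) (ζ : ℂ) : ℂ :=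
  reducedPotential α ν hbar ζ - Complex.exp (-2 * ζ) / 4

/-- The WKB forcing term `F = V^(-1/2) (V - U + (-4 V'' V + 5 V'^2) / (16 V^2))`, where
primes are `y`-derivatives and `r` is the chosen value of the square root of `V` at the point. -/
def forcing (U V : ℂ → ℂ) (ζ r : ℂ) : ℂ :=
  (V ζ - U ζ + (-4 * coverDeriv (coverDeriv V) ζ * V ζ + 5 * (coverDeriv V ζ) ^ 2)
    / (16 * (V ζ) ^ 2)) / r

/-- The velocity of the curve `γ = exp ∘ c` in the `y`-plane. -/
def velocity (c : ℝ → ℂ) (t : ℝ) : ℂ :=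
  deriv (fun τ => Complex.exp (c τ)) t

/-- The increment of the action `S = ∫ √V dy` along the curve, between the times `s` and `t`;
`r` is the branch of `√V` along the curve. -/
def actionIncr (c r : ℝ → ℂ) (s t : ℝ) : ℂ :=
  ∫ τ in s..t, r τ * velocity c τ

/-- The kernel `B(γ(t), γ(s)) = (exp (-2 ∫_s^t √V dy) - 1) / 2`. -/
def kernelB (c r : ℝ → ℂ) (t s : ℝ) : ℂ :=
  (Complex.exp (-2 * actionIncr c r s t) - 1) / 2

/-- The boundary points `0` and `∞_k` added to the universal cover. -/
inductive BoundaryPoint : Type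
  | zero : BoundaryPoint
  | infty (k : ℤ) : BoundaryPoint

/-- Convergence to a boundary point, for a function `f` into the universal cover.
The point `∞_k` stands for the `k`-th Stokes sector of the original variable
`x = ħ^(-1/(α+1)) y`, whose argument is `arg y - arg ħ / (α+1)`: converging to it means that the
modulus tends to infinity and that `x` stays in a closed subsector. -/
def TendsToBoundary {β : Type} (α : ℝ) (hbar : ℂ) (l : Filter β) (f : β → ℂ) :
    BoundaryPoint → Prop
  | .zero => Tendsto (fun p => (f p).re) l atBot
  | .infty k =>
      Tendsto (fun p => (f p).re) l atTop ∧
        ∃ ε : ℝ, 0 < ε ∧ ∀ᶠ p in l,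
          |(f p).im - hbar.arg / (α + 1) - k * Real.pi / (α + 1)|
            ≤ (Real.pi - ε) / (2 * α + 2)

/-- `c` is piecewise smooth on `(0,1)`: continuous, and smooth up to the end-points on each closed
subinterval of `(0,1)` whose interior avoids a finite set of break points. -/
def PiecewiseSmooth (c : ℝ → ℂ) : Prop :=
  ∃ P : Finset ℝ, ∀ a b : ℝ, 0 < a → a < b → b < 1 → (∀ x ∈ P, x ∉ Ioo a b) →
    ContDiffOn ℝ ∞ c (Icc a b)

/-- The curve `γ = exp ∘ c` from the boundary point `p` to the boundary point `q`, with the branch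
`r` of `√V` along it, is admissible. -/
structure IsAdmissible (α ν : ℝ) (hbar : ℂ) (p q : BoundaryPoint) (c r : ℝ → ℂ) : Prop where
  smooth : PiecewiseSmooth c
  injective : InjOn c (Ioo 0 1)
  start : TendsToBoundary α hbar (𝓝[>] (0 : ℝ)) c p
  finish : TendsToBoundary α hbar (𝓝[<] (1 : ℝ)) c q
  ne_zero : ∀ t ∈ Ioo (0 : ℝ) 1, reducedPotential α ν hbar (c t) ≠ 0
  branch_continuous : ContinuousOn r (Ioo 0 1)
  branch_sq : ∀ t ∈ Ioo (0 : ℝ) 1, r t ^ 2 = reducedPotential α ν hbar (c t)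
  integrable : IntegrableOn (fun t =>
      ‖forcing (potential α ν hbar) (reducedPotential α ν hbar) (c t) (r t)‖ * ‖velocity c t‖)
      (Ioo 0 1)
  action_bounded_below : ∃ β : ℝ, ∀ s t : ℝ, 0 < s → s ≤ t → t < 1 → β ≤ (actionIncr c r s t).re
  levinson : ∀ t₀ ∈ Ioo (0 : ℝ) 1,
    Tendsto (fun t => (actionIncr c r t₀ t).re) (𝓝[<] 1) atTop

/-- `Re S` is monotone (non-decreasing) along the curve. -/
def ActionMonotone (c r : ℝ → ℂ) : Prop :=
  ∀ s t : ℝ, 0 < s → s ≤ t → t < 1 → 0 ≤ (actionIncr c r s t).re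

/-- The curve is a finite concatenation of horizontal trajectories (`Im S` constant) and vertical
trajectories (`Re S` constant). -/
def IsTrajectoryConcatenation (c r : ℝ → ℂ) : Prop :=
  ∃ P : Finset ℝ, ∀ a b : ℝ, 0 < a → a < b → b < 1 → (∀ x ∈ P, x ∉ Ioo a b) →
    (∀ s ∈ Icc a b, ∀ t ∈ Icc a b, (actionIncr c r s t).im = 0) ∨
      (∀ s ∈ Icc a b, ∀ t ∈ Icc a b, (actionIncr c r s t).re = 0)

/-- Two curves from the boundary point `p` to the boundary point `q` are homotopic in the universal
cover minus the turning points (the zeros of `V`), with fixed end-points `p` and `q`. -/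
def Homotopic (α ν : ℝ) (hbar : ℂ) (p q : BoundaryPoint) (c₀ c₁ : ℝ → ℂ) : Prop :=
  ∃ H : ℝ × ℝ → ℂ,
    ContinuousOn H (Icc 0 1 ×ˢ Ioo 0 1) ∧
    (∀ x ∈ Icc (0 : ℝ) 1 ×ˢ Ioo (0 : ℝ) 1, reducedPotential α ν hbar (H x) ≠ 0) ∧
    (∀ t ∈ Ioo (0 : ℝ) 1, H (0, t) = c₀ t) ∧
    (∀ t ∈ Ioo (0 : ℝ) 1, H (1, t) = c₁ t) ∧
    TendsToBoundary α hbar (𝓟 (Icc (0 : ℝ) 1) ×ˢ 𝓝[>] (0 : ℝ)) H p ∧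
    TendsToBoundary α hbar (𝓟 (Icc (0 : ℝ) 1) ×ˢ 𝓝[<] (1 : ℝ)) H q

/-- `z` is a continuous solution on `[0,1]` of the Volterra equation
`z(t) = 1 + ∫_0^t B(γ(t),γ(s)) F(γ(s)) γ'(s) z(s) ds` satisfied by the ratio of an exact solution
of `ψ'' = U ψ` to the WKB function `exp (∫ √V - V' / (4 V))`. The value at `t = 1` is the limit as
`t → 1`. -/
def IsVolterraSolution (α ν : ℝ) (hbar : ℂ) (c r z : ℝ → ℂ) : Prop :=
  ContinuousOn z (Icc 0 1) ∧
    ∀ t ∈ Ico (0 : ℝ) 1, z t = 1 + ∫ s in (0 : ℝ)..t,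
      kernelB c r t s *
        forcing (potential α ν hbar) (reducedPotential α ν hbar) (c s) (r s) *
        velocity c s * z s

/-- `w` is the end-point value `z_{p,q}` attached to the homotopy class of the curve `c₀`: this
class contains admissible curves, and along each of them the Volterra equation is solvable and its
solution has end-point value `w`. -/
def IsEndpointValue (α ν : ℝ) (hbar : ℂ) (p q : BoundaryPoint) (c₀ : ℝ → ℂ) (w : ℂ) : Prop :=
  (∃ c r : ℝ → ℂ, IsAdmissible α ν hbar p q c r ∧ Homotopic α ν hbar p q c₀ c) ∧
    ∀ c r : ℝ → ℂ, IsAdmissible α ν hbar p q c r → Homotopic α ν hbar p q c₀ c →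
      (∃ z : ℝ → ℂ, IsVolterraSolution α ν hbar c r z) ∧
        ∀ z : ℝ → ℂ, IsVolterraSolution α ν hbar c r z → z 1 = w

/-- The class of `c₀` contains an admissible curve along which `Re S` is monotone and which is
built from horizontal and vertical trajectories. -/
def HasTrajectoryRealization (α ν : ℝ) (hbar : ℂ) (p q : BoundaryPoint) (c₀ : ℝ → ℂ) : Prop :=
  ∃ c r : ℝ → ℂ, IsAdmissible α ν hbar p q c r ∧ Homotopic α ν hbar p q c₀ c ∧
    ActionMonotone c r ∧ IsTrajectoryConcatenation c r

/-- The critical value `ν_* = (α + 1) / α^(α/(α+1))`. -/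
def nuStar (α : ℝ) : ℝ :=
  (α + 1) / α ^ (α / (α + 1))

/-- The ray `arg y = k π / (α+1)`, run from `∞_k` to `0`. For `k = ±1` and `ν ≥ ν_*` there is no
turning point with `0 < ± arg y ≤ π / (α+1)`, so this ray is homotopic to every curve from `∞_{±1}`
to `0` which passes above (`k = 1`), respectively below (`k = -1`), both real turning points within
this sector. -/
def rayCurve (α : ℝ) (k : ℤ) (t : ℝ) : ℂ :=
  ((1 / t - 1 / (1 - t) : ℝ) : ℂ) + ((k * Real.pi / (α + 1) : ℝ) : ℂ) * Complex.I

/-- A curve from `∞_1` to `∞_{-1}` inside the sector `|arg y| < π / (α+1)`, crossing the positive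
real axis once, at the minimum point `y_* = α^(-1/(2α+2))` of `y^(2α) + y⁻²`, which for `ν > ν_*`
lies between the two real turning points. -/
def crossingCurve (α : ℝ) (t : ℝ) : ℂ :=
  ((-Real.log α / (2 * α + 2) + (1 - 2 * t) ^ 2 / (4 * t * (1 - t)) : ℝ) : ℂ) +
    (((1 - 2 * t) * Real.pi / (α + 1) : ℝ) : ℂ) * Complex.I

end WKB

end

/-!
Everything is written in `ζ = log y`, where `y² V = ħ⁻² g` for `g = y^(2α+2) - ν y² + 1` (`symbol`).
For a solution `ψ` of `ψ'' = U ψ` and a WKB function `W` the ratio `z = ψ / W` and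
`P = -z' / √V` (`defect`) satisfy `z' = -√V P`, `P' = F z - 2 √V P`, primes being `d/dy`. Along a
curve which starts with `z = 1`, `P = 0` this system is the Volterra equation
(`SystemAlong.volterra`).

*Homotopy invariance.* At each boundary point there is an exact solution asymptotic to the
subdominant WKB function, on a whole neighbourhood (`IsEnd.exists_reference`,
`exists_isBoundaryChart`). By admissibility `W`, continued along the curve, is subdominant at the
start and dominant at the finish (at `0`, where a curve may spiral, the sign of `√V` is inherited
from one curve of the class). So the Volterra equation is solved by
`ψ / W` with `ψ` subdominant at the start, and `z(1)` is a normalized Wronskian of the two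
subdominant solutions (`IsAdmissible.exists_volterra`); it is unique by Gronwall's inequality.
Continuing `(√V, W)` along a homotopy shows that the normalization, hence `z(1)`, depends on the
class only (`IsAdmissible.exists_volterra_pair`).

*Estimate.* If `Re S` increases along one curve of the class, then `|z(1) - 1| ≤ m exp (4 m)` with
`m = ∫ |F| |dy|`. The curves used are the ray itself and, for `z_{1,-1}`, the rays
`arg y = ±cornerAngle` joined by an arc of `|y| = y_*` (`crossingPath`). On them the terms of `g`
lie in a sector of opening less than `π` (for `-g` on the arc, where `ν ≥ ν₁ > ν_*` enters), which
gives the sign of `Re dS` and `m ≤ K |ħ|` uniformly in `ν`. On a ray the bound is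
`∫ N / (1 + N)^(3/2) dx`, with `N = |y|^(2α+2) + ν |y|²` and `x = log |y|`, and `2 N ≤ dN/dx`.

*Trajectories.* On a domain with a single-valued action `S` the middle part of such a curve is
replaced by a staircase in the coordinate `S` (`IsAction.exists_staircase`), its ends by horizontal
trajectories into the boundary points (`exists_tail_zero`, `exists_tail_infty`). The slit domain for
the crossing path contains no turning point: by the law of sines and the concavity of `sin`, a zero
of `V` with `0 < |arg y| < π / (α + 1)` would force `ν < ν_*` (`symbol_ne_zero_of_pos`).
-/

noncomputable section

namespace WKB

open scoped Real
open Complex (I I_im I_re I_sq abs_im_le_norm abs_re_le_norm add_im add_re conj_im continuous_re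
  exp exp_add exp_log exp_nat_mul exp_ne_zero exp_neg exp_sub im_ofReal_mul mul_im mul_re neg_im
  neg_re normSq_apply norm_exp norm_ofNat norm_real ofRealCLM ofReal_im ofReal_ne_zero
  ofReal_one ofReal_re re_le_norm re_ofReal_mul sq_norm sub_im sub_re)
open Real (cos cos_le_one exp_le_exp exp_pos log_mul norm_eq_abs norm_of_nonneg pi_pos sin sqrt
  tan)
open Metric (ball ball_mem_nhds closedBall isOpen_ball mem_ball mem_ball_self)

/-! ### Holomorphic primitives and logarithms on star-convex domains -/

/-- The integral along segments from the centre is a primitive: near each segment it agrees with a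
primitive on a convex neighbourhood. -/
theorem StarConvex.exists_hasDerivAt {D : Set ℂ} (hD : IsOpen D) {z₀ : ℂ}
    (hs : StarConvex ℝ z₀ D) {f : ℂ → ℂ} (hf : DifferentiableOn ℂ f D) :
    ∃ S : ℂ → ℂ, ∀ ζ ∈ D, HasDerivAt S (f ζ) ζ := by
  refine ⟨fun ζ => ∫ s in (0 : ℝ)..1, f (z₀ + s * (ζ - z₀)) * (ζ - z₀), fun ζ₁ hζ₁ => ?_⟩
  have hseg : segment ℝ z₀ ζ₁ ⊆ D := hs.segment_subset hζ₁
  have hcomp : IsCompact (segment ℝ z₀ ζ₁) := by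
    rw [segment_eq_image]
    exact isCompact_Icc.image (by fun_prop)
  obtain ⟨δ, hδ, hN⟩ := hcomp.exists_thickening_subset_open hD hseg
  have hNc : Convex ℝ (Metric.thickening δ (segment ℝ z₀ ζ₁)) := (convex_segment _ _).thickening δ
  have hNo : IsOpen (Metric.thickening δ (segment ℝ z₀ ζ₁)) := Metric.isOpen_thickening
  set N := Metric.thickening δ (segment ℝ z₀ ζ₁) with hNdef
  obtain ⟨P, hP⟩ := hNc.exists_forall_hasDerivWithinAt (hf.mono hN)
  have hz₀ : z₀ ∈ N := Metric.self_subset_thickening hδ _ (left_mem_segment ℝ _ _)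
  have hζN : ζ₁ ∈ N := Metric.self_subset_thickening hδ _ (right_mem_segment ℝ _ _)
  have hP' : ∀ ζ ∈ N, HasDerivAt P (f ζ) ζ := fun ζ hζ => (hP ζ hζ).hasDerivAt (hNo.mem_nhds hζ)
  have key : ∀ ζ ∈ N, (∫ s in (0 : ℝ)..1, f (z₀ + s * (ζ - z₀)) * (ζ - z₀)) = P ζ - P z₀ := by
    intro ζ hζ
    have hmem : ∀ s ∈ Icc (0 : ℝ) 1, z₀ + (s : ℂ) * (ζ - z₀) ∈ N := by
      intro s hs'
      have := hNc.add_smul_sub_mem hz₀ hζ hs'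
      simpa [Complex.real_smul] using this
    have hline : ∀ s : ℝ, HasDerivAt (fun s : ℝ => z₀ + (s : ℂ) * (ζ - z₀)) (ζ - z₀) s := by
      intro s
      simpa using ((ofRealCLM.hasDerivAt (x := s)).mul_const (ζ - z₀)).const_add z₀
    rw [intervalIntegral.integral_eq_sub_of_hasDerivAt
      (f := fun s : ℝ => P (z₀ + (s : ℂ) * (ζ - z₀)))]
    · simp
    · intro s hs'
      rw [uIcc_of_le zero_le_one] at hs'
      exact (hP' _ (hmem s hs')).comp_of_eq s (hline s) rfl
    · apply ContinuousOn.intervalIntegrable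
      rw [uIcc_of_le zero_le_one]
      exact ((hf.continuousOn.mono hN).comp (by fun_prop) hmem).mul continuousOn_const
  refine ((hP' ζ₁ hζN).sub_const (P z₀)).congr_of_eventuallyEq ?_
  filter_upwards [hNo.mem_nhds hζN] with ζ hζ using key ζ hζ

theorem StarConvex.exists_log {D : Set ℂ} (hD : IsOpen D) {z₀ : ℂ} (hz₀ : z₀ ∈ D)
    (hs : StarConvex ℝ z₀ D) {g : ℂ → ℂ} (hg : DifferentiableOn ℂ g D) (h0 : ∀ ζ ∈ D, g ζ ≠ 0) :
    ∃ L : ℂ → ℂ, DifferentiableOn ℂ L D ∧ ∀ ζ ∈ D, exp (L ζ) = g ζ := by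
  obtain ⟨L, hL⟩ := StarConvex.exists_hasDerivAt hD hs ((hg.deriv hD).div hg h0)
  have hpre : IsPreconnected D := (hs.isPathConnected hz₀).isConnected.isPreconnected
  have hgd : ∀ ζ ∈ D, HasDerivAt g (deriv g ζ) ζ := fun ζ hζ =>
    (hg.differentiableAt (hD.mem_nhds hζ)).hasDerivAt
  have hq : ∀ ζ ∈ D, HasDerivAt (fun ζ => exp (-L ζ) * g ζ) 0 ζ := by
    intro ζ hζ
    have h := ((hL ζ hζ).neg.cexp).mul (hgd ζ hζ)
    refine h.congr_deriv ?_
    simp only [Pi.div_apply]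
    field_simp [h0 ζ hζ]
    ring
  have hconst : ∀ ζ ∈ D, exp (-L ζ) * g ζ = exp (-L z₀) * g z₀ := by
    intro ζ hζ
    exact hD.is_const_of_deriv_eq_zero hpre
      (fun ζ hζ => (hq ζ hζ).differentiableAt.differentiableWithinAt)
      (fun ζ hζ => (hq ζ hζ).deriv) hζ hz₀
  refine ⟨fun ζ => L ζ + (Complex.log (g z₀) - L z₀), ?_, fun ζ hζ => ?_⟩
  · exact fun ζ hζ => ((hL ζ hζ).differentiableAt.add_const _).differentiableWithinAt
  · rw [exp_add, exp_sub, exp_log (h0 z₀ hz₀)]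
    have := hconst ζ hζ
    rw [exp_neg, exp_neg] at this
    have h1 := exp_ne_zero (L ζ)
    have h2 := exp_ne_zero (L z₀)
    field_simp at this ⊢
    linear_combination -this

/-! ### Entire solutions of linear systems -/

/-- A linear system `Y' = A Y` with entire coefficients has an entire solution with any prescribed
value at the origin, namely the sum of the Picard iterates. -/
theorem exists_entire_solution {E : Type*} [NormedAddCommGroup E] [NormedSpace ℂ E]
    [CompleteSpace E] {A : ℂ → E →L[ℂ] E} (hA : Differentiable ℂ A) (y₀ : E) :
    ∃ Y : ℂ → E, (∀ ζ, HasDerivAt Y (A ζ (Y ζ)) ζ) ∧ Y 0 = y₀ := by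
  have hstep : ∀ Y : {Y : ℂ → E // Differentiable ℂ Y}, ∃ Z : {Z : ℂ → E // Differentiable ℂ Z},
      (∀ ζ, HasDerivAt Z.1 (A ζ (Y.1 ζ)) ζ) ∧ Z.1 0 = 0 := by
    intro Y
    have hd : Differentiable ℂ fun ζ => A ζ (Y.1 ζ) := hA.clm_apply Y.2
    obtain ⟨Z, hZ⟩ := hd.isExactOn_univ
    have h' : ∀ ζ, HasDerivAt (fun ζ => Z ζ - Z 0) (A ζ (Y.1 ζ)) ζ := fun ζ =>
      (hZ ζ (mem_univ _)).sub_const _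
    exact ⟨⟨fun ζ => Z ζ - Z 0, fun ζ => (h' ζ).differentiableAt⟩, h', by simp⟩
  choose T hT hT0 using hstep
  let Y : ℕ → {Y : ℂ → E // Differentiable ℂ Y} := fun n =>
    Nat.rec ⟨fun _ => y₀, differentiable_const _⟩ (fun _ Y => T Y) n
  have hY0 : ∀ ζ, (Y 0).1 ζ = y₀ := fun ζ => rfl
  have hYs : ∀ n ζ, HasDerivAt (Y (n + 1)).1 (A ζ ((Y n).1 ζ)) ζ := fun n => hT (Y n)
  have hYs0 : ∀ n, (Y (n + 1)).1 0 = 0 := fun n => hT0 (Y n)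
  have hbound : ∀ ρ : ℝ, 0 < ρ → ∃ M : ℝ, 0 ≤ M ∧ ∀ n ζ, ‖ζ‖ ≤ ρ →
      ‖(Y n).1 ζ‖ ≤ ‖y₀‖ * ((M * ‖ζ‖) ^ n / n.factorial) := by
    intro ρ hρ
    obtain ⟨M, hM⟩ := (isCompact_closedBall (0 : ℂ) ρ).exists_bound_of_continuousOn
      hA.continuous.continuousOn
    have hM' : ∀ ζ, ‖ζ‖ ≤ ρ → ‖A ζ‖ ≤ M := fun ζ hζ => hM ζ (by simpa using hζ)
    have hM0 : 0 ≤ M := (norm_nonneg _).trans (hM' 0 (by simpa using hρ.le))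
    refine ⟨M, hM0, fun n => ?_⟩
    induction n with
    | zero => intro ζ _; simp [hY0]
    | succ n ih =>
      intro ζ hζ
      have hline : ∀ s : ℝ, HasDerivAt (fun s : ℝ => (s : ℂ) * ζ) ζ s := by
        intro s
        simpa using (ofRealCLM.hasDerivAt (x := s)).mul_const ζ
      have hder : ∀ s : ℝ, HasDerivAt (fun s : ℝ => (Y (n + 1)).1 ((s : ℂ) * ζ))
          (ζ • A ((s : ℂ) * ζ) ((Y n).1 ((s : ℂ) * ζ))) s := fun s =>
        (hYs n ((s : ℂ) * ζ)).scomp s (hline s)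
      have hB : ∀ s : ℝ, HasDerivAt
          (fun s : ℝ => ‖y₀‖ * ((M * (s * ‖ζ‖)) ^ (n + 1) / (n + 1).factorial))
          (‖ζ‖ * (M * (‖y₀‖ * ((M * (s * ‖ζ‖)) ^ n / n.factorial)))) s := by
        intro s
        have h1 : HasDerivAt (fun s : ℝ => M * (s * ‖ζ‖)) (M * ‖ζ‖) s := by
          simpa using ((hasDerivAt_id s).mul_const ‖ζ‖).const_mul M
        have h2 := ((h1.pow (n + 1)).div_const ((n + 1).factorial : ℝ)).const_mul ‖y₀‖
        refine h2.congr_deriv ?_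
        rw [Nat.factorial_succ]
        have : (n.factorial : ℝ) ≠ 0 := by positivity
        have : ((n : ℝ) + 1) ≠ 0 := by positivity
        push_cast
        field_simp
      have := image_norm_le_of_norm_deriv_right_le_deriv_boundary (a := 0) (b := 1)
        (f := fun s : ℝ => (Y (n + 1)).1 ((s : ℂ) * ζ))
        (fun s _ => (hder s).continuousAt.continuousWithinAt)
        (fun s _ => (hder s).hasDerivWithinAt)
        (B := fun s : ℝ => ‖y₀‖ * ((M * (s * ‖ζ‖)) ^ (n + 1) / (n + 1).factorial))
        (by simp [hYs0 n]) hB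
        (fun s hs => ?_) (right_mem_Icc.2 zero_le_one)
      · simpa using this
      · have hs1 : ‖(s : ℂ) * ζ‖ = s * ‖ζ‖ := by
          rw [norm_mul, norm_real, norm_of_nonneg hs.1]
        have hs2 : ‖(s : ℂ) * ζ‖ ≤ ρ := by
          rw [hs1]; nlinarith [hs.1, hs.2, norm_nonneg ζ]
        rw [norm_smul]
        gcongr
        refine (ContinuousLinearMap.le_opNorm _ _).trans ?_
        gcongr
        · exact hM' _ hs2
        · simpa only [hs1] using ih _ hs2
  have hsumm : ∀ ρ : ℝ, 0 < ρ → ∃ u : ℕ → ℝ, Summable u ∧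
      ∀ (n : ℕ) (ζ : ℂ), ζ ∈ ball (0 : ℂ) ρ → ‖(Y n).1 ζ‖ ≤ u n := by
    intro ρ hρ
    obtain ⟨M, hM0, hM⟩ := hbound ρ hρ
    refine ⟨fun n => ‖y₀‖ * ((M * ρ) ^ n / n.factorial),
      (Real.summable_pow_div_factorial (M * ρ)).mul_left _, fun n ζ hζ => ?_⟩
    have hζ' : ‖ζ‖ ≤ ρ := by simpa using (mem_ball.1 hζ).le
    refine (hM n ζ hζ').trans ?_
    dsimp only
    gcongr
  refine ⟨fun ζ => ∑' n, (Y n).1 ζ, fun ζ => ?_, ?_⟩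
  · obtain ⟨u, hu, hb⟩ := hsumm (‖ζ‖ + 1) (by positivity)
    have hζ : ζ ∈ ball (0 : ℂ) (‖ζ‖ + 1) := by simp
    have hdiff := Complex.differentiableOn_tsum_of_summable_norm hu
      (fun n => (Y n).2.differentiableOn) isOpen_ball hb
    have hder := Complex.hasSum_deriv_of_summable_norm hu
      (fun n => (Y n).2.differentiableOn) isOpen_ball hb hζ
    have hs : Summable fun n => (Y n).1 ζ := .of_norm_bounded hu fun n => hb n ζ hζ
    have h1 : HasSum (fun n => A ζ ((Y n).1 ζ)) (A ζ (∑' n, (Y n).1 ζ)) :=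
      (A ζ).hasSum hs.hasSum
    have h2 : HasSum (fun n => deriv (Y n).1 ζ) (A ζ (∑' n, (Y n).1 ζ)) := by
      rw [← hasSum_nat_add_iff' 1]
      have hd0 : deriv (Y 0).1 ζ = 0 := by
        have : (Y 0).1 = fun _ => y₀ := funext hY0
        rw [this]; simp
      simpa [hd0, (hYs _ ζ).deriv] using h1
    have := (hdiff.differentiableAt (isOpen_ball.mem_nhds hζ)).hasDerivAt
    rwa [hder.unique h2] at this
  · show ∑' n, (Y n).1 0 = y₀
    rw [tsum_eq_single 0]
    · exact hY0 0
    · intro n hn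
      obtain ⟨m, rfl⟩ := Nat.exists_eq_succ_of_ne_zero hn
      exact hYs0 m

section

/-! ### Local branches of the WKB function -/

theorem hasDerivAt_coverDeriv {V : ℂ → ℂ} (hV : Differentiable ℂ V) (ζ : ℂ) :
    HasDerivAt V (exp ζ * coverDeriv V ζ) ζ := by
  refine (hV ζ).hasDerivAt.congr_deriv ?_
  rw [coverDeriv, ← mul_assoc, ← exp_add]
  simp

/-- A branch on `D` of `ρ = √V` together with a WKB function `W = V^(-1/4) exp (∫ √V dy)`, which is
encoded through its logarithmic derivative `√V - V' / (4 V)`. -/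
structure IsWKBBranch (V : ℂ → ℂ) (D : Set ℂ) (ρ W : ℂ → ℂ) : Prop where
  isOpen : IsOpen D
  ne_zero : ∀ ζ ∈ D, V ζ ≠ 0
  sq : ∀ ζ ∈ D, ρ ζ ^ 2 = V ζ
  W_ne_zero : ∀ ζ ∈ D, W ζ ≠ 0
  deriv_ρ : ∀ ζ ∈ D, HasDerivAt ρ (exp ζ * coverDeriv V ζ / (2 * ρ ζ)) ζ
  deriv_W : ∀ ζ ∈ D,
    HasDerivAt W (exp ζ * (ρ ζ - coverDeriv V ζ / (4 * V ζ)) * W ζ) ζ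

namespace IsWKBBranch

variable {V : ℂ → ℂ} {D : Set ℂ} {ρ W : ℂ → ℂ}

theorem ρ_ne_zero (h : IsWKBBranch V D ρ W) {ζ : ℂ} (hζ : ζ ∈ D) : ρ ζ ≠ 0 := by
  intro h0
  apply h.ne_zero ζ hζ
  rw [← h.sq ζ hζ, h0]; simp

theorem mono (h : IsWKBBranch V D ρ W) {D' : Set ℂ} (hD' : IsOpen D') (hs : D' ⊆ D) :
    IsWKBBranch V D' ρ W :=
  ⟨hD', fun ζ hζ => h.ne_zero ζ (hs hζ), fun ζ hζ => h.sq ζ (hs hζ),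
    fun ζ hζ => h.W_ne_zero ζ (hs hζ), fun ζ hζ => h.deriv_ρ ζ (hs hζ),
    fun ζ hζ => h.deriv_W ζ (hs hζ)⟩

theorem const_mul (h : IsWKBBranch V D ρ W) {k : ℂ} (hk : k ≠ 0) :
    IsWKBBranch V D ρ (fun ζ => k * W ζ) :=
  ⟨h.isOpen, h.ne_zero, h.sq, fun ζ hζ => mul_ne_zero hk (h.W_ne_zero ζ hζ), h.deriv_ρ,
    fun ζ hζ => ((h.deriv_W ζ hζ).const_mul k).congr_deriv (by ring)⟩

/-- The WKB function of the opposite branch `-√V` is `1 / (√V W)`. -/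
theorem flip (h : IsWKBBranch V D ρ W) :
    IsWKBBranch V D (fun ζ => -ρ ζ) (fun ζ => (ρ ζ * W ζ)⁻¹) := by
  refine ⟨h.isOpen, h.ne_zero, fun ζ hζ => by rw [neg_sq, h.sq ζ hζ],
    fun ζ hζ => inv_ne_zero (mul_ne_zero (h.ρ_ne_zero hζ) (h.W_ne_zero ζ hζ)),
    fun ζ hζ => ?_, fun ζ hζ => ?_⟩
  · refine (h.deriv_ρ ζ hζ).neg.congr_deriv ?_
    have := h.ρ_ne_zero hζ
    field_simp
  · have h1 := h.ρ_ne_zero hζ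
    have h2 := h.W_ne_zero ζ hζ
    refine (((h.deriv_ρ ζ hζ).mul (h.deriv_W ζ hζ)).inv (mul_ne_zero h1 h2)).congr_deriv ?_
    rw [Pi.mul_apply, ← h.sq ζ hζ]
    field_simp
    ring

/-- `W² √V = exp (2 S)` satisfies the corresponding equation. -/
theorem deriv_action (h : IsWKBBranch V D ρ W) {ζ : ℂ} (hζ : ζ ∈ D) :
    HasDerivAt (fun ζ => W ζ ^ 2 * ρ ζ) (2 * (exp ζ * ρ ζ) * (W ζ ^ 2 * ρ ζ)) ζ := by
  refine (((h.deriv_W ζ hζ).pow 2).mul (h.deriv_ρ ζ hζ)).congr_deriv ?_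
  have h1 := h.ρ_ne_zero hζ
  simp only [Pi.pow_apply]
  rw [← h.sq ζ hζ]
  field_simp
  ring

end IsWKBBranch

/-- On a star-convex domain without turning points there is a branch with prescribed values at the
centre. -/
theorem exists_isWKBBranch {V : ℂ → ℂ} (hV : Differentiable ℂ V)
    (hV1 : Differentiable ℂ (coverDeriv V)) {D : Set ℂ} (hD : IsOpen D) {z₀ : ℂ} (hz₀ : z₀ ∈ D)
    (hs : StarConvex ℝ z₀ D) (h0 : ∀ ζ ∈ D, V ζ ≠ 0) {ρ₀ w₀ : ℂ} (hρ₀ : ρ₀ ^ 2 = V z₀)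
    (hw₀ : w₀ ≠ 0) : ∃ ρ W : ℂ → ℂ, IsWKBBranch V D ρ W ∧ ρ z₀ = ρ₀ ∧ W z₀ = w₀ := by
  obtain ⟨L, hL, hLe⟩ := StarConvex.exists_log hD hz₀ hs hV.differentiableOn h0
  have hLd : ∀ ζ ∈ D, HasDerivAt L (exp ζ * coverDeriv V ζ / V ζ) ζ := by
    intro ζ hζ
    have h1 := (hL.differentiableAt (hD.mem_nhds hζ)).hasDerivAt
    have h2 : HasDerivAt V (exp (L ζ) * deriv L ζ) ζ := by
      refine h1.cexp.congr_of_eventuallyEq ?_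
      filter_upwards [hD.mem_nhds hζ] with ξ hξ using (hLe ξ hξ).symm
    have h3 := h2.unique (hasDerivAt_coverDeriv hV ζ)
    rw [hLe ζ hζ] at h3
    refine h1.congr_deriv ?_
    rw [← h3]
    field_simp [h0 ζ hζ]
  have hsq : ∀ ζ ∈ D, exp (L ζ / 2) ^ 2 = V ζ := by
    intro ζ hζ
    rw [← exp_nat_mul, ← hLe ζ hζ]
    congr 1; push_cast; ring
  obtain ⟨ε, hε, hε0⟩ : ∃ ε : ℂ, ε ^ 2 = 1 ∧ ε * exp (L z₀ / 2) = ρ₀ := by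
    have := hsq z₀ hz₀
    rw [← hρ₀] at this
    rcases sq_eq_sq_iff_eq_or_eq_neg.1 this with h | h
    · exact ⟨1, by simp, by simpa using h⟩
    · exact ⟨-1, by simp, by simp [h]⟩
  have hε1 : ε ≠ 0 := by rintro rfl; simp at hε
  have hρd : ∀ ζ ∈ D, HasDerivAt (fun ζ => ε * exp (L ζ / 2))
      (exp ζ * coverDeriv V ζ / (2 * (ε * exp (L ζ / 2)))) ζ := by
    intro ζ hζ
    refine (((hLd ζ hζ).div_const 2).cexp.const_mul ε).congr_deriv ?_
    have h1 := exp_ne_zero (L ζ / 2)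
    rw [← hsq ζ hζ]
    field_simp
    rw [hε, one_mul]
  obtain ⟨S, hS⟩ := StarConvex.exists_hasDerivAt (f := fun ζ =>
    exp ζ * (ε * exp (L ζ / 2) - coverDeriv V ζ / (4 * V ζ))) hD hs (by
      intro ζ hζ
      refine (Complex.differentiable_exp ζ |>.mul ((hρd ζ hζ).differentiableAt.sub
        ((hV1 ζ).div ((hV ζ).const_mul 4) ?_))).differentiableWithinAt
      simpa using h0 ζ hζ)
  refine ⟨fun ζ => ε * exp (L ζ / 2), fun ζ => w₀ * exp (S ζ - S z₀),
    ⟨hD, h0, fun ζ hζ => ?_, fun ζ hζ => ?_, hρd, fun ζ hζ => ?_⟩, hε0, by simp⟩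
  · rw [mul_pow, hε, one_mul, hsq ζ hζ]
  · exact mul_ne_zero hw₀ (exp_ne_zero _)
  · exact (((hS ζ hζ).sub_const (S z₀)).cexp.const_mul w₀).congr_deriv (by ring)

/-- Two branches on a preconnected open set which share the value of `√V` at a point have the same
`√V` and proportional WKB functions. -/
theorem IsWKBBranch.eqOn {V : ℂ → ℂ} {D : Set ℂ} {ρ W ρ' W' : ℂ → ℂ}
    (h : IsWKBBranch V D ρ W) (h' : IsWKBBranch V D ρ' W') (hD : IsPreconnected D) {ζ₀ : ℂ}
    (hζ₀ : ζ₀ ∈ D) (he : ρ ζ₀ = ρ' ζ₀) :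
    (∀ ζ ∈ D, ρ ζ = ρ' ζ) ∧ ∃ k : ℂ, k ≠ 0 ∧ ∀ ζ ∈ D, W' ζ = k * W ζ := by
  have hρ : ∀ ζ ∈ D, ρ ζ = ρ' ζ := by
    have := hD.eq_of_sq_eq (f := ρ) (g := ρ')
      (fun ζ hζ => (h.deriv_ρ ζ hζ).continuousAt.continuousWithinAt)
      (fun ζ hζ => (h'.deriv_ρ ζ hζ).continuousAt.continuousWithinAt)
      (fun ζ hζ => by simp [h.sq ζ hζ, h'.sq ζ hζ]) (fun {ζ} hζ => h'.ρ_ne_zero hζ) hζ₀ he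
    exact this
  refine ⟨hρ, W' ζ₀ / W ζ₀, div_ne_zero (h'.W_ne_zero _ hζ₀) (h.W_ne_zero _ hζ₀), ?_⟩
  have hq : ∀ ζ ∈ D, HasDerivAt (fun ζ => W' ζ / W ζ) 0 ζ := by
    intro ζ hζ
    refine ((h'.deriv_W ζ hζ).div (h.deriv_W ζ hζ) (h.W_ne_zero ζ hζ)).congr_deriv ?_
    rw [hρ ζ hζ]
    ring
  intro ζ hζ
  have := h.isOpen.is_const_of_deriv_eq_zero hD
    (fun ζ hζ => (hq ζ hζ).differentiableAt.differentiableWithinAt)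
    (fun ζ hζ => (hq ζ hζ).deriv) hζ hζ₀
  rw [← this, div_mul_cancel₀ _ (h.W_ne_zero ζ hζ)]

/-! ### The first-order system for the ratio of a solution to the WKB function -/

/-- `(ψ, χ)` is an entire solution of `ψ'' = U ψ`, with `χ = ψ' = dψ/dy`. -/
def IsSolution (U ψ χ : ℂ → ℂ) : Prop :=
  ∀ ζ, HasDerivAt ψ (exp ζ * χ ζ) ζ ∧ HasDerivAt χ (exp ζ * (U ζ * ψ ζ)) ζ

theorem exists_isSolution {U : ℂ → ℂ} (hU : Differentiable ℂ U) (b x₀ y₀ : ℂ) :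
    ∃ ψ χ : ℂ → ℂ, IsSolution U ψ χ ∧ ψ b = x₀ ∧ χ b = y₀ := by
  let A : ℂ → (ℂ × ℂ) →L[ℂ] (ℂ × ℂ) := fun ζ =>
    exp (ζ + b) • (ContinuousLinearMap.inl ℂ ℂ ℂ ∘L ContinuousLinearMap.snd ℂ ℂ ℂ) +
    (exp (ζ + b) * U (ζ + b)) •
      (ContinuousLinearMap.inr ℂ ℂ ℂ ∘L ContinuousLinearMap.fst ℂ ℂ ℂ)
  have hA : Differentiable ℂ A := by
    have : Differentiable ℂ fun ζ => U (ζ + b) := hU.comp (by fun_prop)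
    fun_prop
  obtain ⟨Y, hY, hY0⟩ := exists_entire_solution hA (x₀, y₀)
  refine ⟨fun ζ => (Y (ζ - b)).1, fun ζ => (Y (ζ - b)).2, fun ζ => ⟨?_, ?_⟩, by simp [hY0],
    by simp [hY0]⟩
  · have := (ContinuousLinearMap.fst ℂ ℂ ℂ).hasFDerivAt.comp_hasDerivAt (ζ - b) (hY (ζ - b))
    refine (this.comp_sub_const ζ b).congr_deriv ?_
    simp [A]
  · have := (ContinuousLinearMap.snd ℂ ℂ ℂ).hasFDerivAt.comp_hasDerivAt (ζ - b) (hY (ζ - b))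
    refine (this.comp_sub_const ζ b).congr_deriv ?_
    simp [A, mul_assoc]

theorem IsSolution.const_mul {U ψ χ : ℂ → ℂ} (h : IsSolution U ψ χ) (k : ℂ) :
    IsSolution U (fun ζ => k * ψ ζ) (fun ζ => k * χ ζ) := fun ζ =>
  ⟨((h ζ).1.const_mul k).congr_deriv (by ring), ((h ζ).2.const_mul k).congr_deriv (by ring)⟩

theorem IsSolution.add {U ψ χ ψ' χ' : ℂ → ℂ} (h : IsSolution U ψ χ) (h' : IsSolution U ψ' χ') :
    IsSolution U (fun ζ => ψ ζ + ψ' ζ) (fun ζ => χ ζ + χ' ζ) := fun ζ =>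
  ⟨((h ζ).1.add (h' ζ).1).congr_deriv (by ring), ((h ζ).2.add (h' ζ).2).congr_deriv (by ring)⟩

theorem IsSolution.wronskian_eq {U ψ χ ψ' χ' : ℂ → ℂ} (h : IsSolution U ψ χ)
    (h' : IsSolution U ψ' χ') (ζ ξ : ℂ) :
    ψ ζ * χ' ζ - χ ζ * ψ' ζ = ψ ξ * χ' ξ - χ ξ * ψ' ξ := by
  have hd : ∀ ζ, HasDerivAt (fun ζ => ψ ζ * χ' ζ - χ ζ * ψ' ζ) 0 ζ := fun ζ =>
    (((h ζ).1.mul (h' ζ).2).sub ((h ζ).2.mul (h' ζ).1)).congr_deriv (by ring)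
  exact is_const_of_deriv_eq_zero (fun ζ => (hd ζ).differentiableAt) (fun ζ => (hd ζ).deriv) ζ ξ

/-- The second component `P = -(√V)⁻¹ dz/dy` attached to the ratio `z = ψ / W`. -/
def defect (V1 V ρ W ψ χ : ℂ) : ℂ :=
  ψ / W * (1 - V1 / (4 * ρ * V)) - χ / (ρ * W)

theorem defect_smul_smul {V1 V ρ W ψ χ k : ℂ} (hk : k ≠ 0) :
    defect V1 V ρ (k * W) (k * ψ) (k * χ) = defect V1 V ρ W ψ χ := by
  rw [defect, defect, mul_div_mul_left _ _ hk, mul_left_comm ρ k W, mul_div_mul_left _ _ hk]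

section System

variable {U V : ℂ → ℂ} {D : Set ℂ} {ρ W ψ χ : ℂ → ℂ}

/-- The first equation of the system, `dz/dy = -√V P`. -/
theorem IsWKBBranch.hasDerivAt_ratio (h : IsWKBBranch V D ρ W) (hs : IsSolution U ψ χ) {ζ : ℂ}
    (hζ : ζ ∈ D) :
    HasDerivAt (fun ζ => ψ ζ / W ζ)
      (-(exp ζ * ρ ζ * defect (coverDeriv V ζ) (V ζ) (ρ ζ) (W ζ) (ψ ζ) (χ ζ))) ζ := by
  refine ((hs ζ).1.div (h.deriv_W ζ hζ) (h.W_ne_zero ζ hζ)).congr_deriv ?_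
  have h1 := h.ρ_ne_zero hζ
  have h2 := h.W_ne_zero ζ hζ
  rw [defect, ← h.sq ζ hζ]
  field_simp
  ring

/-- The second equation of the system, `dP/dy = F z - 2 √V P`. -/
theorem IsWKBBranch.hasDerivAt_defect (hV : Differentiable ℂ V)
    (hV1 : Differentiable ℂ (coverDeriv V)) (h : IsWKBBranch V D ρ W) (hs : IsSolution U ψ χ)
    {ζ : ℂ} (hζ : ζ ∈ D) :
    HasDerivAt (fun ζ => defect (coverDeriv V ζ) (V ζ) (ρ ζ) (W ζ) (ψ ζ) (χ ζ))
      (exp ζ * (forcing U V ζ (ρ ζ) * (ψ ζ / W ζ)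
        - 2 * ρ ζ * defect (coverDeriv V ζ) (V ζ) (ρ ζ) (W ζ) (ψ ζ) (χ ζ))) ζ := by
  have h1 := h.ρ_ne_zero hζ
  have h2 := h.W_ne_zero ζ hζ
  have h3 := h.ne_zero ζ hζ
  have hz := h.hasDerivAt_ratio hs hζ
  have hv1 := hasDerivAt_coverDeriv hV1 ζ
  have hv := hasDerivAt_coverDeriv hV ζ
  have hρ := h.deriv_ρ ζ hζ
  have hW := h.deriv_W ζ hζ
  have e1 := (hv1.div ((hρ.const_mul (4 : ℂ)).mul hv)
    (mul_ne_zero (mul_ne_zero (by norm_num : (4 : ℂ) ≠ 0) h1) h3)).const_sub 1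
  have e2 := (hs ζ).2.div (hρ.mul hW) (mul_ne_zero h1 h2)
  have e3 := (hz.mul e1).sub e2
  refine e3.congr_deriv ?_
  simp only [Pi.mul_apply, Pi.div_apply, defect, forcing]
  rw [← h.sq ζ hζ]
  field_simp
  ring

end System

end

section

/-! ### Continuation of the WKB function along maps into the complement of the turning points -/

/-- A continuation of `(√V, W)` along `c` on the set `A`: near each point of `A` the pair of
functions `(R, w)` is the composition with `c` of a local branch. -/
def IsWKBLift {X : Type*} [TopologicalSpace X] (V : ℂ → ℂ) (c : X → ℂ) (A : Set X)
    (R w : X → ℂ) : Prop :=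
  ∀ x ∈ A, ∃ (D : Set ℂ) (ρ W : ℂ → ℂ), IsWKBBranch V D ρ W ∧ c x ∈ D ∧
    ∀ᶠ y in 𝓝[A] x, R y = ρ (c y) ∧ w y = W (c y)

section Lift

variable {X : Type*} [TopologicalSpace X] {V : ℂ → ℂ} {c : X → ℂ} {A B : Set X} {R w R' w' : X → ℂ}

theorem IsWKBLift.mono (h : IsWKBLift V c A R w) (hB : B ⊆ A) : IsWKBLift V c B R w := by
  intro x hx
  obtain ⟨D, ρ, W, hb, hc, he⟩ := h x (hB hx)
  exact ⟨D, ρ, W, hb, hc, he.filter_mono (nhdsWithin_mono x hB)⟩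

theorem IsWKBLift.const_mul (h : IsWKBLift V c A R w) {k : ℂ} (hk : k ≠ 0) :
    IsWKBLift V c A R (fun x => k * w x) := by
  intro x hx
  obtain ⟨D, ρ, W, hb, hc, he⟩ := h x hx
  exact ⟨D, ρ, _, hb.const_mul hk, hc, he.mono fun y hy => ⟨hy.1, by simp [hy.2]⟩⟩

theorem IsWKBLift.flip (h : IsWKBLift V c A R w) :
    IsWKBLift V c A (fun x => -R x) (fun x => (R x * w x)⁻¹) := by
  intro x hx
  obtain ⟨D, ρ, W, hb, hc, he⟩ := h x hx
  exact ⟨D, _, _, hb.flip, hc, he.mono fun y hy => by simp [hy.1, hy.2]⟩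

theorem IsWKBLift.sq (h : IsWKBLift V c A R w) {x : X} (hx : x ∈ A) : R x ^ 2 = V (c x) := by
  obtain ⟨D, ρ, W, hb, hc, he⟩ := h x hx
  rw [(he.self_of_nhdsWithin hx).1, hb.sq _ hc]

theorem IsWKBLift.R_ne_zero (h : IsWKBLift V c A R w) {x : X} (hx : x ∈ A) : R x ≠ 0 := by
  obtain ⟨D, ρ, W, hb, hc, he⟩ := h x hx
  rw [(he.self_of_nhdsWithin hx).1]
  exact hb.ρ_ne_zero hc

theorem IsWKBLift.w_ne_zero (h : IsWKBLift V c A R w) {x : X} (hx : x ∈ A) : w x ≠ 0 := by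
  obtain ⟨D, ρ, W, hb, hc, he⟩ := h x hx
  rw [(he.self_of_nhdsWithin hx).2]
  exact hb.W_ne_zero _ hc

theorem IsWKBBranch.isWKBLift {D : Set ℂ} {ρ W : ℂ → ℂ} (h : IsWKBBranch V D ρ W)
    (hc : MapsTo c A D) : IsWKBLift V c A (fun x => ρ (c x)) (fun x => W (c x)) :=
  fun _ hx => ⟨D, ρ, W, h, hc hx, Eventually.of_forall fun _ => ⟨rfl, rfl⟩⟩

theorem IsWKBLift.continuousOn_R (h : IsWKBLift V c A R w) (hc : ContinuousOn c A) :
    ContinuousOn R A := by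
  intro x hx
  obtain ⟨D, ρ, W, hb, hcx, he⟩ := h x hx
  exact ((hb.deriv_ρ _ hcx).continuousAt.comp_continuousWithinAt (hc x hx)).congr_of_eventuallyEq
    (he.mono fun y hy => hy.1) (he.self_of_nhdsWithin hx).1

theorem IsWKBLift.comp {Y : Type*} [TopologicalSpace Y] {c' : Y → ℂ} {A' : Set Y} {φ : Y → X}
    (h : IsWKBLift V c A R w) (hφ : ContinuousOn φ A') (hm : MapsTo φ A' A)
    (hc : ∀ y ∈ A', c (φ y) = c' y) :
    IsWKBLift V c' A' (fun y => R (φ y)) (fun y => w (φ y)) := by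
  intro y hy
  obtain ⟨D, ρ, W, hb, hcx, he⟩ := h (φ y) (hm hy)
  refine ⟨D, ρ, W, hb, hc y hy ▸ hcx, ?_⟩
  have ht : Tendsto φ (𝓝[A'] y) (𝓝[A] (φ y)) :=
    tendsto_nhdsWithin_of_tendsto_nhds_of_eventually_within _ (hφ y hy)
      (eventually_mem_nhdsWithin.mono fun z hz => hm hz)
  filter_upwards [ht.eventually he, eventually_mem_nhdsWithin] with z hz hzA
  rw [← hc z hzA]
  exact hz

/-- Around a point, two local branches can be compared on a common ball. -/
theorem exists_ball_compare {D D' : Set ℂ} {ρ W ρ' W' : ℂ → ℂ} (h : IsWKBBranch V D ρ W)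
    (h' : IsWKBBranch V D' ρ' W') {ζ : ℂ} (hζ : ζ ∈ D) (hζ' : ζ ∈ D') (he : ρ ζ = ρ' ζ) :
    ∃ ε > 0, ball ζ ε ⊆ D ∧ ∃ k : ℂ, k ≠ 0 ∧
      ∀ ξ ∈ ball ζ ε, ρ ξ = ρ' ξ ∧ W' ξ = k * W ξ := by
  obtain ⟨ε, hε, hs⟩ := Metric.isOpen_iff.1 (h.isOpen.inter h'.isOpen) ζ ⟨hζ, hζ'⟩
  have hs1 : ball ζ ε ⊆ D := fun ξ hξ => (hs hξ).1
  have hs2 : ball ζ ε ⊆ D' := fun ξ hξ => (hs hξ).2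
  obtain ⟨h1, k, hk, h2⟩ := (h.mono isOpen_ball hs1).eqOn (h'.mono isOpen_ball hs2)
    (convex_ball ζ ε).isPreconnected (mem_ball_self hε) he
  exact ⟨ε, hε, hs1, k, hk, fun ξ hξ => ⟨h1 ξ hξ, h2 ξ hξ⟩⟩

/-- A continuation along a preconnected set is determined by its value at one point. -/
theorem IsWKBLift.eqOn (h : IsWKBLift V c A R w) (h' : IsWKBLift V c A R' w')
    (hc : ContinuousOn c A) (hA : IsPreconnected A) {x₀ : X} (hx₀ : x₀ ∈ A) (hR : R x₀ = R' x₀)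
    (hw : w x₀ = w' x₀) : ∀ x ∈ A, R x = R' x ∧ w x = w' x := by
  have key : ∀ x ∈ A, ∀ᶠ y in 𝓝[A] x,
      (R x = R' x ∧ w x = w' x) ↔ (R y = R' y ∧ w y = w' y) := by
    intro x hx
    by_cases hRx : R x = R' x
    · obtain ⟨D, ρ, W, hb, hcx, he⟩ := h x hx
      obtain ⟨D', ρ', W', hb', hcx', he'⟩ := h' x hx
      have e1 := he.self_of_nhdsWithin hx
      have e2 := he'.self_of_nhdsWithin hx
      obtain ⟨ε, hε, -, k, hk, hk'⟩ := exists_ball_compare hb hb' hcx hcx'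
        (by rw [← e1.1, ← e2.1, hRx])
      have hx0 := hb.W_ne_zero _ hcx
      have hbx := (hk' _ (mem_ball_self hε)).2
      filter_upwards [he, he', (hc x hx).eventually (ball_mem_nhds _ hε),
        (hc x hx).eventually (hb.isOpen.mem_nhds hcx)] with y hy hy' hyb hyD
      have hy0 := hb.W_ne_zero _ hyD
      rw [hy.1, hy'.1, hy.2, hy'.2, e1.1, e1.2, e2.1, e2.2, hbx, (hk' _ hyb).2,
        (hk' _ hyb).1, (hk' _ (mem_ball_self hε)).1]
      simp [hx0, hy0]
    · have hne : ∀ᶠ y in 𝓝[A] x, R y ≠ R' y :=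
        ((h.continuousOn_R hc x hx).sub (h'.continuousOn_R hc x hx)).eventually_ne
          (sub_ne_zero.2 hRx) |>.mono fun y hy => sub_ne_zero.1 hy
      filter_upwards [hne] with y hy
      simp [hRx, hy]
  intro x hx
  have := hA.induction₂ (fun x y => (R x = R' x ∧ w x = w' x) ↔ (R y = R' y ∧ w y = w' y))
    key (fun _ _ _ _ _ _ => Iff.trans) (fun _ _ _ _ => Iff.symm) hx₀ hx
  exact this.1 ⟨hR, hw⟩

/-- Continuations on two closed sets which agree on the intersection glue. -/
theorem IsWKBLift.union (h : IsWKBLift V c A R w) (h' : IsWKBLift V c B R' w') (hA : IsClosed A)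
    (hB : IsClosed B) (hc : ContinuousOn c (A ∪ B))
    (he : ∀ x ∈ A ∩ B, R x = R' x ∧ w x = w' x) : ∃ R w, IsWKBLift V c (A ∪ B) R w := by
  classical
  refine ⟨fun x => if x ∈ A then R x else R' x, fun x => if x ∈ A then w x else w' x, ?_⟩
  intro x hx
  by_cases hxA : x ∈ A
  · obtain ⟨D, ρ, W, hb, hcx, hev⟩ := h x hxA
    by_cases hxB : x ∈ B
    · obtain ⟨D', ρ', W', hb', hcx', hev'⟩ := h' x hxB
      have e1 := hev.self_of_nhdsWithin hxA
      have e2 := hev'.self_of_nhdsWithin hxB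
      have e3 := he x ⟨hxA, hxB⟩
      obtain ⟨ε, hε, hsD, k, hk, hk'⟩ := exists_ball_compare hb hb' hcx hcx'
        (by rw [← e1.1, ← e2.1, e3.1])
      have hk1 : k = 1 := by
        have := (hk' _ (mem_ball_self hε)).2
        rw [← e1.2, ← e2.2, e3.2] at this
        exact (mul_eq_right₀ (h'.w_ne_zero hxB)).1 this.symm
      subst hk1
      refine ⟨D, ρ, W, hb, hcx, ?_⟩
      have hball := (hc x hx).eventually (ball_mem_nhds _ hε)
      rw [eventually_nhdsWithin_iff] at hev hev' hball ⊢
      filter_upwards [hev, hev', hball] with y hy hy' hyb hyAB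
      have hyb' := hyb hyAB
      by_cases hyA : y ∈ A
      · simp [hyA, hy hyA]
      · have hyB : y ∈ B := hyAB.resolve_left hyA
        simp [hyA, hy' hyB, hk' _ hyb']
    · refine ⟨D, ρ, W, hb, hcx, ?_⟩
      rw [eventually_nhdsWithin_iff] at hev ⊢
      filter_upwards [hev, hB.isOpen_compl.mem_nhds hxB] with y hy hyB hyAB
      have hyA : y ∈ A := hyAB.resolve_right hyB
      simp [hyA, hy hyA]
  · have hxB : x ∈ B := hx.resolve_left hxA
    obtain ⟨D', ρ', W', hb', hcx', hev'⟩ := h' x hxB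
    refine ⟨D', ρ', W', hb', hcx', ?_⟩
    rw [eventually_nhdsWithin_iff] at hev' ⊢
    filter_upwards [hev', hA.isOpen_compl.mem_nhds hxA] with y hy hyA hyAB
    have hyB : y ∈ B := hyAB.resolve_left hyA
    have : y ∉ A := hyA
    simp [this, hy hyB]

/-- A continuation can be renormalised to any admissible value at a given point. -/
theorem IsWKBLift.normalize (h : IsWKBLift V c A R w) {x₀ : X} (hx₀ : x₀ ∈ A) {R₀ w₀ : ℂ}
    (hR₀ : R₀ ^ 2 = V (c x₀)) (hw₀ : w₀ ≠ 0) :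
    ∃ R w, IsWKBLift V c A R w ∧ R x₀ = R₀ ∧ w x₀ = w₀ := by
  have hs := h.sq hx₀
  rw [← hR₀] at hs
  have hw := h.w_ne_zero hx₀
  rcases sq_eq_sq_iff_eq_or_eq_neg.1 hs with e | e
  · exact ⟨R, _, h.const_mul (div_ne_zero hw₀ hw), e, div_mul_cancel₀ _ hw⟩
  · have hw' := h.flip.w_ne_zero hx₀
    exact ⟨_, _, h.flip.const_mul (div_ne_zero hw₀ hw'), by simp [e], div_mul_cancel₀ _ hw'⟩

theorem exists_isWKBLift_union (h : ∃ R w, IsWKBLift V c A R w) (h' : ∃ R w, IsWKBLift V c B R w)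
    (hA : IsClosed A) (hB : IsClosed B) (hc : ContinuousOn c (A ∪ B))
    (hAB : IsConnected (A ∩ B)) : ∃ R w, IsWKBLift V c (A ∪ B) R w := by
  obtain ⟨R, w, h⟩ := h
  obtain ⟨R', w', h'⟩ := h'
  obtain ⟨x₀, hx₀⟩ := hAB.nonempty
  obtain ⟨R'', w'', h'', e1, e2⟩ := h'.normalize hx₀.2 (h.sq hx₀.1) (h.w_ne_zero hx₀.1)
  refine h.union h'' hA hB hc ?_
  exact (h.mono inter_subset_left).eqOn (h''.mono inter_subset_right)
    (hc.mono (inter_subset_left.trans subset_union_left)) hAB.isPreconnected hx₀ e1.symm e2.symm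

end Lift

open scoped unitInterval in
/-- The pair `(√V, W)` can be continued along any continuous map of a square. -/
theorem exists_isWKBLift_square {V : ℂ → ℂ} (hV : Differentiable ℂ V)
    (hV1 : Differentiable ℂ (coverDeriv V)) {c : I × I → ℂ} (hc : Continuous c)
    (h0 : ∀ x, V (c x) ≠ 0) : ∃ R w, IsWKBLift V c univ R w := by
  have hloc : ∀ x : I × I, ∃ (ρ W : ℂ → ℂ) (D : Set ℂ), IsWKBBranch V D ρ W ∧ c x ∈ D := by
    intro x
    obtain ⟨ε, hε, hb⟩ := Metric.isOpen_iff.1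
      (hV.continuous.isOpen_preimage _ isOpen_compl_singleton) (c x) (h0 x)
    obtain ⟨ρ₀, hρ₀⟩ := IsAlgClosed.exists_pow_nat_eq (V (c x)) two_pos
    obtain ⟨ρ, W, h, -, -⟩ := exists_isWKBBranch hV hV1 isOpen_ball
      (mem_ball_self hε) ((convex_ball (c x) ε).starConvex (mem_ball_self hε)) hb
      hρ₀ one_ne_zero
    exact ⟨ρ, W, _, h, mem_ball_self hε⟩
  choose ρ W D hb hcD using hloc
  obtain ⟨t, ht0, htm, ⟨N, hN⟩, hcell⟩ := exists_monotone_Icc_subset_open_cover_unitInterval_prod_self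
    (c := fun x => c ⁻¹' D x) (fun x => (hb x).isOpen.preimage hc)
    (fun x _ => mem_iUnion.2 ⟨x, hcD x⟩)
  have hgood : ∀ n m, ∃ R w, IsWKBLift V c (Icc (t n) (t (n + 1)) ×ˢ Icc (t m) (t (m + 1))) R w := by
    intro n m
    obtain ⟨i, hi⟩ := hcell n m
    exact ⟨_, _, (hb i).isWKBLift (c := c) hi⟩
  have hrow : ∀ m n, ∃ R w, IsWKBLift V c (Icc 0 (t n) ×ˢ Icc (t m) (t (m + 1))) R w := by
    intro m n
    induction n with
    | zero =>
      obtain ⟨R, w, h⟩ := hgood 0 m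
      refine ⟨R, w, h.mono (prod_mono ?_ le_rfl)⟩
      rw [ht0]
      exact Icc_subset_Icc_right bot_le
    | succ n ih =>
      have hu : Icc (0 : I) (t (n + 1)) = Icc 0 (t n) ∪ Icc (t n) (t (n + 1)) :=
        (Icc_union_Icc_eq_Icc bot_le (htm n.le_succ)).symm
      rw [hu, union_prod]
      refine exists_isWKBLift_union ih (hgood n m) (isClosed_Icc.prod isClosed_Icc)
        (isClosed_Icc.prod isClosed_Icc) hc.continuousOn ?_
      rw [← inter_prod, Icc_inter_Icc, max_eq_right (unitInterval.nonneg' : (0 : I) ≤ t n),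
        min_eq_left (htm n.le_succ)]
      exact (isConnected_Icc le_rfl).prod (isConnected_Icc (htm m.le_succ))
  have hall : ∀ m, ∃ R w, IsWKBLift V c ((univ : Set I) ×ˢ Icc 0 (t m)) R w := by
    intro m
    have huniv : ∀ m, ∃ R w, IsWKBLift V c ((univ : Set I) ×ˢ Icc (t m) (t (m + 1))) R w := by
      intro m
      have := hrow m N
      rwa [hN N le_rfl, show Icc (0 : I) 1 = univ from Icc_bot_top] at this
    induction m with
    | zero =>
      obtain ⟨R, w, h⟩ := huniv 0
      refine ⟨R, w, h.mono (prod_mono le_rfl ?_)⟩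
      rw [ht0]
      exact Icc_subset_Icc_right bot_le
    | succ m ih =>
      have hu : Icc (0 : I) (t (m + 1)) = Icc 0 (t m) ∪ Icc (t m) (t (m + 1)) :=
        (Icc_union_Icc_eq_Icc bot_le (htm m.le_succ)).symm
      rw [hu, prod_union]
      refine exists_isWKBLift_union ih (huniv m) (isClosed_univ.prod isClosed_Icc)
        (isClosed_univ.prod isClosed_Icc) hc.continuousOn ?_
      rw [← prod_inter, Icc_inter_Icc, max_eq_right (unitInterval.nonneg' : (0 : I) ≤ t m),
        min_eq_left (htm m.le_succ)]
      refine IsConnected.prod ?_ (isConnected_Icc le_rfl)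
      exact isConnected_univ
  have := hall N
  rwa [hN N le_rfl, show Icc (0 : I) 1 = univ from Icc_bot_top, univ_prod_univ] at this

theorem exists_isWKBLift_rectangle {V : ℂ → ℂ} (hV : Differentiable ℂ V)
    (hV1 : Differentiable ℂ (coverDeriv V)) {H : ℝ × ℝ → ℂ} {a b : ℝ} (hab : a < b)
    (hH : ContinuousOn H (Icc 0 1 ×ˢ Icc a b)) (h0 : ∀ x ∈ Icc (0 : ℝ) 1 ×ˢ Icc a b, V (H x) ≠ 0) :
    ∃ R w, IsWKBLift V H (Icc 0 1 ×ˢ Icc a b) R w := by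
  have hmem : ∀ x : unitInterval × unitInterval,
      ((x.1 : ℝ), a + (b - a) * x.2) ∈ Icc (0 : ℝ) 1 ×ˢ Icc a b := by
    intro x
    have h1 := x.2.2
    refine ⟨x.1.2, ?_, ?_⟩ <;> dsimp only <;> nlinarith [h1.1, h1.2]
  obtain ⟨R, w, h⟩ := exists_isWKBLift_square hV hV1
    (c := fun x : unitInterval × unitInterval => H ((x.1 : ℝ), a + (b - a) * x.2))
    (hH.comp_continuous (by fun_prop) hmem) (fun x => h0 _ (hmem x))
  refine ⟨_, _, h.comp (A' := Icc 0 1 ×ˢ Icc a b) (c' := H)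
    (φ := fun y : ℝ × ℝ => (projIcc 0 1 zero_le_one y.1,
      projIcc 0 1 zero_le_one ((y.2 - a) / (b - a)))) ?_ (mapsTo_univ _ _) ?_⟩
  · apply Continuous.continuousOn
    exact (continuous_projIcc.comp continuous_fst).prodMk
      (continuous_projIcc.comp (by fun_prop))
  · rintro ⟨y1, y2⟩ ⟨hy1, hy2⟩
    have hba : b - a ≠ 0 := (sub_pos.2 hab).ne'
    have hm : (y2 - a) / (b - a) ∈ Icc (0 : ℝ) 1 :=
      ⟨div_nonneg (sub_nonneg.2 hy2.1) (sub_pos.2 hab).le,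
        (div_le_one (sub_pos.2 hab)).2 (by linarith [hy2.2])⟩
    dsimp only
    rw [projIcc_of_mem _ hy1, projIcc_of_mem _ hm]
    congr 2
    field_simp
    ring

/-- The pair `(√V, W)` can be continued along any homotopy of open curves. -/
theorem exists_isWKBLift_strip {V : ℂ → ℂ} (hV : Differentiable ℂ V)
    (hV1 : Differentiable ℂ (coverDeriv V)) {H : ℝ × ℝ → ℂ}
    (hH : ContinuousOn H (Icc 0 1 ×ˢ Ioo 0 1))
    (h0 : ∀ x ∈ Icc (0 : ℝ) 1 ×ˢ Ioo (0 : ℝ) 1, V (H x) ≠ 0)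
    {R₀ w₀ : ℂ} (hR₀ : R₀ ^ 2 = V (H (0, 1 / 2))) (hw₀ : w₀ ≠ 0) :
    ∃ R w, IsWKBLift V H (Icc 0 1 ×ˢ Ioo 0 1) R w ∧ R (0, 1 / 2) = R₀ ∧ w (0, 1 / 2) = w₀ := by
  let e : ℕ → ℝ := fun n => 1 / ((n : ℝ) + 3)
  have he0 : ∀ n, 0 < e n := fun n => by positivity
  have he1 : ∀ n, e n ≤ 1 / 3 := fun n => by
    apply one_div_le_one_div_of_le <;> [norm_num; linarith [(Nat.cast_nonneg n : (0 : ℝ) ≤ n)]]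
  have hanti : ∀ {m n}, m ≤ n → e n ≤ e m := fun {m n} hmn => by
    apply one_div_le_one_div_of_le (by positivity)
    have : (m : ℝ) ≤ n := by exact_mod_cast hmn
    linarith
  let A : ℕ → Set (ℝ × ℝ) := fun n => Icc 0 1 ×ˢ Icc (e n) (1 - e n)
  have hAmono : ∀ {m n}, m ≤ n → A m ⊆ A n := fun {m n} hmn =>
    prod_mono le_rfl (Icc_subset_Icc (hanti hmn) (by linarith [hanti hmn]))
  have hAs : ∀ n, A n ⊆ Icc 0 1 ×ˢ Ioo 0 1 := fun n =>
    prod_mono le_rfl fun t ht => ⟨(he0 n).trans_le ht.1, by linarith [ht.2, he0 n]⟩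
  have hx₀ : ∀ n, ((0 : ℝ), (1 / 2 : ℝ)) ∈ A n := fun n =>
    ⟨⟨le_rfl, zero_le_one⟩, by show e n ≤ 1 / 2; linarith [he1 n],
      by show (1 / 2 : ℝ) ≤ 1 - e n; linarith [he1 n]⟩
  have hex : ∀ n, ∃ R w, IsWKBLift V H (A n) R w ∧ R (0, 1 / 2) = R₀ ∧ w (0, 1 / 2) = w₀ := by
    intro n
    obtain ⟨R, w, h⟩ := exists_isWKBLift_rectangle hV hV1 (a := e n) (b := 1 - e n)
      (by linarith [he1 n]) (hH.mono (hAs n)) (fun x hx => h0 x (hAs n hx))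
    exact h.normalize (hx₀ n) hR₀ hw₀
  choose R w hL hLR hLw using hex
  have hagree : ∀ m n, m ≤ n → ∀ x ∈ A m, R m x = R n x ∧ w m x = w n x := fun m n hmn =>
    (hL m).eqOn ((hL n).mono (hAmono hmn)) (hH.mono (hAs m))
      ((convex_Icc _ _).prod (convex_Icc _ _)).isPreconnected (hx₀ m)
      ((hLR m).trans (hLR n).symm) ((hLw m).trans (hLw n).symm)
  have hagree' : ∀ m n, ∀ x, x ∈ A m → x ∈ A n → R m x = R n x ∧ w m x = w n x := by
    intro m n x hm hn
    rcases le_total m n with h | h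
    · exact hagree m n h x hm
    · exact ⟨(hagree n m h x hn).1.symm, (hagree n m h x hn).2.symm⟩
  have hcov : ∀ x : ℝ × ℝ, ∃ n, x ∈ Icc (0 : ℝ) 1 ×ˢ Ioo (0 : ℝ) 1 →
      e n < x.2 ∧ x.2 < 1 - e n := by
    intro x
    by_cases hx : x ∈ Icc (0 : ℝ) 1 ×ˢ Ioo (0 : ℝ) 1
    · have hpos : 0 < min x.2 (1 - x.2) := lt_min hx.2.1 (by linarith [hx.2.2])
      obtain ⟨n, hn⟩ := exists_nat_one_div_lt hpos
      have : e n ≤ 1 / ((n : ℝ) + 1) := one_div_le_one_div_of_le (by positivity) (by linarith)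
      refine ⟨n, fun _ => ⟨by linarith [min_le_left x.2 (1 - x.2)],
        by linarith [min_le_right x.2 (1 - x.2)]⟩⟩
    · exact ⟨0, fun h => absurd h hx⟩
  choose N hN using hcov
  have hNA : ∀ x ∈ Icc (0 : ℝ) 1 ×ˢ Ioo (0 : ℝ) 1, x ∈ A (N x) := fun x hx =>
    ⟨hx.1, (hN x hx).1.le, (hN x hx).2.le⟩
  refine ⟨fun x => R (N x) x, fun x => w (N x) x, fun x hx => ?_, hLR _, hLw _⟩
  obtain ⟨D, ρ, W, hb, hcx, hev⟩ := hL (N x) x (hNA x hx)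
  refine ⟨D, ρ, W, hb, hcx, ?_⟩
  have hopen : {y : ℝ × ℝ | e (N x) < y.2 ∧ y.2 < 1 - e (N x)} ∈ 𝓝 x :=
    ((isOpen_lt continuous_const continuous_snd).inter
      (isOpen_lt continuous_snd continuous_const)).mem_nhds (hN x hx)
  rw [eventually_nhdsWithin_iff] at hev ⊢
  filter_upwards [hev, hopen] with y hy hyo hys
  have hyA : y ∈ A (N x) := ⟨hys.1, hyo.1.le, hyo.2.le⟩
  have := hagree' _ _ y (hNA y hys) hyA
  rw [this.1, this.2]
  exact hy hyA

end

section

/-! ### An integral Gronwall inequality and the Volterra form of the system -/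

/-- For a non-negative integrable `k` with primitive `K`, `∫ k e^{2K} ≤ (e^{2K} - 1) / 2`. -/
theorem integral_mul_exp_le {k : ℝ → ℝ} {a b : ℝ} (hab : a ≤ b)
    (hk : IntervalIntegrable k volume a b) (hk0 : ∀ t ∈ Icc a b, 0 ≤ k t) :
    ∫ s in a..b, k s * Real.exp (2 * ∫ r in a..s, k r) ≤
      (Real.exp (2 * ∫ r in a..b, k r) - 1) / 2 := by
  set E : ℝ → ℝ := fun s => Real.exp (2 * ∫ r in a..s, k r) with hE
  have hmono : MonotoneOn E (uIcc a b) := by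
    rw [uIcc_of_le hab]
    intro s hs t ht hst
    apply exp_le_exp.2
    have h1 : IntervalIntegrable k volume a s := hk.mono_set (by
      rw [uIcc_of_le hab, uIcc_of_le hs.1]; exact Icc_subset_Icc_right hs.2)
    have h2 : IntervalIntegrable k volume s t := hk.mono_set (by
      rw [uIcc_of_le hab, uIcc_of_le hst]; exact Icc_subset_Icc hs.1 ht.2)
    rw [← intervalIntegral.integral_add_adjacent_intervals h1 h2]
    have : 0 ≤ ∫ r in s..t, k r := intervalIntegral.integral_nonneg hst fun r hr =>
      hk0 r ⟨hs.1.trans hr.1, hr.2.trans ht.2⟩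
    linarith
  have hmem := hmono.intervalIntegral_deriv_mem_uIcc
  have hab' : E a ≤ E b := hmono left_mem_uIcc right_mem_uIcc hab
  have hEa : E a = 1 := by simp [hE]
  rw [uIcc_of_le (sub_nonneg.2 hab')] at hmem
  have hcongr : ∫ s in a..b, k s * E s = ∫ s in a..b, deriv E s / 2 := by
    apply intervalIntegral.integral_congr_ae
    filter_upwards [hk.ae_hasDerivAt_integral] with s hs hsab
    have h1 := hs (uIoc_subset_uIcc hsab) a left_mem_uIcc
    rw [((h1.const_mul 2).exp).deriv]
    ring
  rw [hcongr, intervalIntegral.integral_div]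
  have := hmem.2
  rw [hEa] at this
  show _ ≤ (E b - 1) / 2
  linarith

/-- Gronwall's inequality for an integrable kernel `k`. The weight `exp (-2 ∫ k)` makes the integral
term at most half of the weighted maximum of `u`. -/
theorem le_mul_exp_of_le_add_integral {k u : ℝ → ℝ} {a b A : ℝ} (hab : a ≤ b)
    (hk : IntervalIntegrable k volume a b) (hk0 : ∀ t ∈ Icc a b, 0 ≤ k t)
    (hu : ContinuousOn u (Icc a b)) (hu0 : ∀ t ∈ Icc a b, 0 ≤ u t)
    (h : ∀ t ∈ Icc a b, u t ≤ A + ∫ s in a..t, k s * u s) :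
    ∀ t ∈ Icc a b, u t ≤ A * Real.exp (2 * ∫ s in a..t, k s) := by
  have hKc : ContinuousOn (fun t => ∫ s in a..t, k s) (Icc a b) := by
    have := intervalIntegral.continuousOn_primitive_interval
      (by rw [uIcc_of_le hab]; exact (intervalIntegrable_iff_integrableOn_Icc_of_le hab).1 hk)
    rwa [uIcc_of_le hab] at this
  have hwc : ContinuousOn (fun t => u t * Real.exp (-(2 * ∫ s in a..t, k s))) (Icc a b) :=
    hu.mul (Real.continuous_exp.comp_continuousOn (hKc.const_mul 2 |>.neg) |>.congr
      fun t _ => rfl)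
  -- at a maximum `T` of the weighted function the inequality gives `M ≤ A`
  obtain ⟨T, hT, hmax⟩ := isCompact_Icc.exists_isMaxOn (nonempty_Icc.2 hab) hwc
  set M := u T * Real.exp (-(2 * ∫ s in a..T, k s)) with hM
  have hM0 : 0 ≤ M := mul_nonneg (hu0 T hT) (exp_pos _).le
  have hle : ∀ t ∈ Icc a b, u t ≤ M * Real.exp (2 * ∫ s in a..t, k s) := by
    intro t ht
    have := hmax ht
    simp only [mem_ofPred_eq] at this
    rw [Real.exp_neg, ← div_eq_mul_inv, div_le_iff₀ (exp_pos _)] at this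
    exact this
  have hsub : uIcc a T ⊆ uIcc a b := by
    rw [uIcc_of_le hab, uIcc_of_le hT.1]; exact Icc_subset_Icc_right hT.2
  have hsub' : Icc a T ⊆ Icc a b := Icc_subset_Icc_right hT.2
  have hkT := hk.mono_set hsub
  have hint1 : IntervalIntegrable (fun s => k s * u s) volume a T :=
    hkT.mul_continuousOn (by rw [uIcc_of_le hT.1]; exact hu.mono hsub')
  have hint2 : IntervalIntegrable (fun s => k s * Real.exp (2 * ∫ r in a..s, k r)) volume a T :=
    hkT.mul_continuousOn (by
      rw [uIcc_of_le hT.1]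
      exact Real.continuous_exp.comp_continuousOn ((hKc.mono hsub').const_mul 2))
  have hstep : ∫ s in a..T, k s * u s ≤ M * ((Real.exp (2 * ∫ r in a..T, k r) - 1) / 2) := by
    calc ∫ s in a..T, k s * u s
        ≤ ∫ s in a..T, M * (k s * Real.exp (2 * ∫ r in a..s, k r)) := by
          apply intervalIntegral.integral_mono_on hT.1 hint1 (hint2.const_mul M)
          intro s hs
          have := mul_le_mul_of_nonneg_left (hle s (hsub' hs)) (hk0 s (hsub' hs))
          linarith
      _ = M * ∫ s in a..T, k s * Real.exp (2 * ∫ r in a..s, k r) := by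
          rw [intervalIntegral.integral_const_mul]
      _ ≤ _ := mul_le_mul_of_nonneg_left
          (integral_mul_exp_le hT.1 hkT fun t ht => hk0 t (hsub' ht)) hM0
  have hKT : 0 ≤ ∫ r in a..T, k r :=
    intervalIntegral.integral_nonneg hT.1 fun r hr => hk0 r (hsub' hr)
  have huT : u T = M * Real.exp (2 * ∫ s in a..T, k s) := by
    rw [hM, mul_assoc, ← Real.exp_add]; simp
  have hMA : M ≤ A := by
    have h1 := h T hT
    have h2 : (1 : ℝ) ≤ Real.exp (2 * ∫ s in a..T, k s) := Real.one_le_exp (by linarith)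
    nlinarith
  exact fun t ht => (hle t ht).trans (mul_le_mul_of_nonneg_right hMA (exp_pos _).le)

/-- Volterra form of the system `z' = -m P`, `P' = f z - 2 m P`, in terms of `h` with `h' = 2 m h`:
one integrates `z - P / 2` and `h P`. -/
theorem volterra_of_system {z P h f : ℝ → ℂ} {a b : ℝ} (hab : a ≤ b) {E : Set ℝ} (hE : E.Countable)
    (hz : ContinuousOn z (Icc a b)) (hP : ContinuousOn P (Icc a b)) (hh : ContinuousOn h (Icc a b))
    (hh0 : ∀ t ∈ Icc a b, h t ≠ 0)
    (hd1 : ∀ t ∈ Ioo a b \ E, HasDerivAt (fun t => z t - P t / 2) (-(f t * z t) / 2) t)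
    (hd2 : ∀ t ∈ Ioo a b \ E, HasDerivAt (fun t => h t * P t) (h t * (f t * z t)) t)
    (hf : IntervalIntegrable f volume a b) {t : ℝ} (ht : t ∈ Icc a b) :
    P t = h a / h t * P a + ∫ s in a..t, h s / h t * (f s * z s) ∧
    z t = z a - P a / 2 + P t / 2 - (∫ s in a..t, f s * z s) / 2 := by
  have hsub : Icc a t ⊆ Icc a b := Icc_subset_Icc_right ht.2
  have hsubo : Ioo a t \ E ⊆ Ioo a b \ E := sdiff_subset_sdiff_left (Ioo_subset_Ioo_right ht.2)
  have hft : IntervalIntegrable f volume a t := hf.mono_set (by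
    rw [uIcc_of_le hab, uIcc_of_le ht.1]; exact hsub)
  have hfz : IntervalIntegrable (fun s => f s * z s) volume a t :=
    hft.mul_continuousOn (by rw [uIcc_of_le ht.1]; exact hz.mono hsub)
  have hhfz : IntervalIntegrable (fun s => h s * (f s * z s)) volume a t :=
    hfz.continuousOn_mul (by rw [uIcc_of_le ht.1]; exact hh.mono hsub)
  have h1 := integral_eq_of_hasDerivAt_off_countable_of_le _ _ ht.1 hE
    ((hz.sub (hP.div_const 2)).mono hsub) (fun x hx => hd1 x (hsubo hx))
    (hfz.neg.div_const 2)
  have h2 := integral_eq_of_hasDerivAt_off_countable_of_le _ _ ht.1 hE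
    ((hh.mul hP).mono hsub) (fun x hx => hd2 x (hsubo hx)) hhfz
  have hht := hh0 t ht
  constructor
  · have : ∀ s, h s / h t * (f s * z s) = (h t)⁻¹ * (h s * (f s * z s)) := fun s => by
      field_simp
    simp only [this]
    rw [intervalIntegral.integral_const_mul, h2]
    simp only [Pi.mul_apply]
    field_simp
    ring
  · have h3 : ∫ s in a..t, -(f s * z s) / 2 = -((∫ s in a..t, f s * z s) / 2) := by
      rw [← intervalIntegral.integral_div, ← intervalIntegral.integral_neg]
      congr 1; ext s; ring
    rw [h3] at h1
    simp only [Pi.sub_apply] at h1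
    linear_combination (-1 : ℂ) * h1

/-- Bounds for the system: along a path with `‖h s‖ ≤ M ‖h t‖` for `s ≤ t`, the pair `(z, P)`
stays close to its initial value. -/
theorem bounds_of_system {z P h f : ℝ → ℂ} {a b M : ℝ} (hab : a ≤ b) {E : Set ℝ}
    (hE : E.Countable) (hz : ContinuousOn z (Icc a b)) (hP : ContinuousOn P (Icc a b))
    (hh : ContinuousOn h (Icc a b)) (hh0 : ∀ t ∈ Icc a b, h t ≠ 0)
    (hd1 : ∀ t ∈ Ioo a b \ E, HasDerivAt (fun t => z t - P t / 2) (-(f t * z t) / 2) t)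
    (hd2 : ∀ t ∈ Ioo a b \ E, HasDerivAt (fun t => h t * P t) (h t * (f t * z t)) t)
    (hf : IntervalIntegrable f volume a b)
    (hM : ∀ s ∈ Icc a b, ∀ t ∈ Icc a b, s ≤ t → ‖h s / h t‖ ≤ M) {t : ℝ} (ht : t ∈ Icc a b) :
    ‖z t‖ ≤ (‖z a‖ + (1 + M) * ‖P a‖) * Real.exp (2 * ((1 + M) * ∫ s in a..b, ‖f s‖)) ∧
    ‖P t‖ ≤ M * ‖P a‖ + M * ∫ s in a..t, ‖f s‖ * ‖z s‖ ∧
    ‖z t - z a‖ ≤ (1 + M) * ‖P a‖ + (1 + M) * ∫ s in a..t, ‖f s‖ * ‖z s‖ := by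
  have hM0 : 0 ≤ M := (norm_nonneg _).trans (hM a (left_mem_Icc.2 hab) a (left_mem_Icc.2 hab) le_rfl)
  have hstep : ∀ t ∈ Icc a b, ‖P t‖ ≤ M * ‖P a‖ + M * ∫ s in a..t, ‖f s‖ * ‖z s‖ ∧
      ‖z t - z a‖ ≤ (1 + M) * ‖P a‖ + (1 + M) * ∫ s in a..t, ‖f s‖ * ‖z s‖ := by
    intro t ht
    have hsub : Icc a t ⊆ Icc a b := Icc_subset_Icc_right ht.2
    have hft : IntervalIntegrable f volume a t := hf.mono_set (by
      rw [uIcc_of_le hab, uIcc_of_le ht.1]; exact hsub)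
    have hfz : IntervalIntegrable (fun s => ‖f s‖ * ‖z s‖) volume a t :=
      hft.norm.mul_continuousOn (by rw [uIcc_of_le ht.1]; exact (hz.mono hsub).norm)
    obtain ⟨e1, e2⟩ := volterra_of_system hab hE hz hP hh hh0 hd1 hd2 hf ht
    have i0 : 0 ≤ ∫ s in a..t, ‖f s‖ * ‖z s‖ :=
      intervalIntegral.integral_nonneg ht.1 fun s _ => by positivity
    have i1 : ‖∫ s in a..t, f s * z s‖ ≤ ∫ s in a..t, ‖f s‖ * ‖z s‖ := by
      refine (intervalIntegral.norm_integral_le_integral_norm ht.1).trans_eq ?_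
      simp only [norm_mul]
    have i2 : ‖∫ s in a..t, h s / h t * (f s * z s)‖ ≤ M * ∫ s in a..t, ‖f s‖ * ‖z s‖ := by
      rw [← intervalIntegral.integral_const_mul]
      apply intervalIntegral.norm_integral_le_of_norm_le ht.1 _ (hfz.const_mul M)
      refine Eventually.of_forall fun s hs => ?_
      rw [norm_mul, norm_mul]
      exact mul_le_mul_of_nonneg_right (hM s (hsub (Ioc_subset_Icc_self hs)) t ht hs.2)
        (by positivity)
    have hPt : ‖P t‖ ≤ M * ‖P a‖ + M * ∫ s in a..t, ‖f s‖ * ‖z s‖ := by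
      rw [e1]
      refine (norm_add_le _ _).trans (add_le_add ?_ i2)
      rw [norm_mul]
      exact mul_le_mul_of_nonneg_right (hM a (left_mem_Icc.2 hab) t ht ht.1) (norm_nonneg _)
    refine ⟨hPt, ?_⟩
    have e3 : z t - z a = P t / 2 - P a / 2 - (∫ s in a..t, f s * z s) / 2 := by
      rw [e2]; ring
    rw [e3]
    refine (norm_sub_le _ _).trans ?_
    have e4 := norm_sub_le (P t / 2) (P a / 2)
    simp only [norm_div, norm_ofNat] at e4 ⊢
    nlinarith [norm_nonneg (P a)]
  have hmain := le_mul_exp_of_le_add_integral (u := fun t => ‖z t‖) (k := fun s => (1 + M) * ‖f s‖)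
    (A := ‖z a‖ + (1 + M) * ‖P a‖) hab (hf.norm.const_mul _) (fun _ _ => by positivity) hz.norm
    (fun _ _ => norm_nonneg _) (fun t ht => by
      have := (hstep t ht).2
      have h2 := norm_le_norm_add_norm_sub' (z t) (z a)
      simp only [mul_assoc]
      rw [intervalIntegral.integral_const_mul]
      linarith) t ht
  refine ⟨hmain.trans ?_, hstep t ht⟩
  gcongr
  rw [intervalIntegral.integral_const_mul]
  gcongr
  apply intervalIntegral.integral_mono_interval le_rfl ht.1 ht.2 _ hf.norm
  exact Eventually.of_forall fun s => norm_nonneg _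

/-! ### The system along a curve -/

section Curve

variable {U V : ℂ → ℂ} {ψ χ : ℂ → ℂ} {c R w : ℝ → ℂ} {A : Set ℝ}

theorem velocity_eq {c : ℝ → ℂ} {c' : ℂ} {t : ℝ} (hc : HasDerivAt c c' t) :
    velocity c t = exp (c t) * c' := hc.cexp.deriv

theorem IsWKBLift.hasDerivAt_comp (h : IsWKBLift V c A R w) {t : ℝ} (hA : A ∈ 𝓝 t)
    {G : ℂ → ℂ → ℂ → ℂ} {G' : ℂ → ℂ → ℂ → ℂ}
    (hG : ∀ (D : Set ℂ) (ρ W : ℂ → ℂ), IsWKBBranch V D ρ W → ∀ ζ ∈ D,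
      HasDerivAt (fun ζ => G ζ (ρ ζ) (W ζ)) (exp ζ * G' ζ (ρ ζ) (W ζ)) ζ)
    (hc : DifferentiableAt ℝ c t) :
    HasDerivAt (fun t => G (c t) (R t) (w t)) (velocity c t * G' (c t) (R t) (w t)) t := by
  obtain ⟨D, ρ, W, hb, hcx, he⟩ := h t (mem_of_mem_nhds hA)
  rw [nhdsWithin_eq_nhds.2 hA] at he
  have h1 := (hG D ρ W hb (c t) hcx).comp_of_eq t hc.hasDerivAt rfl
  have e1 := he.self_of_nhds
  rw [velocity_eq hc.hasDerivAt, e1.1, e1.2]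
  refine (h1.congr_of_eventuallyEq ?_).congr_deriv (by ring)
  filter_upwards [he] with s hs
  rw [hs.1, hs.2]; rfl

theorem IsWKBLift.continuousOn_comp {X : Type*} [TopologicalSpace X] {c R w : X → ℂ} {A : Set X}
    (h : IsWKBLift V c A R w) (hc : ContinuousOn c A) {G : ℂ → ℂ → ℂ → ℂ}
    (hG : ∀ (D : Set ℂ) (ρ W : ℂ → ℂ), IsWKBBranch V D ρ W → ∀ ζ ∈ D,
      ContinuousAt (fun ζ => G ζ (ρ ζ) (W ζ)) ζ) :
    ContinuousOn (fun t => G (c t) (R t) (w t)) A := by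
  intro x hx
  obtain ⟨D, ρ, W, hb, hcx, he⟩ := h x hx
  refine ((hG D ρ W hb (c x) hcx).comp_continuousWithinAt (hc x hx)).congr_of_eventuallyEq
    (he.mono fun y hy => ?_) ?_
  · simp only [hy.1, hy.2, Function.comp_apply]
  · have := he.self_of_nhdsWithin hx
    rw [this.1, this.2]; rfl

/-- The ratio `z = ψ / W` along a curve. -/
def ratioAlong (ψ : ℂ → ℂ) {X : Type*} (c w : X → ℂ) (t : X) : ℂ := ψ (c t) / w t

/-- The component `P` along a curve. -/
def defectAlong (V ψ χ : ℂ → ℂ) {X : Type*} (c R w : X → ℂ) (t : X) : ℂ :=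
  defect (coverDeriv V (c t)) (V (c t)) (R t) (w t) (ψ (c t)) (χ (c t))

theorem IsWKBLift.hasDerivAt_sub (hV : Differentiable ℂ V)
    (hV1 : Differentiable ℂ (coverDeriv V)) (h : IsWKBLift V c A R w) (hs : IsSolution U ψ χ) {t : ℝ}
    (hA : A ∈ 𝓝 t) (hc : DifferentiableAt ℝ c t) :
    HasDerivAt (fun t => ratioAlong ψ c w t - defectAlong V ψ χ c R w t / 2)
      (-(forcing U V (c t) (R t) * velocity c t * ratioAlong ψ c w t) / 2) t := by
  refine (h.hasDerivAt_comp hA (G := fun ζ ρ W => ψ ζ / W -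
    defect (coverDeriv V ζ) (V ζ) ρ W (ψ ζ) (χ ζ) / 2) (G' := fun ζ ρ W =>
      -(forcing U V ζ ρ * (ψ ζ / W)) / 2) ?_ hc).congr_deriv ?_
  · intro D ρ W hb ζ hζ
    refine ((hb.hasDerivAt_ratio hs hζ).sub
      ((hb.hasDerivAt_defect hV hV1 hs hζ).div_const 2)).congr_deriv ?_
    ring
  · simp only [ratioAlong]; ring

theorem IsWKBLift.hasDerivAt_mul (hV : Differentiable ℂ V)
    (hV1 : Differentiable ℂ (coverDeriv V)) (h : IsWKBLift V c A R w) (hs : IsSolution U ψ χ) {t : ℝ}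
    (hA : A ∈ 𝓝 t) (hc : DifferentiableAt ℝ c t) :
    HasDerivAt (fun t => w t ^ 2 * R t * defectAlong V ψ χ c R w t)
      (w t ^ 2 * R t * (forcing U V (c t) (R t) * velocity c t * ratioAlong ψ c w t)) t := by
  refine (h.hasDerivAt_comp hA (G := fun ζ ρ W => W ^ 2 * ρ *
    defect (coverDeriv V ζ) (V ζ) ρ W (ψ ζ) (χ ζ)) (G' := fun ζ ρ W =>
      W ^ 2 * ρ * (forcing U V ζ ρ * (ψ ζ / W))) ?_ hc).congr_deriv ?_
  · intro D ρ W hb ζ hζ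
    refine ((hb.deriv_action hζ).mul (hb.hasDerivAt_defect hV hV1 hs hζ)).congr_deriv ?_
    ring
  · simp only [ratioAlong]; ring

theorem IsWKBLift.continuousOn_ratioAlong {X : Type*} [TopologicalSpace X] {c R w : X → ℂ}
    {A : Set X} (h : IsWKBLift V c A R w) (hc : ContinuousOn c A) (hs : IsSolution U ψ χ) :
    ContinuousOn (ratioAlong ψ c w) A :=
  h.continuousOn_comp hc (G := fun ζ _ W => ψ ζ / W)
    fun _ _ _ hb _ hζ => (hb.hasDerivAt_ratio hs hζ).continuousAt

theorem IsWKBLift.continuousOn_defectAlong (hV : Differentiable ℂ V)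
    (hV1 : Differentiable ℂ (coverDeriv V)) {X : Type*} [TopologicalSpace X] {c R w : X → ℂ}
    {A : Set X} (h : IsWKBLift V c A R w) (hc : ContinuousOn c A) (hs : IsSolution U ψ χ) :
    ContinuousOn (defectAlong V ψ χ c R w) A :=
  h.continuousOn_comp hc (G := fun ζ ρ W => defect (coverDeriv V ζ) (V ζ) ρ W (ψ ζ) (χ ζ))
    fun _ _ _ hb _ hζ => (hb.hasDerivAt_defect hV hV1 hs hζ).continuousAt

theorem IsWKBLift.continuousOn_action {X : Type*} [TopologicalSpace X] {c R w : X → ℂ}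
    {A : Set X} (h : IsWKBLift V c A R w) (hc : ContinuousOn c A) :
    ContinuousOn (fun t => w t ^ 2 * R t) A :=
  h.continuousOn_comp hc (G := fun _ ρ W => W ^ 2 * ρ)
    fun _ _ _ hb _ hζ => (hb.deriv_action hζ).continuousAt

theorem IsWKBLift.hasDerivAt_action (h : IsWKBLift V c A R w) {t : ℝ} (hA : A ∈ 𝓝 t)
    (hc : DifferentiableAt ℝ c t) :
    HasDerivAt (fun t => w t ^ 2 * R t) (2 * (R t * velocity c t) * (w t ^ 2 * R t)) t := by
  refine (h.hasDerivAt_comp hA (G := fun _ ρ W => W ^ 2 * ρ)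
    (G' := fun _ ρ W => 2 * ρ * (W ^ 2 * ρ)) ?_ hc).congr_deriv (by ring)
  intro D ρ W hb ζ hζ
  exact (hb.deriv_action hζ).congr_deriv (by ring)

theorem IsWKBLift.action_ne_zero {X : Type*} [TopologicalSpace X] {c R w : X → ℂ}
    {A : Set X} (h : IsWKBLift V c A R w) {x : X} (hx : x ∈ A) : w x ^ 2 * R x ≠ 0 :=
  mul_ne_zero (pow_ne_zero 2 (h.w_ne_zero hx)) (h.R_ne_zero hx)

end Curve

end

section

/-! ### Subdominant solutions at a boundary point -/

theorem IsWKBLift.continuousOn_forcing {U V : ℂ → ℂ} (hU : Continuous U)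
    (hV1 : Differentiable ℂ (coverDeriv V)) {X : Type*} [TopologicalSpace X] {c R w : X → ℂ}
    {A : Set X} (h : IsWKBLift V c A R w) (hc : ContinuousOn c A) :
    ContinuousOn (fun t => forcing U V (c t) (R t)) A := by
  refine h.continuousOn_comp hc (G := fun ζ ρ _ => forcing U V ζ ρ) fun D ρ W hb ζ hζ => ?_
  have h1 := hb.ne_zero ζ hζ
  have h2 := (hb.deriv_W ζ hζ)
  have hVc : ContinuousAt V ζ := by
    have : (fun ζ => ρ ζ ^ 2) =ᶠ[𝓝 ζ] V := by
      filter_upwards [hb.isOpen.mem_nhds hζ] with ξ hξ using hb.sq ξ hξ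
    exact ((hb.deriv_ρ ζ hζ).continuousAt.pow 2).congr this
  have hV2 : Continuous (coverDeriv (coverDeriv V)) := by
    have : Differentiable ℂ (deriv (coverDeriv V)) := hV1.deriv
    exact (Complex.continuous_exp.comp continuous_neg).mul this.continuous
  unfold forcing
  refine ContinuousAt.div₀ ?_ (hb.deriv_ρ ζ hζ).continuousAt (hb.ρ_ne_zero hζ)
  refine (hVc.sub hU.continuousAt).add (ContinuousAt.div₀ ?_ ?_ ?_)
  · exact ((hV2.continuousAt.const_mul (-4)).mul hVc).add
      ((hV1.continuous.continuousAt.pow 2).const_mul 5)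
  · exact (hVc.pow 2).const_mul 16
  · exact mul_ne_zero (by norm_num) (pow_ne_zero 2 h1)

/-- A neighbourhood `D` of a boundary point, which lies in the direction `σ = ±1` of the real axis
of the cover, together with the branch `(ρ, W)` for which `W` is subdominant there: `Re S` increases
at a definite rate when one moves away from the boundary point along horizontal lines, and the
forcing term decays exponentially. The half-lines from the base point `b` towards the boundary
point stay in `D`. -/
structure IsEnd (U V : ℂ → ℂ) (D : Set ℂ) (σ : ℝ) (b : ℂ) (ρ W : ℂ → ℂ) (κ C a : ℝ) : Prop where
  branch : IsWKBBranch V D ρ W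
  convex : Convex ℝ D
  σ_sq : σ * σ = 1
  base : ∀ N : ℝ, 0 ≤ N → b + (σ * N : ℝ) ∈ D
  κ_pos : 0 < κ
  C_nonneg : 0 ≤ C
  a_pos : 0 < a
  mono : ∀ ζ ∈ D, κ * ‖exp ζ * ρ ζ‖ ≤ -σ * (exp ζ * ρ ζ).re
  bound : ∀ ζ ∈ D, ‖forcing U V ζ (ρ ζ) * exp ζ‖ ≤ C * Real.exp (-a * (σ * ζ.re))

/-- The error bound for the reference solutions, at `σ Re ζ = x`. -/
def endError (C a x : ℝ) : ℝ :=
  2 * (2 * C / a * Real.exp (-a * x)) * Real.exp (4 * (2 * C / a * Real.exp (-a * x)))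

theorem tendsto_endError {C a : ℝ} (ha : 0 < a) : Tendsto (endError C a) atTop (𝓝 0) := by
  have h1 : Tendsto (fun x : ℝ => Real.exp (-a * x)) atTop (𝓝 0) :=
    Real.tendsto_exp_atBot.comp (tendsto_id.const_mul_atTop_of_neg (neg_lt_zero.2 ha))
  have h2 := h1.const_mul (2 * C / a)
  have h3 := (h2.const_mul 2).mul ((h2.const_mul 4).rexp)
  simp only [mul_zero, zero_mul] at h3
  exact h3

/-- Along a path on which `Re S` increases the modulus of `h = W² √V` increases. -/
theorem norm_action_monotoneOn {h m : ℝ → ℂ} {a b : ℝ} (hh : ContinuousOn h (Icc a b))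
    (hd : ∀ t ∈ Ioo a b, HasDerivAt h (2 * m t * h t) t) (hm : ∀ t ∈ Ioo a b, 0 ≤ (m t).re) :
    MonotoneOn (fun t => ‖h t‖ ^ 2) (Icc a b) := by
  have hd2 : ∀ t ∈ Ioo a b, HasDerivAt (fun t => ‖h t‖ ^ 2) (4 * (m t).re * ‖h t‖ ^ 2) t := by
    intro t ht
    refine (hd t ht).norm_sq.congr_deriv ?_
    rw [Complex.inner, ← Complex.normSq_eq_norm_sq, normSq_apply]
    simp
    ring
  apply monotoneOn_of_deriv_nonneg (convex_Icc a b) (f := fun t => ‖h t‖ ^ 2) (hh.norm.pow 2)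
  · rw [interior_Icc]
    exact fun t ht => (hd2 t ht).differentiableAt.differentiableWithinAt
  · rw [interior_Icc]
    intro t ht
    rw [(hd2 t ht).deriv]
    have := hm t ht
    positivity

section

variable {U V : ℂ → ℂ} {D : Set ℂ} {σ κ C a : ℝ} {b : ℂ} {ρ W : ℂ → ℂ}

theorem hasDerivAt_line (p q : ℂ) (t : ℝ) :
    HasDerivAt (fun t : ℝ => p + (t : ℂ) * (q - p)) (q - p) t := by
  simpa using ((ofRealCLM.hasDerivAt (x := t)).mul_const (q - p)).const_add p

theorem line_mem_of_convex {D : Set ℂ} (hD : Convex ℝ D) {p q : ℂ} (hp : p ∈ D) (hq : q ∈ D) {t : ℝ}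
    (ht : t ∈ Icc (0 : ℝ) 1) : p + (t : ℂ) * (q - p) ∈ D := by
  simpa [Complex.real_smul] using hD.add_smul_sub_mem hp hq ht

/-- The pair `(z, P)` with initial value `(1, 0)` at a point close to the boundary point is
controlled along straight segments which are nearly horizontal, since `Re S` increases on them. -/
theorem IsEnd.segment_bound (hU : Continuous U) (hV : Differentiable ℂ V)
    (hV1 : Differentiable ℂ (coverDeriv V)) (h : IsEnd U V D σ b ρ W κ C a) {ψ χ : ℂ → ℂ}
    (hs : IsSolution U ψ χ) {p ζ : ℂ} (hp : p ∈ D) (hζ : ζ ∈ D)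
    (hX : σ * ζ.re < σ * p.re) (hY : |ζ.im - p.im| ≤ σ * p.re - σ * ζ.re)
    (hY' : |ζ.im - p.im| ≤ κ * (σ * p.re - σ * ζ.re)) (hz : ψ p / W p = 1)
    (hP : defect (coverDeriv V p) (V p) (ρ p) (W p) (ψ p) (χ p) = 0) :
    ‖ψ ζ / W ζ - 1‖ ≤ endError C a (σ * ζ.re) ∧
    ‖defect (coverDeriv V ζ) (V ζ) (ρ ζ) (W ζ) (ψ ζ) (χ ζ)‖ ≤ endError C a (σ * ζ.re) := by
  set c : ℝ → ℂ := fun t => p + (t : ℂ) * (ζ - p) with hc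
  have hcd : ∀ t, HasDerivAt c (ζ - p) t := hasDerivAt_line p ζ
  have hcc : Continuous c := continuous_iff_continuousAt.2 fun t => (hcd t).continuousAt
  have hcD : MapsTo c (Icc 0 1) D := fun t ht => line_mem_of_convex h.convex hp hζ ht
  have hL : IsWKBLift V c (Icc 0 1) (fun t => ρ (c t)) (fun t => W (c t)) :=
    h.branch.isWKBLift hcD
  have hvel : ∀ t, velocity c t = exp (c t) * (ζ - p) := fun t => velocity_eq (hcd t)
  have hc0 : c 0 = p := by simp [hc]
  have hc1 : c 1 = ζ := by simp [hc]
  set f : ℝ → ℂ := fun t => forcing U V (c t) (ρ (c t)) * velocity c t with hf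
  have hfc : ContinuousOn f (Icc 0 1) := by
    refine (hL.continuousOn_forcing hU hV1 hcc.continuousOn).mul ?_
    rw [show velocity c = _ from funext hvel]
    fun_prop
  have hfi : IntervalIntegrable f volume 0 1 := by
    apply ContinuousOn.intervalIntegrable; rwa [uIcc_of_le zero_le_one]
  set X := σ * ζ.re with hXdef
  set X₀ := σ * p.re with hX₀def
  have hre : ∀ t, σ * (c t).re = X₀ + t * (X - X₀) := by
    intro t; simp [hc, hXdef, hX₀def]; ring
  have hnorm : ‖ζ - p‖ ≤ 2 * (X₀ - X) := by
    refine (Complex.norm_le_abs_re_add_abs_im _).trans ?_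
    have : |(ζ - p).re| = X₀ - X := by
      have hσ : |σ| = 1 := by
        have := h.σ_sq
        rw [← abs_mul_abs_self] at this
        nlinarith [abs_nonneg σ]
      have h1 : |σ * (ζ - p).re| = |(ζ - p).re| := by rw [abs_mul, hσ, one_mul]
      rw [← h1, show σ * (ζ - p).re = -(X₀ - X) by rw [sub_re]; ring, abs_neg,
        abs_of_pos (sub_pos.2 hX)]
    rw [this, sub_im]
    linarith
  have hfb : ∀ t ∈ Icc (0 : ℝ) 1, ‖f t‖ ≤ 2 * C / a * (a * (X₀ - X) *
      Real.exp (-a * (X₀ + t * (X - X₀)))) := by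
    intro t ht
    have h1 := h.bound (c t) (hcD ht)
    rw [hre] at h1
    have h2 : f t = forcing U V (c t) (ρ (c t)) * exp (c t) * (ζ - p) := by
      rw [hf]; simp only [hvel]; ring
    rw [h2, norm_mul]
    have ha := h.a_pos
    calc _ ≤ (C * Real.exp (-a * (X₀ + t * (X - X₀)))) * (2 * (X₀ - X)) := by
          apply mul_le_mul h1 hnorm (norm_nonneg _)
          have := h.C_nonneg
          positivity
      _ = _ := by field_simp
  have hprim : ∀ t : ℝ, HasDerivAt (fun t : ℝ => Real.exp (-a * (X₀ + t * (X - X₀))))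
      (a * (X₀ - X) * Real.exp (-a * (X₀ + t * (X - X₀)))) t := by
    intro t
    have := ((((hasDerivAt_id t).mul_const (X - X₀)).const_add X₀).const_mul (-a)).exp
    refine this.congr_deriv ?_
    simp; ring
  set m := 2 * C / a * Real.exp (-a * X) with hm
  -- the forcing term decays like `exp (-a σ Re ζ)`, so its integral over the segment is small
  have hfint : ∫ t in (0 : ℝ)..1, ‖f t‖ ≤ m := by
    have hcont : Continuous fun t : ℝ => a * (X₀ - X) * Real.exp (-a * (X₀ + t * (X - X₀))) := by
      fun_prop
    calc ∫ t in (0 : ℝ)..1, ‖f t‖ ≤ ∫ t in (0 : ℝ)..1, 2 * C / a * (a * (X₀ - X) *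
          Real.exp (-a * (X₀ + t * (X - X₀)))) :=
          intervalIntegral.integral_mono_on zero_le_one hfi.norm
            ((hcont.const_mul _).intervalIntegrable _ _) hfb
      _ = 2 * C / a * (Real.exp (-a * X) - Real.exp (-a * X₀)) := by
          rw [intervalIntegral.integral_const_mul,
            intervalIntegral.integral_eq_sub_of_hasDerivAt (fun t _ => hprim t)
              (hcont.intervalIntegrable _ _)]
          simp
      _ ≤ m := by
          rw [hm]
          have : 0 ≤ 2 * C / a := div_nonneg (mul_nonneg two_pos.le h.C_nonneg) h.a_pos.le
          have := exp_pos (-a * X₀)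
          gcongr
          linarith
  have hact : ∀ t ∈ Ioo (0 : ℝ) 1, HasDerivAt (fun t => W (c t) ^ 2 * ρ (c t))
      (2 * (ρ (c t) * velocity c t) * (W (c t) ^ 2 * ρ (c t))) t := fun t ht =>
    hL.hasDerivAt_action (Icc_mem_nhds ht.1 ht.2) (hcd t).differentiableAt
  have hrepos : ∀ t ∈ Ioo (0 : ℝ) 1, 0 ≤ (ρ (c t) * velocity c t).re := by
    intro t ht
    have h1 := h.mono (c t) (hcD (Ioo_subset_Icc_self ht))
    set q := exp (c t) * ρ (c t) with hq
    have h2 : ρ (c t) * velocity c t = q * (ζ - p) := by rw [hvel, hq]; ring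
    have h3 : |q.im| ≤ ‖q‖ := abs_im_le_norm q
    rw [h2, mul_re]
    have h4 : q.re * (ζ - p).re = (-σ * q.re) * (X₀ - X) := by
      have : (ζ - p).re = (σ * σ) * (ζ - p).re := by rw [h.σ_sq, one_mul]
      rw [this, hXdef, hX₀def, sub_re]; ring
    rw [h4]
    have h5 : q.im * (ζ - p).im ≤ ‖q‖ * (κ * (X₀ - X)) := by
      calc q.im * (ζ - p).im ≤ |q.im * (ζ - p).im| := le_abs_self _
        _ = |q.im| * |ζ.im - p.im| := by rw [abs_mul, sub_im]
        _ ≤ _ := mul_le_mul h3 hY' (abs_nonneg _) (norm_nonneg _)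
    nlinarith [sub_pos.2 hX]
  have hmono := norm_action_monotoneOn (hL.continuousOn_action hcc.continuousOn) hact hrepos
  have hM : ∀ s ∈ Icc (0 : ℝ) 1, ∀ t ∈ Icc (0 : ℝ) 1, s ≤ t →
      ‖(W (c s) ^ 2 * ρ (c s)) / (W (c t) ^ 2 * ρ (c t))‖ ≤ 1 := by
    intro s hs' t ht hst
    rw [norm_div]
    apply div_le_one_of_le₀ _ (norm_nonneg _)
    exact le_of_sq_le_sq (hmono hs' ht hst) (norm_nonneg _)
  have hb := fun t (ht : t ∈ Icc (0 : ℝ) 1) => bounds_of_system (f := f) zero_le_one countable_empty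
    (hL.continuousOn_ratioAlong hcc.continuousOn hs)
    (hL.continuousOn_defectAlong hV hV1 hcc.continuousOn hs)
    (hL.continuousOn_action hcc.continuousOn) (fun t ht => hL.action_ne_zero ht)
    (fun t ht => hL.hasDerivAt_sub hV hV1 hs (Icc_mem_nhds ht.1.1 ht.1.2) (hcd t).differentiableAt)
    (fun t ht => hL.hasDerivAt_mul hV hV1 hs (Icc_mem_nhds ht.1.1 ht.1.2) (hcd t).differentiableAt)
    hfi hM ht
  have hz0 : ratioAlong ψ c (fun t => W (c t)) 0 = 1 := by rw [ratioAlong, hc0, hz]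
  have hP0 : defectAlong V ψ χ c (fun t => ρ (c t)) (fun t => W (c t)) 0 = 0 := by
    rw [defectAlong, hc0, hP]
  simp only [hz0, hP0, norm_one, norm_zero, mul_zero, add_zero, one_mul, zero_add] at hb
  have hi0 : 0 ≤ ∫ t in (0 : ℝ)..1, ‖f t‖ :=
    intervalIntegral.integral_nonneg zero_le_one fun _ _ => norm_nonneg _
  have hm0 : 0 ≤ m := hi0.trans hfint
  have hzb : ∀ t ∈ Icc (0 : ℝ) 1, ‖ratioAlong ψ c (fun t => W (c t)) t‖ ≤ Real.exp (4 * m) := by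
    intro t ht
    refine (hb t ht).1.trans (exp_le_exp.2 ?_)
    linarith
  have hfz : ∫ t in (0 : ℝ)..1, ‖f t‖ * ‖ratioAlong ψ c (fun t => W (c t)) t‖
      ≤ m * Real.exp (4 * m) := by
    calc _ ≤ ∫ t in (0 : ℝ)..1, ‖f t‖ * Real.exp (4 * m) := by
          apply intervalIntegral.integral_mono_on zero_le_one
          · apply hfi.norm.mul_continuousOn
            rw [uIcc_of_le zero_le_one]
            exact (hL.continuousOn_ratioAlong hcc.continuousOn hs).norm
          · exact hfi.norm.mul_const _
          · exact fun t ht => mul_le_mul_of_nonneg_left (hzb t ht) (norm_nonneg _)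
      _ = (∫ t in (0 : ℝ)..1, ‖f t‖) * Real.exp (4 * m) := intervalIntegral.integral_mul_const _ _
      _ ≤ _ := by gcongr
  have hb1 := hb 1 (right_mem_Icc.2 zero_le_one)
  rw [endError, ← hm]
  have hpos := exp_pos (4 * m)
  constructor
  · have := hb1.2.2
    rw [ratioAlong, hc1] at this
    nlinarith
  · have := hb1.2.1
    rw [defectAlong, hc1] at this
    nlinarith [mul_nonneg hm0 hpos.le]

theorem IsSolution.eq_zero {U ψ χ : ℂ → ℂ} (hU : Differentiable ℂ U) (h : IsSolution U ψ χ)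
    {b : ℂ} (h1 : ψ b = 0) (h2 : χ b = 0) (ζ : ℂ) : ψ ζ = 0 ∧ χ ζ = 0 := by
  obtain ⟨ψ₁, χ₁, hs₁, e1, e2⟩ := exists_isSolution hU ζ 1 0
  obtain ⟨ψ₂, χ₂, hs₂, e3, e4⟩ := exists_isSolution hU ζ 0 1
  have w1 := h.wronskian_eq hs₁ ζ b
  have w2 := h.wronskian_eq hs₂ ζ b
  rw [e1, e2, h1, h2] at w1
  rw [e3, e4, h1, h2] at w2
  constructor
  · linear_combination w2
  · linear_combination -w1

/-- Existence of the subdominant solution at a boundary point, normalised by the WKB function: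
a limit of solutions which agree with the WKB function at points tending to the boundary point. -/
theorem IsEnd.exists_reference (hU : Differentiable ℂ U) (hV : Differentiable ℂ V)
    (hV1 : Differentiable ℂ (coverDeriv V)) (h : IsEnd U V D σ b ρ W κ C a) :
    ∃ ψ χ : ℂ → ℂ, IsSolution U ψ χ ∧ ∀ ζ ∈ D,
      ‖ψ ζ / W ζ - 1‖ ≤ endError C a (σ * ζ.re) ∧
      ‖defect (coverDeriv V ζ) (V ζ) (ρ ζ) (W ζ) (ψ ζ) (χ ζ)‖ ≤ endError C a (σ * ζ.re) := by
  have hpD : ∀ n : ℕ, b + (σ * (n : ℝ) : ℝ) ∈ D := fun n => h.base n n.cast_nonneg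
  have hbD : b ∈ D := by simpa using hpD 0
  set p : ℕ → ℂ := fun n => b + (σ * (n : ℝ) : ℝ) with hp
  have hex : ∀ n, ∃ ψ χ, IsSolution U ψ χ ∧ ψ (p n) / W (p n) = 1 ∧
      defect (coverDeriv V (p n)) (V (p n)) (ρ (p n)) (W (p n)) (ψ (p n)) (χ (p n)) = 0 := by
    intro n
    obtain ⟨ψ, χ, hs, e1, e2⟩ := exists_isSolution hU (p n) (W (p n))
      (ρ (p n) * W (p n) * (1 - coverDeriv V (p n) / (4 * ρ (p n) * V (p n))))
    have hW := h.branch.W_ne_zero _ (hpD n)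
    have hρ := h.branch.ρ_ne_zero (hpD n)
    refine ⟨ψ, χ, hs, by rw [e1, div_self hW], ?_⟩
    rw [defect, e1, e2, div_self hW, mul_div_cancel_left₀ _ (mul_ne_zero hρ hW)]
    ring
  choose ψ χ hs hz hP using hex
  have hre : ∀ n, σ * (p n).re = σ * b.re + n := by
    intro n
    have := h.σ_sq
    simp only [hp, add_re, ofReal_re]
    linear_combination (n : ℝ) * this
  have him : ∀ n, (p n).im = b.im := fun n => by simp [hp]
  have hbound : ∀ ζ ∈ D, ∀ᶠ n in atTop, ‖ψ n ζ / W ζ - 1‖ ≤ endError C a (σ * ζ.re) ∧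
      ‖defect (coverDeriv V ζ) (V ζ) (ρ ζ) (W ζ) (ψ n ζ) (χ n ζ)‖ ≤ endError C a (σ * ζ.re) := by
    intro ζ hζ
    have ht : Tendsto (fun n : ℕ => σ * (p n).re - σ * ζ.re) atTop atTop := by
      simp only [hre]
      have := tendsto_natCast_atTop_atTop (R := ℝ)
      simpa [sub_eq_add_neg] using
        tendsto_atTop_add_const_right _ (-(σ * ζ.re)) (tendsto_atTop_add_const_left _ (σ * b.re) this)
    filter_upwards [ht.eventually_gt_atTop 0, ht.eventually_ge_atTop |ζ.im - b.im|,
      (ht.const_mul_atTop h.κ_pos).eventually_ge_atTop |ζ.im - b.im|] with n h1 h2 h3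
    refine h.segment_bound hU.continuous hV hV1 (hs n) (hpD n) hζ (by linarith) ?_ ?_ (hz n) (hP n)
    · rwa [him]
    · rwa [him]
  have hWb := h.branch.W_ne_zero b hbD
  have hρb := h.branch.ρ_ne_zero hbD
  -- the Cauchy data at `b` are bounded, hence converge along a subsequence
  have hdata : ∃ M : ℝ, ∀ᶠ n in atTop, (ψ n b, χ n b) ∈ closedBall (0 : ℂ × ℂ) M := by
    set E := endError C a (σ * b.re)
    set B := 1 - coverDeriv V b / (4 * ρ b * V b)
    refine ⟨max (‖W b‖ * (1 + E)) (‖ρ b * W b‖ * ((1 + E) * ‖B‖ + E)), ?_⟩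
    filter_upwards [hbound b hbD] with n hn
    have e1 : ‖ψ n b / W b‖ ≤ 1 + E := by
      have := norm_le_norm_add_norm_sub' (ψ n b / W b) 1
      rw [norm_one] at this
      linarith [hn.1]
    have e2 : ψ n b = W b * (ψ n b / W b) := by field_simp
    have e3 : χ n b = ρ b * W b * ((ψ n b / W b) * B -
        defect (coverDeriv V b) (V b) (ρ b) (W b) (ψ n b) (χ n b)) := by
      rw [defect, sub_sub_cancel, mul_div_cancel₀ _ (mul_ne_zero hρb hWb)]
    rw [mem_closedBall_zero_iff, Prod.norm_def]
    apply max_le_max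
    · show ‖ψ n b‖ ≤ _
      rw [e2, norm_mul]
      exact mul_le_mul_of_nonneg_left e1 (norm_nonneg _)
    · show ‖χ n b‖ ≤ _
      rw [e3, norm_mul]
      apply mul_le_mul_of_nonneg_left _ (norm_nonneg _)
      refine (norm_sub_le _ _).trans (add_le_add ?_ hn.2)
      rw [norm_mul]
      exact mul_le_mul_of_nonneg_right e1 (norm_nonneg _)
  obtain ⟨M, hM⟩ := hdata
  obtain ⟨⟨x, y⟩, -, φ, hφ, hlim⟩ := tendsto_subseq_of_frequently_bounded
    (Metric.isBounded_closedBall (x := (0 : ℂ × ℂ)) (r := M)) hM.frequently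
  obtain ⟨ψ₁, χ₁, hs₁, a1, a2⟩ := exists_isSolution hU b 1 0
  obtain ⟨ψ₂, χ₂, hs₂, a3, a4⟩ := exists_isSolution hU b 0 1
  -- convergence of the data at `b` implies pointwise convergence of the solutions
  have hlin : ∀ n ζ, ψ n ζ = ψ n b * ψ₁ ζ + χ n b * ψ₂ ζ ∧
      χ n ζ = ψ n b * χ₁ ζ + χ n b * χ₂ ζ := by
    intro n ζ
    have hd := (hs n).add (((hs₁.const_mul (ψ n b)).add (hs₂.const_mul (χ n b))).const_mul (-1))
    have := hd.eq_zero hU (b := b) (by simp [a1, a3]) (by simp [a2, a4]) ζ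
    exact ⟨by linear_combination this.1, by linear_combination this.2⟩
  refine ⟨fun ζ => x * ψ₁ ζ + y * ψ₂ ζ, fun ζ => x * χ₁ ζ + y * χ₂ ζ,
    (hs₁.const_mul x).add (hs₂.const_mul y), fun ζ hζ => ?_⟩
  have hx : Tendsto (fun n => ψ (φ n) b) atTop (𝓝 x) := (continuous_fst.tendsto _).comp hlim
  have hy : Tendsto (fun n => χ (φ n) b) atTop (𝓝 y) := (continuous_snd.tendsto _).comp hlim
  have hψ : Tendsto (fun n => ψ (φ n) ζ) atTop (𝓝 (x * ψ₁ ζ + y * ψ₂ ζ)) := by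
    simp only [fun n => (hlin (φ n) ζ).1]
    exact (hx.mul_const _).add (hy.mul_const _)
  have hχ : Tendsto (fun n => χ (φ n) ζ) atTop (𝓝 (x * χ₁ ζ + y * χ₂ ζ)) := by
    simp only [fun n => (hlin (φ n) ζ).2]
    exact (hx.mul_const _).add (hy.mul_const _)
  have hev := hφ.tendsto_atTop.eventually (hbound ζ hζ)
  constructor
  · refine le_of_tendsto (((hψ.div_const (W ζ)).sub_const 1).norm) (hev.mono fun n hn => hn.1)
  · have hlim2 := ((hψ.div_const (W ζ)).mul_const
      (1 - coverDeriv V ζ / (4 * ρ ζ * V ζ))).sub (hχ.div_const (ρ ζ * W ζ))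
    exact le_of_tendsto hlim2.norm (hev.mono fun n hn => hn.2)

end

end

section

/-! ### Piecewise smooth curves -/

/-- `x` is the only point of the finite set `P` in a neighbourhood contained in `(0,1)`. -/
theorem exists_isolating_radius (P : Finset ℝ) {x : ℝ} (hx : x ∈ Ioo (0 : ℝ) 1) :
    ∃ η > 0, 0 < x - η ∧ x + η < 1 ∧ ∀ y ∈ P, y ≠ x → y ∉ Ioo (x - η) (x + η) := by
  have hcl : IsClosed ((P.erase x : Finset ℝ) : Set ℝ) := (Finset.finite_toSet _).isClosed
  have hmem : ((P.erase x : Finset ℝ) : Set ℝ)ᶜ ∩ Ioo 0 1 ∈ 𝓝 x :=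
    inter_mem (hcl.isOpen_compl.mem_nhds (by simp)) (Ioo_mem_nhds hx.1 hx.2)
  obtain ⟨η, hη, hs⟩ := Metric.mem_nhds_iff.1 hmem
  refine ⟨η / 2, half_pos hη, ?_, ?_, fun y hy hyx hyI => ?_⟩
  · have : x - η / 2 ∈ ball x η := by
      rw [mem_ball, Real.dist_eq, sub_sub_cancel_left, abs_neg, abs_of_pos (half_pos hη)]
      linarith
    exact (hs this).2.1
  · have : x + η / 2 ∈ ball x η := by
      rw [mem_ball, Real.dist_eq, add_sub_cancel_left, abs_of_pos (half_pos hη)]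
      linarith
    exact (hs this).2.2
  · have : y ∈ ball x η := by
      rw [mem_ball, Real.dist_eq, abs_lt]
      constructor <;> linarith [hyI.1, hyI.2]
    exact (hs this).1 (by simp [hy, hyx])

theorem PiecewiseSmooth.exists_local {c : ℝ → ℂ} (h : PiecewiseSmooth c) {x : ℝ}
    (hx : x ∈ Ioo (0 : ℝ) 1) : ∃ η > 0, 0 < x - η ∧ x + η < 1 ∧
      ContDiffOn ℝ ∞ c (Icc (x - η) x) ∧ ContDiffOn ℝ ∞ c (Icc x (x + η)) := by
  obtain ⟨P, hP⟩ := h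
  obtain ⟨η, hη, h0, h1, hy⟩ := exists_isolating_radius P hx
  refine ⟨η, hη, h0, h1, hP _ _ h0 (by linarith) hx.2 fun y hyP hyI => ?_,
    hP _ _ hx.1 (by linarith) h1 fun y hyP hyI => ?_⟩
  · exact hy y hyP hyI.2.ne ⟨hyI.1, by linarith [hyI.2]⟩
  · exact hy y hyP hyI.1.ne' ⟨by linarith [hyI.1], hyI.2⟩

theorem PiecewiseSmooth.continuousOn {c : ℝ → ℂ} (h : PiecewiseSmooth c) :
    ContinuousOn c (Ioo 0 1) := by
  intro x hx
  obtain ⟨η, hη, h0, h1, hl, hr⟩ := h.exists_local hx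
  apply ContinuousAt.continuousWithinAt
  rw [continuousAt_iff_continuous_left_right]
  refine ⟨(hl.continuousOn x (right_mem_Icc.2 (by linarith))).mono_of_mem_nhdsWithin ?_,
    (hr.continuousOn x (left_mem_Icc.2 (by linarith))).mono_of_mem_nhdsWithin ?_⟩
  · exact Icc_mem_nhdsLE (by linarith)
  · exact Icc_mem_nhdsGE (by linarith)

theorem PiecewiseSmooth.exists_contDiffAt {c : ℝ → ℂ} (h : PiecewiseSmooth c) :
    ∃ P : Finset ℝ, ∀ t ∈ Ioo (0 : ℝ) 1, t ∉ P → ContDiffAt ℝ ∞ c t := by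
  obtain ⟨P, hP⟩ := h
  refine ⟨P, fun t ht htP => ?_⟩
  obtain ⟨η, hη, h0, h1, hy⟩ := exists_isolating_radius P ht
  refine (hP _ _ h0 (by linarith) h1 fun y hyP hyI => ?_).contDiffAt
    (Icc_mem_nhds (by linarith) (by linarith))
  exact hy y hyP (fun e => htP (e ▸ hyP)) hyI

theorem continuousAt_velocity {c : ℝ → ℂ} {t : ℝ} (h : ContDiffAt ℝ ∞ c t) :
    ContinuousAt (velocity c) t := by
  have h1 : ContDiffAt ℝ ∞ (fun τ => exp (c τ)) t := h.cexp
  have h2 : ContDiffAt ℝ 1 (fun τ => exp (c τ)) t := h1.of_le (by simp)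
  have h3 := (h2.fderiv_right (m := 0) (by simp)).continuousAt.clm_apply
    (continuousAt_const (y := (1 : ℝ)))
  exact h3

theorem PiecewiseSmooth.intervalIntegrable_velocity {c : ℝ → ℂ} (h : PiecewiseSmooth c) {s t : ℝ}
    (hs : s ∈ Ioo (0 : ℝ) 1) (ht : t ∈ Ioo (0 : ℝ) 1) :
    IntervalIntegrable (velocity c) volume s t := by
  have key : ∀ a b : ℝ, a < b → ContDiffOn ℝ ∞ c (Icc a b) →
      IntegrableOn (velocity c) (Icc a b) := by
    intro a b hab hc
    have h1 : ContDiffOn ℝ ∞ (fun τ => exp (c τ)) (Icc a b) := hc.cexp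
    have h2 : ContinuousOn (derivWithin (fun τ => exp (c τ)) (Icc a b)) (Icc a b) :=
      h1.continuousOn_derivWithin (uniqueDiffOn_Icc hab) (by simp)
    have h3 : IntegrableOn (derivWithin (fun τ => exp (c τ)) (Icc a b)) (Icc a b) volume :=
      h2.integrableOn_Icc
    rw [integrableOn_Icc_iff_integrableOn_Ioo] at h3 ⊢
    refine h3.congr_fun (fun x hx => ?_) measurableSet_Ioo
    exact derivWithin_of_mem_nhds (Icc_mem_nhds hx.1 hx.2)
  have hloc : LocallyIntegrableOn (velocity c) (Ioo 0 1) := by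
    intro x hx
    obtain ⟨η, hη, h0, h1, hl, hr⟩ := h.exists_local hx
    refine ⟨Icc (x - η) (x + η), mem_nhdsWithin_of_mem_nhds
      (Icc_mem_nhds (by linarith) (by linarith)), ?_⟩
    rw [← Icc_union_Icc_eq_Icc (b := x) (by linarith) (by linarith)]
    exact (key _ _ (by linarith) hl).union (key _ _ (by linarith) hr)
  rw [intervalIntegrable_iff']
  refine hloc.integrableOn_compact_subset ?_ isCompact_uIcc
  exact (ordConnected_Ioo).uIcc_subset hs ht

/-! ### Passing to the limit at the end-points of a curve -/

section Limits

variable {z P h f : ℝ → ℂ} {M : ℝ} {E : Set ℝ}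

/-- The data of the system `z' = -m P`, `P' = f z - 2 m P` along an open curve which starts with the
values `(1, 0)` at the initial end-point; `h` is `exp (2 S)`. -/
structure SystemAlong (z P h f : ℝ → ℂ) (M : ℝ) (E : Set ℝ) : Prop where
  countable : E.Countable
  z_cont : ContinuousOn z (Ioo 0 1)
  P_cont : ContinuousOn P (Ioo 0 1)
  h_cont : ContinuousOn h (Ioo 0 1)
  h_ne : ∀ t ∈ Ioo (0 : ℝ) 1, h t ≠ 0
  deriv_sub : ∀ t ∈ Ioo (0 : ℝ) 1 \ E, HasDerivAt (fun t => z t - P t / 2) (-(f t * z t) / 2) t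
  deriv_mul : ∀ t ∈ Ioo (0 : ℝ) 1 \ E, HasDerivAt (fun t => h t * P t) (h t * (f t * z t)) t
  f_int : IntegrableOn f (Ioo 0 1)
  h_le : ∀ s t, 0 < s → s ≤ t → t < 1 → ‖h s / h t‖ ≤ M
  z_zero : Tendsto z (𝓝[>] 0) (𝓝 1)
  P_zero : Tendsto P (𝓝[>] 0) (𝓝 0)

theorem SystemAlong.intervalIntegrable (H : SystemAlong z P h f M E) :
    IntervalIntegrable f volume 0 1 := by
  rw [intervalIntegrable_iff_integrableOn_Ioo_of_le zero_le_one]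
  exact H.f_int

theorem SystemAlong.M_nonneg (H : SystemAlong z P h f M E) : 0 ≤ M :=
  (norm_nonneg _).trans (H.h_le (1 / 2) (1 / 2) (by norm_num) le_rfl (by norm_num))

theorem SystemAlong.norm_le (H : SystemAlong z P h f M E) {t : ℝ} (ht : t ∈ Ioo (0 : ℝ) 1) :
    ‖z t‖ ≤ Real.exp (2 * ((1 + M) * ∫ s in (0 : ℝ)..1, ‖f s‖)) := by
  have hlim : Tendsto (fun ε => (‖z ε‖ + (1 + M) * ‖P ε‖) *
      Real.exp (2 * ((1 + M) * ∫ s in (0 : ℝ)..1, ‖f s‖))) (𝓝[>] 0)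
      (𝓝 ((‖(1 : ℂ)‖ + (1 + M) * ‖(0 : ℂ)‖) *
        Real.exp (2 * ((1 + M) * ∫ s in (0 : ℝ)..1, ‖f s‖)))) :=
    (H.z_zero.norm.add (H.P_zero.norm.const_mul _)).mul_const _
  simp only [norm_one, norm_zero, mul_zero, add_zero, one_mul] at hlim
  refine ge_of_tendsto hlim ?_
  filter_upwards [Ioo_mem_nhdsGT ht.1] with ε hε
  have hsub : Icc ε t ⊆ Ioo 0 1 := fun x hx => ⟨hε.1.trans_le hx.1, hx.2.trans_lt ht.2⟩
  have hsubo : Ioo ε t \ E ⊆ Ioo 0 1 \ E :=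
    sdiff_subset_sdiff_left (Ioo_subset_Icc_self.trans hsub)
  have hf1 := H.intervalIntegrable
  have hint : IntervalIntegrable f volume ε t := hf1.mono_set (by
    rw [uIcc_of_le hε.2.le, uIcc_of_le zero_le_one]; exact hsub.trans Ioo_subset_Icc_self)
  have := (bounds_of_system (M := M) hε.2.le H.countable (H.z_cont.mono hsub)
    (H.P_cont.mono hsub) (H.h_cont.mono hsub) (fun s hs => H.h_ne s (hsub hs))
    (fun s hs => H.deriv_sub s (hsubo hs)) (fun s hs => H.deriv_mul s (hsubo hs)) hint
    (fun s hs r hr hsr => H.h_le s r (hsub hs).1 hsr (hsub hr).2) (right_mem_Icc.2 hε.2.le)).1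
  refine this.trans ?_
  have hM := H.M_nonneg
  gcongr
  exact intervalIntegral.integral_mono_interval hε.1.le hε.2.le ht.2.le
    (Eventually.of_forall fun s => norm_nonneg _) hf1.norm

theorem SystemAlong.integrableOn_mul (H : SystemAlong z P h f M E) :
    IntegrableOn (fun s => f s * z s) (Ioo 0 1) := by
  have hzm : AEStronglyMeasurable z (volume.restrict (Ioo 0 1)) :=
    H.z_cont.aestronglyMeasurable measurableSet_Ioo
  have := H.f_int.mul_bdd (c := Real.exp (2 * ((1 + M) * ∫ s in (0 : ℝ)..1, ‖f s‖))) hzm (by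
    rw [ae_restrict_iff' measurableSet_Ioo]
    exact Eventually.of_forall fun t ht => H.norm_le ht)
  exact this

theorem SystemAlong.intervalIntegrable_mul (H : SystemAlong z P h f M E) :
    IntervalIntegrable (fun s => f s * z s) volume 0 1 := by
  rw [intervalIntegrable_iff_integrableOn_Ioo_of_le zero_le_one]
  exact H.integrableOn_mul

theorem tendsto_integral_left {g : ℝ → ℂ} {t : ℝ} (ht : 0 < t)
    (hg : IntervalIntegrable g volume 0 t) :
    Tendsto (fun ε => ∫ s in ε..t, g s) (𝓝[>] 0) (𝓝 (∫ s in (0 : ℝ)..t, g s)) := by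
  have hc := intervalIntegral.continuousOn_primitive_interval
    (f := g) (a := 0) (b := t) (μ := volume) (by
      rw [uIcc_of_le ht.le]; exact (intervalIntegrable_iff_integrableOn_Icc_of_le ht.le).1 hg)
  rw [uIcc_of_le ht.le] at hc
  have h0 : Tendsto (fun ε => ∫ s in (0 : ℝ)..ε, g s) (𝓝[>] 0) (𝓝 0) := by
    have h1 := (hc 0 (left_mem_Icc.2 ht.le)).mono_left
      (nhdsWithin_mono 0 (Ioc_subset_Icc_self (a := (0 : ℝ)) (b := t)))
    rw [nhdsWithin_Ioc_eq_nhdsGT ht] at h1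
    simpa using h1
  have h2 := (tendsto_const_nhds (x := ∫ s in (0 : ℝ)..t, g s)).sub h0
  rw [sub_zero] at h2
  refine h2.congr' ?_
  filter_upwards [Ioo_mem_nhdsGT ht] with ε hε
  have i1 : IntervalIntegrable g volume 0 ε := hg.mono_set (by
    rw [uIcc_of_le hε.1.le, uIcc_of_le ht.le]; exact Icc_subset_Icc_right hε.2.le)
  have i2 : IntervalIntegrable g volume ε t := hg.mono_set (by
    rw [uIcc_of_le hε.2.le, uIcc_of_le ht.le]; exact Icc_subset_Icc_left hε.1.le)
  rw [← intervalIntegral.integral_add_adjacent_intervals i1 i2]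
  ring

/-- The integral equations from time `0`, as limits of those from time `ε`. -/
theorem SystemAlong.volterra (H : SystemAlong z P h f M E) {t : ℝ} (ht : t ∈ Ioo (0 : ℝ) 1) :
    P t = ∫ s in (0 : ℝ)..t, h s / h t * (f s * z s) ∧
    z t = 1 + P t / 2 - (∫ s in (0 : ℝ)..t, f s * z s) / 2 ∧
    IntervalIntegrable (fun s => h s / h t * (f s * z s)) volume 0 t := by
  have hfz : IntervalIntegrable (fun s => f s * z s) volume 0 t :=
    H.intervalIntegrable_mul.mono_set (by
      rw [uIcc_of_le ht.1.le, uIcc_of_le zero_le_one]; exact Icc_subset_Icc_right ht.2.le)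
  have hsub0 : Ioo 0 t ⊆ Ioo (0 : ℝ) 1 := Ioo_subset_Ioo_right ht.2.le
  have hhfz : IntervalIntegrable (fun s => h s / h t * (f s * z s)) volume 0 t := by
    rw [intervalIntegrable_iff_integrableOn_Ioo_of_le ht.1.le] at hfz ⊢
    have := Integrable.bdd_mul (c := M) (f := fun s => h s / h t) hfz
      (((H.h_cont.mono hsub0).div_const _).aestronglyMeasurable measurableSet_Ioo) (by
        rw [ae_restrict_iff' measurableSet_Ioo]
        exact Eventually.of_forall fun s hs => H.h_le s t hs.1 hs.2.le ht.2)
    exact this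
  have hev : ∀ᶠ ε in 𝓝[>] (0 : ℝ),
      P t = h ε / h t * P ε + ∫ s in ε..t, h s / h t * (f s * z s) ∧
      z t = z ε - P ε / 2 + P t / 2 - (∫ s in ε..t, f s * z s) / 2 := by
    filter_upwards [Ioo_mem_nhdsGT ht.1] with ε hε
    have hsub : Icc ε t ⊆ Ioo 0 1 := fun x hx => ⟨hε.1.trans_le hx.1, hx.2.trans_lt ht.2⟩
    have hsubo : Ioo ε t \ E ⊆ Ioo 0 1 \ E :=
      sdiff_subset_sdiff_left (Ioo_subset_Icc_self.trans hsub)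
    have hint : IntervalIntegrable f volume ε t := H.intervalIntegrable.mono_set (by
      rw [uIcc_of_le hε.2.le, uIcc_of_le zero_le_one]; exact hsub.trans Ioo_subset_Icc_self)
    exact volterra_of_system hε.2.le H.countable (H.z_cont.mono hsub)
      (H.P_cont.mono hsub) (H.h_cont.mono hsub) (fun s hs => H.h_ne s (hsub hs))
      (fun s hs => H.deriv_sub s (hsubo hs)) (fun s hs => H.deriv_mul s (hsubo hs)) hint
      (right_mem_Icc.2 hε.2.le)
  refine ⟨?_, ?_, hhfz⟩
  · have h1 : Tendsto (fun ε => h ε / h t * P ε) (𝓝[>] 0) (𝓝 0) := by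
      have hb : Tendsto (fun ε => M * ‖P ε‖) (𝓝[>] 0) (𝓝 0) := by
        simpa using H.P_zero.norm.const_mul M
      refine squeeze_zero_norm' ?_ hb
      filter_upwards [Ioo_mem_nhdsGT ht.1] with ε hε
      rw [norm_mul]
      exact mul_le_mul_of_nonneg_right (H.h_le ε t hε.1 hε.2.le ht.2) (norm_nonneg _)
    have h2 := h1.add (tendsto_integral_left ht.1 hhfz)
    rw [zero_add] at h2
    exact tendsto_nhds_unique (tendsto_const_nhds.congr' (hev.mono fun ε hε => hε.1)) h2
  · have h2 := (((H.z_zero.sub (H.P_zero.div_const 2)).add_const (P t / 2)).sub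
      ((tendsto_integral_left ht.1 hfz).div_const 2))
    rw [zero_div, sub_zero] at h2
    exact tendsto_nhds_unique (tendsto_const_nhds.congr' (hev.mono fun ε hε => hε.2)) h2

/-- If `|h| → ∞` at the finish then `P → 0`, by dominated convergence in the integral for `P`. -/
theorem SystemAlong.tendsto_one (H : SystemAlong z P h f M E)
    (hh : Tendsto (fun t => ‖h t‖) (𝓝[<] 1) atTop) :
    Tendsto P (𝓝[<] 1) (𝓝 0) ∧
    Tendsto z (𝓝[<] 1) (𝓝 (1 - (∫ s in (0 : ℝ)..1, f s * z s) / 2)) := by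
  have hIoo : ∀ᶠ t in 𝓝[<] (1 : ℝ), t ∈ Ioo (0 : ℝ) 1 := Ioo_mem_nhdsLT zero_lt_one
  have hP : Tendsto P (𝓝[<] 1) (𝓝 0) := by
    have hdom : Tendsto (fun t => ∫ s in Ioo (0 : ℝ) 1,
        (Ioo 0 t).indicator (fun s => h s / h t * (f s * z s)) s) (𝓝[<] 1)
        (𝓝 (∫ _ in Ioo (0 : ℝ) 1, (0 : ℂ))) := by
      apply tendsto_integral_filter_of_dominated_convergence (fun s => M * ‖f s * z s‖)
      · filter_upwards [hIoo] with t ht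
        have := (H.volterra ht).2.2
        rw [intervalIntegrable_iff_integrableOn_Ioo_of_le ht.1.le] at this
        have h2 := this.integrable_indicator measurableSet_Ioo
        exact h2.aestronglyMeasurable.restrict
      · filter_upwards [hIoo] with t ht
        refine Eventually.of_forall fun s => ?_
        by_cases hs : s ∈ Ioo 0 t
        · rw [indicator_of_mem hs, norm_mul]
          exact mul_le_mul_of_nonneg_right (H.h_le s t hs.1 hs.2.le ht.2) (norm_nonneg _)
        · rw [indicator_of_notMem hs, norm_zero]
          exact mul_nonneg H.M_nonneg (norm_nonneg _)
      · exact H.integrableOn_mul.norm.const_mul M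
      · rw [ae_restrict_iff' measurableSet_Ioo]
        refine Eventually.of_forall fun s hs => ?_
        have h1 : Tendsto (fun t => ‖h s * (f s * z s)‖ * ‖h t‖⁻¹) (𝓝[<] 1) (𝓝 0) := by
          simpa using (tendsto_inv_atTop_zero.comp hh).const_mul ‖h s * (f s * z s)‖
        refine squeeze_zero_norm (fun t => ?_) h1
        by_cases hs : s ∈ Ioo 0 t
        · rw [indicator_of_mem hs, ← norm_inv, ← norm_mul]
          apply le_of_eq; congr 1; ring
        · rw [indicator_of_notMem hs, norm_zero]; positivity
    rw [integral_zero] at hdom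
    refine hdom.congr' ?_
    filter_upwards [hIoo] with t ht
    rw [(H.volterra ht).1, setIntegral_indicator measurableSet_Ioo,
      inter_eq_self_of_subset_right (Ioo_subset_Ioo_right ht.2.le),
      intervalIntegral.integral_of_le ht.1.le, integral_Ioc_eq_integral_Ioo]
  refine ⟨hP, ?_⟩
  have hc := intervalIntegral.continuousOn_primitive_interval
    (f := fun s => f s * z s) (a := 0) (b := 1) (μ := volume) (by
      rw [uIcc_of_le zero_le_one]
      exact (intervalIntegrable_iff_integrableOn_Icc_of_le zero_le_one).1 H.intervalIntegrable_mul)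
  rw [uIcc_of_le zero_le_one] at hc
  have h1 := (hc 1 (right_mem_Icc.2 zero_le_one)).mono_left
    (nhdsWithin_mono 1 (show Ico (0 : ℝ) 1 ⊆ Icc 0 1 from Ico_subset_Icc_self))
  rw [nhdsWithin_Ico_eq_nhdsLT zero_lt_one] at h1
  have h2 := ((hP.div_const 2).const_add 1).sub (h1.div_const 2)
  rw [zero_div, add_zero] at h2
  refine h2.congr' ?_
  filter_upwards [hIoo] with t ht
  exact (H.volterra ht).2.1.symm

/-- The end-point value is close to `1` if the forcing term is small. -/
theorem SystemAlong.norm_sub_one_le (H : SystemAlong z P h f M E) :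
    ‖(1 - (∫ s in (0 : ℝ)..1, f s * z s) / 2) - 1‖ ≤ (∫ s in (0 : ℝ)..1, ‖f s‖) *
      Real.exp (2 * ((1 + M) * ∫ s in (0 : ℝ)..1, ‖f s‖)) := by
  set B := Real.exp (2 * ((1 + M) * ∫ s in (0 : ℝ)..1, ‖f s‖)) with hB
  have hi : 0 ≤ ∫ s in (0 : ℝ)..1, ‖f s‖ :=
    intervalIntegral.integral_nonneg zero_le_one fun _ _ => norm_nonneg _
  have h1 : ‖∫ s in (0 : ℝ)..1, f s * z s‖ ≤ (∫ s in (0 : ℝ)..1, ‖f s‖) * B := by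
    rw [← intervalIntegral.integral_mul_const]
    apply intervalIntegral.norm_integral_le_of_norm_le zero_le_one _
      (H.intervalIntegrable.norm.mul_const B)
    have : ∀ᵐ s : ℝ, s ≠ 1 := by simp [ae_iff, measure_singleton]
    filter_upwards [this] with s hs1 hs
    rw [norm_mul]
    exact mul_le_mul_of_nonneg_left (H.norm_le ⟨hs.1, lt_of_le_of_ne hs.2 hs1⟩) (norm_nonneg _)
  have h2 : (1 - (∫ s in (0 : ℝ)..1, f s * z s) / 2) - 1 =
      -((∫ s in (0 : ℝ)..1, f s * z s) / 2) := by ring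
  rw [h2, norm_neg, norm_div, norm_ofNat]
  have := mul_nonneg hi (exp_pos (2 * ((1 + M) * ∫ s in (0 : ℝ)..1, ‖f s‖))).le
  linarith

end Limits

end

section

/-! ### The Volterra equation along an admissible curve -/

theorem differentiable_reducedPotential (α ν : ℝ) (ħ : ℂ) :
    Differentiable ℂ (reducedPotential α ν ħ) := by
  unfold reducedPotential; fun_prop

theorem differentiable_potential (α ν : ℝ) (ħ : ℂ) :
    Differentiable ℂ (potential α ν ħ) := by
  unfold potential
  exact (differentiable_reducedPotential α ν ħ).sub (by fun_prop)

theorem differentiable_coverDeriv_reducedPotential (α ν : ℝ) (ħ : ℂ) :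
    Differentiable ℂ (coverDeriv (reducedPotential α ν ħ)) := by
  have : Differentiable ℂ (deriv (reducedPotential α ν ħ)) :=
    (differentiable_reducedPotential α ν ħ).deriv
  unfold coverDeriv
  exact Differentiable.mul (by fun_prop) this

section Action

variable {V : ℂ → ℂ} {c r w : ℝ → ℂ}

theorem PiecewiseSmooth.intervalIntegrable_action (hc : PiecewiseSmooth c)
    (hr : ContinuousOn r (Ioo 0 1)) {s t : ℝ} (hs : s ∈ Ioo (0 : ℝ) 1) (ht : t ∈ Ioo (0 : ℝ) 1) :
    IntervalIntegrable (fun τ => r τ * velocity c τ) volume s t :=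
  (hc.intervalIntegrable_velocity hs ht).continuousOn_mul
    (hr.mono ((ordConnected_Ioo).uIcc_subset hs ht))

/-- The function `h = W² √V` is, up to a factor, the exponential of twice the action. -/
theorem IsWKBLift.action_eq (h : IsWKBLift V c (Ioo 0 1) r w) (hc : PiecewiseSmooth c) {s t : ℝ}
    (hs : s ∈ Ioo (0 : ℝ) 1) (ht : t ∈ Ioo (0 : ℝ) 1) (hst : s ≤ t) :
    w t ^ 2 * r t = w s ^ 2 * r s * exp (2 * actionIncr c r s t) := by
  have hr := h.continuousOn_R hc.continuousOn
  have hsub : Icc s t ⊆ Ioo 0 1 := fun x hx => ⟨hs.1.trans_le hx.1, hx.2.trans_lt ht.2⟩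
  obtain ⟨P, hP⟩ := hc.exists_contDiffAt
  have hint := hc.intervalIntegrable_action hr hs ht
  have hAc : ContinuousOn (fun x => actionIncr c r s x) (Icc s t) := by
    have := intervalIntegral.continuousOn_primitive_interval
      (f := fun τ => r τ * velocity c τ) (a := s) (b := t) (μ := volume) (by
      rw [uIcc_of_le hst]; exact (intervalIntegrable_iff_integrableOn_Icc_of_le hst).1 hint)
    rwa [uIcc_of_le hst] at this
  have hopen : IsOpen (Ioo (0 : ℝ) 1 \ P) := isOpen_Ioo.sdiff P.finite_toSet.isClosed
  have hcont : ∀ x ∈ Ioo (0 : ℝ) 1 \ P, ContinuousAt (fun τ => r τ * velocity c τ) x :=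
    fun x hx => (hr.continuousAt (isOpen_Ioo.mem_nhds hx.1)).mul
      (continuousAt_velocity (hP x hx.1 (by simpa using hx.2)))
  have key := integral_eq_of_hasDerivAt_off_countable_of_le
    (fun x => w x ^ 2 * r x * exp (-(2 * actionIncr c r s x))) (fun _ => 0) hst
    P.countable_toSet
    (((h.continuousOn_action hc.continuousOn).mono hsub).mul (hAc.const_mul 2).neg.cexp)
    (fun x hx => by
      have hx1 : x ∈ Ioo (0 : ℝ) 1 := hsub (Ioo_subset_Icc_self hx.1)
      have hxP : x ∈ Ioo (0 : ℝ) 1 \ P := ⟨hx1, hx.2⟩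
      have h1 := h.hasDerivAt_action (isOpen_Ioo.mem_nhds hx1)
        ((hP x hx1 (by simpa using hx.2)).differentiableAt (by simp))
      have h2 : HasDerivAt (fun x => actionIncr c r s x) (r x * velocity c x) x :=
        intervalIntegral.integral_hasDerivAt_right
          (hc.intervalIntegrable_action hr hs hx1)
          (ContinuousAt.stronglyMeasurableAtFilter hopen hcont x hxP) (hcont x hxP)
      refine (h1.mul (h2.const_mul 2).neg.cexp).congr_deriv ?_
      simp only [Pi.neg_apply]
      ring) (by simp)
  simp only [intervalIntegral.integral_zero] at key
  have h0 : actionIncr c r s s = 0 := by simp [actionIncr]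
  rw [h0] at key
  simp only [mul_zero, neg_zero, Complex.exp_zero, mul_one] at key
  have e := sub_eq_zero.1 key.symm
  rw [← e, mul_assoc, ← exp_add]
  simp

theorem IsWKBLift.norm_action_eq (h : IsWKBLift V c (Ioo 0 1) r w) (hc : PiecewiseSmooth c)
    {s t : ℝ} (hs : s ∈ Ioo (0 : ℝ) 1) (ht : t ∈ Ioo (0 : ℝ) 1) (hst : s ≤ t) :
    ‖w t ^ 2 * r t‖ = ‖w s ^ 2 * r s‖ * Real.exp (2 * (actionIncr c r s t).re) := by
  rw [h.action_eq hc hs ht hst, norm_mul, norm_exp]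
  simp

theorem IsWKBLift.kernelB_eq (h : IsWKBLift V c (Ioo 0 1) r w) (hc : PiecewiseSmooth c)
    {s t : ℝ} (hs : s ∈ Ioo (0 : ℝ) 1) (ht : t ∈ Ioo (0 : ℝ) 1) (hst : s ≤ t) :
    kernelB c r t s = (w s ^ 2 * r s / (w t ^ 2 * r t) - 1) / 2 := by
  have h0 := h.action_ne_zero hs
  rw [kernelB, h.action_eq hc hs ht hst, div_mul_cancel_left₀ h0, ← exp_neg]
  congr 4; ring

end Action

/-- The neighbourhoods in `D` of the end of `D` in the direction `σ` of the real axis. -/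
def endFilter (D : Set ℂ) (σ : ℝ) : Filter ℂ :=
  comap (fun ζ : ℂ => σ * ζ.re) atTop ⊓ 𝓟 D

theorem tendsto_endFilter {β : Type*} {D : Set ℂ} {σ : ℝ} {l : Filter β} {f : β → ℂ} :
    Tendsto f l (endFilter D σ) ↔
      Tendsto (fun x => σ * (f x).re) l atTop ∧ ∀ᶠ x in l, f x ∈ D := by
  rw [endFilter, tendsto_inf, tendsto_comap_iff, tendsto_principal]; rfl

/-- `(ψ, χ)` is a solution of `ψ'' = U ψ` asymptotic to the WKB function `W` at an end of `D`, in
the sense that `ψ / W → 1` and the corresponding defect tends to `0`. -/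
structure IsAsymptotic (U V : ℂ → ℂ) (D : Set ℂ) (σ : ℝ) (ρ W ψ χ : ℂ → ℂ) : Prop where
  branch : IsWKBBranch V D ρ W
  sol : IsSolution U ψ χ
  ratio : Tendsto (fun ζ => ψ ζ / W ζ) (endFilter D σ) (𝓝 1)
  defect : Tendsto (fun ζ => defect (coverDeriv V ζ) (V ζ) (ρ ζ) (W ζ) (ψ ζ) (χ ζ))
    (endFilter D σ) (𝓝 0)

theorem IsEnd.exists_isAsymptotic {U V : ℂ → ℂ} {D : Set ℂ} {σ : ℝ} {b : ℂ} {ρ W : ℂ → ℂ}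
    {κ C a : ℝ} (hU : Differentiable ℂ U) (hV : Differentiable ℂ V)
    (hV1 : Differentiable ℂ (coverDeriv V)) (h : IsEnd U V D σ b ρ W κ C a) :
    ∃ ψ χ, IsAsymptotic U V D σ ρ W ψ χ := by
  obtain ⟨ψ, χ, hs, hb⟩ := h.exists_reference hU hV hV1
  have hE : Tendsto (fun ζ : ℂ => endError C a (σ * ζ.re)) (endFilter D σ) (𝓝 0) :=
    (tendsto_endError h.a_pos).comp (tendsto_comap.mono_left inf_le_left)
  have hD : ∀ᶠ ζ in endFilter D σ, ζ ∈ D := mem_inf_of_right (mem_principal_self D)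
  refine ⟨ψ, χ, h.branch, hs, ?_, ?_⟩
  · rw [tendsto_iff_norm_sub_tendsto_zero]
    exact squeeze_zero' (Eventually.of_forall fun _ => norm_nonneg _)
      (hD.mono fun ζ hζ => (hb ζ hζ).1) hE
  · exact squeeze_zero_norm' (hD.mono fun ζ hζ => (hb ζ hζ).2) hE

section Endpoint

variable {α ν : ℝ} {ħ : ℂ} {p q : BoundaryPoint} {c r w : ℝ → ℂ}

/-- The density `F dy` of the Volterra equation. -/
def forcingDensity (α ν : ℝ) (ħ : ℂ) (c r : ℝ → ℂ) (t : ℝ) : ℂ :=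
  forcing (potential α ν ħ) (reducedPotential α ν ħ) (c t) (r t) * velocity c t

theorem PiecewiseSmooth.aestronglyMeasurable_forcingDensity (hs : PiecewiseSmooth c)
    (hl : IsWKBLift (reducedPotential α ν ħ) c (Ioo 0 1) r w) :
    AEStronglyMeasurable (forcingDensity α ν ħ c r) (volume.restrict (Ioo 0 1)) := by
  obtain ⟨P, hP⟩ := hs.exists_contDiffAt
  have hF := hl.continuousOn_forcing (U := potential α ν ħ)
    (differentiable_potential α ν ħ).continuous
    (differentiable_coverDeriv_reducedPotential α ν ħ) hs.continuousOn
  have hv : AEStronglyMeasurable (velocity c) (volume.restrict (Ioo 0 1)) := by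
    have h1 : ContinuousOn (velocity c) (Ioo (0 : ℝ) 1 \ P) := fun x hx =>
      (continuousAt_velocity (hP x hx.1 (by simpa using hx.2))).continuousWithinAt
    have h2 := h1.aestronglyMeasurable (μ := volume) (measurableSet_Ioo.diff P.measurableSet)
    have h3 : volume.restrict (Ioo (0 : ℝ) 1 \ P) = volume.restrict (Ioo 0 1) :=
      Measure.restrict_congr_set (sdiff_null_ae_eq_self (P.finite_toSet.measure_zero _))
    rwa [h3] at h2
  exact (hF.aestronglyMeasurable measurableSet_Ioo).mul hv

theorem IsAdmissible.integrableOn_forcingDensity (h : IsAdmissible α ν ħ p q c r)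
    (hl : IsWKBLift (reducedPotential α ν ħ) c (Ioo 0 1) r w) :
    IntegrableOn (forcingDensity α ν ħ c r) (Ioo 0 1) :=
  h.integrable.mono' (h.smooth.aestronglyMeasurable_forcingDensity hl)
    (Eventually.of_forall fun t => by rw [forcingDensity, norm_mul])

theorem IsAdmissible.norm_action_le (h : IsAdmissible α ν ħ p q c r)
    (hl : IsWKBLift (reducedPotential α ν ħ) c (Ioo 0 1) r w) {β : ℝ}
    (hβ : ∀ s t : ℝ, 0 < s → s ≤ t → t < 1 → β ≤ (actionIncr c r s t).re) (s t : ℝ)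
    (hs : 0 < s) (hst : s ≤ t) (ht : t < 1) :
    ‖w s ^ 2 * r s / (w t ^ 2 * r t)‖ ≤ Real.exp (-2 * β) := by
  have hs1 : s ∈ Ioo (0 : ℝ) 1 := ⟨hs, hst.trans_lt ht⟩
  have h0 : 0 < ‖w s ^ 2 * r s‖ := norm_pos_iff.2 (hl.action_ne_zero hs1)
  rw [norm_div, hl.norm_action_eq h.smooth hs1 ⟨hs.trans_le hst, ht⟩ hst,
    div_mul_cancel_left₀ h0.ne', ← Real.exp_neg]
  exact exp_le_exp.2 (by linarith [hβ s t hs hst ht])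

theorem IsAdmissible.tendsto_norm_action (h : IsAdmissible α ν ħ p q c r)
    (hl : IsWKBLift (reducedPotential α ν ħ) c (Ioo 0 1) r w) :
    Tendsto (fun t => ‖w t ^ 2 * r t‖) (𝓝[<] 1) atTop := by
  have hh : (1 / 2 : ℝ) ∈ Ioo (0 : ℝ) 1 := by norm_num
  have h0 : 0 < ‖w (1 / 2) ^ 2 * r (1 / 2)‖ := norm_pos_iff.2 (hl.action_ne_zero hh)
  have h1 := (Real.tendsto_exp_atTop.comp
    ((h.levinson _ hh).const_mul_atTop (zero_lt_two' ℝ))).const_mul_atTop h0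
  refine h1.congr' ?_
  filter_upwards [Ioo_mem_nhdsLT (show (1 / 2 : ℝ) < 1 by norm_num)] with t ht
  exact (hl.norm_action_eq h.smooth hh ⟨by linarith [ht.1], ht.2⟩ ht.1.le).symm

/-- The kernel in terms of `h = W² √V`: `2 B(t, s) = h(s) / h(t) - 1`. -/
theorem IsAdmissible.kernel_integrand_eq (h : IsAdmissible α ν ħ p q c r)
    (hl : IsWKBLift (reducedPotential α ν ħ) c (Ioo 0 1) r w) {s t : ℝ}
    (hs : 0 < s) (hst : s ≤ t) (ht : t < 1) (z : ℂ) :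
    kernelB c r t s * forcing (potential α ν ħ) (reducedPotential α ν ħ) (c s) (r s) *
      velocity c s * z =
    (w s ^ 2 * r s / (w t ^ 2 * r t) * (forcingDensity α ν ħ c r s * z)
      - forcingDensity α ν ħ c r s * z) / 2 := by
  rw [hl.kernelB_eq h.smooth ⟨hs, hst.trans_lt ht⟩ ⟨hs.trans_le hst, ht⟩ hst, forcingDensity]
  ring

/-- Solutions of the Volterra equation are unique. -/
theorem IsAdmissible.volterra_unique (h : IsAdmissible α ν ħ p q c r)
    (hl : IsWKBLift (reducedPotential α ν ħ) c (Ioo 0 1) r w) {z₁ z₂ : ℝ → ℂ}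
    (h₁ : IsVolterraSolution α ν ħ c r z₁) (h₂ : IsVolterraSolution α ν ħ c r z₂) :
    z₁ 1 = z₂ 1 := by
  obtain ⟨β, hβ⟩ := h.action_bounded_below
  set M := Real.exp (-2 * β)
  have hf := h.integrableOn_forcingDensity hl
  set f := forcingDensity α ν ħ c r
  have heq : ∀ T ∈ Ioo (0 : ℝ) 1, z₁ T = z₂ T := by
    intro T hT
    have hsubT : Icc 0 T ⊆ Icc (0 : ℝ) 1 := Icc_subset_Icc_right hT.2.le
    have hfT : IntervalIntegrable f volume 0 T := by
      rw [intervalIntegrable_iff_integrableOn_Ioo_of_le hT.1.le]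
      exact hf.mono_set (Ioo_subset_Ioo_right hT.2.le)
    have hu : ContinuousOn (fun t => ‖z₁ t - z₂ t‖) (Icc 0 T) :=
      ((h₁.1.sub h₂.1).mono hsubT).norm
    have hint : ∀ z : ℝ → ℂ, ContinuousOn z (Icc 0 1) → ∀ t ∈ Icc (0 : ℝ) T,
        IntervalIntegrable (fun s => kernelB c r t s *
          forcing (potential α ν ħ) (reducedPotential α ν ħ) (c s) (r s) *
          velocity c s * z s) volume 0 t := by
      intro z hz t ht
      have hft : IntervalIntegrable f volume 0 t := hfT.mono_set (by
        rw [uIcc_of_le hT.1.le, uIcc_of_le ht.1]; exact Icc_subset_Icc_right ht.2)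
      have hfz : IntervalIntegrable (fun s => f s * z s) volume 0 t :=
        hft.mul_continuousOn (by
          rw [uIcc_of_le ht.1]; exact hz.mono ((Icc_subset_Icc_right ht.2).trans hsubT))
      rw [intervalIntegrable_iff_integrableOn_Ioo_of_le ht.1] at hfz ⊢
      have hsub0 : Ioo 0 t ⊆ Ioo (0 : ℝ) 1 := Ioo_subset_Ioo_right (ht.2.trans hT.2.le)
      have h3 := Integrable.bdd_mul (c := M)
        (f := fun s => w s ^ 2 * r s / (w t ^ 2 * r t)) hfz
        ((((hl.continuousOn_action h.smooth.continuousOn).mono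
          hsub0).div_const _).aestronglyMeasurable measurableSet_Ioo) (by
          rw [ae_restrict_iff' measurableSet_Ioo]
          exact Eventually.of_forall fun s hs =>
            h.norm_action_le hl hβ s t hs.1 hs.2.le (ht.2.trans_lt hT.2))
      refine IntegrableOn.congr_fun ((Integrable.sub h3 hfz).div_const 2) (fun s hs => ?_)
        measurableSet_Ioo
      exact (h.kernel_integrand_eq hl hs.1 hs.2.le (ht.2.trans_lt hT.2) (z s)).symm
    -- Gronwall for `|z₁ - z₂|`: the modulus of the kernel is at most `(1 + M) / 2`
    have hG := le_mul_exp_of_le_add_integral (k := fun s => (1 + M) / 2 * ‖f s‖) (A := 0)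
      (u := fun t => ‖z₁ t - z₂ t‖) hT.1.le (hfT.norm.const_mul _) (fun _ _ => by positivity) hu
      (fun _ _ => norm_nonneg _) (fun t ht => ?_) T (right_mem_Icc.2 hT.1.le)
    · simp only [zero_mul] at hG
      exact sub_eq_zero.1 (norm_le_zero_iff.1 hG)
    · have ht1 : t ∈ Ico (0 : ℝ) 1 := ⟨ht.1, ht.2.trans_lt hT.2⟩
      have hft : IntervalIntegrable f volume 0 t := hfT.mono_set (by
        rw [uIcc_of_le hT.1.le, uIcc_of_le ht.1]; exact Icc_subset_Icc_right ht.2)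
      rw [zero_add, h₁.2 t ht1, h₂.2 t ht1, add_sub_add_left_eq_sub,
        ← intervalIntegral.integral_sub (hint z₁ h₁.1 t ht) (hint z₂ h₂.1 t ht)]
      apply intervalIntegral.norm_integral_le_of_norm_le ht.1
      · refine Eventually.of_forall fun s hs => ?_
        rw [← mul_sub, mul_assoc (kernelB c r t s), norm_mul, norm_mul]
        gcongr
        · have hs1 : s < 1 := hs.2.trans_lt ht1.2
          rw [hl.kernelB_eq h.smooth ⟨hs.1, hs1⟩ ⟨hs.1.trans_le hs.2, ht1.2⟩ hs.2, norm_div,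
            norm_ofNat]
          have := norm_sub_le (w s ^ 2 * r s / (w t ^ 2 * r t)) 1
          have h4 := h.norm_action_le hl hβ s t hs.1 hs.2 ht1.2
          rw [norm_one] at this
          gcongr
          linarith
        · exact le_rfl
      · exact (hft.norm.const_mul _).mul_continuousOn (by
          rw [uIcc_of_le ht.1]; exact hu.mono (Icc_subset_Icc_right ht.2))
  have hcl : ∀ z : ℝ → ℂ, ContinuousOn z (Icc 0 1) → Tendsto z (𝓝[<] 1) (𝓝 (z 1)) := by
    intro z hz
    have := (hz 1 (right_mem_Icc.2 zero_le_one)).mono_left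
      (nhdsWithin_mono 1 (show Ico (0 : ℝ) 1 ⊆ Icc 0 1 from Ico_subset_Icc_self))
    rwa [nhdsWithin_Ico_eq_nhdsLT zero_lt_one] at this
  refine tendsto_nhds_unique ((hcl z₁ h₁.1).congr' ?_) (hcl z₂ h₂.1)
  filter_upwards [Ioo_mem_nhdsLT (zero_lt_one' ℝ)] with t ht using heq t ht

section

variable {Dp Dq : Set ℂ} {σp σq : ℝ} {ρp Wp ψp χp ρq Wq ψq χq : ℂ → ℂ} {kp kq : ℂ}

/-- If the end-point asymptotics of the continued WKB function are known, then the Volterra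
equation is solved by the ratio of the solution subdominant at the initial end-point and the WKB
function, and the end-point value is a multiple of the Wronskian of the two solutions which are
subdominant at the end-points. -/
theorem IsAdmissible.exists_volterra (h : IsAdmissible α ν ħ p q c r)
    (hl : IsWKBLift (reducedPotential α ν ħ) c (Ioo 0 1) r w)
    (Sp : IsAsymptotic (potential α ν ħ) (reducedPotential α ν ħ) Dp σp ρp Wp ψp χp)
    (Sq : IsAsymptotic (potential α ν ħ) (reducedPotential α ν ħ) Dq σq ρq Wq ψq χq)
    (hp : Tendsto c (𝓝[>] 0) (endFilter Dp σp)) (hq : Tendsto c (𝓝[<] 1) (endFilter Dq σq))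
    (hkp : kp ≠ 0) (hkq : kq ≠ 0)
    (ep : ∀ᶠ t in 𝓝[>] 0, r t = ρp (c t) ∧ w t = kp * Wp (c t))
    (eq : ∀ᶠ t in 𝓝[<] 1, -r t = ρq (c t) ∧ (r t * w t)⁻¹ = kq * Wq (c t)) :
    ∃ z, IsVolterraSolution α ν ħ c r z ∧
      (∀ ξ, -2 * z 1 = kp * kq * (ψp ξ * χq ξ - χp ξ * ψq ξ)) ∧
      ∀ β m : ℝ, (∀ s t : ℝ, 0 < s → s ≤ t → t < 1 → β ≤ (actionIncr c r s t).re) →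
        (∫ t in Ioo (0 : ℝ) 1, ‖forcing (potential α ν ħ) (reducedPotential α ν ħ)
          (c t) (r t)‖ * ‖velocity c t‖) ≤ m →
        ‖z 1 - 1‖ ≤ m * Real.exp (2 * ((1 + Real.exp (-2 * β)) * m)) := by
  obtain ⟨β, hβ⟩ := h.action_bounded_below
  obtain ⟨P, hP⟩ := h.smooth.exists_contDiffAt
  have hV := differentiable_reducedPotential α ν ħ
  have hV1 := differentiable_coverDeriv_reducedPotential α ν ħ
  have hf := h.integrableOn_forcingDensity hl
  have hcc := h.smooth.continuousOn
  set V := reducedPotential α ν ħ with hVdef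
  set U := potential α ν ħ
  set f := forcingDensity α ν ħ c r with hfdef
  have hsol := Sp.sol.const_mul kp
  set z : ℝ → ℂ := ratioAlong (fun ζ => kp * ψp ζ) c w with hz
  set Q : ℝ → ℂ := defectAlong V (fun ζ => kp * ψp ζ) (fun ζ => kp * χp ζ) c r w with hQ
  have hz0 : Tendsto z (𝓝[>] 0) (𝓝 1) := by
    refine (Sp.ratio.comp hp).congr' (ep.mono fun t ht => ?_)
    simp only [hz, ratioAlong, ht.2, Function.comp_apply]
    rw [mul_div_mul_left _ _ hkp]
  have hQ0 : Tendsto Q (𝓝[>] 0) (𝓝 0) := by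
    refine (Sp.defect.comp hp).congr' (ep.mono fun t ht => ?_)
    simp only [hQ, defectAlong, ht.2, ht.1, Function.comp_apply]
    rw [defect_smul_smul hkp]
  have sys : ∀ β : ℝ, (∀ s t : ℝ, 0 < s → s ≤ t → t < 1 → β ≤ (actionIncr c r s t).re) →
      SystemAlong z Q (fun t => w t ^ 2 * r t) f (Real.exp (-2 * β)) P := fun β hβ =>
    { countable := P.countable_toSet
      z_cont := hl.continuousOn_ratioAlong hcc hsol
      P_cont := hl.continuousOn_defectAlong hV hV1 hcc hsol
      h_cont := hl.continuousOn_action hcc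
      h_ne := fun t ht => hl.action_ne_zero ht
      deriv_sub := fun t ht => hl.hasDerivAt_sub hV hV1 hsol (isOpen_Ioo.mem_nhds ht.1)
        ((hP t ht.1 (by simpa using ht.2)).differentiableAt (by simp))
      deriv_mul := fun t ht => hl.hasDerivAt_mul hV hV1 hsol (isOpen_Ioo.mem_nhds ht.1)
        ((hP t ht.1 (by simpa using ht.2)).differentiableAt (by simp))
      f_int := hf
      h_le := h.norm_action_le hl hβ
      z_zero := hz0
      P_zero := hQ0 }
  have S := sys β hβ
  obtain ⟨hQ1, hz1⟩ := S.tendsto_one (h.tendsto_norm_action hl)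
  set z₁ := 1 - (∫ s in (0 : ℝ)..1, f s * z s) / 2 with hz₁
  let Z : ℝ → ℂ := fun t => if t = 0 then 1 else if t = 1 then z₁ else z t
  have hZ : ∀ t ∈ Ioo (0 : ℝ) 1, Z t = z t := fun t ht => by
    simp [Z, ht.1.ne', ht.2.ne]
  have hZ0 : Z 0 = 1 := by simp [Z]
  have hZ1 : Z 1 = z₁ := by simp [Z]
  refine ⟨Z, ⟨?_, ?_⟩, fun ξ => ?_, fun β m hβ hm => ?_⟩
  · have hev0 : z =ᶠ[𝓝[>] 0] Z := by
      filter_upwards [Ioo_mem_nhdsGT (zero_lt_one' ℝ)] with t ht using (hZ t ht).symm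
    have hev1 : z =ᶠ[𝓝[<] 1] Z := by
      filter_upwards [Ioo_mem_nhdsLT (zero_lt_one' ℝ)] with t ht using (hZ t ht).symm
    intro t ht
    rcases eq_or_lt_of_le ht.1 with h0 | h0
    · subst h0
      have : ContinuousWithinAt Z (Ioi 0) 0 := by
        rw [ContinuousWithinAt, hZ0]; exact hz0.congr' hev0
      exact (continuousWithinAt_Ioi_iff_Ici.1 this).mono Icc_subset_Ici_self
    rcases eq_or_lt_of_le ht.2 with h1 | h1
    · subst h1
      have : ContinuousWithinAt Z (Iio 1) 1 := by
        rw [ContinuousWithinAt, hZ1]; exact hz1.congr' hev1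
      exact (continuousWithinAt_Iio_iff_Iic.1 this).mono Icc_subset_Iic_self
    · refine (((S.z_cont.continuousAt (Ioo_mem_nhds h0 h1))).congr ?_).continuousWithinAt
      filter_upwards [Ioo_mem_nhds h0 h1] with s hs using (hZ s hs).symm
  · intro t ht
    rcases eq_or_lt_of_le ht.1 with h0 | h0
    · subst h0; simp [hZ0]
    have ht' : t ∈ Ioo (0 : ℝ) 1 := ⟨h0, ht.2⟩
    obtain ⟨v1, v2, v3⟩ := S.volterra ht'
    have hfz : IntervalIntegrable (fun s => f s * z s) volume 0 t :=
      S.intervalIntegrable_mul.mono_set (by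
        rw [uIcc_of_le h0.le, uIcc_of_le zero_le_one]; exact Icc_subset_Icc_right ht.2.le)
    rw [hZ t ht', v2, v1]
    have : ∫ s in (0 : ℝ)..t, kernelB c r t s * forcing U V (c s) (r s) * velocity c s * Z s =
        ∫ s in (0 : ℝ)..t, (w s ^ 2 * r s / (w t ^ 2 * r t) * (f s * z s) - f s * z s) / 2 := by
      rw [intervalIntegral.integral_of_le h0.le, intervalIntegral.integral_of_le h0.le]
      refine setIntegral_congr_fun measurableSet_Ioc fun s hs => ?_
      rw [hZ s ⟨hs.1, hs.2.trans_lt ht.2⟩]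
      exact h.kernel_integrand_eq hl hs.1 hs.2 ht.2 (z s)
    rw [this, intervalIntegral.integral_div, intervalIntegral.integral_sub v3 hfz]
    ring
  · have hlq := hl.flip
    set w' : ℝ → ℂ := fun x => (r x * w x)⁻¹
    have hr' : Tendsto (ratioAlong (fun ζ => kq * ψq ζ) c w') (𝓝[<] 1) (𝓝 1) := by
      refine (Sq.ratio.comp hq).congr' (eq.mono fun t ht => ?_)
      simp only [ratioAlong, w', ht.2, Function.comp_apply]
      rw [mul_div_mul_left _ _ hkq]
    have hd' : Tendsto (defectAlong V (fun ζ => kq * ψq ζ) (fun ζ => kq * χq ζ) c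
        (fun t => -r t) w') (𝓝[<] 1) (𝓝 0) := by
      refine (Sq.defect.comp hq).congr' (eq.mono fun t ht => ?_)
      simp only [defectAlong, w', ht.2, ht.1, Function.comp_apply]
      rw [defect_smul_smul hkq]
    have hlim := (((hz1.mul hr').const_mul (-2)).add (hz1.mul hd')).add (hQ1.mul hr')
    simp only [mul_one, mul_zero, add_zero] at hlim
    rw [hZ1]
    refine tendsto_nhds_unique hlim (tendsto_const_nhds.congr' ?_)
    filter_upwards [Ioo_mem_nhdsLT (zero_lt_one' ℝ)] with t ht
    have h1 := hl.w_ne_zero ht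
    have h2 := hl.R_ne_zero ht
    rw [Sp.sol.wronskian_eq Sq.sol ξ (c t)]
    have h3 : V (c t) ≠ 0 := h.ne_zero t ht
    simp only [hz, hQ, ratioAlong, defectAlong, WKB.defect, w']
    field_simp
    ring
  · rw [hZ1]
    have hb := (sys β hβ).norm_sub_one_le
    have hI : ∫ s in (0 : ℝ)..1, ‖f s‖ ≤ m := by
      rw [intervalIntegral.integral_of_le zero_le_one, integral_Ioc_eq_integral_Ioo]
      refine le_trans (le_of_eq ?_) hm
      exact integral_congr_ae (Eventually.of_forall fun t => by
        simp only [hfdef, forcingDensity, norm_mul]; rfl)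
    have hI0 : 0 ≤ ∫ s in (0 : ℝ)..1, ‖f s‖ :=
      intervalIntegral.integral_nonneg zero_le_one fun _ _ => norm_nonneg _
    refine hb.trans ?_
    have := hI0.trans hI
    gcongr

end

end Endpoint

end

section

/-! ### Homotopy invariance of the end-point value -/

theorem IsWKBLift.congr {X : Type*} [TopologicalSpace X] {V : ℂ → ℂ} {c : X → ℂ} {A : Set X}
    {R w R' w' : X → ℂ} (h : IsWKBLift V c A R w) (hR : ∀ x ∈ A, R' x = R x)
    (hw : ∀ x ∈ A, w' x = w x) : IsWKBLift V c A R' w' := by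
  intro x hx
  obtain ⟨D, ρ, W, hb, hc, he⟩ := h x hx
  refine ⟨D, ρ, W, hb, hc, ?_⟩
  filter_upwards [he, eventually_mem_nhdsWithin] with y hy hyA
  rwa [hR y hyA, hw y hyA]

/-- A continuation along a map into the domain of a branch is, up to constants, the given branch or
the opposite one. -/
theorem IsWKBLift.eq_or_eq_flip {X : Type*} [TopologicalSpace X] {V : ℂ → ℂ} {c : X → ℂ} {A : Set X}
    {R w : X → ℂ} (h : IsWKBLift V c A R w) {D : Set ℂ} {ρ W : ℂ → ℂ} (hb : IsWKBBranch V D ρ W)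
    (hc : ContinuousOn c A) (hcD : MapsTo c A D) (hA : IsPreconnected A) (hne : A.Nonempty) :
    (∃ k : ℂ, k ≠ 0 ∧ ∀ x ∈ A, R x = ρ (c x) ∧ w x = k * W (c x)) ∨
    (∃ k : ℂ, k ≠ 0 ∧ ∀ x ∈ A, -R x = ρ (c x) ∧ (R x * w x)⁻¹ = k * W (c x)) := by
  obtain ⟨x₀, hx₀⟩ := hne
  have key : ∀ {R w : X → ℂ}, IsWKBLift V c A R w → R x₀ = ρ (c x₀) →
      ∃ k : ℂ, k ≠ 0 ∧ ∀ x ∈ A, R x = ρ (c x) ∧ w x = k * W (c x) := by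
    intro R w h hR
    have hk : w x₀ / W (c x₀) ≠ 0 := div_ne_zero (h.w_ne_zero hx₀) (hb.W_ne_zero _ (hcD hx₀))
    exact ⟨_, hk, h.eqOn ((hb.isWKBLift hcD).const_mul hk) hc hA hx₀ hR
      (div_mul_cancel₀ _ (hb.W_ne_zero _ (hcD hx₀))).symm⟩
  have hs := h.sq hx₀
  rw [← hb.sq _ (hcD hx₀)] at hs
  rcases sq_eq_sq_iff_eq_or_eq_neg.1 hs with e | e
  · exact Or.inl (key h e)
  · exact Or.inr (key h.flip (by rw [e, neg_neg]))

/-- In a horizontal half-strip the action of the branch of an end tends to `-∞` towards that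
end. -/
theorem IsEnd.tendsto_action {U V : ℂ → ℂ} {D : Set ℂ} {σ : ℝ} {b : ℂ} {ρ W : ℂ → ℂ}
    {κ C a : ℝ} (h : IsEnd U V D σ b ρ W κ C a) {m₀ B : ℝ} (hm₀ : 0 < m₀)
    (hm : ∀ ζ ∈ D, m₀ ≤ ‖exp ζ * ρ ζ‖) (hB : ∀ ζ ∈ D, |ζ.im - b.im| ≤ B) :
    Tendsto (fun ζ => ‖W ζ ^ 2 * ρ ζ‖) (endFilter D σ) (𝓝 0) := by
  have hbD : b ∈ D := by simpa using h.base 0 le_rfl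
  have hκ := h.κ_pos
  have hre : Tendsto (fun ζ : ℂ => σ * ζ.re) (endFilter D σ) atTop :=
    tendsto_comap.mono_left inf_le_left
  have hD : ∀ᶠ ζ in endFilter D σ, ζ ∈ D := mem_inf_of_right (mem_principal_self D)
  have hX : Tendsto (fun ζ : ℂ => κ * m₀ * (σ * ζ.re + -(σ * b.re))) (endFilter D σ) atTop :=
    (hre.atTop_add tendsto_const_nhds).const_mul_atTop (by positivity)
  have hlim : Tendsto (fun ζ : ℂ => ‖W b ^ 2 * ρ b‖ *
      Real.exp (-(κ * m₀ * (σ * ζ.re + -(σ * b.re))))) (endFilter D σ) (𝓝 0) := by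
    have := (Real.tendsto_exp_neg_atTop_nhds_zero.comp hX).const_mul ‖W b ^ 2 * ρ b‖
    rw [mul_zero] at this
    exact this
  refine squeeze_zero' (Eventually.of_forall fun _ => norm_nonneg _) ?_ hlim
  filter_upwards [hD, hre.eventually_ge_atTop (σ * b.re + 2 * B / κ + 1)] with ζ hζ hζX
  set X := σ * ζ.re + -(σ * b.re) with hXdef
  have hB0 : 0 ≤ B := (abs_nonneg _).trans (hB ζ hζ)
  have hX1 : 2 * B ≤ κ * X := by
    have : 2 * B / κ ≤ X := by rw [hXdef]; linarith
    rwa [div_le_iff₀' hκ] at this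
  set L : ℝ → ℂ := fun t => ζ + (t : ℂ) * (b - ζ)
  have hLD : ∀ t ∈ Icc (0 : ℝ) 1, L t ∈ D := fun t ht => line_mem_of_convex h.convex hζ hbD ht
  set μ := κ * m₀ * X with hμ
  set m : ℝ → ℂ := fun t => exp (L t) * ρ (L t) * (b - ζ) with hmdef
  have hd : ∀ t ∈ Icc (0 : ℝ) 1, HasDerivAt
      (fun t : ℝ => (W (L t) ^ 2 * ρ (L t)) * exp (-(μ * t : ℝ)))
      (2 * (m t - μ / 2) * ((W (L t) ^ 2 * ρ (L t)) * exp (-(μ * t : ℝ)))) t := by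
    intro t ht
    have h1 := (h.branch.deriv_action (hLD t ht)).comp t (hasDerivAt_line ζ b t)
    have h2 : HasDerivAt (fun t : ℝ => exp (-(μ * t : ℝ)))
        (exp (-(μ * t : ℝ)) * (-(μ : ℂ))) t := by
      have := ((ofRealCLM.hasDerivAt (x := t)).const_mul (μ : ℂ)).neg.cexp
      simpa using this
    refine (h1.mul h2).congr_deriv ?_
    simp only [Function.comp_apply, hmdef, L]
    ring
  have hmono := norm_action_monotoneOn (a := 0) (b := 1)
    (h := fun t : ℝ => (W (L t) ^ 2 * ρ (L t)) * exp (-(μ * t : ℝ)))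
    (m := fun t => m t - μ / 2)
    (fun t ht => (hd t ht).continuousAt.continuousWithinAt)
    (fun t ht => hd t (Ioo_subset_Icc_self ht)) (fun t ht => by
      have htD := hLD t (Ioo_subset_Icc_self ht)
      have e1 := h.mono _ htD
      have e2 := hm _ htD
      have e3 := hB ζ hζ
      set n := exp (L t) * ρ (L t)
      have e4 : (m t - (μ : ℂ) / 2).re = n.re * (b - ζ).re - n.im * (b - ζ).im - μ / 2 := by
        have : (μ : ℂ) / 2 = ((μ / 2 : ℝ) : ℂ) := by push_cast; rfl
        rw [sub_re, this, ofReal_re, hmdef, mul_re]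
      rw [e4]
      have e5 : n.re * (b - ζ).re = (-σ * n.re) * X := by
        rw [hXdef, sub_re]
        linear_combination (n.re * ζ.re - n.re * b.re) * h.σ_sq
      have e6 : n.im * (b - ζ).im ≤ ‖n‖ * B := by
        refine (le_abs_self _).trans ?_
        rw [abs_mul]
        refine mul_le_mul (abs_im_le_norm n) ?_ (abs_nonneg _) (norm_nonneg _)
        rw [sub_im, abs_sub_comm]; exact e3
      have hX0 : 0 ≤ X := by
        by_contra hneg
        nlinarith
      have e7 : κ * ‖n‖ * X ≤ (-σ * n.re) * X := mul_le_mul_of_nonneg_right e1 hX0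
      have e8 : ‖n‖ * (2 * B) ≤ ‖n‖ * (κ * X) := mul_le_mul_of_nonneg_left hX1 (norm_nonneg _)
      have e9 : (κ * X) * m₀ ≤ (κ * X) * ‖n‖ :=
        mul_le_mul_of_nonneg_left e2 (by positivity)
      rw [e5, hμ]
      linarith)
  have := hmono (left_mem_Icc.2 zero_le_one) (right_mem_Icc.2 zero_le_one) zero_le_one
  simp only [L, Complex.ofReal_zero, zero_mul, add_zero, mul_zero, neg_zero, Complex.exp_zero,
    mul_one, ofReal_one, one_mul, add_sub_cancel] at this
  have h2 := abs_le_of_sq_le_sq this (norm_nonneg _)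
  rw [abs_of_nonneg (norm_nonneg _), norm_mul (W b ^ 2 * ρ b), ← Complex.ofReal_neg,
    Complex.norm_exp_ofReal] at h2
  exact h2

/-- The data attached to a neighbourhood `D` of the boundary point `p`: the branch `(ρ, W)` of the
WKB function which is subdominant at `p` and an exact solution asymptotic to it. At the points
`∞_k` the action along this branch tends to `-∞`; at `0` this fails on curves which spiral. -/
structure IsBoundaryChart (α ν : ℝ) (ħ : ℂ) (p : BoundaryPoint) (D : Set ℂ) (σ : ℝ)
    (ρ W ψ χ : ℂ → ℂ) : Prop where
  asymptotic : IsAsymptotic (potential α ν ħ) (reducedPotential α ν ħ) D σ ρ W ψ χ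
  action : p ≠ .zero → Tendsto (fun ζ => ‖W ζ ^ 2 * ρ ζ‖) (endFilter D σ) (𝓝 0)
  sign : ∀ ζ ∈ D, 0 < -σ * (exp ζ * ρ ζ).re
  σ_zero : p = .zero → σ = -1

section

variable {α ν : ℝ} {ħ : ℂ} {p q : BoundaryPoint} {c r w : ℝ → ℂ}

theorem TendsToBoundary.comp {β γ : Type} {l : Filter β} {l' : Filter γ} {f : β → ℂ} {φ : γ → β}
    (h : TendsToBoundary α ħ l f p) (hφ : Tendsto φ l' l) :
    TendsToBoundary α ħ l' (fun x => f (φ x)) p := by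
  cases p with
  | zero => exact Tendsto.comp (g := fun x => (f x).re) h hφ
  | infty k =>
    obtain ⟨h1, ε, hε, h2⟩ := h
    exact ⟨h1.comp hφ, ε, hε, hφ.eventually h2⟩

theorem TendsToBoundary.congr' {β : Type} {l : Filter β} {f g : β → ℂ}
    (h : TendsToBoundary α ħ l f p) (hfg : f =ᶠ[l] g) : TendsToBoundary α ħ l g p := by
  cases p with
  | zero => exact Tendsto.congr' (hfg.mono fun x hx => by rw [hx]) h
  | infty k =>
    obtain ⟨h1, ε, hε, h2⟩ := h
    refine ⟨h1.congr' (hfg.mono fun x hx => by rw [hx]), ε, hε, ?_⟩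
    filter_upwards [h2, hfg] with x hx hx'
    rwa [← hx']

theorem tendsto_slice (a : ℝ) (ha : a ∈ Icc (0 : ℝ) 1) (l : Filter ℝ) :
    Tendsto (fun t => (a, t)) l (𝓟 (Icc (0 : ℝ) 1) ×ˢ l) :=
  Tendsto.prodMk (tendsto_principal.2 (Eventually.of_forall fun _ => ha)) tendsto_id

/-- The branch `-√V` cannot be subdominant at the start: then `|h| → ∞` there, against the lower
bound for the action. -/
theorem IsAdmissible.not_flip_start {D : Set ℂ} {σ : ℝ} {ρ W ψ χ : ℂ → ℂ} {k : ℂ}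
    (h : IsAdmissible α ν ħ p q c r)
    (hl : IsWKBLift (reducedPotential α ν ħ) c (Ioo 0 1) r w)
    (hC : IsBoundaryChart α ν ħ p D σ ρ W ψ χ) (hp : p ≠ .zero)
    (hc : Tendsto c (𝓝[>] 0) (endFilter D σ))
    (e : ∀ᶠ t in 𝓝[>] 0, -r t = ρ (c t) ∧ (r t * w t)⁻¹ = k * W (c t)) : False := by
  obtain ⟨β, hβ⟩ := h.action_bounded_below
  have h0 : Tendsto (fun t => ‖k‖ ^ 2 * ‖W (c t) ^ 2 * ρ (c t)‖) (𝓝[>] 0) (𝓝 0) := by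
    simpa using ((hC.action hp).comp hc).const_mul (‖k‖ ^ 2)
  have hhalf : (1 / 2 : ℝ) ∈ Ioo (0 : ℝ) 1 := by norm_num
  have hpos : 0 < ‖w (1 / 2) ^ 2 * r (1 / 2)‖ := norm_pos_iff.2 (hl.action_ne_zero hhalf)
  set A := ‖w (1 / 2) ^ 2 * r (1 / 2)‖
  have hsmall := h0.eventually_lt_const (show 0 < Real.exp (2 * β) / A by positivity)
  obtain ⟨s, hs1, hs2, hs3⟩ := (hsmall.and (e.and
    (Ioo_mem_nhdsGT (show (0 : ℝ) < 1 / 2 by norm_num)))).exists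
  have hs : s ∈ Ioo (0 : ℝ) 1 := ⟨hs3.1, by linarith [hs3.2]⟩
  have e1 := hl.norm_action_eq h.smooth hs hhalf hs3.2.le
  have e2 := exp_le_exp.2
    (mul_le_mul_of_nonneg_left (hβ s (1 / 2) hs3.1 hs3.2.le (by norm_num)) zero_le_two)
  have hr := hl.R_ne_zero hs
  have hw := hl.w_ne_zero hs
  have e3 : ‖k‖ ^ 2 * ‖W (c s) ^ 2 * ρ (c s)‖ = ‖w s ^ 2 * r s‖⁻¹ := by
    rw [← norm_pow, ← norm_mul, ← mul_assoc, ← mul_pow, ← hs2.2, ← hs2.1, ← norm_inv, ← norm_neg]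
    congr 1
    field_simp
  have hps : 0 < ‖w s ^ 2 * r s‖ := norm_pos_iff.2 (hl.action_ne_zero hs)
  rw [e3, lt_div_iff₀ hpos] at hs1
  change A = _ at e1
  rw [e1, inv_mul_cancel_left₀ hps.ne'] at hs1
  linarith

/-- The branch `√V` cannot be subdominant at the finish: then `h → 0` there, against the growth of
the action. -/
theorem IsAdmissible.not_same_finish {D : Set ℂ} {σ : ℝ} {ρ W ψ χ : ℂ → ℂ} {k : ℂ}
    (h : IsAdmissible α ν ħ p q c r)
    (hl : IsWKBLift (reducedPotential α ν ħ) c (Ioo 0 1) r w)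
    (hC : IsBoundaryChart α ν ħ q D σ ρ W ψ χ) (hq : q ≠ .zero)
    (hc : Tendsto c (𝓝[<] 1) (endFilter D σ))
    (e : ∀ᶠ t in 𝓝[<] 1, r t = ρ (c t) ∧ w t = k * W (c t)) : False := by
  have h0 : Tendsto (fun t => ‖k‖ ^ 2 * ‖W (c t) ^ 2 * ρ (c t)‖) (𝓝[<] 1) (𝓝 0) := by
    simpa using ((hC.action hq).comp hc).const_mul (‖k‖ ^ 2)
  have h1 : Tendsto (fun t => ‖w t ^ 2 * r t‖) (𝓝[<] 1) (𝓝 0) := by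
    refine h0.congr' (e.mono fun t ht => ?_)
    simp only
    rw [ht.1, ht.2, ← norm_pow, ← norm_mul]
    congr 1; ring
  exact not_tendsto_nhds_of_tendsto_atTop (h.tendsto_norm_action hl) 0 h1

/-- Two homotopic admissible curves have the same end-point value. At the initial end-point the
sign of `√V` is forced by the lower bound on the action; at the final one it is forced by the growth
of the action if that point is some `∞_k`, and is prescribed along the first curve otherwise. -/
theorem IsAdmissible.exists_volterra_pair
    (hchart : ∀ (p : BoundaryPoint) (l : Filter (ℝ × ℝ)) (f : ℝ × ℝ → ℂ),
      TendsToBoundary α ħ l f p → ∃ D σ ρ W ψ χ,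
        IsBoundaryChart α ν ħ p D σ ρ W ψ χ ∧ Tendsto f l (endFilter D σ))
    (hp : p ≠ .zero) {c₀ r₀ : ℝ → ℂ} (h₀ : IsAdmissible α ν ħ p q c₀ r₀)
    (hq : q = .zero → ∃ᶠ t in 𝓝[<] (1 : ℝ), (exp (c₀ t) * r₀ t).re ≤ 0)
    (h : IsAdmissible α ν ħ p q c r) (hh : Homotopic α ν ħ p q c₀ c) :
    ∃ z₀ z, IsVolterraSolution α ν ħ c₀ r₀ z₀ ∧ IsVolterraSolution α ν ħ c r z ∧
      z₀ 1 = z 1 ∧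
      (∀ z', IsVolterraSolution α ν ħ c₀ r₀ z' → z' 1 = z₀ 1) ∧
      (∀ z', IsVolterraSolution α ν ħ c r z' → z' 1 = z₀ 1) ∧
      ∀ β m : ℝ, (∀ s t : ℝ, 0 < s → s ≤ t → t < 1 → β ≤ (actionIncr c₀ r₀ s t).re) →
        (∫ t in Ioo (0 : ℝ) 1, ‖forcing (potential α ν ħ) (reducedPotential α ν ħ)
          (c₀ t) (r₀ t)‖ * ‖velocity c₀ t‖) ≤ m →
        ‖z₀ 1 - 1‖ ≤ m * Real.exp (2 * ((1 + Real.exp (-2 * β)) * m)) := by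
  obtain ⟨H, hH, hH0, hHc₀, hHc, hHp, hHq⟩ := hh
  have hV := differentiable_reducedPotential α ν ħ
  have hV1 := differentiable_coverDeriv_reducedPotential α ν ħ
  obtain ⟨Dp, σp, ρp, Wp, ψp, χp, Cp, hDp⟩ := hchart p _ H hHp
  obtain ⟨Dq, σq, ρq, Wq, ψq, χq, Cq, hDq⟩ := hchart q _ H hHq
  set V := reducedPotential α ν ħ with hVdef
  have hhalf : (1 / 2 : ℝ) ∈ Ioo (0 : ℝ) 1 := by norm_num
  have z01 : (0 : ℝ) ∈ Icc (0 : ℝ) 1 := by simp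
  have o01 : (1 : ℝ) ∈ Icc (0 : ℝ) 1 := by simp
  obtain ⟨R, w, hl, hR, -⟩ := exists_isWKBLift_strip hV hV1 hH hH0 (R₀ := r₀ (1 / 2)) (w₀ := 1)
    (by rw [hHc₀ _ hhalf]; exact h₀.branch_sq _ hhalf) one_ne_zero
  have slice : ∀ a ∈ Icc (0 : ℝ) 1, ∀ γ : ℝ → ℂ, (∀ t ∈ Ioo (0 : ℝ) 1, H (a, t) = γ t) →
      IsWKBLift V γ (Ioo 0 1) (fun t => R (a, t)) (fun t => w (a, t)) := fun a ha γ hγ =>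
    hl.comp (φ := fun t => (a, t)) (by fun_prop) (fun t ht => ⟨ha, ht⟩) hγ
  have l0 := slice 0 z01 c₀ hHc₀
  have l1 := slice 1 o01 c hHc
  have hsqr : ∀ {γ s S v : ℝ → ℂ}, IsWKBLift V γ (Ioo 0 1) S v → ContinuousOn γ (Ioo 0 1) →
      ContinuousOn s (Ioo 0 1) → (∀ t ∈ Ioo (0 : ℝ) 1, s t ^ 2 = V (γ t)) →
      EqOn s S (Ioo 0 1) ∨ EqOn s (-S) (Ioo 0 1) := fun hL hγ hs hsq =>
    isPreconnected_Ioo.eq_or_eq_neg_of_sq_eq hs (hL.continuousOn_R hγ)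
      (fun t ht => by simp only [Pi.pow_apply]; rw [hsq t ht, hL.sq ht])
      (fun ht => hL.R_ne_zero ht)
  have hr₀ : EqOn r₀ (fun t => R (0, t)) (Ioo 0 1) :=
    isPreconnected_Ioo.eq_of_sq_eq h₀.branch_continuous (l0.continuousOn_R h₀.smooth.continuousOn)
      (fun t ht => by simp only [Pi.pow_apply]; rw [h₀.branch_sq t ht, l0.sq ht])
      (fun ht => l0.R_ne_zero ht) hhalf hR.symm
  have hr₀' : ∀ t ∈ Ioo (0 : ℝ) 1, R (0, t) = r₀ t := fun t ht => (hr₀ ht).symm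
  replace l0 : IsWKBLift V c₀ (Ioo 0 1) r₀ (fun t => w (0, t)) := l0.congr hr₀ fun _ _ => rfl
  -- comparison near the initial end-point
  obtain ⟨a, ha, ha1, haD⟩ : ∃ a, 0 < a ∧ a ≤ 1 ∧ ∀ x ∈ Icc (0 : ℝ) 1 ×ˢ Ioo (0 : ℝ) a, H x ∈ Dp := by
    have h1 := (tendsto_endFilter.1 hDp).2
    rw [eventually_swap_iff, eventually_prod_principal_iff] at h1
    obtain ⟨a, ha, h2⟩ := mem_nhdsGT_iff_exists_Ioo_subset.1 h1
    exact ⟨min a 1, lt_min ha zero_lt_one, min_le_right _ _, fun x hx =>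
      h2 ⟨hx.2.1, hx.2.2.trans_le (min_le_left _ _)⟩ x.1 hx.1⟩
  obtain ⟨b, hb, hb0, hbD⟩ : ∃ b, b < 1 ∧ 0 ≤ b ∧ ∀ x ∈ Icc (0 : ℝ) 1 ×ˢ Ioo (b : ℝ) 1, H x ∈ Dq := by
    have h1 := (tendsto_endFilter.1 hDq).2
    rw [eventually_swap_iff, eventually_prod_principal_iff] at h1
    obtain ⟨b, hb, h2⟩ := mem_nhdsLT_iff_exists_Ioo_subset.1 h1
    exact ⟨max b 0, max_lt hb zero_lt_one, le_max_right _ _, fun x hx =>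
      h2 ⟨(le_max_left _ _).trans_lt hx.2.1, hx.2.2⟩ x.1 hx.1⟩
  have hsa : Icc (0 : ℝ) 1 ×ˢ Ioo (0 : ℝ) a ⊆ Icc (0 : ℝ) 1 ×ˢ Ioo (0 : ℝ) 1 :=
    prod_mono le_rfl (Ioo_subset_Ioo_right ha1)
  have hsb : Icc (0 : ℝ) 1 ×ˢ Ioo (b : ℝ) 1 ⊆ Icc (0 : ℝ) 1 ×ˢ Ioo (0 : ℝ) 1 :=
    prod_mono le_rfl (Ioo_subset_Ioo_left hb0)
  have nza : ∀ t ∈ Ioo 0 a, t ∈ Ioo (0 : ℝ) 1 := fun t ht => ⟨ht.1, ht.2.trans_le ha1⟩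
  have nzb : ∀ t ∈ Ioo b 1, t ∈ Ioo (0 : ℝ) 1 := fun t ht => ⟨hb0.trans_lt ht.1, ht.2⟩
  have tend : ∀ {x : ℝ}, x ∈ Icc (0 : ℝ) 1 → ∀ {l : Filter ℝ} {D : Set ℂ} {σ : ℝ}
      {γ : ℝ → ℂ}, (∀ t ∈ Ioo (0 : ℝ) 1, H (x, t) = γ t) → (∀ᶠ t in l, t ∈ Ioo (0 : ℝ) 1) →
      Tendsto H (𝓟 (Icc (0 : ℝ) 1) ×ˢ l) (endFilter D σ) → Tendsto γ l (endFilter D σ) :=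
    fun hx l D σ γ hγ hl hT => (hT.comp (tendsto_slice _ hx l)).congr' (hl.mono fun t ht => hγ t ht)
  have i0 : ∀ᶠ t in 𝓝[>] (0 : ℝ), t ∈ Ioo (0 : ℝ) 1 := Ioo_mem_nhdsGT zero_lt_one
  have i1 : ∀ᶠ t in 𝓝[<] (1 : ℝ), t ∈ Ioo (0 : ℝ) 1 := Ioo_mem_nhdsLT zero_lt_one
  have tp₀ := tend z01 hHc₀ i0 hDp
  have tq₀ := tend z01 hHc₀ i1 hDq
  have tp := tend o01 hHc i0 hDp
  have tq := tend o01 hHc i1 hDq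
  have hpc := (hl.mono hsa).eq_or_eq_flip Cp.asymptotic.branch (hH.mono hsa) haD
    (isPreconnected_Icc.prod isPreconnected_Ioo) ⟨(0, a / 2), z01, by constructor <;> linarith⟩
  have hqc := (hl.mono hsb).eq_or_eq_flip Cq.asymptotic.branch (hH.mono hsb) hbD
    (isPreconnected_Icc.prod isPreconnected_Ioo) ⟨(0, (b + 1) / 2), z01, by constructor <;> linarith⟩
  have ea : ∀ᶠ t in 𝓝[>] (0 : ℝ), t ∈ Ioo 0 a := Ioo_mem_nhdsGT ha
  have eb : ∀ᶠ t in 𝓝[<] (1 : ℝ), t ∈ Ioo b 1 := Ioo_mem_nhdsLT hb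
  -- the sign of `√V` at the start of `c₀`, then of `c`, and at the common finish
  rcases hpc with ⟨kp, hkp, hkp'⟩ | ⟨k, hk, hk'⟩
  swap
  · exfalso
    refine h₀.not_flip_start l0 Cp hp tp₀ (k := k) (ea.mono fun t ht => ?_)
    have := hk' (0, t) ⟨z01, ht⟩
    rwa [hHc₀ t (nza t ht), hr₀' t (nza t ht)] at this
  have hr : EqOn r (fun t => R (1, t)) (Ioo 0 1) := by
    rcases hsqr l1 h.smooth.continuousOn h.branch_continuous h.branch_sq with e | e
    · exact e
    · exfalso
      have l1' : IsWKBLift V c (Ioo 0 1) r (fun t => (R (1, t) * w (1, t))⁻¹) :=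
        l1.flip.congr e fun _ _ => rfl
      refine h.not_flip_start l1' Cp hp tp (k := -kp) (ea.mono fun t ht => ?_)
      have h1 := hkp' (1, t) ⟨o01, ht⟩
      rw [hHc t (nza t ht)] at h1
      have h2 : r t = -R (1, t) := e (nza t ht)
      have h3 := l1.R_ne_zero (nza t ht)
      have h4 := l1.w_ne_zero (nza t ht)
      rw [h2, neg_neg, neg_mul (kp : ℂ), ← h1.2]
      refine ⟨h1.1, ?_⟩
      field_simp
  have hr' : ∀ t ∈ Ioo (0 : ℝ) 1, R (1, t) = r t := fun t ht => (hr ht).symm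
  replace l1 : IsWKBLift V c (Ioo 0 1) r (fun t => w (1, t)) := l1.congr hr fun _ _ => rfl
  rcases hqc with ⟨k, hk, hk'⟩ | ⟨kq, hkq, hkq'⟩
  · exfalso
    have ev : ∀ᶠ t in 𝓝[<] (1 : ℝ), r₀ t = ρq (c₀ t) ∧ w (0, t) = k * Wq (c₀ t) := by
      filter_upwards [eb] with t ht
      have := hk' (0, t) ⟨z01, ht⟩
      rwa [hHc₀ t (nzb t ht), hr₀' t (nzb t ht)] at this
    by_cases hq0 : q = .zero
    · obtain ⟨t, h1, h2, h3⟩ := ((hq hq0).and_eventually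
        (ev.and (tendsto_endFilter.1 tq₀).2)).exists
      have := Cq.sign _ h3
      rw [Cq.σ_zero hq0, ← h2.1] at this
      linarith
    · exact h₀.not_same_finish l0 Cq hq0 tq₀ ev
  obtain ⟨z₀, s₀, v₀, b₀⟩ := h₀.exists_volterra l0 Cp.asymptotic Cq.asymptotic tp₀ tq₀ hkp hkq
    (ea.mono fun t ht => by
      have := hkp' (0, t) ⟨z01, ht⟩
      rwa [hHc₀ t (nza t ht), hr₀' t (nza t ht)] at this)
    (eb.mono fun t ht => by
      have := hkq' (0, t) ⟨z01, ht⟩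
      rwa [hHc₀ t (nzb t ht), hr₀' t (nzb t ht)] at this)
  obtain ⟨z, s, v, -⟩ := h.exists_volterra l1 Cp.asymptotic Cq.asymptotic tp tq hkp hkq
    (ea.mono fun t ht => by
      have := hkp' (1, t) ⟨o01, ht⟩
      rwa [hHc t (nza t ht), hr' t (nza t ht)] at this)
    (eb.mono fun t ht => by
      have := hkq' (1, t) ⟨o01, ht⟩
      rwa [hHc t (nzb t ht), hr' t (nzb t ht)] at this)
  -- both values are the same multiple of the Wronskian of `ψp` and `ψq`
  have e : z₀ 1 = z 1 := by linear_combination (-1 / 2 : ℂ) * (v₀ 0) + (1 / 2 : ℂ) * v 0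
  exact ⟨z₀, z, s₀, s, e, fun z' hz' => h₀.volterra_unique l0 hz' s₀,
    fun z' hz' => (h.volterra_unique l1 hz' s).trans e.symm, b₀⟩

end

/-! ### The homotopy relation -/

section

variable {α ν : ℝ} {ħ : ℂ} {p q : BoundaryPoint} {c₀ c₁ c₂ r₀ : ℝ → ℂ}

theorem TendsToBoundary.sup {β : Type} {l l' : Filter β} {f : β → ℂ}
    (h : TendsToBoundary α ħ l f p) (h' : TendsToBoundary α ħ l' f p) (hα : 0 < α) :
    TendsToBoundary α ħ (l ⊔ l') f p := by
  cases p with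
  | zero => exact Tendsto.sup h h'
  | infty k =>
    obtain ⟨h1, ε, hε, h2⟩ := h
    obtain ⟨h1', ε', hε', h2'⟩ := h'
    refine ⟨h1.sup h1', min ε ε', lt_min hε hε', eventually_sup.2 ⟨?_, ?_⟩⟩
    · refine h2.mono fun x hx => hx.trans ?_
      gcongr
      exact min_le_left _ _
    · refine h2'.mono fun x hx => hx.trans ?_
      gcongr
      exact min_le_right _ _

theorem Homotopic.refl (hc : ContinuousOn c₀ (Ioo 0 1))
    (h0 : ∀ t ∈ Ioo (0 : ℝ) 1, reducedPotential α ν ħ (c₀ t) ≠ 0)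
    (hp : TendsToBoundary α ħ (𝓝[>] (0 : ℝ)) c₀ p)
    (hq : TendsToBoundary α ħ (𝓝[<] (1 : ℝ)) c₀ q) : Homotopic α ν ħ p q c₀ c₀ :=
  ⟨fun x => c₀ x.2, hc.comp continuousOn_snd fun _ hx => hx.2, fun _ hx => h0 _ hx.2,
    fun _ _ => rfl, fun _ _ => rfl, hp.comp tendsto_snd, hq.comp tendsto_snd⟩

theorem Homotopic.symm (h : Homotopic α ν ħ p q c₀ c₁) : Homotopic α ν ħ p q c₁ c₀ := by
  obtain ⟨H, hH, hH0, e0, e1, hp, hq⟩ := h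
  have hm : MapsTo (fun x : ℝ × ℝ => (1 - x.1, x.2)) (Icc 0 1 ×ˢ Ioo 0 1) (Icc 0 1 ×ˢ Ioo 0 1) :=
    fun x hx => ⟨⟨by linarith [hx.1.2], by linarith [hx.1.1]⟩, hx.2⟩
  have ht : ∀ l : Filter ℝ, Tendsto (fun x : ℝ × ℝ => (1 - x.1, x.2))
      (𝓟 (Icc (0 : ℝ) 1) ×ˢ l) (𝓟 (Icc (0 : ℝ) 1) ×ˢ l) := fun l =>
    Tendsto.prodMap (f := fun x : ℝ => 1 - x) (g := id)
      (tendsto_principal_principal.2 fun x hx => ⟨by linarith [hx.2], by linarith [hx.1]⟩) tendsto_id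
  exact ⟨fun x => H (1 - x.1, x.2), hH.comp (by fun_prop) hm, fun x hx => hH0 _ (hm hx),
    fun t ht => by simp [e1 t ht], fun t ht => by simp [e0 t ht], hp.comp (ht _), hq.comp (ht _)⟩

theorem Homotopic.trans (hα : 0 < α) (h : Homotopic α ν ħ p q c₀ c₁)
    (h' : Homotopic α ν ħ p q c₁ c₂) : Homotopic α ν ħ p q c₀ c₂ := by
  obtain ⟨H, hH, hH0, e0, e1, hp, hq⟩ := h
  obtain ⟨H', hH', hH0', e0', e1', hp', hq'⟩ := h'
  let K : ℝ × ℝ → ℂ := fun x => if x.1 ≤ 1 / 2 then H (2 * x.1, x.2) else H' (2 * x.1 - 1, x.2)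
  have K1 : ∀ x : ℝ × ℝ, x.1 ≤ 1 / 2 → K x = H (2 * x.1, x.2) := fun x hx => if_pos hx
  have K2 : ∀ x : ℝ × ℝ, 1 / 2 ≤ x.1 → x.2 ∈ Ioo (0 : ℝ) 1 → K x = H' (2 * x.1 - 1, x.2) := by
    intro x hx ht
    rcases eq_or_lt_of_le hx with e | e
    · rw [K1 x e.ge, ← e]
      norm_num
      rw [e1 _ ht, e0' _ ht]
    · exact if_neg (not_le.2 e)
  have hl : ∀ l : Filter ℝ, (∀ᶠ t in l, t ∈ Ioo (0 : ℝ) 1) → ∀ p,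
      TendsToBoundary α ħ (𝓟 (Icc (0 : ℝ) 1) ×ˢ l) H p →
      TendsToBoundary α ħ (𝓟 (Icc (0 : ℝ) 1) ×ˢ l) H' p →
      TendsToBoundary α ħ (𝓟 (Icc (0 : ℝ) 1) ×ˢ l) K p := by
    intro l hlI p h1 h2
    have hu : Icc (0 : ℝ) 1 = Icc 0 (1 / 2) ∪ Icc (1 / 2) 1 :=
      (Icc_union_Icc_eq_Icc (by norm_num) (by norm_num)).symm
    rw [hu, ← sup_principal, sup_prod]
    refine TendsToBoundary.sup ?_ ?_ hα
    · have t1 : Tendsto (fun x : ℝ × ℝ => (2 * x.1, x.2))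
          (𝓟 (Icc (0 : ℝ) (1 / 2)) ×ˢ l) (𝓟 (Icc (0 : ℝ) 1) ×ˢ l) :=
        Tendsto.prodMap (f := fun x : ℝ => 2 * x) (g := id) (tendsto_principal_principal.2
          fun x hx => ⟨by linarith [hx.1], by linarith [hx.2]⟩) tendsto_id
      refine (h1.comp t1).congr' ?_
      have : ∀ᶠ x in 𝓟 (Icc (0 : ℝ) (1 / 2)) ×ˢ l, x.1 ∈ Icc (0 : ℝ) (1 / 2) :=
        tendsto_fst.eventually (mem_principal_self _)
      exact this.mono fun x hx => (K1 x hx.2).symm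
    · have t1 : Tendsto (fun x : ℝ × ℝ => (2 * x.1 - 1, x.2))
          (𝓟 (Icc (1 / 2 : ℝ) 1) ×ˢ l) (𝓟 (Icc (0 : ℝ) 1) ×ˢ l) :=
        Tendsto.prodMap (f := fun x : ℝ => 2 * x - 1) (g := id) (tendsto_principal_principal.2
          fun x hx => ⟨by linarith [hx.1], by linarith [hx.2]⟩) tendsto_id
      refine (h2.comp t1).congr' ?_
      have : ∀ᶠ x in 𝓟 (Icc (1 / 2 : ℝ) 1) ×ˢ l, x.1 ∈ Icc (1 / 2 : ℝ) 1 :=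
        tendsto_fst.eventually (mem_principal_self _)
      filter_upwards [this, tendsto_snd.eventually hlI] with x hx hx2
      exact (K2 x hx.1 hx2).symm
  refine ⟨K, ?_, fun x hx => ?_, fun t ht => ?_, fun t ht => ?_,
    hl _ (Ioo_mem_nhdsGT zero_lt_one) _ hp hp', hl _ (Ioo_mem_nhdsLT zero_lt_one) _ hq hq'⟩
  · have c1 : ContinuousOn K ((Icc 0 1 ×ˢ Ioo 0 1) ∩ {x | x.1 ≤ 1 / 2}) := by
      refine ContinuousOn.congr (f := fun x : ℝ × ℝ => H (2 * x.1, x.2)) ?_ fun x hx => K1 x hx.2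
      refine hH.comp (by fun_prop) fun x hx => ⟨⟨?_, ?_⟩, hx.1.2⟩
      · linarith [hx.1.1.1]
      · have : x.1 ≤ 1 / 2 := hx.2
        show 2 * x.1 ≤ 1
        linarith
    have c2 : ContinuousOn K ((Icc 0 1 ×ˢ Ioo 0 1) ∩ {x | 1 / 2 ≤ x.1}) := by
      refine ContinuousOn.congr (f := fun x : ℝ × ℝ => H' (2 * x.1 - 1, x.2)) ?_
        fun x hx => K2 x hx.2 hx.1.2
      refine hH'.comp (by fun_prop) fun x hx => ⟨⟨?_, ?_⟩, hx.1.2⟩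
      · have : 1 / 2 ≤ x.1 := hx.2
        show 0 ≤ 2 * x.1 - 1
        linarith
      · show 2 * x.1 - 1 ≤ 1
        linarith [hx.1.1.2]
    intro x hx
    have hcl1 : IsClosed {x : ℝ × ℝ | x.1 ≤ 1 / 2} := isClosed_le continuous_fst continuous_const
    have hcl2 : IsClosed {x : ℝ × ℝ | 1 / 2 ≤ x.1} := isClosed_le continuous_const continuous_fst
    have hun : Icc (0 : ℝ) 1 ×ˢ Ioo (0 : ℝ) 1 =
        ((Icc 0 1 ×ˢ Ioo 0 1) ∩ {x | x.1 ≤ 1 / 2}) ∪ ((Icc 0 1 ×ˢ Ioo 0 1) ∩ {x | 1 / 2 ≤ x.1}) := by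
      rw [← inter_union_distrib_left]
      ext y
      simp [le_total]
    have part : ∀ C : Set (ℝ × ℝ), IsClosed C → ContinuousOn K ((Icc 0 1 ×ˢ Ioo 0 1) ∩ C) →
        ContinuousWithinAt K ((Icc 0 1 ×ˢ Ioo 0 1) ∩ C) x := by
      intro C hC hK
      by_cases hxC : x ∈ C
      · exact hK x ⟨hx, hxC⟩
      · have : 𝓝[(Icc 0 1 ×ˢ Ioo 0 1) ∩ C] x = ⊥ :=
          notMem_closure_iff_nhdsWithin_eq_bot.1 fun hx' =>
            hxC (closure_minimal inter_subset_right hC hx')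
        rw [ContinuousWithinAt, this]
        exact tendsto_bot
    rw [hun]
    exact (part _ hcl1 c1).union (part _ hcl2 c2)
  · rcases le_total x.1 (1 / 2) with e | e
    · rw [K1 x e]
      exact hH0 _ ⟨⟨by linarith [hx.1.1], by linarith⟩, hx.2⟩
    · rw [K2 x e hx.2]
      exact hH0' _ ⟨⟨by linarith, by linarith [hx.1.2]⟩, hx.2⟩
  · rw [K1 _ (by norm_num)]
    simp [e0 t ht]
  · rw [K2 _ (by norm_num) ht]
    norm_num
    exact e1' t ht

/-- The end-point value of a homotopy class is determined by one admissible curve `c₁` in it, and is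
estimated by means of this curve. -/
theorem IsAdmissible.exists_isEndpointValue (hα : 0 < α)
    (hchart : ∀ (p : BoundaryPoint) (l : Filter (ℝ × ℝ)) (f : ℝ × ℝ → ℂ),
      TendsToBoundary α ħ l f p → ∃ D σ ρ W ψ χ,
        IsBoundaryChart α ν ħ p D σ ρ W ψ χ ∧ Tendsto f l (endFilter D σ))
    (hp : p ≠ .zero) {r₁ : ℝ → ℂ} (h₁ : IsAdmissible α ν ħ p q c₁ r₁)
    (hq : q = .zero → ∃ᶠ t in 𝓝[<] (1 : ℝ), (exp (c₁ t) * r₁ t).re ≤ 0)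
    (hh : Homotopic α ν ħ p q c₀ c₁) :
    ∃ z : ℂ, IsEndpointValue α ν ħ p q c₀ z ∧
      ∀ β m : ℝ, (∀ s t : ℝ, 0 < s → s ≤ t → t < 1 → β ≤ (actionIncr c₁ r₁ s t).re) →
        (∫ t in Ioo (0 : ℝ) 1, ‖forcing (potential α ν ħ) (reducedPotential α ν ħ)
          (c₁ t) (r₁ t)‖ * ‖velocity c₁ t‖) ≤ m →
        ‖z - 1‖ ≤ m * Real.exp (2 * ((1 + Real.exp (-2 * β)) * m)) := by
  have hrefl : Homotopic α ν ħ p q c₁ c₁ :=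
    Homotopic.refl h₁.smooth.continuousOn h₁.ne_zero h₁.start h₁.finish
  obtain ⟨Z, -, hZ, -, -, hu, -, hb⟩ := h₁.exists_volterra_pair hchart hp hq h₁ hrefl
  refine ⟨Z 1, ⟨⟨c₁, r₁, h₁, hh⟩, fun c r h hc => ?_⟩, hb⟩
  obtain ⟨z₀, z, s₀, s, e, -, hu', -⟩ := h₁.exists_volterra_pair hchart hp hq h (hh.symm.trans hα hc)
  exact ⟨⟨z, s⟩, fun z' hz' => (hu' z' hz').trans (hu z₀ s₀)⟩

end

end

section

/-! ### The potential in the logarithmic variable -/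

/-- The function `g = ħ² y² V = y^(2α+2) - ν y² + 1`. -/
def symbol (α ν : ℝ) (ζ : ℂ) : ℂ :=
  exp ((2 * α + 2) * ζ) - ν * exp (2 * ζ) + 1

/-- The sum `|y|^(2α+2) + ν |y|²` of the moduli of the non-constant terms of `symbol`, as a function
of `x = log |y|`. -/
def symbolSize (α ν x : ℝ) : ℝ :=
  Real.exp ((2 * α + 2) * x) + ν * Real.exp (2 * x)

variable {α ν : ℝ} {ħ : ℂ}

theorem symbolSize_nonneg (hν : 0 ≤ ν) (x : ℝ) : 0 ≤ symbolSize α ν x := by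
  unfold symbolSize; positivity

theorem norm_exp_two (ζ : ℂ) : ‖exp (2 * ζ)‖ = Real.exp (2 * ζ.re) := by
  rw [norm_exp]; simp

theorem norm_exp_mul (α : ℝ) (ζ : ℂ) :
    ‖exp ((2 * α + 2) * ζ)‖ = Real.exp ((2 * α + 2) * ζ.re) := by
  rw [norm_exp]; simp

theorem continuous_symbol : Continuous (symbol α ν) := by
  unfold symbol; fun_prop

theorem reducedPotential_eq (α ν : ℝ) (ħ ζ : ℂ) :
    reducedPotential α ν ħ ζ = (ħ ^ 2)⁻¹ * exp (-ζ) ^ 2 * symbol α ν ζ := by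
  have h1 : exp ((2 * α + 2) * ζ) = exp (2 * α * ζ) * exp ζ ^ 2 := by
    rw [← exp_nat_mul, ← exp_add]; congr 1; push_cast; ring
  have h2 : exp (2 * ζ) = exp ζ ^ 2 := by rw [← exp_nat_mul]; simp
  have h3 : exp (-2 * ζ) = (exp ζ ^ 2)⁻¹ := by
    rw [← h2, ← exp_neg]; congr 1; ring
  have h0 := exp_ne_zero ζ
  rw [reducedPotential, symbol, h1, h2, h3, exp_neg]
  field_simp

theorem reducedPotential_ne_zero_iff (hb : ħ ≠ 0) (ζ : ℂ) :
    reducedPotential α ν ħ ζ ≠ 0 ↔ symbol α ν ζ ≠ 0 := by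
  rw [reducedPotential_eq]
  simp [hb]

theorem sq_mul_eq_symbol (hb : ħ ≠ 0) {ζ r : ℂ} (hr : r ^ 2 = reducedPotential α ν ħ ζ) :
    (ħ * (exp ζ * r)) ^ 2 = symbol α ν ζ := by
  rw [mul_pow, mul_pow, hr, reducedPotential_eq, exp_neg]
  have h0 := exp_ne_zero ζ
  field_simp

theorem coverDeriv_reducedPotential (α ν : ℝ) (ħ : ℂ) :
    coverDeriv (reducedPotential α ν ħ) = fun ζ => (ħ ^ 2)⁻¹ *
      (2 * α * exp ((2 * α - 1) * ζ) - 2 * exp (-3 * ζ)) := by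
  ext ζ
  have h1 : HasDerivAt (reducedPotential α ν ħ) ((ħ ^ 2)⁻¹ *
      (exp (2 * α * ζ) * (2 * α) + exp (-2 * ζ) * (-2))) ζ := by
    have := (((((hasDerivAt_id ζ).const_mul (2 * (α : ℂ))).cexp.sub_const (ν : ℂ)).add
      ((hasDerivAt_id ζ).const_mul (-2 : ℂ)).cexp).const_mul ((ħ ^ 2)⁻¹))
    exact this.congr_deriv (by simp)
  rw [coverDeriv, h1.deriv]
  have e1 : exp ((2 * α - 1) * ζ) = exp (-ζ) * exp (2 * α * ζ) := by
    rw [← exp_add]; congr 1; ring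
  have e2 : exp (-3 * ζ) = exp (-ζ) * exp (-2 * ζ) := by
    rw [← exp_add]; congr 1; ring
  rw [e1, e2]; ring

theorem coverDeriv_coverDeriv_reducedPotential (α ν : ℝ) (ħ ζ : ℂ) :
    coverDeriv (coverDeriv (reducedPotential α ν ħ)) ζ = (ħ ^ 2)⁻¹ *
      (2 * α * (2 * α - 1) * exp ((2 * α - 2) * ζ) + 6 * exp (-4 * ζ)) := by
  rw [coverDeriv_reducedPotential]
  have h1 : HasDerivAt (fun ζ : ℂ => (ħ ^ 2)⁻¹ *
      (2 * α * exp ((2 * α - 1) * ζ) - 2 * exp (-3 * ζ))) ((ħ ^ 2)⁻¹ *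
      (2 * α * (exp ((2 * α - 1) * ζ) * (2 * α - 1))
        - 2 * (exp (-3 * ζ) * (-3)))) ζ := by
    have := (((((hasDerivAt_id ζ).const_mul (2 * (α : ℂ) - 1)).cexp.const_mul (2 * (α : ℂ))).sub
      (((hasDerivAt_id ζ).const_mul (-3 : ℂ)).cexp.const_mul 2)).const_mul ((ħ ^ 2)⁻¹))
    simpa using this
  rw [coverDeriv, h1.deriv]
  have e1 : exp ((2 * α - 2) * ζ) = exp (-ζ) * exp ((2 * α - 1) * ζ) := by
    rw [← exp_add]; congr 1; ring
  have e2 : exp (-4 * ζ) = exp (-ζ) * exp (-3 * ζ) := by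
    rw [← exp_add]; congr 1; ring
  rw [e1, e2]; ring

/-- In the variable `ζ = log y` the forcing term is `F dy = (5 g'² - 4 g g'') / (16 g² m) dζ`, where
`g` is `symbol` and `m = y √V`; the term `V - U = 1 / (4 y²)` cancels the singularity at `0`. -/
theorem forcing_mul_exp (hb : ħ ≠ 0) {ζ r : ℂ} (hr : r ≠ 0) (hg : symbol α ν ζ ≠ 0) :
    forcing (potential α ν ħ) (reducedPotential α ν ħ) ζ r * exp ζ =
      (5 * ((2 * α + 2) * exp ((2 * α + 2) * ζ) - 2 * ν * exp (2 * ζ)) ^ 2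
        - 4 * symbol α ν ζ * ((2 * α + 2) ^ 2 * exp ((2 * α + 2) * ζ)
          - 4 * ν * exp (2 * ζ))) / (16 * symbol α ν ζ ^ 2 * (exp ζ * r)) := by
  rw [forcing, coverDeriv_coverDeriv_reducedPotential, coverDeriv_reducedPotential, potential,
    sub_sub_cancel, reducedPotential_eq]
  have h0 := exp_ne_zero ζ
  have h1 : exp ((2 * α + 2) * ζ) = exp (2 * α * ζ) * exp ζ ^ 2 := by
    rw [← exp_nat_mul, ← exp_add]; congr 1; push_cast; ring
  have h2 : exp (2 * ζ) = exp ζ ^ 2 := by rw [← exp_nat_mul]; simp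
  have h3 : exp (-2 * ζ) = (exp ζ ^ 2)⁻¹ := by
    rw [← h2, ← exp_neg]; congr 1; ring
  have h4 : exp (-3 * ζ) = (exp ζ ^ 3)⁻¹ := by
    rw [← exp_nat_mul, ← exp_neg]; congr 1; push_cast; ring
  have h5 : exp (-4 * ζ) = (exp ζ ^ 4)⁻¹ := by
    rw [← exp_nat_mul, ← exp_neg]; congr 1; push_cast; ring
  have h6 : exp ((2 * α - 1) * ζ) = exp (2 * α * ζ) / exp ζ := by
    rw [← exp_sub]; congr 1; ring
  have h7 : exp ((2 * α - 2) * ζ) = exp (2 * α * ζ) / exp ζ ^ 2 := by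
    rw [← h2, ← exp_sub]; congr 1; ring
  have hgd : symbol α ν ζ = exp (2 * α * ζ) * exp ζ ^ 2
      - ν * exp ζ ^ 2 + 1 := by rw [symbol, h1, h2]
  simp only [h3, h4, h5, h6, h7, h1, h2, exp_neg]
  set y := exp ζ
  set p := exp (2 * α * ζ)
  set g := symbol α ν ζ
  have hν : (ν : ℂ) * y ^ 2 = p * y ^ 2 + 1 - g := by rw [hgd]; ring
  have hν' : (2 : ℂ) * ν * y ^ 2 = 2 * (p * y ^ 2 + 1 - g) := by rw [← hν]; ring
  have hν'' : (4 : ℂ) * ν * y ^ 2 = 4 * (p * y ^ 2 + 1 - g) := by rw [← hν]; ring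
  rw [hν', hν'']
  field_simp
  ring

theorem norm_symbol_le (hν : 0 ≤ ν) (ζ : ℂ) : ‖symbol α ν ζ‖ ≤ 1 + symbolSize α ν ζ.re := by
  rw [symbol, symbolSize, ← norm_exp_two, ← norm_exp_mul]
  refine (norm_add_le _ _).trans ?_
  have h1 := norm_sub_le (exp ((2 * α + 2) * ζ)) (ν * exp (2 * ζ))
  rw [norm_mul, norm_real, norm_of_nonneg hν] at h1
  rw [norm_one]
  linarith

theorem norm_sq_mul_eq (hb : ħ ≠ 0) {ζ r : ℂ} (hr : r ^ 2 = reducedPotential α ν ħ ζ) :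
    ‖exp ζ * r‖ = sqrt ‖symbol α ν ζ‖ / ‖ħ‖ := by
  have h := sq_mul_eq_symbol hb hr
  have hb' := norm_pos_iff.2 hb
  rw [eq_div_iff hb'.ne', ← h, norm_pow, Real.sqrt_sq (norm_nonneg _), norm_mul ħ, mul_comm]

/-- The constant in the bound for the forcing term, where `|g| ≥ s (1 + |y|^(2α+2) + ν |y|²)`. -/
def forcingConst (α s : ℝ) : ℝ := 9 * (2 * α + 2) ^ 2 / (16 * (s ^ 2 * sqrt s))

theorem forcingConst_pos (hα : 0 < α) {s : ℝ} (hs : 0 < s) : 0 < forcingConst α s := by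
  unfold forcingConst; positivity

/-- If the terms of `g` do not cancel, then `|F dy/dζ| ≤ K |ħ| N / (1 + N)^(3/2)`, `N = symbolSize`. -/
theorem norm_forcing_le (hα : 0 < α) (hν : 0 ≤ ν) (hb : ħ ≠ 0) {ζ r : ℂ}
    (hr : r ^ 2 = reducedPotential α ν ħ ζ) {s : ℝ} (hs : 0 < s)
    (hg : s * (1 + symbolSize α ν ζ.re) ≤ ‖symbol α ν ζ‖) :
    ‖forcing (potential α ν ħ) (reducedPotential α ν ħ) ζ r * exp ζ‖ ≤
      ‖ħ‖ * forcingConst α s * (symbolSize α ν ζ.re /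
        ((1 + symbolSize α ν ζ.re) * sqrt (1 + symbolSize α ν ζ.re))) := by
  have hN := symbolSize_nonneg (α := α) hν ζ.re
  have hgl := norm_symbol_le (α := α) hν ζ
  have hb' := norm_pos_iff.2 hb
  have hg0 : 0 < ‖symbol α ν ζ‖ := lt_of_lt_of_le (by positivity) hg
  have hgne : symbol α ν ζ ≠ 0 := norm_pos_iff.1 hg0
  have hr0 : r ≠ 0 := by
    intro h0
    rw [h0] at hr
    exact (reducedPotential_ne_zero_iff hb ζ).2 hgne (by rw [← hr]; simp)
  rw [forcing_mul_exp hb hr0 hgne, norm_div, norm_mul, norm_mul, norm_pow, norm_sq_mul_eq hb hr,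
    norm_ofNat]
  have hE := norm_exp_mul α ζ
  have hB := norm_exp_two ζ
  set E := exp ((2 * α + 2) * ζ)
  set B := exp (2 * ζ)
  set g := symbol α ν ζ
  have hNE : symbolSize α ν ζ.re = ‖E‖ + ν * ‖B‖ := by rw [symbolSize, hE, hB]
  set N := symbolSize α ν ζ.re
  have ha : ‖(2 * α + 2 : ℂ)‖ = 2 * α + 2 := by
    rw [show (2 * α + 2 : ℂ) = ((2 * α + 2 : ℝ) : ℂ) by push_cast; rfl, norm_real,
      norm_of_nonneg (by positivity)]
  have hνn : ‖(ν : ℂ)‖ = ν := by rw [norm_real, norm_of_nonneg hν]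
  have hνB : 0 ≤ ν * ‖B‖ := by positivity
  have h1 : ‖(2 * α + 2) * E - 2 * ν * B‖ ≤ (2 * α + 2) * N := by
    refine (norm_sub_le _ _).trans ?_
    rw [norm_mul, norm_mul, norm_mul, ha, hνn, norm_ofNat, hNE]
    nlinarith
  have h2 : ‖(2 * α + 2) ^ 2 * E - 4 * ν * B‖ ≤ (2 * α + 2) ^ 2 * N := by
    refine (norm_sub_le _ _).trans ?_
    rw [norm_mul, norm_mul, norm_mul, norm_pow, ha, hνn, norm_ofNat, hNE]
    have : (4 : ℝ) ≤ (2 * α + 2) ^ 2 := by nlinarith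
    nlinarith
  have hnum : ‖5 * ((2 * α + 2) * E - 2 * ν * B) ^ 2 -
      4 * g * ((2 * α + 2) ^ 2 * E - 4 * ν * B)‖ ≤ 9 * (2 * α + 2) ^ 2 * (N * (1 + N)) := by
    refine (norm_sub_le _ _).trans ?_
    rw [norm_mul, norm_mul, norm_mul, norm_pow, norm_ofNat, norm_ofNat]
    have h3 : ‖(2 * α + 2) * E - 2 * ν * B‖ ^ 2 ≤ ((2 * α + 2) * N) ^ 2 := by gcongr
    have h4 : ‖g‖ * ‖(2 * α + 2) ^ 2 * E - 4 * ν * B‖ ≤ (1 + N) * ((2 * α + 2) ^ 2 * N) := by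
      gcongr
    have h5 : (2 * α + 2) ^ 2 * N ^ 2 ≤ (2 * α + 2) ^ 2 * (N * (1 + N)) := by
      gcongr; nlinarith
    nlinarith
  have hden : 16 * (s ^ 2 * sqrt s) * ((1 + N) ^ 2 * sqrt (1 + N)) / ‖ħ‖ ≤
      16 * ‖g‖ ^ 2 * (sqrt ‖g‖ / ‖ħ‖) := by
    have h6 : (s * (1 + N)) ^ 2 ≤ ‖g‖ ^ 2 := by gcongr
    have h7 : sqrt s * sqrt (1 + N) ≤ sqrt ‖g‖ := by
      rw [← Real.sqrt_mul hs.le]; exact Real.sqrt_le_sqrt hg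
    rw [mul_div_assoc']
    refine div_le_div_of_nonneg_right ?_ hb'.le
    calc 16 * (s ^ 2 * sqrt s) * ((1 + N) ^ 2 * sqrt (1 + N))
        = 16 * (s * (1 + N)) ^ 2 * (sqrt s * sqrt (1 + N)) := by ring
      _ ≤ 16 * ‖g‖ ^ 2 * sqrt ‖g‖ := by gcongr
  refine (div_le_div₀ (by positivity) hnum (by positivity) hden).trans_eq ?_
  rw [forcingConst]
  field_simp

/-! ### Square roots -/

/-- The principal branch of the square root. -/
def csqrt (z : ℂ) : ℂ := exp (Complex.log z / 2)

theorem csqrt_sq {z : ℂ} (hz : z ≠ 0) : csqrt z ^ 2 = z := by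
  rw [csqrt, ← exp_nat_mul]
  convert exp_log hz using 2
  push_cast; ring

theorem csqrt_re_nonneg (z : ℂ) : 0 ≤ (csqrt z).re := by
  rw [csqrt, Complex.exp_re]
  apply mul_nonneg (exp_pos _).le
  apply Real.cos_nonneg_of_mem_Icc
  have h1 := Complex.neg_pi_lt_arg z
  have h2 := Complex.arg_le_pi z
  have : (Complex.log z / 2).im = z.arg / 2 := by
    rw [show (2 : ℂ) = ((2 : ℝ) : ℂ) by simp, Complex.div_ofReal_im, Complex.log_im]
  rw [this]
  constructor <;> linarith

theorem continuousAt_csqrt {z : ℂ} (hz : z ∈ Complex.slitPlane) : ContinuousAt csqrt z :=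
  ((continuousAt_clog hz).div_const 2).cexp

theorem norm_sub_one_le_of_sq {u δ : ℂ} (hu : u ^ 2 = 1 + δ) (hre : 0 ≤ u.re) : ‖u - 1‖ ≤ ‖δ‖ := by
  have h1 : (u - 1) * (u + 1) = δ := by linear_combination hu
  have h2 : 1 ≤ ‖u + 1‖ := by
    refine le_trans ?_ (re_le_norm _)
    simp [hre]
  rw [← h1, norm_mul]
  exact le_mul_of_one_le_right (norm_nonneg _) h2

/-- A multiple `q u` of a number `q` in a sector by a square root `u` of a number close to `1`
stays in a sector. -/
theorem re_mul_of_near_one {q u : ℂ} {s : ℝ} (hs0 : 0 < s) (hs1 : s ≤ 1) (hq : s * ‖q‖ ≤ q.re)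
    (hu : ‖u - 1‖ ≤ s / 2) :
    s / 4 * ‖q * u‖ ≤ (q * u).re ∧ ‖q‖ / 2 ≤ ‖q * u‖ := by
  have h1 : q * u = q + q * (u - 1) := by ring
  have h2 : ‖q * (u - 1)‖ ≤ ‖q‖ * (s / 2) := by rw [norm_mul]; gcongr
  have h3 : -‖q * (u - 1)‖ ≤ (q * (u - 1)).re :=
    (abs_le.1 (abs_re_le_norm _)).1
  have h4 : ‖q * u‖ ≤ ‖q‖ + ‖q * (u - 1)‖ := by rw [h1]; exact norm_add_le _ _
  have h5 : ‖q‖ - ‖q * (u - 1)‖ ≤ ‖q * u‖ := by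
    rw [h1]
    have := norm_sub_norm_le q (-(q * (u - 1)))
    rwa [norm_neg, sub_neg_eq_add] at this
  have hq0 := norm_nonneg q
  constructor
  · have h6 : (q * u).re = q.re + (q * (u - 1)).re := by rw [h1, add_re]
    rw [h6]
    have h7 : s * ‖q * u‖ ≤ s * (2 * ‖q‖) := by
      gcongr
      nlinarith
    linarith
  · nlinarith

/-! ### Neighbourhoods of the boundary points -/

theorem exists_isWKBBranch_of_continuousOn {V : ℂ → ℂ} (hV : Differentiable ℂ V)
    (hV1 : Differentiable ℂ (coverDeriv V)) {D : Set ℂ} (hD : IsOpen D) {z₀ : ℂ} (hz₀ : z₀ ∈ D)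
    (hs : StarConvex ℝ z₀ D) {n : ℂ → ℂ} (hn : ContinuousOn n D) (hsq : ∀ ζ ∈ D, n ζ ^ 2 = V ζ)
    (h0 : ∀ ζ ∈ D, V ζ ≠ 0) : ∃ W, IsWKBBranch V D n W := by
  obtain ⟨ρ, W, hb, hρ, -⟩ := exists_isWKBBranch hV hV1 hD hz₀ hs h0 (hsq z₀ hz₀) one_ne_zero
  have he : EqOn n ρ D := by
    refine (hs.isPathConnected hz₀).isConnected.isPreconnected.eq_of_sq_eq hn
      (fun ζ hζ => (hb.deriv_ρ ζ hζ).continuousAt.continuousWithinAt) (fun ζ hζ => ?_)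
      (fun hζ => hb.ρ_ne_zero hζ) hz₀ hρ.symm
    simp only [Pi.pow_apply]
    rw [hsq ζ hζ, hb.sq ζ hζ]
  refine ⟨W, hD, h0, hsq, hb.W_ne_zero, fun ζ hζ => ?_, fun ζ hζ => ?_⟩
  · rw [he hζ]
    exact (hb.deriv_ρ ζ hζ).congr_of_eventuallyEq (he.eventuallyEq_of_mem (hD.mem_nhds hζ))
  · rw [he hζ]
    exact hb.deriv_W ζ hζ

/-- If `y² V = q² (1 + δ)` on a convex set, with `q` in a sector of the right half-plane and `δ`
small, then the branch `-σ q √(1 + δ) / y` of `√V` makes the set a neighbourhood of its end in the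
direction `σ`. -/
theorem exists_isEnd {U V : ℂ → ℂ} (hV : Differentiable ℂ V)
    (hV1 : Differentiable ℂ (coverDeriv V)) {D : Set ℂ} (hD : IsOpen D) (hDc : Convex ℝ D)
    {σ : ℝ} (hσ : σ * σ = 1) {b : ℂ} (hbase : ∀ N : ℝ, 0 ≤ N → b + (σ * N : ℝ) ∈ D)
    {q δ : ℂ → ℂ} (hq : ContinuousOn q D) (hδ : ContinuousOn δ D) {s : ℝ} (hs0 : 0 < s) (hs1 : s ≤ 1)
    (hVq : ∀ ζ ∈ D, V ζ = (exp (-ζ) * q ζ) ^ 2 * (1 + δ ζ))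
    (hq0 : ∀ ζ ∈ D, q ζ ≠ 0) (hqs : ∀ ζ ∈ D, s * ‖q ζ‖ ≤ (q ζ).re) (hδs : ∀ ζ ∈ D, ‖δ ζ‖ ≤ s / 2)
    {C a : ℝ} (hC : 0 ≤ C) (ha : 0 < a)
    (hF : ∀ ζ ∈ D, ∀ r : ℂ, r ^ 2 = V ζ →
      ‖forcing U V ζ r * exp ζ‖ ≤ C * Real.exp (-a * (σ * ζ.re))) :
    ∃ ρ W, IsEnd U V D σ b ρ W (s / 4) C a ∧ ∀ ζ ∈ D, ‖q ζ‖ / 2 ≤ ‖exp ζ * ρ ζ‖ := by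
  have hbD : b ∈ D := by simpa using hbase 0 le_rfl
  have hδ1 : ∀ ζ ∈ D, ‖δ ζ‖ < 1 := fun ζ hζ => (hδs ζ hζ).trans_lt (by linarith)
  have hsl : ∀ ζ ∈ D, 1 + δ ζ ∈ Complex.slitPlane := fun ζ hζ =>
    Complex.mem_slitPlane_of_norm_lt_one (hδ1 ζ hζ)
  have hne : ∀ ζ ∈ D, 1 + δ ζ ≠ 0 := fun ζ hζ => Complex.slitPlane_ne_zero (hsl ζ hζ)
  set ρ : ℂ → ℂ := fun ζ => -σ * (exp (-ζ) * (q ζ * csqrt (1 + δ ζ))) with hρ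
  have hσ2 : (σ : ℂ) ^ 2 = 1 := by rw [sq, ← Complex.ofReal_mul, hσ, ofReal_one]
  have hρc : ContinuousOn ρ D := by
    refine continuousOn_const.mul (ContinuousOn.mul (by fun_prop) (hq.mul fun ζ hζ => ?_))
    exact (continuousAt_csqrt (hsl ζ hζ)).comp_continuousWithinAt
      (f := fun ζ => 1 + δ ζ) (continuousWithinAt_const.add (hδ ζ hζ))
  have hρsq : ∀ ζ ∈ D, ρ ζ ^ 2 = V ζ := fun ζ hζ => by
    rw [hVq ζ hζ, hρ]
    linear_combination (exp (-ζ) * q ζ) ^ 2 * csqrt (1 + δ ζ) ^ 2 * hσ2 +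
      (exp (-ζ) * q ζ) ^ 2 * csqrt_sq (hne ζ hζ)
  have hV0 : ∀ ζ ∈ D, V ζ ≠ 0 := fun ζ hζ => by
    rw [hVq ζ hζ]
    exact mul_ne_zero (pow_ne_zero 2 (mul_ne_zero (exp_ne_zero _) (hq0 ζ hζ))) (hne ζ hζ)
  obtain ⟨W, hW⟩ := exists_isWKBBranch_of_continuousOn hV hV1 hD hbD (hDc.starConvex hbD) hρc hρsq hV0
  have hm : ∀ ζ, exp ζ * ρ ζ = (-σ : ℝ) * (q ζ * csqrt (1 + δ ζ)) := fun ζ => by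
    rw [hρ]
    have : exp ζ * exp (-ζ) = 1 := by rw [← exp_add]; simp
    push_cast
    linear_combination (-σ * (q ζ * csqrt (1 + δ ζ)) : ℂ) * this
  have hσa : |σ| = 1 := by
    have : |σ| * |σ| = 1 := by rw [abs_mul_abs_self, hσ]
    nlinarith [abs_nonneg σ]
  have hnear : ∀ ζ ∈ D, ‖csqrt (1 + δ ζ) - 1‖ ≤ s / 2 := fun ζ hζ =>
    (norm_sub_one_le_of_sq (csqrt_sq (hne ζ hζ)) (csqrt_re_nonneg _)).trans (hδs ζ hζ)
  have hn : ∀ ζ, ‖exp ζ * ρ ζ‖ = ‖q ζ * csqrt (1 + δ ζ)‖ := fun ζ => by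
    rw [hm, norm_mul, norm_real, norm_eq_abs, abs_neg, hσa, one_mul]
  refine ⟨ρ, W, ⟨hW, hDc, hσ, hbase, by positivity, hC, ha, fun ζ hζ => ?_,
    fun ζ hζ => hF ζ hζ _ (hρsq ζ hζ)⟩, fun ζ hζ => ?_⟩
  · rw [hn, hm, re_ofReal_mul, ← mul_assoc, neg_mul_neg, hσ, one_mul]
    exact (re_mul_of_near_one hs0 hs1 (hqs ζ hζ) (hnear ζ hζ)).1
  · rw [hn]
    exact (re_mul_of_near_one hs0 hs1 (hqs ζ hζ) (hnear ζ hζ)).2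

end

section

variable {α ν : ℝ} {ħ : ℂ}

theorem exists_symbolSize_zero_le (hα : 0 < α) (ν : ℝ) {η : ℝ} (hη : 0 < η) :
    ∃ R > 0, ∀ x ≤ -R, symbolSize α ν x ≤ η := by
  have h1 : Tendsto (symbolSize α ν) atBot (𝓝 0) := by
    have e1 : Tendsto (fun x : ℝ => Real.exp ((2 * α + 2) * x)) atBot (𝓝 0) :=
      Real.tendsto_exp_atBot.comp (tendsto_id.const_mul_atBot (by linarith))
    have e2 : Tendsto (fun x : ℝ => Real.exp (2 * x)) atBot (𝓝 0) :=
      Real.tendsto_exp_atBot.comp (tendsto_id.const_mul_atBot (by norm_num))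
    have := e1.add (e2.const_mul ν)
    rw [mul_zero, add_zero] at this
    exact this
  obtain ⟨R, hR⟩ := eventually_atBot.1 (h1.eventually_le_const hη)
  exact ⟨max 1 (-R), by positivity, fun x hx => hR x (by linarith [le_max_right 1 (-R)])⟩

theorem exists_le_exp (hα : 0 < α) (ν : ℝ) {η : ℝ} (hη : 0 < η) :
    ∃ R > 0, ∀ x ≥ R, 1 + ν * Real.exp (2 * x) ≤ η * Real.exp ((2 * α + 2) * x) := by
  have h1 : Tendsto (fun x : ℝ => Real.exp (-(2 * α + 2) * x) + ν * Real.exp (-(2 * α) * x)) atTop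
      (𝓝 0) := by
    have e1 : Tendsto (fun x : ℝ => Real.exp (-(2 * α + 2) * x)) atTop (𝓝 0) :=
      Real.tendsto_exp_atBot.comp (tendsto_id.const_mul_atTop_of_neg (by linarith))
    have e2 : Tendsto (fun x : ℝ => Real.exp (-(2 * α) * x)) atTop (𝓝 0) :=
      Real.tendsto_exp_atBot.comp (tendsto_id.const_mul_atTop_of_neg (by linarith))
    simpa using e1.add (e2.const_mul ν)
  obtain ⟨R, hR⟩ := eventually_atTop.1 (h1.eventually_le_const hη)
  refine ⟨max 1 R, by positivity, fun x hx => ?_⟩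
  have := mul_le_mul_of_nonneg_right (hR x ((le_max_right 1 R).trans hx))
    (exp_pos ((2 * α + 2) * x)).le
  rw [add_mul, mul_assoc, ← Real.exp_add, ← Real.exp_add] at this
  have e1 : -(2 * α + 2) * x + (2 * α + 2) * x = 0 := by ring
  have e2 : -(2 * α) * x + (2 * α + 2) * x = 2 * x := by ring
  rwa [e1, e2, Real.exp_zero] at this

/-- The central direction of the Stokes sector at `∞_k`. -/
def sectorAngle (α : ℝ) (ħ : ℂ) (k : ℤ) : ℝ :=
  (ħ.arg + k * π) / (α + 1)

/-- The leading part `± y^(α+1) / ħ` of `y √V` at `∞_k`, with the sign for which it is positive on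
the central direction of the Stokes sector. -/
def sectorCoord (α : ℝ) (ħ : ℂ) (k : ℤ) (ζ : ℂ) : ℂ :=
  (‖ħ‖⁻¹ : ℝ) * exp ((α + 1) * (ζ - sectorAngle α ħ k * I))

/-- The relative error of the leading part of the potential at `∞`. -/
def symbolError (α ν : ℝ) (ζ : ℂ) : ℂ :=
  (1 - ν * exp (2 * ζ)) / exp ((2 * α + 2) * ζ)

theorem sectorCoord_ne_zero (hb : ħ ≠ 0) (k : ℤ) (ζ : ℂ) : sectorCoord α ħ k ζ ≠ 0 :=
  mul_ne_zero (ofReal_ne_zero.2 (inv_ne_zero (norm_ne_zero_iff.2 hb)))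
    (exp_ne_zero _)

theorem norm_sectorCoord (k : ℤ) (ζ : ℂ) :
    ‖sectorCoord α ħ k ζ‖ = ‖ħ‖⁻¹ * Real.exp ((α + 1) * ζ.re) := by
  rw [sectorCoord, norm_mul, norm_real, norm_inv, norm_norm, norm_exp]
  congr 2
  simp

theorem sectorCoord_re (k : ℤ) (ζ : ℂ) :
    (sectorCoord α ħ k ζ).re = ‖ħ‖⁻¹ * (Real.exp ((α + 1) * ζ.re) *
      cos ((α + 1) * (ζ.im - sectorAngle α ħ k))) := by
  rw [sectorCoord, re_ofReal_mul, Complex.exp_re]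
  simp

theorem sectorCoord_im (k : ℤ) (ζ : ℂ) :
    (sectorCoord α ħ k ζ).im = ‖ħ‖⁻¹ * (Real.exp ((α + 1) * ζ.re) *
      sin ((α + 1) * (ζ.im - sectorAngle α ħ k))) := by
  rw [sectorCoord, im_ofReal_mul, Complex.exp_im]
  simp

theorem sectorCoord_sq (hα : 0 < α) (k : ℤ) (ζ : ℂ) :
    sectorCoord α ħ k ζ ^ 2 = (ħ ^ 2)⁻¹ * exp ((2 * α + 2) * ζ) := by
  have h1 : ħ ^ 2 = (‖ħ‖ : ℂ) ^ 2 * exp (2 * (ħ.arg * I)) := by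
    conv_lhs => rw [← Complex.norm_mul_exp_arg_mul_I ħ]
    rw [mul_pow, ← exp_nat_mul]; simp
  have hα' : (α + 1 : ℂ) ≠ 0 := by
    rw [← ofReal_one, ← Complex.ofReal_add, ofReal_ne_zero]; positivity
  have h2 : (2 : ℕ) * ((α + 1) * (ζ - sectorAngle α ħ k * I)) =
      (2 * α + 2) * ζ + (-(2 * (ħ.arg * I)) + (-k : ℤ) * (2 * π * I)) := by
    rw [sectorAngle]; push_cast; field_simp; ring
  rw [sectorCoord, mul_pow, ← exp_nat_mul, h2, exp_add, exp_add,
    Complex.exp_int_mul_two_pi_mul_I, mul_one, exp_neg, h1, mul_inv]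
  push_cast
  ring

theorem symbol_eq (α ν : ℝ) (ζ : ℂ) :
    symbol α ν ζ = exp ((2 * α + 2) * ζ) * (1 + symbolError α ν ζ) := by
  rw [symbol, symbolError]
  have := exp_ne_zero ((2 * α + 2) * ζ)
  field_simp
  ring

theorem reducedPotential_eq_sectorCoord (hα : 0 < α) (k : ℤ) (ζ : ℂ) :
    reducedPotential α ν ħ ζ =
      (exp (-ζ) * sectorCoord α ħ k ζ) ^ 2 * (1 + symbolError α ν ζ) := by
  rw [reducedPotential_eq, symbol_eq, mul_pow, sectorCoord_sq hα]
  ring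

theorem norm_symbolError_le (hν : 0 ≤ ν) {η : ℝ} {ζ : ℂ}
    (h : 1 + ν * Real.exp (2 * ζ.re) ≤ η * Real.exp ((2 * α + 2) * ζ.re)) :
    ‖symbolError α ν ζ‖ ≤ η := by
  rw [symbolError, norm_div, norm_exp_mul, div_le_iff₀ (exp_pos _)]
  refine (norm_sub_le _ _).trans ?_
  rwa [norm_mul, norm_exp_two, norm_real, norm_of_nonneg hν, norm_one]

theorem norm_forcing_le_infty (hα : 0 < α) (hν : 0 ≤ ν) (hb : ħ ≠ 0) {ζ r : ℂ}
    (hr : r ^ 2 = reducedPotential α ν ħ ζ)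
    (h : 1 + ν * Real.exp (2 * ζ.re) ≤ 1 / 2 * Real.exp ((2 * α + 2) * ζ.re)) :
    ‖forcing (potential α ν ħ) (reducedPotential α ν ħ) ζ r * exp ζ‖ ≤
      ‖ħ‖ * forcingConst α (1 / 3) * Real.exp (-(α + 1) * ζ.re) := by
  have hδ := norm_symbolError_le hν h
  have h1 : 1 / 2 ≤ ‖1 + symbolError α ν ζ‖ := by
    have := norm_sub_norm_le (1 : ℂ) (-symbolError α ν ζ)
    rw [norm_neg, sub_neg_eq_add, norm_one] at this
    linarith
  have hg : 1 / 3 * (1 + symbolSize α ν ζ.re) ≤ ‖symbol α ν ζ‖ := by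
    rw [symbol_eq, norm_mul, norm_exp_mul, symbolSize]
    nlinarith [exp_pos ((2 * α + 2) * ζ.re)]
  refine (norm_forcing_le hα hν hb hr (by norm_num) hg).trans ?_
  have hf := forcingConst_pos hα (s := 1 / 3) (by norm_num)
  gcongr
  have hN := symbolSize_nonneg (α := α) hν ζ.re
  have hA : Real.exp ((α + 1) * ζ.re) ≤ sqrt (1 + symbolSize α ν ζ.re) := by
    apply Real.le_sqrt_of_sq_le
    rw [← Real.exp_nat_mul, symbolSize]
    have : Real.exp ((2 : ℕ) * ((α + 1) * ζ.re)) = Real.exp ((2 * α + 2) * ζ.re) := by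
      congr 1; push_cast; ring
    rw [this]
    have := mul_nonneg hν (exp_pos (2 * ζ.re)).le
    linarith
  set N := symbolSize α ν ζ.re
  rw [neg_mul, Real.exp_neg, div_le_iff₀ (by positivity)]
  have h3 : N ≤ 1 + N := by linarith
  have hE := exp_pos ((α + 1) * ζ.re)
  calc N ≤ 1 + N := h3
    _ = (Real.exp ((α + 1) * ζ.re))⁻¹ * ((1 + N) * Real.exp ((α + 1) * ζ.re)) := by
        field_simp
    _ ≤ _ := by gcongr

theorem norm_symbol_sub_one_le (hν : 0 ≤ ν) (ζ : ℂ) :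
    ‖symbol α ν ζ - 1‖ ≤ symbolSize α ν ζ.re := by
  rw [symbol, add_sub_cancel_right, symbolSize, ← norm_exp_two, ← norm_exp_mul]
  refine (norm_sub_le _ _).trans ?_
  rw [norm_mul, norm_real, norm_of_nonneg hν]

theorem norm_forcing_le_zero (hα : 0 < α) (hν : 0 ≤ ν) (hb : ħ ≠ 0) {ζ r : ℂ}
    (hr : r ^ 2 = reducedPotential α ν ħ ζ) (h : symbolSize α ν ζ.re ≤ 1 / 4)
    (hx : ζ.re ≤ 0) :
    ‖forcing (potential α ν ħ) (reducedPotential α ν ħ) ζ r * exp ζ‖ ≤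
      ‖ħ‖ * forcingConst α (1 / 2) * (1 + ν) * Real.exp (2 * ζ.re) := by
  have hN := symbolSize_nonneg (α := α) hν ζ.re
  have hδ := norm_symbol_sub_one_le (α := α) hν ζ
  have h1 : 3 / 4 ≤ ‖symbol α ν ζ‖ := by
    have := norm_sub_norm_le (1 : ℂ) (1 - symbol α ν ζ)
    rw [sub_sub_cancel, norm_one, norm_sub_rev] at this
    linarith
  refine (norm_forcing_le hα hν hb hr (s := 1 / 2) (by norm_num) (by linarith)).trans ?_
  have hf := forcingConst_pos hα (s := 1 / 2) (by norm_num)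
  rw [mul_assoc (‖ħ‖ * forcingConst α (1 / 2))]
  gcongr
  have h2 : symbolSize α ν ζ.re ≤ (1 + ν) * Real.exp (2 * ζ.re) := by
    rw [symbolSize, add_mul (1 : ℝ) ν, one_mul]
    have : Real.exp ((2 * α + 2) * ζ.re) ≤ Real.exp (2 * ζ.re) :=
      exp_le_exp.2 (by nlinarith)
    linarith
  refine le_trans ?_ h2
  apply div_le_self hN
  have : 1 ≤ sqrt (1 + symbolSize α ν ζ.re) := Real.one_le_sqrt.2 (by linarith)
  nlinarith

theorem re_inv_of_norm_le (hb : ħ ≠ 0) (hre : ‖ħ‖ ≤ 2 * ħ.re) :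
    1 / 2 * ‖ħ⁻¹‖ ≤ (ħ⁻¹).re := by
  have h := norm_pos_iff.2 hb
  rw [Complex.inv_re, Complex.normSq_eq_norm_sq, norm_inv, le_div_iff₀ (by positivity)]
  field_simp
  linarith

theorem isBoundaryChart_of_isEnd {p : BoundaryPoint} {D : Set ℂ} {σ : ℝ} {b : ℂ} {ρ W : ℂ → ℂ}
    {κ C a : ℝ} (h : IsEnd (potential α ν ħ) (reducedPotential α ν ħ) D σ b ρ W κ C a)
    (hp : p = .zero → σ = -1)
    (ha : p ≠ .zero → Tendsto (fun ζ => ‖W ζ ^ 2 * ρ ζ‖) (endFilter D σ) (𝓝 0)) :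
    ∃ ψ χ, IsBoundaryChart α ν ħ p D σ ρ W ψ χ := by
  obtain ⟨ψ, χ, hA⟩ := h.exists_isAsymptotic (differentiable_potential α ν ħ)
    (differentiable_reducedPotential α ν ħ) (differentiable_coverDeriv_reducedPotential α ν ħ)
  refine ⟨ψ, χ, hA, ha, fun ζ hζ => lt_of_lt_of_le ?_ (h.mono ζ hζ), hp⟩
  exact mul_pos h.κ_pos (norm_pos_iff.2 (mul_ne_zero (exp_ne_zero _)
    (h.branch.ρ_ne_zero hζ)))

/-- A left half-plane is a neighbourhood of `0`; there `y² V = ħ⁻² (1 + O(N))`. -/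
theorem exists_isBoundaryChart_zero (hα : 0 < α) (hν : 0 ≤ ν) (hb : ħ ≠ 0)
    (hre : ‖ħ‖ ≤ 2 * ħ.re) :
    ∃ R > 0, ∃ ρ W ψ χ, IsBoundaryChart α ν ħ .zero {ζ | ζ.re < -R} (-1) ρ W ψ χ := by
  obtain ⟨R, hR0, hR⟩ := exists_symbolSize_zero_le hα ν (show (0 : ℝ) < 1 / 4 by norm_num)
  have hDo : IsOpen {ζ : ℂ | ζ.re < -R} := isOpen_lt continuous_re continuous_const
  obtain ⟨ρ, W, hE, -⟩ := exists_isEnd (U := potential α ν ħ)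
    (differentiable_reducedPotential α ν ħ)
    (differentiable_coverDeriv_reducedPotential α ν ħ)
    (D := {ζ : ℂ | ζ.re < -R}) hDo (convex_halfSpace_re_lt _) (σ := -1) (by norm_num)
    (b := ((-R - 1 : ℝ) : ℂ)) (fun N hN => by
      simp only [mem_ofPred_eq, add_re, ofReal_re]; linarith)
    (q := fun _ => ħ⁻¹) (δ := fun ζ => symbol α ν ζ - 1) (s := 1 / 2)
    continuousOn_const (continuous_symbol.sub continuous_const).continuousOn
    (by norm_num) (by norm_num) (fun ζ _ => by rw [reducedPotential_eq]; ring)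
    (fun _ _ => inv_ne_zero hb) (fun _ _ => re_inv_of_norm_le hb hre)
    (fun ζ hζ => (norm_symbol_sub_one_le hν ζ).trans
      ((hR ζ.re (le_of_lt hζ)).trans (by norm_num)))
    (C := ‖ħ‖ * forcingConst α (1 / 2) * (1 + ν)) (a := 2)
    (by have := forcingConst_pos hα (s := 1 / 2) (by norm_num); positivity) (by norm_num)
    (fun ζ hζ r hr => by
      have hζ' : ζ.re < -R := hζ
      refine (norm_forcing_le_zero hα hν hb hr (hR ζ.re hζ'.le) (by linarith)).trans_eq ?_
      congr 2; ring)
  obtain ⟨ψ, χ, h⟩ := isBoundaryChart_of_isEnd (p := .zero) hE (fun _ => rfl)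
    (fun h => absurd rfl h)
  exact ⟨R, hR0, ρ, W, ψ, χ, h⟩

/-- A horizontal half-strip in the Stokes sector at `∞_k`. -/
def sectorStrip (α : ℝ) (ħ : ℂ) (k : ℤ) (ε R : ℝ) : Set ℂ :=
  {ζ | R < ζ.re ∧ |ζ.im - sectorAngle α ħ k| < (π - ε) / (2 * α + 2)}

theorem sectorStrip_eq (k : ℤ) (ε R : ℝ) : sectorStrip α ħ k ε R = {ζ | R < ζ.re} ∩
    ({ζ | sectorAngle α ħ k - (π - ε) / (2 * α + 2) < ζ.im} ∩
      {ζ | ζ.im < sectorAngle α ħ k + (π - ε) / (2 * α + 2)}) := by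
  ext ζ
  simp only [sectorStrip, mem_ofPred_eq, mem_inter_iff, abs_lt]
  constructor
  · rintro ⟨h1, h2, h3⟩
    exact ⟨h1, by linarith, by linarith⟩
  · rintro ⟨h1, h2, h3⟩
    exact ⟨h1, by linarith, by linarith⟩

theorem isOpen_sectorStrip (k : ℤ) (ε R : ℝ) : IsOpen (sectorStrip α ħ k ε R) := by
  rw [sectorStrip_eq]
  exact (isOpen_lt continuous_const continuous_re).inter
    ((isOpen_lt continuous_const Complex.continuous_im).inter
      (isOpen_lt Complex.continuous_im continuous_const))

theorem convex_sectorStrip (k : ℤ) (ε R : ℝ) : Convex ℝ (sectorStrip α ħ k ε R) := by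
  rw [sectorStrip_eq]
  exact (convex_halfSpace_re_gt R).inter ((convex_halfSpace_im_gt _).inter (convex_halfSpace_im_lt _))

theorem sectorCoord_sector (hα : 0 < α) (hb : ħ ≠ 0) (k : ℤ) {ε : ℝ} (hε : 0 < ε) {ζ : ℂ}
    (h : |ζ.im - sectorAngle α ħ k| < (π - ε) / (2 * α + 2)) :
    sin (ε / 2) * ‖sectorCoord α ħ k ζ‖ ≤ (sectorCoord α ħ k ζ).re := by
  have hb' := norm_pos_iff.2 hb
  rw [norm_sectorCoord, sectorCoord_re, mul_left_comm]
  refine mul_le_mul_of_nonneg_left ?_ (inv_nonneg.2 hb'.le)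
  rw [mul_comm]
  refine mul_le_mul_of_nonneg_left ?_ (exp_pos _).le
  rw [← Real.cos_pi_div_two_sub, ← Real.cos_abs ((α + 1) * _), abs_mul,
    abs_of_pos (show 0 < α + 1 by linarith)]
  rw [lt_div_iff₀ (by linarith)] at h
  apply Real.cos_le_cos_of_nonneg_of_le_pi
  · have := abs_nonneg (ζ.im - sectorAngle α ħ k); positivity
  · linarith [pi_pos]
  · linarith

/-- A half-strip in the Stokes sector is a neighbourhood of `∞_k`; there `y √V ∼ -sectorCoord`. -/
theorem exists_isBoundaryChart_infty (hα : 0 < α) (hν : 0 ≤ ν) (hb : ħ ≠ 0) (k : ℤ) {ε : ℝ}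
    (hε : 0 < ε) (hε1 : ε ≤ 1) :
    ∃ R > 0, ∃ ρ W ψ χ,
      IsBoundaryChart α ν ħ (.infty k) (sectorStrip α ħ k ε R) 1 ρ W ψ χ := by
  have hs : 0 < sin (ε / 2) := Real.sin_pos_of_pos_of_lt_pi (by linarith)
    (by linarith [Real.pi_gt_three])
  have hs1 := Real.sin_le_one (ε / 2)
  have hb' := norm_pos_iff.2 hb
  obtain ⟨R, hR0, hR⟩ := exists_le_exp hα ν (half_pos hs)
  obtain ⟨ρ, W, hE, hm⟩ := exists_isEnd (U := potential α ν ħ)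
    (differentiable_reducedPotential α ν ħ)
    (differentiable_coverDeriv_reducedPotential α ν ħ)
    (D := sectorStrip α ħ k ε R) (isOpen_sectorStrip k ε R) (convex_sectorStrip k ε R)
    (σ := 1) (by norm_num) (b := ((R + 1 : ℝ) : ℂ) + sectorAngle α ħ k * I)
    (fun N hN => by
      constructor
      · simp; linarith
      · simp only [add_im, ofReal_im, mul_im, ofReal_re,
          I_im, mul_one, I_re, mul_zero, add_zero, zero_add, sub_self, abs_zero]
        have := Real.pi_gt_three
        apply div_pos <;> linarith)
    (q := sectorCoord α ħ k) (δ := symbolError α ν) (s := sin (ε / 2))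
    (by unfold sectorCoord; fun_prop)
    (by
      unfold symbolError
      exact (Continuous.div (by fun_prop) (by fun_prop)
        fun _ => exp_ne_zero _).continuousOn) hs hs1
    (fun ζ _ => reducedPotential_eq_sectorCoord hα k ζ)
    (fun ζ _ => sectorCoord_ne_zero hb k ζ) (fun ζ hζ => sectorCoord_sector hα hb k hε hζ.2)
    (fun ζ hζ => norm_symbolError_le hν (hR ζ.re hζ.1.le))
    (C := ‖ħ‖ * forcingConst α (1 / 3)) (a := α + 1)
    (by have := forcingConst_pos hα (s := 1 / 3) (by norm_num); positivity) (by linarith)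
    (fun ζ hζ r hr => by
      rw [one_mul]
      refine norm_forcing_le_infty hα hν hb hr ((hR ζ.re hζ.1.le).trans ?_)
      gcongr)
  obtain ⟨ψ, χ, h⟩ := isBoundaryChart_of_isEnd (p := .infty k) hE (by simp) (fun _ => by
    refine hE.tendsto_action (m₀ := ‖ħ‖⁻¹ / 2) (B := (π - ε) / (2 * α + 2)) (by positivity)
      (fun ζ hζ => ?_) (fun ζ hζ => ?_)
    · refine le_trans ?_ (hm ζ hζ)
      rw [norm_sectorCoord]
      gcongr
      refine le_mul_of_one_le_right (by positivity) (Real.one_le_exp ?_)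
      have := hR0.trans hζ.1
      positivity
    · simpa using hζ.2.le)
  exact ⟨R, hR0, ρ, W, ψ, χ, h⟩

/-- Every boundary point has a chart, which a given map converging to this point enters. -/
theorem exists_isBoundaryChart (hα : 0 < α) (hν : 0 ≤ ν) (hb : ħ ≠ 0)
    (hre : ‖ħ‖ ≤ 2 * ħ.re) {β : Type} (p : BoundaryPoint) (l : Filter β) (f : β → ℂ)
    (h : TendsToBoundary α ħ l f p) : ∃ D σ ρ W ψ χ,
      IsBoundaryChart α ν ħ p D σ ρ W ψ χ ∧ Tendsto f l (endFilter D σ) := by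
  cases p with
  | zero =>
    obtain ⟨R, -, ρ, W, ψ, χ, hC⟩ := exists_isBoundaryChart_zero hα hν hb hre
    have h' : Tendsto (fun x => (f x).re) l atBot := h
    refine ⟨_, _, ρ, W, ψ, χ, hC, tendsto_endFilter.2 ⟨?_, h'.eventually_lt_atBot (-R)⟩⟩
    refine (tendsto_neg_atBot_atTop.comp h').congr fun x => ?_
    simp
  | infty k =>
    obtain ⟨h1, ε, hε, h2⟩ := h
    have hε' : 0 < min ε 1 := lt_min hε one_pos
    obtain ⟨R, -, ρ, W, ψ, χ, hC⟩ := exists_isBoundaryChart_infty hα hν hb k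
      (half_pos hε') (by linarith [min_le_right ε 1])
    refine ⟨_, _, ρ, W, ψ, χ, hC, tendsto_endFilter.2 ⟨by simpa using h1, ?_⟩⟩
    filter_upwards [h1.eventually_gt_atTop R, h2] with x hx hx2
    refine ⟨hx, ?_⟩
    have e : (f x).im - sectorAngle α ħ k =
        (f x).im - ħ.arg / (α + 1) - k * π / (α + 1) := by rw [sectorAngle]; ring
    rw [e]
    refine hx2.trans_lt ?_
    gcongr
    linarith [min_le_left ε 1]

end

section

/-! ### Curves in a domain on which the action is single-valued -/

/-- `S` is an action function `∫ √V dy` on `D`, for the branch `ρ` of `√V`. -/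
structure IsAction (V : ℂ → ℂ) (D : Set ℂ) (ρ S : ℂ → ℂ) : Prop where
  branch : ∃ W, IsWKBBranch V D ρ W
  deriv_S : ∀ ζ ∈ D, HasDerivAt S (exp ζ * ρ ζ) ζ

theorem exists_isAction {V : ℂ → ℂ} (hV : Differentiable ℂ V)
    (hV1 : Differentiable ℂ (coverDeriv V)) {D : Set ℂ} (hD : IsOpen D) {z₀ : ℂ} (hz₀ : z₀ ∈ D)
    (hs : StarConvex ℝ z₀ D) (h0 : ∀ ζ ∈ D, V ζ ≠ 0) {ρ₀ : ℂ} (hρ₀ : ρ₀ ^ 2 = V z₀) :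
    ∃ ρ S, IsAction V D ρ S ∧ ρ z₀ = ρ₀ := by
  obtain ⟨ρ, W, hb, hρ, -⟩ := exists_isWKBBranch hV hV1 hD hz₀ hs h0 hρ₀ one_ne_zero
  obtain ⟨S, hS⟩ := StarConvex.exists_hasDerivAt hD hs (f := fun ζ => exp ζ * ρ ζ)
    fun ζ hζ => (DifferentiableAt.mul (by fun_prop)
      (hb.deriv_ρ ζ hζ).differentiableAt).differentiableWithinAt
  exact ⟨ρ, S, ⟨⟨W, hb⟩, hS⟩, hρ⟩

namespace IsAction

variable {V : ℂ → ℂ} {D : Set ℂ} {ρ S : ℂ → ℂ}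

theorem isOpen (h : IsAction V D ρ S) : IsOpen D := h.branch.choose_spec.isOpen

theorem ne_zero (h : IsAction V D ρ S) {ζ : ℂ} (hζ : ζ ∈ D) : V ζ ≠ 0 :=
  h.branch.choose_spec.ne_zero ζ hζ

theorem sq (h : IsAction V D ρ S) {ζ : ℂ} (hζ : ζ ∈ D) : ρ ζ ^ 2 = V ζ :=
  h.branch.choose_spec.sq ζ hζ

theorem continuousOn (h : IsAction V D ρ S) : ContinuousOn ρ D := fun ζ hζ =>
  (h.branch.choose_spec.deriv_ρ ζ hζ).continuousAt.continuousWithinAt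

theorem deriv_ne_zero (h : IsAction V D ρ S) {ζ : ℂ} (hζ : ζ ∈ D) : exp ζ * ρ ζ ≠ 0 :=
  mul_ne_zero (exp_ne_zero _) (h.branch.choose_spec.ρ_ne_zero hζ)

theorem contDiffAt (h : IsAction V D ρ S) {ζ : ℂ} (hζ : ζ ∈ D) : ContDiffAt ℂ ∞ S ζ := by
  have hd : DifferentiableOn ℂ S D := fun ξ hξ =>
    (h.deriv_S ξ hξ).differentiableAt.differentiableWithinAt
  exact (hd.contDiffOn h.isOpen).contDiffAt (h.isOpen.mem_nhds hζ)

/-- Near a point of `D` the action is a coordinate. -/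
theorem exists_chart (h : IsAction V D ρ S) {ζ : ℂ} (hζ : ζ ∈ D) :
    ∃ e : OpenPartialHomeomorph ℂ ℂ, ζ ∈ e.source ∧ e.source ⊆ D ∧ (∀ ξ, e ξ = S ξ) ∧
      ContDiffAt ℝ ∞ e.symm (S ζ) := by
  have hS : HasStrictDerivAt S (exp ζ * ρ ζ) ζ :=
    (h.contDiffAt hζ).hasStrictDerivAt' (h.deriv_S ζ hζ) (by simp)
  have hS' := hS.hasStrictFDerivAt_equiv (h.deriv_ne_zero hζ)
  set e₀ := HasStrictFDerivAt.toOpenPartialHomeomorph S hS' with he₀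
  have hζ₀ : ζ ∈ e₀.source := HasStrictFDerivAt.mem_toOpenPartialHomeomorph_source hS'
  set e := e₀.restr D with he
  have hs : e.source = e₀.source ∩ D := by rw [he, e₀.restr_source, h.isOpen.interior_eq]
  have hζe : ζ ∈ e.source := by rw [hs]; exact ⟨hζ₀, hζ⟩
  have heS : ∀ ξ, e ξ = S ξ := fun ξ => rfl
  refine ⟨e, hζe, by rw [hs]; exact inter_subset_right, heS, ?_⟩
  have hmem : S ζ ∈ e.target := e.map_source hζe
  have hinv : e.symm (S ζ) = ζ := e.left_inv hζe
  have := e.contDiffAt_symm_deriv (n := ∞) (h.deriv_ne_zero hζ) hmem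
    (by rw [hinv]; exact h.deriv_S ζ hζ) (by rw [hinv]; exact h.contDiffAt hζ)
  exact this.restrict_scalars ℝ

variable {c : ℝ → ℂ}

/-- A continuous curve in `D` is as smooth as the action along it. -/
theorem contDiffOn_of_comp (h : IsAction V D ρ S) {I : Set ℝ} (hc : ContinuousOn c I)
    (hcD : MapsTo c I D) (hS : ContDiffOn ℝ ∞ (fun t => S (c t)) I) : ContDiffOn ℝ ∞ c I := by
  intro t ht
  obtain ⟨e, he, -, heS, hd⟩ := h.exists_chart (hcD ht)
  have h1 : ContDiffWithinAt ℝ ∞ (fun t => e.symm (S (c t))) I t :=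
    hd.comp_contDiffWithinAt t (hS t ht)
  refine h1.congr_of_eventuallyEq ?_ ?_
  · filter_upwards [(hc t ht).eventually (e.open_source.mem_nhds he)] with s hs
    rw [← heS, e.left_inv hs]
  · rw [← heS, e.left_inv he]

theorem actionIncr_eq (h : IsAction V D ρ S) (hc : PiecewiseSmooth c) (hcD : MapsTo c (Ioo 0 1) D)
    {s t : ℝ} (hs : 0 < s) (hst : s ≤ t) (ht : t < 1) :
    actionIncr c (fun t => ρ (c t)) s t = S (c t) - S (c s) := by
  have hsub : Icc s t ⊆ Ioo 0 1 := fun x hx => ⟨hs.trans_le hx.1, hx.2.trans_lt ht⟩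
  obtain ⟨P, hP⟩ := hc.exists_contDiffAt
  refine integral_eq_of_hasDerivAt_off_countable_of_le (fun x => S (c x)) _ hst P.countable_toSet
    (fun x hx => ?_) (fun x hx => ?_) ?_
  · exact (h.deriv_S _ (hcD (hsub hx))).continuousAt.comp_continuousWithinAt
      ((hc.continuousOn.mono hsub) x hx)
  · have hx1 := hsub (Ioo_subset_Icc_self hx.1)
    have hd := ((hP x hx1 (by simpa using hx.2)).differentiableAt (by simp)).hasDerivAt
    refine ((h.deriv_S _ (hcD hx1)).comp_of_eq x hd rfl).congr_deriv ?_
    rw [velocity_eq hd]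
    ring
  · exact hc.intervalIntegrable_action (h.continuousOn.comp hc.continuousOn hcD)
      ⟨hs, hst.trans_lt ht⟩ ⟨hs.trans_le hst, ht⟩

theorem deriv_re (h : IsAction V D ρ S) {c' : ℂ} {t : ℝ} (ht : c t ∈ D) (hc : HasDerivAt c c' t) :
    HasDerivAt (fun t => (S (c t)).re) ((exp (c t) * ρ (c t) * c').re) t := by
  have := (h.deriv_S _ ht).comp_of_eq t hc rfl
  exact Complex.reCLM.hasFDerivAt.comp_hasDerivAt t this

end IsAction

section Admissible

variable {α ν : ℝ} {ħ : ℂ} {p q : BoundaryPoint} {c c₀ c₁ : ℝ → ℂ} {D : Set ℂ} {ρ S : ℂ → ℂ}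

/-- An injective curve on which `Re S` increases to `+∞` and `F` is integrable is admissible. -/
theorem IsAction.isAdmissible (h : IsAction (reducedPotential α ν ħ) D ρ S)
    (hc : PiecewiseSmooth c) (hcD : MapsTo c (Ioo 0 1) D) (hinj : InjOn c (Ioo 0 1))
    (hp : TendsToBoundary α ħ (𝓝[>] (0 : ℝ)) c p)
    (hq : TendsToBoundary α ħ (𝓝[<] (1 : ℝ)) c q)
    (hint : IntegrableOn (fun t => ‖forcing (potential α ν ħ) (reducedPotential α ν ħ) (c t)
      (ρ (c t))‖ * ‖velocity c t‖) (Ioo 0 1))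
    (hmono : MonotoneOn (fun t => (S (c t)).re) (Ioo 0 1))
    (hlev : Tendsto (fun t => (S (c t)).re) (𝓝[<] 1) atTop) :
    IsAdmissible α ν ħ p q c (fun t => ρ (c t)) ∧ ActionMonotone c (fun t => ρ (c t)) := by
  have hm : ActionMonotone c (fun t => ρ (c t)) := fun s t hs hst ht => by
    rw [h.actionIncr_eq hc hcD hs hst ht, sub_re, sub_nonneg]
    exact hmono ⟨hs, hst.trans_lt ht⟩ ⟨hs.trans_le hst, ht⟩ hst
  refine ⟨⟨hc, hinj, hp, hq, fun t ht => h.ne_zero (hcD ht),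
    h.continuousOn.comp hc.continuousOn hcD, fun t ht => h.sq (hcD ht), hint, ⟨0, hm⟩,
    fun t₀ ht₀ => ?_⟩, hm⟩
  have h1 := tendsto_atTop_add_const_right _ (-(S (c t₀)).re) hlev
  refine h1.congr' ?_
  filter_upwards [Ioo_mem_nhdsLT ht₀.2] with t ht
  rw [h.actionIncr_eq hc hcD ht₀.1 ht.1.le ht.2, sub_re, sub_eq_add_neg]

theorem TendsToBoundary.segment {l : Filter ℝ} (h₀ : TendsToBoundary α ħ l c₀ p)
    (h₁ : TendsToBoundary α ħ l c₁ p) (hα : 0 < α) :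
    TendsToBoundary α ħ (𝓟 (Icc (0 : ℝ) 1) ×ˢ l)
      (fun x => c₀ x.2 + (x.1 : ℂ) * (c₁ x.2 - c₀ x.2)) p := by
  have hfst : ∀ᶠ x : ℝ × ℝ in 𝓟 (Icc (0 : ℝ) 1) ×ˢ l, x.1 ∈ Icc (0 : ℝ) 1 :=
    tendsto_fst.eventually (mem_principal_self _)
  have hre : ∀ x : ℝ × ℝ, (c₀ x.2 + (x.1 : ℂ) * (c₁ x.2 - c₀ x.2)).re =
      (1 - x.1) * (c₀ x.2).re + x.1 * (c₁ x.2).re := fun x => by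
    rw [add_re, re_ofReal_mul, sub_re]; ring
  have him : ∀ x : ℝ × ℝ, (c₀ x.2 + (x.1 : ℂ) * (c₁ x.2 - c₀ x.2)).im =
      (1 - x.1) * (c₀ x.2).im + x.1 * (c₁ x.2).im := fun x => by
    rw [add_im, im_ofReal_mul, sub_im]; ring
  have conv : ∀ {a x y M : ℝ}, a ∈ Icc (0 : ℝ) 1 → x ≤ M → y ≤ M →
      (1 - a) * x + a * y ≤ M := fun {a x y M} ha hx hy => by
    nlinarith [mul_le_mul_of_nonneg_left hx (sub_nonneg.2 ha.2),
      mul_le_mul_of_nonneg_left hy ha.1]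
  cases p with
  | zero =>
    have e₀ : Tendsto (fun t => (c₀ t).re) l atBot := h₀
    have e₁ : Tendsto (fun t => (c₁ t).re) l atBot := h₁
    show Tendsto (fun x : ℝ × ℝ => (c₀ x.2 + (x.1 : ℂ) * (c₁ x.2 - c₀ x.2)).re) _ atBot
    rw [tendsto_atBot]
    intro M
    filter_upwards [hfst, tendsto_snd.eventually (e₀.eventually_le_atBot M),
      tendsto_snd.eventually (e₁.eventually_le_atBot M)] with x hx h1 h2
    rw [hre]
    exact conv hx h1 h2
  | infty k =>
    obtain ⟨e₀, ε₀, hε₀, b₀⟩ := h₀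
    obtain ⟨e₁, ε₁, hε₁, b₁⟩ := h₁
    refine ⟨?_, min ε₀ ε₁, lt_min hε₀ hε₁, ?_⟩
    · rw [tendsto_atTop]
      intro M
      filter_upwards [hfst, tendsto_snd.eventually (e₀.eventually_ge_atTop M),
        tendsto_snd.eventually (e₁.eventually_ge_atTop M)] with x hx h1 h2
      rw [hre]
      nlinarith [conv hx (neg_le_neg h1) (neg_le_neg h2)]
    · filter_upwards [hfst, tendsto_snd.eventually b₀, tendsto_snd.eventually b₁] with x hx h1 h2
      have k1 : (π - ε₀) / (2 * α + 2) ≤ (π - min ε₀ ε₁) / (2 * α + 2) := by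
        gcongr; exact min_le_left _ _
      have k2 : (π - ε₁) / (2 * α + 2) ≤ (π - min ε₀ ε₁) / (2 * α + 2) := by
        gcongr; exact min_le_right _ _
      rw [him]
      obtain ⟨h3, h4⟩ := abs_le.1 (h1.trans k1)
      obtain ⟨h5, h6⟩ := abs_le.1 (h2.trans k2)
      have l1 := conv hx h4 h6
      have l2 := conv hx (neg_le.1 h3) (neg_le.1 h5)
      rw [abs_le]
      constructor <;> nlinarith

/-- The straight-line homotopy. -/
theorem Homotopic.of_segment (hα : 0 < α) (hc₀ : ContinuousOn c₀ (Ioo 0 1))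
    (hc₁ : ContinuousOn c₁ (Ioo 0 1))
    (hV : ∀ t ∈ Ioo (0 : ℝ) 1, ∀ a ∈ Icc (0 : ℝ) 1,
      reducedPotential α ν ħ (c₀ t + (a : ℂ) * (c₁ t - c₀ t)) ≠ 0)
    (hp₀ : TendsToBoundary α ħ (𝓝[>] (0 : ℝ)) c₀ p)
    (hp₁ : TendsToBoundary α ħ (𝓝[>] (0 : ℝ)) c₁ p)
    (hq₀ : TendsToBoundary α ħ (𝓝[<] (1 : ℝ)) c₀ q)
    (hq₁ : TendsToBoundary α ħ (𝓝[<] (1 : ℝ)) c₁ q) : Homotopic α ν ħ p q c₀ c₁ := by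
  have hs : ∀ {f : ℝ → ℂ}, ContinuousOn f (Ioo 0 1) →
      ContinuousOn (fun x : ℝ × ℝ => f x.2) (Icc 0 1 ×ˢ Ioo 0 1) := fun hf =>
    hf.comp continuousOn_snd fun x hx => hx.2
  refine ⟨fun x => c₀ x.2 + (x.1 : ℂ) * (c₁ x.2 - c₀ x.2), ?_, fun x hx => hV _ hx.2 _ hx.1,
    fun t _ => by simp, fun t _ => by simp, hp₀.segment hp₁ hα, hq₀.segment hq₁ hα⟩
  exact (hs hc₀).add (ContinuousOn.mul (by fun_prop) ((hs hc₁).sub (hs hc₀)))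

end Admissible

/-! ### Integrals bounded by the variation of a monotone function -/

/-- If `φ ≤ K G'` for a monotone `G` with values in `[0, 1]`, then `∫ φ ≤ K`. No regularity of `G`
beyond monotonicity is needed. -/
theorem integrableOn_of_le_deriv {φ G : ℝ → ℝ} {a b K : ℝ} (hab : a < b) {E : Set ℝ}
    (hE : E.Countable) (hφ : AEStronglyMeasurable φ (volume.restrict (Ioo a b)))
    (hφ0 : ∀ t ∈ Ioo a b, 0 ≤ φ t) (hG : MonotoneOn G (Ioo a b))
    (hG0 : ∀ t ∈ Ioo a b, 0 ≤ G t) (hG1 : ∀ t ∈ Ioo a b, G t ≤ 1)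
    (hK : 0 ≤ K) (h : ∀ t ∈ Ioo a b \ E, φ t ≤ K * deriv G t) :
    IntegrableOn φ (Ioo a b) ∧ ∫ t in Ioo a b, φ t ≤ K := by
  set H : ℝ → ℝ := fun t => if t ≤ a then 0 else if b ≤ t then 1 else G t with hH
  have hHG : ∀ t ∈ Ioo a b, H t = G t := fun t ht => by
    simp [hH, not_le.2 ht.1, not_le.2 ht.2]
  have hHa : H a = 0 := by simp [hH]
  have hHb : H b = 1 := by simp [hH, not_le.2 hab]
  have hmono : MonotoneOn H (uIcc a b) := by
    rw [uIcc_of_le hab.le]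
    intro s hs t ht hst
    rcases eq_or_lt_of_le hs.1 with rfl | hs1
    · rw [hHa]
      rcases eq_or_lt_of_le ht.1 with rfl | ht1
      · exact hHa.ge
      rcases eq_or_lt_of_le ht.2 with rfl | ht2
      · rw [hHb]; exact zero_le_one
      · rw [hHG t ⟨ht1, ht2⟩]; exact hG0 t ⟨ht1, ht2⟩
    rcases eq_or_lt_of_le ht.2 with rfl | ht2
    · rw [hHb]
      rcases eq_or_lt_of_le hs.2 with rfl | hs2
      · exact hHb.le
      · rw [hHG s ⟨hs1, hs2⟩]; exact hG1 s ⟨hs1, hs2⟩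
    · have hs' : s ∈ Ioo a b := ⟨hs1, hst.trans_lt ht2⟩
      have ht' : t ∈ Ioo a b := ⟨hs1.trans_le hst, ht2⟩
      rw [hHG s hs', hHG t ht']
      exact hG hs' ht' hst
  have hd : ∀ t ∈ Ioo a b, deriv H t = deriv G t := fun t ht =>
    Filter.EventuallyEq.deriv_eq (by
      filter_upwards [Ioo_mem_nhds ht.1 ht.2] with s hs using hHG s hs)
  have hle : ∀ᵐ t ∂volume.restrict (Ioo a b), φ t ≤ K * deriv H t := by
    rw [ae_restrict_iff' measurableSet_Ioo]
    filter_upwards [hE.ae_notMem volume] with t htE ht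
    rw [hd t ht]
    exact h t ⟨ht, htE⟩
  have hi : IntegrableOn (fun t => K * deriv H t) (Ioo a b) := by
    have := hmono.intervalIntegrable_deriv.const_mul K
    rwa [intervalIntegrable_iff_integrableOn_Ioo_of_le hab.le] at this
  have hφi : IntegrableOn φ (Ioo a b) := by
    refine Integrable.mono' hi hφ ?_
    filter_upwards [hle, (ae_restrict_iff' measurableSet_Ioo).2 (Eventually.of_forall hφ0)] with
      t ht ht0
    rwa [norm_of_nonneg ht0]
  refine ⟨hφi, (integral_mono_ae hφi hi hle).trans ?_⟩
  rw [integral_const_mul, ← integral_Ioc_eq_integral_Ioo,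
    ← intervalIntegral.integral_of_le hab.le]
  have := hmono.intervalIntegral_deriv_mem_uIcc
  rw [hHa, hHb, sub_zero, uIcc_of_le zero_le_one] at this
  nlinarith [this.2]

end

section

/-! ### Staircases of horizontal and vertical trajectories -/

/-- `c` is a staircase in `D` for the action `S` on the interval `I`: it is made of finitely many
smooth horizontal and vertical trajectories, `Re S` is monotone along it, and it is joined to the
curve `γ` by segments in `D`. -/
structure IsStaircase (S : ℂ → ℂ) (D : Set ℂ) (γ c : ℝ → ℂ) (I : Set ℝ) : Prop where
  continuousOn : ContinuousOn c I
  segment : ∀ t ∈ I, segment ℝ (γ t) (c t) ⊆ D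
  mono : MonotoneOn (fun t => (S (c t)).re) I
  inj : InjOn (fun t => S (c t)) I
  pieces : ∃ P : Finset ℝ, ∀ a b : ℝ, a < b → Icc a b ⊆ I → (∀ x ∈ P, x ∉ Ioo a b) →
    ContDiffOn ℝ ∞ (fun t => S (c t)) (Icc a b) ∧
      ((∀ s ∈ Icc a b, ∀ t ∈ Icc a b, (S (c s)).im = (S (c t)).im) ∨
        ∀ s ∈ Icc a b, ∀ t ∈ Icc a b, (S (c s)).re = (S (c t)).re)

variable {S : ℂ → ℂ} {D : Set ℂ} {γ c c₁ c₂ : ℝ → ℂ} {I I₁ I₂ : Set ℝ}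

theorem IsStaircase.congr (h : IsStaircase S D γ c₁ I) (he : EqOn c₁ c₂ I) :
    IsStaircase S D γ c₂ I := by
  obtain ⟨P, hP⟩ := h.pieces
  have he' : ∀ t ∈ I, S (c₂ t) = S (c₁ t) := fun t ht => by rw [he ht]
  refine ⟨h.continuousOn.congr fun t ht => (he ht).symm, fun t ht => by
    rw [← he ht]; exact h.segment t ht, fun s hs t ht hst => ?_, fun s hs t ht hst => ?_, P,
    fun a b hab hsub hx => ?_⟩
  · simp only [he' s hs, he' t ht]; exact h.mono hs ht hst
  · simp only [he' s hs, he' t ht] at hst; exact h.inj hs ht hst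
  · obtain ⟨h1, h2⟩ := hP a b hab hsub hx
    refine ⟨h1.congr fun t ht => he' t (hsub ht), h2.imp (fun h3 s hs t ht => ?_)
      fun h3 s hs t ht => ?_⟩ <;>
    · rw [he' s (hsub hs), he' t (hsub ht)]; exact h3 s hs t ht

theorem IsStaircase.union (h₁ : IsStaircase S D γ c I₁) (h₂ : IsStaircase S D γ c I₂) {b : ℝ}
    (hb₁ : b ∈ I₁) (hb₂ : b ∈ I₂) (hI₁ : ∀ t ∈ I₁, t ≤ b) (hI₂ : ∀ t ∈ I₂, b ≤ t)
    (hne : ∀ s ∈ I₁, ∀ t ∈ I₂, b < t → S (c s) ≠ S (c t)) : IsStaircase S D γ c (I₁ ∪ I₂) := by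
  have side₁ : ∀ t ∈ I₁ ∪ I₂, t ≤ b → t ∈ I₁ := fun t ht htb =>
    ht.elim id fun h => le_antisymm htb (hI₂ t h) ▸ hb₁
  have side₂ : ∀ t ∈ I₁ ∪ I₂, b ≤ t → t ∈ I₂ := fun t ht htb =>
    ht.elim (fun h => le_antisymm (hI₁ t h) htb ▸ hb₂) id
  obtain ⟨P₁, hP₁⟩ := h₁.pieces
  obtain ⟨P₂, hP₂⟩ := h₂.pieces
  refine ⟨fun t ht => ?_, fun t ht => ht.elim (h₁.segment t) (h₂.segment t),
    fun s hs t ht hst => ?_, fun s hs t ht hst => ?_, insert b (P₁ ∪ P₂),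
    fun a a' haa hsub hx => ?_⟩
  · refine ContinuousWithinAt.union ?_ ?_
    · by_cases htb : t ≤ b
      · exact h₁.continuousOn t (side₁ t ht htb)
      · refine continuousWithinAt_of_notMem_closure fun h => htb ?_
        exact closure_minimal (fun x hx => hI₁ x hx) isClosed_Iic h
    · by_cases htb : b ≤ t
      · exact h₂.continuousOn t (side₂ t ht htb)
      · refine continuousWithinAt_of_notMem_closure fun h => htb ?_
        exact closure_minimal (fun x hx => hI₂ x hx) isClosed_Ici h
  · rcases le_total t b with htb | htb
    · exact h₁.mono (side₁ s hs (hst.trans htb)) (side₁ t ht htb) hst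
    rcases le_total s b with hsb | hsb
    · exact (h₁.mono (side₁ s hs hsb) hb₁ hsb).trans (h₂.mono hb₂ (side₂ t ht htb) htb)
    · exact h₂.mono (side₂ s hs hsb) (side₂ t ht htb) hst
  · rcases le_or_gt s b with hsb | hsb <;> rcases le_or_gt t b with htb | htb
    · exact h₁.inj (side₁ s hs hsb) (side₁ t ht htb) hst
    · exact absurd hst (hne s (side₁ s hs hsb) t (side₂ t ht htb.le) htb)
    · exact absurd hst.symm (hne t (side₁ t ht htb) s (side₂ s hs hsb.le) hsb)
    · exact h₂.inj (side₂ s hs hsb.le) (side₂ t ht htb.le) hst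
  · have hb := hx b (by simp)
    rcases le_or_gt a' b with h | h
    · exact hP₁ a a' haa (fun t ht => side₁ t (hsub ht) (ht.2.trans h))
        fun x hxP => hx x (by simp [hxP])
    · have hba : b ≤ a := not_lt.1 fun h' => hb ⟨h', h⟩
      exact hP₂ a a' haa (fun t ht => side₂ t (hsub ht) (hba.trans ht.1))
        fun x hxP => hx x (by simp [hxP])

/-- Two staircases with a common point form a staircase. -/
theorem IsStaircase.glue (h₁ : IsStaircase S D γ c₁ I₁) (h₂ : IsStaircase S D γ c₂ I₂) {b : ℝ}
    (hb₁ : b ∈ I₁) (hb₂ : b ∈ I₂) (hI₁ : ∀ t ∈ I₁, t ≤ b) (hI₂ : ∀ t ∈ I₂, b ≤ t)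
    (hb : c₁ b = c₂ b) (hne : ∀ s ∈ I₁, ∀ t ∈ I₂, b < t → S (c₁ s) ≠ S (c₂ t)) :
    ∃ c, IsStaircase S D γ c (I₁ ∪ I₂) ∧ EqOn c c₁ I₁ ∧ EqOn c c₂ I₂ := by
  have e₁ : EqOn (fun t => if t ≤ b then c₁ t else c₂ t) c₁ I₁ := fun t ht => by
    simp [hI₁ t ht]
  have e₂ : EqOn (fun t => if t ≤ b then c₁ t else c₂ t) c₂ I₂ := fun t ht => by
    rcases eq_or_lt_of_le (hI₂ t ht) with rfl | h
    · simp [hb]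
    · simp [not_le.2 h]
  refine ⟨_, (h₁.congr e₁.symm).union (h₂.congr e₂.symm) hb₁ hb₂ hI₁ hI₂ fun s hs t ht hbt => ?_,
    e₁, e₂⟩
  have := hne s hs t ht hbt
  rwa [← e₁ hs, ← e₂ ht] at this

/-- A single horizontal trajectory. -/
theorem IsStaircase.of_horizontal {w : ℂ} {f : ℝ → ℝ} (hc : ContinuousOn c I)
    (hseg : ∀ t ∈ I, _root_.segment ℝ (γ t) (c t) ⊆ D) (hf : StrictMonoOn f I)
    (hfd : ContDiffOn ℝ ∞ f I) (hS : ∀ t ∈ I, S (c t) = w + (f t : ℂ)) :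
    IsStaircase S D γ c I := by
  refine ⟨hc, hseg, fun s hs t ht hst => ?_, fun s hs t ht hst => ?_, ∅, fun a b _ hsub _ =>
    ⟨?_, Or.inl fun s hs t ht => ?_⟩⟩
  · simp only [hS s hs, hS t ht, add_re, ofReal_re]
    have := hf.monotoneOn hs ht hst
    linarith
  · simp only [hS s hs, hS t ht, add_right_inj, Complex.ofReal_inj] at hst
    exact hf.injOn hs ht hst
  · exact (contDiffOn_const.add (ofRealCLM.contDiff.comp_contDiffOn (hfd.mono hsub))).congr
      fun t ht => hS t (hsub ht)
  · rw [hS s (hsub hs), hS t (hsub ht)]; simp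

/-- A single vertical trajectory. -/
theorem IsStaircase.of_vertical {w : ℂ} {f : ℝ → ℝ} (hc : ContinuousOn c I)
    (hseg : ∀ t ∈ I, _root_.segment ℝ (γ t) (c t) ⊆ D) (hf : InjOn f I)
    (hfd : ContDiffOn ℝ ∞ f I) (hS : ∀ t ∈ I, S (c t) = w + (f t : ℂ) * Complex.I) :
    IsStaircase S D γ c I := by
  refine ⟨hc, hseg, fun s hs t ht hst => ?_, fun s hs t ht hst => ?_, ∅, fun a b _ hsub _ =>
    ⟨?_, Or.inr fun s hs t ht => ?_⟩⟩
  · simp [hS s hs, hS t ht]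
  · simp only [hS s hs, hS t ht, add_right_inj] at hst
    exact hf hs ht (by simpa using hst)
  · exact (contDiffOn_const.add ((ofRealCLM.contDiff.comp_contDiffOn
      (hfd.mono hsub)).mul contDiffOn_const)).congr fun t ht => hS t (hsub ht)
  · rw [hS s (hsub hs), hS t (hsub ht)]; simp

variable {V : ℂ → ℂ} {ρ : ℂ → ℂ}

/-- Near each of its points, a curve along which `Re S` increases can be replaced by a horizontal
trajectory followed by a vertical one. -/
theorem IsAction.exists_local_staircase (h : IsAction V D ρ S) (hγ : ContinuousOn γ I)
    (hD : MapsTo γ I D) (hmono : StrictMonoOn (fun t => (S (γ t)).re) I) {t₀ : ℝ} (ht₀ : t₀ ∈ I) :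
    ∃ U, IsOpen U ∧ t₀ ∈ U ∧ ∀ a b, a < b → Icc a b ⊆ I → Icc a b ⊆ U →
      ∃ c, IsStaircase S D γ c (Icc a b) ∧ c a = γ a ∧ c b = γ b ∧
        ∀ t ∈ Icc a b, a < t → (S (γ a)).re < (S (c t)).re := by
  obtain ⟨e, he, heD, heS, -⟩ := h.exists_chart (hD ht₀)
  obtain ⟨r, hr, hrs⟩ := Metric.mem_nhds_iff.1 (e.open_source.mem_nhds he)
  have hmem : S (γ t₀) ∈ e.target := by rw [← heS]; exact e.map_source he
  have hsymm : e.symm (S (γ t₀)) = γ t₀ := by rw [← heS, e.left_inv he]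
  have hn : e.target ∩ e.symm ⁻¹' ball (γ t₀) r ∈ 𝓝 (S (γ t₀)) := by
    refine inter_mem (e.open_target.mem_nhds hmem) ((e.continuousAt_symm hmem).preimage_mem_nhds ?_)
    rw [hsymm]
    exact ball_mem_nhds _ hr
  obtain ⟨δ, hδ, hδs⟩ := Metric.mem_nhds_iff.1 hn
  have hU : ∀ᶠ t in 𝓝[I] t₀, γ t ∈ ball (γ t₀) r ∧
      S (γ t) ∈ ball (S (γ t₀)) (δ / 2) :=
    ((hγ t₀ ht₀).eventually (ball_mem_nhds _ hr)).and
      (((h.deriv_S _ (hD ht₀)).continuousAt.comp_continuousWithinAt (hγ t₀ ht₀)).eventually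
        (ball_mem_nhds _ (half_pos hδ)))
  obtain ⟨U, hUo, hU0, hU⟩ := mem_nhdsWithin.1 hU
  refine ⟨U, hUo, hU0, fun a b hab hI hUI => ?_⟩
  have hγU : ∀ t ∈ Icc a b, γ t ∈ ball (γ t₀) r ∧
      S (γ t) ∈ ball (S (γ t₀)) (δ / 2) := fun t ht => hU ⟨hUI ht, hI ht⟩
  have ha : a ∈ Icc a b := left_mem_Icc.2 hab.le
  have hb : b ∈ Icc a b := right_mem_Icc.2 hab.le
  have hlt : (S (γ a)).re < (S (γ b)).re := hmono (hI ha) (hI hb) hab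
  set x := (S (γ b)).re - (S (γ a)).re with hx
  set y := (S (γ b)).im - (S (γ a)).im with hy
  have hx0 : 0 < x := sub_pos.2 hlt
  have hγe : ∀ t ∈ Icc a b, e.symm (S (γ t)) = γ t := fun t ht => by
    rw [← heS, e.left_inv (hrs (hγU t ht).1)]
  -- the box spanned by the two end-points lies in the range of the chart
  have box : ∀ p ∈ Icc (0 : ℝ) 1, ∀ q ∈ Icc (0 : ℝ) 1,
      S (γ a) + (p * x : ℝ) + (q * y : ℝ) * Complex.I ∈ ball (S (γ t₀)) δ := by
    intro p hp q hq
    have h1 := (hγU a ha).2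
    have h2 := (hγU b hb).2
    rw [mem_ball, Complex.dist_eq] at h1 h2 ⊢
    have conv : ∀ {p u v : ℝ}, p ∈ Icc (0 : ℝ) 1 → |u| < δ / 2 → |v| < δ / 2 →
        |u + p * (v - u)| < δ / 2 := fun {p u v} hp hu hv => by
      have := convex_Ioo (-(δ / 2)) (δ / 2) (abs_lt.1 hu) (abs_lt.1 hv) (sub_nonneg.2 hp.2) hp.1
        (by ring)
      rw [abs_lt]
      have e1 : u + p * (v - u) = (1 - p) • u + p • v := by simp only [smul_eq_mul]; ring
      rw [e1]; exact this
    refine (Complex.norm_le_abs_re_add_abs_im _).trans_lt ?_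
    have r1 := conv hp ((abs_re_le_norm _).trans_lt h1)
      ((abs_re_le_norm _).trans_lt h2)
    have r2 := conv hq ((abs_im_le_norm _).trans_lt h1)
      ((abs_im_le_norm _).trans_lt h2)
    have e1 : (S (γ a) + (p * x : ℝ) + (q * y : ℝ) * Complex.I - S (γ t₀)).re =
        (S (γ a) - S (γ t₀)).re + p * ((S (γ b) - S (γ t₀)).re - (S (γ a) - S (γ t₀)).re) := by
      simp [hx]; ring
    have e2 : (S (γ a) + (p * x : ℝ) + (q * y : ℝ) * Complex.I - S (γ t₀)).im =
        (S (γ a) - S (γ t₀)).im + q * ((S (γ b) - S (γ t₀)).im - (S (γ a) - S (γ t₀)).im) := by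
      simp [hy]; ring
    rw [e1, e2]
    linarith
  have lift : ∀ {a' b' : ℝ} {σ : ℝ → ℂ}, Icc a' b' ⊆ Icc a b → ContinuousOn σ (Icc a' b') →
      (∀ t ∈ Icc a' b', σ t ∈ ball (S (γ t₀)) δ) →
      ContinuousOn (fun t => e.symm (σ t)) (Icc a' b') ∧
      (∀ t ∈ Icc a' b', _root_.segment ℝ (γ t) (e.symm (σ t)) ⊆ D) ∧
      ∀ t ∈ Icc a' b', S (e.symm (σ t)) = σ t := fun {a' b' σ} hsub hσ hσb =>
    ⟨e.continuousOn_symm.comp hσ fun t ht => (hδs (hσb t ht)).1, fun t ht =>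
      ((convex_ball _ _).segment_subset (hγU t (hsub ht)).1 (hδs (hσb t ht)).2).trans
        (hrs.trans heD), fun t ht => by rw [← heS, e.right_inv (hδs (hσb t ht)).1]⟩
  have aff : ∀ {a' b' : ℝ}, a' < b' → ∀ t ∈ Icc a' b', (t - a') / (b' - a') ∈ Icc (0 : ℝ) 1 :=
    fun {a' b'} hab' t ht => ⟨div_nonneg (by linarith [ht.1]) (by linarith),
      (div_le_one (by linarith)).2 (by linarith [ht.2])⟩
  have zero1 : (0 : ℝ) ∈ Icc (0 : ℝ) 1 := ⟨le_rfl, zero_le_one⟩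
  have one1 : (1 : ℝ) ∈ Icc (0 : ℝ) 1 := ⟨zero_le_one, le_rfl⟩
  have hor : ∀ {b' : ℝ}, a < b' → b' ≤ b →
      IsStaircase S D γ (fun t => e.symm (S (γ a) + ((t - a) / (b' - a) * x : ℝ))) (Icc a b') ∧
      ∀ t ∈ Icc a b', S (e.symm (S (γ a) + ((t - a) / (b' - a) * x : ℝ))) =
        S (γ a) + ((t - a) / (b' - a) * x : ℝ) := fun {b'} hab' hb' => by
    obtain ⟨l1, l2, l3⟩ := lift (a' := a) (b' := b')
      (σ := fun t => S (γ a) + ((t - a) / (b' - a) * x : ℝ))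
      (Icc_subset_Icc_right hb') (by fun_prop) fun t ht => by
        simpa using box _ (aff hab' t ht) 0 zero1
    refine ⟨.of_horizontal l1 l2 (fun s _ t _ hst => ?_) (by fun_prop) l3, l3⟩
    have : 0 < b' - a := sub_pos.2 hab'
    gcongr
  by_cases hy0 : y = 0
  · obtain ⟨k1, k2⟩ := hor hab le_rfl
    refine ⟨_, k1, ?_, ?_, fun t ht hat => ?_⟩
    · simp [hγe a ha]
    · have : S (γ a) + ((b - a) / (b - a) * x : ℝ) = S (γ b) := by
        rw [div_self (by linarith), one_mul]
        apply Complex.ext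
        · simp [hx]
        · simpa using (sub_eq_zero.1 hy0).symm
      show e.symm _ = _
      rw [this, hγe b hb]
    · rw [k2 t ht, add_re, ofReal_re, lt_add_iff_pos_right]
      exact mul_pos (div_pos (by linarith) (by linarith)) hx0
  · set m := (a + b) / 2 with hm
    have ham : a < m := by linarith
    have hmb : m < b := by linarith
    obtain ⟨k1, k2⟩ := hor ham hmb.le
    have hmm : (m - a) / (m - a) * x = x := by rw [div_self (by linarith), one_mul]
    obtain ⟨l1, l2, l3⟩ := lift (a' := m) (b' := b)
      (σ := fun t => S (γ a) + (x : ℝ) + ((t - m) / (b - m) * y : ℝ) * Complex.I)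
      (Icc_subset_Icc_left ham.le) (by fun_prop) fun t ht => by
        simpa using box 1 one1 _ (aff hmb t ht)
    have hbm : b - m ≠ 0 := (sub_pos.2 hmb).ne'
    have k3 : IsStaircase S D γ (fun t => e.symm (S (γ a) + (x : ℝ) +
        ((t - m) / (b - m) * y : ℝ) * Complex.I)) (Icc m b) :=
      .of_vertical l1 l2 (fun s _ t _ hst => by
        have := mul_right_cancel₀ hy0 hst
        field_simp at this
        linarith) (by fun_prop) l3
    obtain ⟨c, hc, c1, c2⟩ := k1.glue k3 (right_mem_Icc.2 ham.le) (left_mem_Icc.2 hmb.le)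
      (fun t ht => ht.2) (fun t ht => ht.1) (by simp [hmm]) (fun s hs t ht hmt hst => by
        rw [k2 s hs, l3 t ht] at hst
        have h1 := congrArg Complex.im hst
        simp only [add_im, ofReal_im, add_zero, mul_im, ofReal_re,
          I_im, I_re, mul_one, mul_zero, left_eq_add, mul_eq_zero] at h1
        exact (h1.resolve_right hy0 |> fun h => (div_pos (sub_pos.2 hmt) (sub_pos.2 hmb)).ne' h))
    rw [Icc_union_Icc_eq_Icc ham.le hmb.le] at hc
    refine ⟨c, hc, ?_, ?_, fun t ht hat => ?_⟩
    · rw [c1 (left_mem_Icc.2 ham.le)]; simp [hγe a ha]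
    · have : S (γ a) + (x : ℝ) + ((b - m) / (b - m) * y : ℝ) * Complex.I = S (γ b) := by
        rw [div_self hbm, one_mul]
        apply Complex.ext
        · simp [hx]
        · simp [hy]
      rw [c2 (right_mem_Icc.2 hmb.le)]
      show e.symm _ = _
      rw [this, hγe b hb]
    · rcases le_total t m with htm | hmt
      · rw [c1 ⟨hat.le, htm⟩, k2 t ⟨hat.le, htm⟩, add_re, ofReal_re,
          lt_add_iff_pos_right]
        exact mul_pos (div_pos (by linarith) (by linarith)) hx0
      · rw [c2 ⟨hmt, ht.2⟩, l3 t ⟨hmt, ht.2⟩, add_re, re_ofReal_mul,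
          add_re, ofReal_re, I_re, mul_zero, add_zero]
        linarith

/-- A curve along which `Re S` increases can be replaced by a staircase with the same end-points. -/
theorem IsAction.exists_staircase (h : IsAction V D ρ S) {A B : ℝ} (hAB : A < B)
    (hγ : ContinuousOn γ (Icc A B)) (hD : MapsTo γ (Icc A B) D)
    (hmono : StrictMonoOn (fun t => (S (γ t)).re) (Icc A B)) :
    ∃ c, IsStaircase S D γ c (Icc A B) ∧ c A = γ A ∧ c B = γ B ∧
      ∀ t ∈ Icc A B, A < t → (S (γ A)).re < (S (c t)).re := by
  choose! U hUo hU0 hU using fun t₀ (ht₀ : t₀ ∈ Icc A B) =>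
    h.exists_local_staircase hγ hD hmono ht₀
  obtain ⟨τ, hτ0, hτm, ⟨N, hN⟩, hτU⟩ := exists_monotone_Icc_subset_open_cover_Icc hAB.le
    (c := fun t₀ : Icc A B => ((↑) : Icc A B → ℝ) ⁻¹' U t₀)
    (fun t₀ => (hUo t₀ t₀.2).preimage continuous_subtype_val)
    fun t _ => mem_iUnion.2 ⟨t, hU0 t t.2⟩
  have key : ∀ n, A < τ n → ∃ c, IsStaircase S D γ c (Icc A (τ n)) ∧ c A = γ A ∧
      c (τ n) = γ (τ n) ∧ ∀ t ∈ Icc A (τ n : ℝ), A < t → (S (γ A)).re < (S (c t)).re := by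
    intro n
    induction n with
    | zero => intro h0; exact absurd h0 (by simp [hτ0])
    | succ n ih =>
      intro hA
      have hle : (τ n : ℝ) ≤ τ (n + 1) := hτm (Nat.le_succ n)
      rcases hle.eq_or_lt with heq | hlt
      · rw [← heq] at hA ⊢; exact ih hA
      obtain ⟨i, hi⟩ := hτU n
      have hsub : Icc (τ n : ℝ) (τ (n + 1)) ⊆ Icc A B := Icc_subset_Icc (τ n).2.1 (τ (n + 1)).2.2
      obtain ⟨c₂, hc₂, h2a, h2b, h2⟩ := hU i i.2 (τ n) (τ (n + 1)) hlt hsub fun t ht =>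
        hi (show (⟨t, hsub ht⟩ : Icc A B) ∈ Icc (τ n) (τ (n + 1)) from ht)
      rcases (τ n).2.1.eq_or_lt with hA' | hA'
      · rw [← hA'] at hc₂ h2a h2
        exact ⟨c₂, hc₂, h2a, h2b, h2⟩
      obtain ⟨c₁, hc₁, h1a, h1b, h1⟩ := ih hA'
      have hmem : (τ n : ℝ) ∈ Icc A (τ n) := right_mem_Icc.2 hA'.le
      obtain ⟨c, hc, e₁, e₂⟩ := hc₁.glue hc₂ hmem (left_mem_Icc.2 hle)
        (fun t ht => ht.2) (fun t ht => ht.1) (h1b.trans h2a.symm) fun s hs t ht hst heq => by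
          have k1 : (S (c₁ s)).re ≤ (S (c₁ (τ n))).re := hc₁.mono hs hmem hs.2
          have k2 := h2 t ht hst
          rw [heq, h1b] at k1
          linarith
      rw [Icc_union_Icc_eq_Icc hA'.le hle] at hc
      refine ⟨c, hc, by rw [e₁ (left_mem_Icc.2 hA'.le), h1a],
        by rw [e₂ (right_mem_Icc.2 hle), h2b], fun t ht hAt => ?_⟩
      rcases le_or_gt t (τ n) with htn | htn
      · rw [e₁ ⟨hAt.le, htn⟩]; exact h1 t ⟨hAt.le, htn⟩ hAt
      · rw [e₂ ⟨htn.le, ht.2⟩]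
        exact (hmono (left_mem_Icc.2 hAB.le) (τ n).2 hA').trans (h2 t ⟨htn.le, ht.2⟩ htn)
  have hNB : (τ N : ℝ) = B := by rw [hN N le_rfl]
  have := key N (by rw [hNB]; exact hAB)
  rwa [hNB] at this

end

section

/-! ### Horizontal trajectories to the boundary points -/

/-- A function whose derivative is close to `1` lifts rays. -/
theorem exists_ray_lift {Ω : Set ℂ} (hΩ : Convex ℝ Ω) {Φ Φ' : ℂ → ℂ}
    (hΦ : ∀ q ∈ Ω, HasDerivAt Φ (Φ' q) q) {κ : ℝ} (hκ0 : 0 < κ) (hκ1 : κ ≤ 1)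
    (h : ∀ q ∈ Ω, ‖Φ' q - 1‖ ≤ κ / 2) {q₀ d : ℂ}
    (hball : ∀ τ : ℝ, 0 ≤ τ → closedBall (q₀ + τ * d) (κ * (τ * ‖d‖)) ⊆ Ω) :
    ∃ ray : ℝ → ℂ, ray 0 = q₀ ∧ ContinuousOn ray (Ici 0) ∧
      ∀ τ : ℝ, 0 ≤ τ → ray τ ∈ closedBall (q₀ + τ * d) (κ * (τ * ‖d‖)) ∧
        Φ (ray τ) = Φ q₀ + τ * d := by
  have hlip : ∀ a ∈ Ω, ∀ b ∈ Ω, ‖Φ a - Φ b - (a - b)‖ ≤ κ / 2 * ‖a - b‖ := fun a ha b hb => by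
    have := hΩ.norm_image_sub_le_of_norm_hasDerivWithin_le (f := fun q => Φ q - q)
      (f' := fun q => Φ' q - 1) (C := κ / 2)
      (fun q hq => ((hΦ q hq).sub (hasDerivAt_id q)).hasDerivWithinAt) h hb ha
    rwa [sub_sub_sub_comm] at this
  have hq₀ : q₀ ∈ Ω := hball 0 le_rfl (by simp)
  have hexp : ∀ a ∈ Ω, ∀ b ∈ Ω, ‖a - b‖ ≤ 2 * ‖Φ a - Φ b‖ := fun a ha b hb => by
    have h1 := norm_sub_norm_le (a - b) (Φ a - Φ b)
    rw [norm_sub_rev (a - b) (Φ a - Φ b)] at h1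
    have h2 := hlip a ha b hb
    nlinarith [norm_nonneg (a - b)]
  have hκn : ((κ / 2).toNNReal : ℝ) = κ / 2 := Real.coe_toNNReal _ (by positivity)
  -- `Φ` is an approximately linear map, so it is onto a ball around `Φ (q₀ + τ d)`
  have hex : ∀ τ : ℝ, 0 ≤ τ → ∃ q ∈ closedBall (q₀ + τ * d) (κ * (τ * ‖d‖)),
      Φ q = Φ q₀ + τ * d := by
    intro τ hτ
    set b := q₀ + τ * d with hb
    have hbΩ : b ∈ Ω := hball τ hτ (Metric.mem_closedBall_self (by positivity))
    have happ : ApproximatesLinearOn Φ (ContinuousLinearEquiv.refl ℂ ℂ : ℂ →L[ℂ] ℂ) Ω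
        (κ / 2).toNNReal := fun x hx y hy => by rw [hκn]; exact hlip x hx y hy
    have hn : ((ContinuousLinearEquiv.refl ℂ ℂ).toNonlinearRightInverse.nnnorm : ℝ) = 1 := by
      simp [ContinuousLinearEquiv.toNonlinearRightInverse]
    have := happ.surjOn_closedBall_of_nonlinearRightInverse
      (ContinuousLinearEquiv.refl ℂ ℂ).toNonlinearRightInverse (ε := κ * (τ * ‖d‖)) (b := b)
      (by positivity) (hball τ hτ)
    obtain ⟨q, hq, hqe⟩ := this (a := Φ q₀ + τ * d) (by
      rw [mem_closedBall_iff_norm, hn, hκn, inv_one]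
      have h1 := hlip b hbΩ q₀ hq₀
      have h2 : ‖b - q₀‖ = τ * ‖d‖ := by
        rw [hb, add_sub_cancel_left, norm_mul, norm_real, norm_of_nonneg hτ]
      rw [h2] at h1
      have h3 : Φ q₀ + τ * d - Φ b = -(Φ b - Φ q₀ - (b - q₀)) := by rw [hb]; ring
      rw [h3, norm_neg]
      refine h1.trans ?_
      have : 0 ≤ τ * ‖d‖ := by positivity
      nlinarith [mul_nonneg (mul_nonneg hκ0.le this) (sub_nonneg.2 hκ1)])
    exact ⟨q, hq, hqe⟩
  choose! ray hray using hex
  refine ⟨ray, ?_, ?_, hray⟩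
  · have := (hray 0 le_rfl).1
    simpa using this
  · refine LipschitzOnWith.continuousOn (K := 2 * ‖d‖₊) (LipschitzOnWith.of_dist_le_mul ?_)
    intro s hs t ht
    rw [dist_eq_norm, dist_eq_norm]
    refine (hexp _ (hball s hs (hray s hs).1) _ (hball t ht (hray t ht).1)).trans_eq ?_
    rw [(hray s hs).2, (hray t ht).2, add_sub_add_left_eq_sub, ← sub_mul, norm_mul,
      ← Complex.ofReal_sub, norm_real]
    push_cast
    ring

/-- `τ` is a parameter which is zero at `t₀` and tends to infinity at one end of the interval `I`
with interior `(a, b)`, whose time runs forwards (`ε = 1`) or backwards (`ε = -1`). -/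
structure IsClock (I : Set ℝ) (l : Filter ℝ) (a b t₀ ε : ℝ) (τ : ℝ → ℝ) : Prop where
  lt : a < b
  subset : Ioo a b ⊆ I
  mem : t₀ ∈ I
  zero : τ t₀ = 0
  nonneg : ∀ t ∈ I, 0 ≤ τ t
  contDiffOn : ContDiffOn ℝ ∞ τ I
  strictMono : StrictMonoOn (fun t => ε * τ t) I
  tendsto : Tendsto τ l atTop
  eventually : ∀ᶠ t in l, t ∈ I
  sign : ε * ε = 1

theorem isClock_start {A : ℝ} (hA : 0 < A) :
    IsClock (Ioc 0 A) (𝓝[>] 0) 0 A A (-1) (fun t => t⁻¹ - A⁻¹) where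
  lt := hA
  subset := Ioo_subset_Ioc_self
  mem := right_mem_Ioc.2 hA
  zero := sub_self _
  nonneg t ht := sub_nonneg.2 (inv_anti₀ ht.1 ht.2)
  contDiffOn := (contDiffOn_id.inv fun t ht => ht.1.ne').sub contDiffOn_const
  strictMono s hs t ht hst := by
    have := inv_strictAnti₀ hs.1 hst
    simp only
    linarith
  tendsto := tendsto_atTop_add_const_right _ _ tendsto_inv_nhdsGT_zero
  eventually := Ioc_mem_nhdsGT hA
  sign := by norm_num

theorem isClock_finish {B : ℝ} (hB : B < 1) :
    IsClock (Ico B 1) (𝓝[<] 1) B 1 B 1 (fun t => (1 - t)⁻¹ - (1 - B)⁻¹) where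
  lt := hB
  subset := Ioo_subset_Ico_self
  mem := left_mem_Ico.2 hB
  zero := sub_self _
  nonneg t ht := sub_nonneg.2 (inv_anti₀ (sub_pos.2 ht.2) (by linarith [ht.1]))
  contDiffOn := ((contDiffOn_const.sub contDiffOn_id).inv fun t ht => (sub_pos.2 ht.2).ne').sub
    contDiffOn_const
  strictMono s hs t ht hst := by
    have := inv_strictAnti₀ (sub_pos.2 ht.2) (show 1 - t < 1 - s by linarith)
    simp only
    linarith
  tendsto := by
    refine tendsto_atTop_add_const_right _ _ (tendsto_inv_nhdsGT_zero.comp ?_)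
    refine tendsto_nhdsWithin_iff.2 ⟨?_, ?_⟩
    · have : Tendsto (fun t : ℝ => 1 - t) (𝓝 1) (𝓝 (1 - 1)) := tendsto_id.const_sub 1
      rw [sub_self] at this
      exact this.mono_left nhdsWithin_le_nhds
    · filter_upwards [self_mem_nhdsWithin] with t ht using sub_pos.2 (mem_Iio.1 ht)
  eventually := Ico_mem_nhdsLT hB
  sign := by norm_num

/-- A horizontal trajectory from `γ t₀` to the boundary point `p`. -/
structure IsTail (α ν : ℝ) (ħ : ℂ) (D : Set ℂ) (ρ S : ℂ → ℂ) (γ : ℝ → ℂ) (p : BoundaryPoint)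
    (I : Set ℝ) (l : Filter ℝ) (a b t₀ ε : ℝ) (τ : ℝ → ℝ) (c : ℝ → ℂ) : Prop where
  clock : IsClock I l a b t₀ ε τ
  base : c t₀ = γ t₀
  continuousOn : ContinuousOn c I
  segment : ∀ t ∈ I, segment ℝ (γ t) (c t) ⊆ D
  action : ∀ t ∈ I, S (c t) = S (γ t₀) + (ε * τ t : ℝ)
  tendsTo : TendsToBoundary α ħ l c p
  integrable : IntegrableOn (fun t => ‖forcing (potential α ν ħ) (reducedPotential α ν ħ)
    (c t) (ρ (c t))‖ * ‖velocity c t‖) (Ioo a b)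

variable {α ν : ℝ} {ħ : ℂ} {p q : BoundaryPoint} {D T Ω : Set ℂ} {ρ S : ℂ → ℂ} {γ c c₀ : ℝ → ℂ}
  {I : Set ℝ} {l : Filter ℝ} {a b t₀ ε : ℝ} {τ : ℝ → ℝ}

theorem IsTail.isStaircase (h : IsTail α ν ħ D ρ S γ p I l a b t₀ ε τ c) :
    IsStaircase S D γ c I :=
  .of_horizontal h.continuousOn h.segment h.clock.strictMono
    (contDiffOn_const.mul h.clock.contDiffOn) h.action

/-- On a horizontal trajectory `y √V dζ = ± dτ`, so a bound of `F dy` by `y √V / (1 + τ)² dζ` makes it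
integrable. -/
theorem IsAction.integrableOn_of_horizontal (h : IsAction (reducedPotential α ν ħ) D ρ S)
    (hτ : IsClock I l a b t₀ ε τ) (hc : ContinuousOn c I) (hcD : MapsTo c I D) {w : ℂ}
    (hS : ∀ t ∈ I, S (c t) = w + (ε * τ t : ℝ)) {K : ℝ} (hK : 0 ≤ K)
    (hle : ∀ t ∈ I, ‖forcing (potential α ν ħ) (reducedPotential α ν ħ) (c t) (ρ (c t)) *
      exp (c t)‖ ≤ K * ‖exp (c t) * ρ (c t)‖ / (1 + τ t) ^ 2) :
    IntegrableOn (fun t => ‖forcing (potential α ν ħ) (reducedPotential α ν ħ)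
      (c t) (ρ (c t))‖ * ‖velocity c t‖) (Ioo a b) := by
  have hsub := hτ.subset
  have hcs : ContDiffOn ℝ ∞ c (Ioo a b) := by
    refine h.contDiffOn_of_comp (hc.mono hsub) (hcD.mono_left hsub) ?_
    refine (contDiffOn_const.add (ofRealCLM.contDiff.comp_contDiffOn
      (contDiffOn_const.mul (hτ.contDiffOn.mono hsub)))).congr fun t ht => hS t (hsub ht)
  have hca : ∀ t ∈ Ioo a b, ContDiffAt ℝ ∞ c t := fun t ht =>
    hcs.contDiffAt (isOpen_Ioo.mem_nhds ht)
  have hτd : ∀ t ∈ Ioo a b, HasDerivAt τ (deriv τ t) t := fun t ht =>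
    (((hτ.contDiffOn.mono hsub).contDiffAt (isOpen_Ioo.mem_nhds ht)).differentiableAt
      (by simp)).hasDerivAt
  obtain ⟨W, hW⟩ := h.branch
  have hF : ContinuousOn (fun t => forcing (potential α ν ħ) (reducedPotential α ν ħ)
      (c t) (ρ (c t))) (Ioo a b) :=
    (hW.isWKBLift (hcD.mono_left hsub)).continuousOn_forcing
      (differentiable_potential α ν ħ).continuous
      (differentiable_coverDeriv_reducedPotential α ν ħ) (hc.mono hsub)
  have hv : ContinuousOn (velocity c) (Ioo a b) := fun t ht =>
    (continuousAt_velocity (hca t ht)).continuousWithinAt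
  have hpos : ∀ t ∈ Ioo a b, 0 < 1 + τ t := fun t ht => by
    linarith [hτ.nonneg t (hsub ht)]
  have hinv : ∀ t ∈ Ioo a b, (1 + τ t)⁻¹ ∈ Icc (0 : ℝ) 1 := fun t ht =>
    ⟨inv_nonneg.2 (hpos t ht).le, inv_le_one_of_one_le₀ (by linarith [hτ.nonneg t (hsub ht)])⟩
  have hε : ε = 1 ∨ ε = -1 := mul_self_eq_one_iff.1 hτ.sign
  -- the primitive of `|τ'| / (1 + τ)²`
  set G : ℝ → ℝ := fun t => (1 + ε) / 2 - ε * (1 + τ t)⁻¹ with hG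
  have hG01 : ∀ t ∈ Ioo a b, G t ∈ Icc (0 : ℝ) 1 := fun t ht => by
    obtain ⟨h0, h1⟩ := hinv t ht
    rcases hε with rfl | rfl <;> constructor <;> simp only [hG] <;> linarith
  have hGd : ∀ t ∈ Ioo a b, HasDerivAt G (ε * deriv τ t / (1 + τ t) ^ 2) t := fun t ht => by
    have := ((((hτd t ht).const_add 1).inv (hpos t ht).ne').const_mul ε).const_sub ((1 + ε) / 2)
    exact this.congr_deriv (by ring)
  have hGm : MonotoneOn G (Ioo a b) := by
    intro s hs t ht hst
    have hm := hτ.strictMono.monotoneOn (hsub hs) (hsub ht) hst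
    rcases hε with rfl | rfl
    · have := inv_anti₀ (hpos s hs) (by linarith : 1 + τ s ≤ 1 + τ t)
      simp only [hG]; linarith
    · have := inv_anti₀ (hpos t ht) (by linarith : 1 + τ t ≤ 1 + τ s)
      simp only [hG]; linarith
  have hd0 : ∀ t ∈ Ioo a b, 0 ≤ ε * deriv τ t := fun t ht => by
    have hd := (hτd t ht).const_mul ε
    rw [← hd.deriv, ← derivWithin_of_isOpen isOpen_Ioo ht]
    exact (hτ.strictMono.monotoneOn.mono hsub).derivWithin_nonneg
  refine (integrableOn_of_le_deriv (G := G) (K := K) (E := ∅) hτ.lt countable_empty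
    ((hF.norm.mul hv.norm).aestronglyMeasurable measurableSet_Ioo)
    (fun t _ => mul_nonneg (norm_nonneg _) (norm_nonneg _)) hGm
    (fun t ht => (hG01 t ht).1) (fun t ht => (hG01 t ht).2) hK fun t ht => ?_).1
  have ht := ht.1
  have hcd : HasDerivAt c (deriv c t) t := ((hca t ht).differentiableAt (by simp)).hasDerivAt
  have hctD := hcD (hsub ht)
  have hm0 := norm_pos_iff.2 (h.deriv_ne_zero hctD)
  have hch : exp (c t) * ρ (c t) * deriv c t = (ε * deriv τ t : ℝ) := by
    have h1 := (h.deriv_S _ hctD).comp_of_eq t hcd rfl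
    have h2 : HasDerivAt (fun t => w + (ε * τ t : ℝ)) ((ε * deriv τ t : ℝ) : ℂ) t :=
      (((hτd t ht).const_mul ε).ofReal_comp).const_add w
    refine h1.unique (h2.congr_of_eventuallyEq ?_)
    filter_upwards [isOpen_Ioo.mem_nhds ht] with s hs using hS s (hsub hs)
  have hn : ‖exp (c t) * ρ (c t)‖ * ‖deriv c t‖ = ε * deriv τ t := by
    rw [← norm_mul, hch, norm_real, norm_of_nonneg (hd0 t ht)]
  show ‖_‖ * ‖velocity c t‖ ≤ _
  rw [(hGd t ht).deriv, velocity_eq hcd, norm_mul (exp _), ← mul_assoc, ← norm_mul]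
  refine (mul_le_mul_of_nonneg_right (hle t (hsub ht)) (norm_nonneg _)).trans_eq ?_
  rw [← hn]
  ring

/-- Horizontal trajectories are lifts of rays in a coordinate in which the action is close to a
linear function. -/
theorem IsAction.exists_horizontal (h : IsAction (reducedPotential α ν ħ) D ρ S)
    (hτ : IsClock I l a b t₀ ε τ) (hΩ : Convex ℝ Ω) (hT : Convex ℝ T) (hTD : T ⊆ D) {Z Z' : ℂ → ℂ}
    (hZ : ∀ q ∈ Ω, HasDerivAt Z (Z' q) q) (hZT : MapsTo Z Ω T) {d : ℂ} (hd : d ≠ 0)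
    {κ : ℝ} (hκ0 : 0 < κ) (hκ1 : κ ≤ 1)
    (hu : ∀ q ∈ Ω, ‖ε * d * (exp (Z q) * ρ (Z q)) * Z' q - 1‖ ≤ κ / 2) {q₀ : ℂ}
    (hball : ∀ τ : ℝ, 0 ≤ τ → closedBall (q₀ + τ * d) (κ * (τ * ‖d‖)) ⊆ Ω)
    (hγ : MapsTo γ I T) (hq₀ : Z q₀ = γ t₀) :
    ∃ c : ℝ → ℂ, c t₀ = γ t₀ ∧ ContinuousOn c I ∧ (∀ t ∈ I, segment ℝ (γ t) (c t) ⊆ D) ∧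
      (∀ t ∈ I, S (c t) = S (γ t₀) + (ε * τ t : ℝ)) ∧
      ∀ t ∈ I, ∃ q ∈ closedBall (q₀ + τ t * d) (κ * (τ t * ‖d‖)), c t = Z q := by
  have hZD : MapsTo Z Ω D := fun q hq => hTD (hZT hq)
  obtain ⟨ray, h0, hcont, hray⟩ := exists_ray_lift hΩ (Φ := fun q => ε * d * S (Z q))
    (Φ' := fun q => ε * d * (exp (Z q) * ρ (Z q)) * Z' q) (fun q hq =>
      (((h.deriv_S _ (hZD hq)).comp q (hZ q hq)).const_mul (ε * d)).congr_deriv (by ring))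
    hκ0 hκ1 hu hball
  have hmem : ∀ t ∈ I, ray (τ t) ∈ Ω := fun t ht =>
    hball _ (hτ.nonneg t ht) (hray _ (hτ.nonneg t ht)).1
  have hε2 : (ε : ℂ) * ε = 1 := by rw [← Complex.ofReal_mul, hτ.sign, ofReal_one]
  have hε : (ε : ℂ) ≠ 0 := fun h => by rw [h, zero_mul] at hε2; exact zero_ne_one hε2
  refine ⟨fun t => Z (ray (τ t)), by simp only [hτ.zero, h0, hq₀], ?_, fun t ht => ?_,
    fun t ht => ?_, fun t ht => ⟨_, (hray _ (hτ.nonneg t ht)).1, rfl⟩⟩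
  · have hZc : ContinuousOn Z Ω := fun q hq => (hZ q hq).continuousAt.continuousWithinAt
    exact hZc.comp (hcont.comp hτ.contDiffOn.continuousOn hτ.nonneg) hmem
  · exact (hT.segment_subset (hγ ht) (hZT (hmem t ht))).trans hTD
  · have h1 := (hray _ (hτ.nonneg t ht)).2
    simp only [hq₀] at h1
    have h2 : (ε * d) * S (Z (ray (τ t))) = (ε * d) * (S (γ t₀) + (ε * τ t : ℝ)) := by
      rw [h1]; push_cast; linear_combination (-(d * τ t)) * hε2
    exact mul_left_cancel₀ (mul_ne_zero hε hd) h2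

/-- A continuous square root of a function close to `1` has a constant sign. -/
theorem re_nonneg_of_isPreconnected {u : ℂ → ℂ} (hT : IsPreconnected T) (hu : ContinuousOn u T)
    (h1 : ∀ ζ ∈ T, ‖u ζ ^ 2 - 1‖ < 1) {z₀ : ℂ} (hz₀ : z₀ ∈ T) (h0 : 0 ≤ (u z₀).re) :
    ∀ ζ ∈ T, 0 ≤ (u ζ).re := by
  intro ζ hζ
  by_contra! hlt
  obtain ⟨ξ, hξ, hξ0⟩ := hT.intermediate_value hζ hz₀
    (continuous_re.comp_continuousOn hu) ⟨hlt.le, h0⟩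
  have h2 := h1 ξ hξ
  have h3 := (abs_re_le_norm (u ξ ^ 2 - 1)).trans_lt h2
  have h4 : (u ξ).re = 0 := hξ0
  rw [pow_two, sub_re, mul_re, h4, abs_lt] at h3
  simp only [Complex.one_re] at h3
  nlinarith [mul_self_nonneg (u ξ).im]

/-- The sign of a square root close to `± 1` is determined by that of a multiple of it. -/
theorem re_nonneg_of_mul {w y δ : ℂ} (hw : w ^ 2 = 1 + δ) (hy : ‖δ‖ * ‖y‖ < y.re)
    (h : 0 ≤ (w * y).re) : 0 ≤ w.re := by
  by_contra! hlt
  have h1 := norm_sub_one_le_of_sq (u := -w) (by rw [neg_sq, hw])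
    (by rw [neg_re]; linarith)
  have h2 : (w * y).re = -y.re - ((-w - 1) * y).re := by
    rw [← neg_re, ← sub_re]; congr 1; ring
  have h3 := (abs_le.1 (abs_re_le_norm ((-w - 1) * y))).1
  rw [norm_mul] at h3
  have h4 : ‖-w - 1‖ * ‖y‖ ≤ ‖δ‖ * ‖y‖ := by gcongr
  linarith

end

section

variable {α ν : ℝ} {ħ : ℂ} {p q : BoundaryPoint} {D : Set ℂ} {ρ S : ℂ → ℂ} {γ c c₀ : ℝ → ℂ}
  {I : Set ℝ} {l : Filter ℝ} {a b t₀ ε : ℝ} {τ : ℝ → ℝ}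

/-- Near `0` the action is close to `-ζ / ħ`, so horizontal trajectories follow the rays of direction
`-ħ` in the `ζ`-plane. -/
theorem exists_tail_zero (hα : 0 < α) (hν : 0 ≤ ν) (hb : ħ ≠ 0) (hre : ‖ħ‖ ≤ 2 * ħ.re)
    (h : IsAction (reducedPotential α ν ħ) D ρ S) (hτ : IsClock I l a b t₀ 1 τ) {R : ℝ}
    (hR0 : 0 ≤ R) (hR : ∀ x ≤ -R, symbolSize α ν x ≤ 1 / 8) (hTD : {ζ : ℂ | ζ.re < -R} ⊆ D)
    (hγ : MapsTo γ I {ζ : ℂ | ζ.re < -R})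
    (hsign : 0 ≤ (-ħ * (exp (γ t₀) * ρ (γ t₀))).re) :
    ∃ c, IsTail α ν ħ D ρ S γ .zero I l a b t₀ 1 τ c := by
  have hb' := norm_pos_iff.2 hb
  have hT : Convex ℝ {ζ : ℂ | ζ.re < -R} := convex_halfSpace_re_lt _
  have hsq : ∀ ζ ∈ {ζ : ℂ | ζ.re < -R}, (-ħ * (exp ζ * ρ ζ)) ^ 2 =
      1 + (symbol α ν ζ - 1) := fun ζ hζ => by
    rw [neg_mul, neg_sq, sq_mul_eq_symbol hb (h.sq (hTD hζ))]; ring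
  have hδ : ∀ ζ ∈ {ζ : ℂ | ζ.re < -R}, ‖symbol α ν ζ - 1‖ ≤ 1 / 8 := fun ζ hζ =>
    (norm_symbol_sub_one_le hν ζ).trans (hR _ (le_of_lt hζ))
  have hpos := re_nonneg_of_isPreconnected (u := fun ζ => -ħ * (exp ζ * ρ ζ))
    hT.isPreconnected (continuousOn_const.mul (ContinuousOn.mul (by fun_prop)
      (h.continuousOn.mono hTD))) (fun ζ hζ => by
        rw [hsq ζ hζ, add_sub_cancel_left]; exact (hδ ζ hζ).trans_lt (by norm_num))
    (hγ hτ.mem) hsign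
  have hnear : ∀ ζ ∈ {ζ : ℂ | ζ.re < -R}, ‖-ħ * (exp ζ * ρ ζ) - 1‖ ≤ 1 / 8 :=
    fun ζ hζ => (norm_sub_one_le_of_sq (hsq ζ hζ) (hpos ζ hζ)).trans (hδ ζ hζ)
  have hballre : ∀ s : ℝ, 0 ≤ s → ∀ z ∈ closedBall (γ t₀ + s * -ħ) (1 / 4 * (s * ‖-ħ‖)),
      z.re ≤ (γ t₀).re - s * (‖ħ‖ / 4) := fun s hs z hz => by
    rw [mem_closedBall_iff_norm, norm_neg] at hz
    have h1 := (abs_le.1 ((abs_re_le_norm _).trans hz)).2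
    rw [sub_re, add_re, re_ofReal_mul, neg_re] at h1
    nlinarith [mul_le_mul_of_nonneg_left hre hs]
  have hγ0 : (γ t₀).re < -R := hγ hτ.mem
  obtain ⟨c, h0, hc, hseg, hS, hq⟩ := h.exists_horizontal hτ hT hT hTD (Z := id)
    (Z' := fun _ => 1) (fun q _ => hasDerivAt_id q) (fun q hq => hq) (d := -ħ)
    (neg_ne_zero.2 hb) (κ := 1 / 4) (by norm_num) (by norm_num) (q₀ := γ t₀) (fun q hq => by
      have := hnear q hq
      norm_num at this ⊢
      exact this) (fun s hs z hz => by
      have := hballre s hs z hz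
      show z.re < -R
      have : 0 ≤ s * (‖ħ‖ / 4) := by positivity
      linarith) hγ rfl
  have hcre : ∀ t ∈ I, (c t).re ≤ -R - τ t * (‖ħ‖ / 4) := fun t ht => by
    obtain ⟨q, hq1, hq2⟩ := hq t ht
    have := hballre _ (hτ.nonneg t ht) q hq1
    rw [hq2, id]
    linarith
  have hcT : ∀ t ∈ I, (c t).re < -R := fun t ht => by
    obtain ⟨q, hq1, hq2⟩ := hq t ht
    have := hballre _ (hτ.nonneg t ht) q hq1
    rw [hq2, id]
    have : 0 ≤ τ t * (‖ħ‖ / 4) := mul_nonneg (hτ.nonneg t ht) (by positivity)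
    linarith
  refine ⟨c, hτ, h0, hc, hseg, hS, ?_, ?_⟩
  · show Tendsto (fun t => (c t).re) l atBot
    have h1 : Tendsto (fun t => -R - τ t * (‖ħ‖ / 4)) l atBot := by
      have := (tendsto_neg_atTop_atBot.comp (hτ.tendsto.atTop_mul_const (show 0 < ‖ħ‖ / 4 by
        positivity)))
      exact tendsto_atBot_add_const_left _ (-R) this
    refine tendsto_atBot_mono' _ ?_ h1
    filter_upwards [hτ.eventually] with t ht using hcre t ht
  · have hfc := forcingConst_pos hα (s := 1 / 2) (by norm_num)
    set η := min (‖ħ‖ / 4) 1 with hη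
    have hη0 : 0 < η := lt_min (by positivity) one_pos
    refine h.integrableOn_of_horizontal hτ hc (fun t ht => hTD (hcT t ht)) hS
      (K := ‖ħ‖ * forcingConst α (1 / 2) * (1 + ν) * 2 * ‖ħ‖ * (η⁻¹) ^ 2)
      (by positivity) fun t ht => ?_
    have hτt := hτ.nonneg t ht
    have hctR := hcT t ht
    have hm : 1 / 2 ≤ ‖ħ‖ * ‖exp (c t) * ρ (c t)‖ := by
      have h1 := hnear (c t) hctR
      have h2 := norm_sub_norm_le (1 : ℂ) (1 - -ħ * (exp (c t) * ρ (c t)))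
      rw [sub_sub_cancel, norm_one, norm_sub_rev, norm_mul, norm_neg] at h2
      linarith
    have hexp : Real.exp (2 * (c t).re) ≤ (η⁻¹) ^ 2 / (1 + τ t) ^ 2 := by
      have h1 : η * (1 + τ t) ≤ Real.exp (η * τ t) := by
        have := Real.add_one_le_exp (η * τ t)
        nlinarith [min_le_right (‖ħ‖ / 4) 1]
      have h2 : Real.exp (2 * (c t).re) ≤ (Real.exp (η * τ t) ^ 2)⁻¹ := by
        rw [← Real.exp_nat_mul, ← Real.exp_neg, exp_le_exp]
        have := hcre t ht
        have := mul_le_mul_of_nonneg_left (min_le_left (‖ħ‖ / 4) 1) hτt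
        rw [← hη] at this
        push_cast
        linarith
      refine h2.trans ?_
      rw [inv_pow, div_eq_mul_inv, ← mul_inv, ← mul_pow]
      gcongr
    refine (norm_forcing_le_zero hα hν hb (h.sq (hTD hctR)) ((hR _ hctR.le).trans (by norm_num))
      (by linarith)).trans ?_
    calc ‖ħ‖ * forcingConst α (1 / 2) * (1 + ν) * Real.exp (2 * (c t).re)
        ≤ ‖ħ‖ * forcingConst α (1 / 2) * (1 + ν) * ((η⁻¹) ^ 2 / (1 + τ t) ^ 2) *
          (2 * (‖ħ‖ * ‖exp (c t) * ρ (c t)‖)) := by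
          have : Real.exp (2 * (c t).re) * 1 ≤ ((η⁻¹) ^ 2 / (1 + τ t) ^ 2) *
              (2 * (‖ħ‖ * ‖exp (c t) * ρ (c t)‖)) := by
            gcongr; linarith
          rw [mul_one] at this
          rw [mul_assoc _ ((η⁻¹) ^ 2 / (1 + τ t) ^ 2)]
          gcongr
      _ = _ := by ring

/-- A horizontal half-strip at `∞_k`, of half-width `θ / (α + 1)`, in which the argument of
`sectorCoord` is less than `θ` in modulus. -/
def argStrip (α : ℝ) (ħ : ℂ) (k : ℤ) (θ R : ℝ) : Set ℂ :=
  {ζ | R < ζ.re ∧ |(α + 1) * (ζ.im - sectorAngle α ħ k)| < θ}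

theorem argStrip_eq (hα : 0 < α) (k : ℤ) (θ R : ℝ) :
    argStrip α ħ k θ R = sectorStrip α ħ k (π - 2 * θ) R := by
  ext ζ
  have h : 0 < α + 1 := by linarith
  rw [argStrip, sectorStrip, mem_ofPred_eq, mem_ofPred_eq, abs_mul, abs_of_pos h, mul_comm,
    ← lt_div_iff₀ h]
  have : (π - (π - 2 * θ)) / (2 * α + 2) = θ / (α + 1) := by
    rw [show 2 * α + 2 = 2 * (α + 1) by ring]
    field_simp
    ring
  rw [this]

/-- The inverse of `sectorCoord`. -/
def sectorInv (α : ℝ) (ħ : ℂ) (k : ℤ) (q : ℂ) : ℂ :=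
  Complex.log (‖ħ‖ * q) / (α + 1) + sectorAngle α ħ k * Complex.I

theorem ofReal_add_one_ne_zero (hα : 0 < α) : (α + 1 : ℂ) ≠ 0 := by
  rw [← ofReal_one, ← Complex.ofReal_add, ofReal_ne_zero]; positivity

theorem sectorCoord_sectorInv (hα : 0 < α) (hb : ħ ≠ 0) (k : ℤ) {q : ℂ} (hq : q ≠ 0) :
    sectorCoord α ħ k (sectorInv α ħ k q) = q := by
  have hb' : (‖ħ‖ : ℂ) ≠ 0 := ofReal_ne_zero.2 (norm_ne_zero_iff.2 hb)
  rw [sectorCoord, sectorInv, add_sub_cancel_right,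
    mul_div_cancel₀ _ (ofReal_add_one_ne_zero hα), exp_log (mul_ne_zero hb' hq)]
  push_cast
  field_simp

theorem sectorInv_sectorCoord (hα : 0 < α) (hb : ħ ≠ 0) (k : ℤ) {ζ : ℂ}
    (h : |(α + 1) * (ζ.im - sectorAngle α ħ k)| < π) :
    sectorInv α ħ k (sectorCoord α ħ k ζ) = ζ := by
  have hb' : (‖ħ‖ : ℂ) ≠ 0 := ofReal_ne_zero.2 (norm_ne_zero_iff.2 hb)
  obtain ⟨h1, h2⟩ := abs_lt.1 h
  have him : ((α + 1) * (ζ - sectorAngle α ħ k * Complex.I) : ℂ).im =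
      (α + 1) * (ζ.im - sectorAngle α ħ k) := by simp
  have e : (‖ħ‖ : ℂ) * sectorCoord α ħ k ζ =
      exp ((α + 1) * (ζ - sectorAngle α ħ k * Complex.I)) := by
    rw [sectorCoord]; push_cast; field_simp
  rw [sectorInv, e, Complex.log_exp (by rw [him]; exact h1) (by rw [him]; exact h2.le),
    mul_div_cancel_left₀ _ (ofReal_add_one_ne_zero hα), sub_add_cancel]

theorem hasDerivAt_sectorInv (hb : ħ ≠ 0) (k : ℤ) {q : ℂ} (hq : 0 < q.re) :
    HasDerivAt (sectorInv α ħ k) (((α + 1) * q)⁻¹) q := by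
  have hb' := norm_pos_iff.2 hb
  have hb'' : (‖ħ‖ : ℂ) ≠ 0 := ofReal_ne_zero.2 hb'.ne'
  have hsl : (‖ħ‖ : ℂ) * q ∈ Complex.slitPlane := by
    refine Or.inl ?_
    rw [re_ofReal_mul]; positivity
  have := ((((hasDerivAt_id q).const_mul (‖ħ‖ : ℂ)).clog hsl).div_const (α + 1 : ℂ)).add_const
    (sectorAngle α ħ k * Complex.I)
  refine this.congr_deriv ?_
  simp only [id, mul_one]
  rw [div_mul_cancel_left₀ hb'', mul_inv, div_eq_mul_inv, mul_comm]

/-- `sectorInv` maps a truncated sector into a half-strip. -/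
theorem sectorInv_mem (hα : 0 < α) (hb : ħ ≠ 0) (k : ℤ) {θ R : ℝ} (hθ0 : 0 < θ)
    (hθ : θ < π / 2) {q : ℂ} (hre : Real.exp ((α + 1) * R) < ‖ħ‖ * q.re)
    (him : |q.im| < tan θ * q.re) : sectorInv α ħ k q ∈ argStrip α ħ k θ R := by
  have hb' := norm_pos_iff.2 hb
  have hα1 : 0 < α + 1 := by linarith
  have hqre : 0 < q.re := pos_of_mul_pos_right ((exp_pos _).trans hre) hb'.le
  have e : sectorInv α ħ k q = (((α + 1)⁻¹ : ℝ) : ℂ) * Complex.log (‖ħ‖ * q) +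
      sectorAngle α ħ k * Complex.I := by
    rw [sectorInv]; push_cast; ring
  have hn : 0 < ‖(‖ħ‖ : ℂ) * q‖ := by
    rw [norm_mul, norm_real, norm_norm]
    exact mul_pos hb' (norm_pos_iff.2 fun h => by simp [h] at hqre)
  constructor
  · rw [e, add_re, re_ofReal_mul, Complex.log_re, re_ofReal_mul,
      I_re, mul_zero, add_zero, inv_mul_eq_div, lt_div_iff₀ hα1, Real.lt_log_iff_exp_lt hn,
      mul_comm R]
    refine hre.trans_le ?_
    rw [norm_mul, norm_real, norm_norm]
    gcongr
    exact re_le_norm q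
  · rw [e, add_im, im_ofReal_mul, Complex.log_im, im_ofReal_mul,
      I_im, mul_one, add_sub_cancel_right, mul_inv_cancel_left₀ hα1.ne',
      Complex.arg_real_mul _ hb']
    have harg : |q.arg| < π / 2 := Complex.abs_arg_lt_pi_div_two_iff.2 (Or.inl hqre)
    obtain ⟨h1, h2⟩ := abs_lt.1 harg
    have ht := Complex.tan_arg q
    have him' : |q.im / q.re| < tan θ := by
      rwa [abs_div, abs_of_pos hqre, div_lt_iff₀ hqre]
    obtain ⟨h3, h4⟩ := abs_lt.1 him'
    rw [← ht] at h3 h4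
    rw [abs_lt]
    constructor
    · by_contra! hle
      have := Real.strictMonoOn_tan.monotoneOn (a := q.arg) (b := -θ) ⟨h1, h2⟩
        ⟨by linarith, by linarith⟩ hle
      rw [Real.tan_neg] at this
      linarith
    · by_contra! hle
      have := Real.strictMonoOn_tan.monotoneOn (a := θ) (b := q.arg)
        ⟨by linarith, by linarith⟩ ⟨h1, h2⟩ hle
      linarith

end

section

variable {α ν : ℝ} {ħ : ℂ} {p q : BoundaryPoint} {D : Set ℂ} {ρ S : ℂ → ℂ} {γ c c₀ : ℝ → ℂ}
  {I : Set ℝ} {l : Filter ℝ} {a b t₀ ε : ℝ} {τ : ℝ → ℝ}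

/-- The image of a half-strip at `∞_k` under `sectorCoord`. -/
def truncatedSector (α : ℝ) (ħ : ℂ) (θ R : ℝ) : Set ℂ :=
  {q | Real.exp ((α + 1) * R) < ‖ħ‖ * q.re ∧ |q.im| < tan θ * q.re}

theorem convex_truncatedSector (θ R : ℝ) : Convex ℝ (truncatedSector α ħ θ R) := by
  intro x hx y hy s t hs ht hst
  obtain ⟨h1, h2⟩ := hx
  obtain ⟨h3, h4⟩ := hy
  obtain ⟨h5, h6⟩ := abs_lt.1 h2
  obtain ⟨h7, h8⟩ := abs_lt.1 h4
  have key : ∀ {u v : ℝ}, 0 < u → 0 < v → 0 < s * u + t * v := fun {u v} hu hv => by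
    rcases hs.eq_or_lt with rfl | hs'
    · have : t = 1 := by linarith
      rw [this]; linarith
    · have := mul_pos hs' hu
      have := mul_nonneg ht hv.le
      linarith
  have e : t = 1 - s := by linarith
  have er : (s • x + t • y).re = s * x.re + t * y.re := by simp
  have ei : (s • x + t • y).im = s * x.im + t * y.im := by simp
  refine ⟨?_, abs_lt.2 ⟨?_, ?_⟩⟩
  · have := key (sub_pos.2 h1) (sub_pos.2 h3)
    rw [er]
    rw [e] at this ⊢
    linarith
  · have := key (neg_lt_iff_pos_add.1 h5) (neg_lt_iff_pos_add.1 h7)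
    rw [er, ei]
    linarith
  · have := key (sub_pos.2 h6) (sub_pos.2 h8)
    rw [er, ei]
    linarith

/-- Near `∞_k` the action is close to `± q / (α + 1)` with `q = sectorCoord`, so horizontal
trajectories follow the real direction in the `q`-plane. -/
theorem exists_tail_infty (hα : 0 < α) (hν : 0 ≤ ν) (hb : ħ ≠ 0) (k : ℤ)
    (h : IsAction (reducedPotential α ν ħ) D ρ S) (hτ : IsClock I l a b t₀ ε τ) {θ κ R : ℝ}
    (hθ0 : 0 < θ) (hθ : θ < π / 2) (hκ0 : 0 < κ) (hκ1 : κ ≤ 1 / 2)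
    (hκ2 : κ ≤ tan θ / 2)
    (hR : ∀ x ≥ R, 1 + ν * Real.exp (2 * x) ≤ κ / 2 * Real.exp ((2 * α + 2) * x))
    (hTD : argStrip α ħ k θ R ⊆ D) (hγ : MapsTo γ I (argStrip α ħ k θ R))
    (hγ0 : Real.exp ((α + 1) * R) < Real.exp ((α + 1) * (γ t₀).re) * cos θ)
    (hy : κ / 2 * ‖ħ * sectorCoord α ħ k (γ t₀)‖ < (ħ * sectorCoord α ħ k (γ t₀)).re)
    (hsign : 0 ≤ (ħ * (ε * (exp (γ t₀) * ρ (γ t₀)))).re) :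
    ∃ c, IsTail α ν ħ D ρ S γ (.infty k) I l a b t₀ ε τ c := by
  have hb' := norm_pos_iff.2 hb
  have hα1 : 0 < α + 1 := by linarith
  have hM : 0 < tan θ := Real.tan_pos_of_pos_of_lt_pi_div_two hθ0 hθ
  set M := tan θ
  set T := argStrip α ħ k θ R with hTdef
  have hT : Convex ℝ T := by rw [hTdef, argStrip_eq hα]; exact convex_sectorStrip _ _ _
  set Ω := truncatedSector α ħ θ R with hΩdef
  have hΩ : Convex ℝ Ω := convex_truncatedSector _ _
  set Q := sectorCoord α ħ k with hQ
  have hQ0 : ∀ ζ, Q ζ ≠ 0 := sectorCoord_ne_zero hb k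
  have hε2 : (ε : ℂ) ^ 2 = 1 := by rw [sq, ← Complex.ofReal_mul, hτ.sign, ofReal_one]
  have hεn : |ε| = 1 := by rcases mul_self_eq_one_iff.1 hτ.sign with e | e <;> rw [e] <;> simp
  set u : ℂ → ℂ := fun ζ => ε * (exp ζ * ρ ζ) / Q ζ with hu
  have hsq : ∀ ζ ∈ T, u ζ ^ 2 = 1 + symbolError α ν ζ := fun ζ hζ => by
    have e1 : exp ζ * exp (-ζ) = 1 := by rw [← exp_add]; simp
    rw [hu]
    simp only
    rw [div_pow, mul_pow, mul_pow, hε2, h.sq (hTD hζ), reducedPotential_eq_sectorCoord hα k,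
      ← hQ, div_eq_iff (pow_ne_zero 2 (hQ0 ζ))]
    linear_combination (Q ζ ^ 2 * (1 + symbolError α ν ζ)) *
      (exp ζ * exp (-ζ) + 1) * e1
  have hδ : ∀ ζ ∈ T, ‖symbolError α ν ζ‖ ≤ κ / 2 := fun ζ hζ =>
    norm_symbolError_le hν (hR _ (le_of_lt hζ.1))
  have hpos := re_nonneg_of_isPreconnected (u := u) hT.isPreconnected
    (ContinuousOn.div (continuousOn_const.mul (ContinuousOn.mul (by fun_prop)
      (h.continuousOn.mono hTD))) (by rw [hQ]; unfold sectorCoord; fun_prop) fun ζ _ => hQ0 ζ)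
    (fun ζ hζ => by
        rw [hsq ζ hζ, add_sub_cancel_left]; exact (hδ ζ hζ).trans_lt (by linarith))
    (hγ hτ.mem) (by
      refine re_nonneg_of_mul (hsq _ (hγ hτ.mem)) (lt_of_le_of_lt ?_ hy) ?_
      · exact mul_le_mul_of_nonneg_right (hδ _ (hγ hτ.mem)) (norm_nonneg _)
      · convert hsign using 2
        have := hQ0 (γ t₀)
        simp only [hu]
        field_simp)
  have hnear : ∀ ζ ∈ T, ‖u ζ - 1‖ ≤ κ / 2 :=
    fun ζ hζ => (norm_sub_one_le_of_sq (hsq ζ hζ) (hpos ζ hζ)).trans (hδ ζ hζ)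
  have hΩre : ∀ q ∈ Ω, 0 < q.re := fun q hq =>
    pos_of_mul_pos_right ((exp_pos _).trans hq.1) hb'.le
  have hΩT : MapsTo (sectorInv α ħ k) Ω T := fun q hq => sectorInv_mem hα hb k hθ0 hθ hq.1 hq.2
  have hQinv : ∀ q ∈ Ω, Q (sectorInv α ħ k q) = q := fun q hq =>
    sectorCoord_sectorInv hα hb k fun h0 => by simpa [h0] using hΩre q hq
  set q₀ := Q (γ t₀) with hq₀def
  have hγT := hγ hτ.mem
  have hq₀ : q₀ ∈ Ω := by
    obtain ⟨-, h2⟩ := hγT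
    set φ := (α + 1) * ((γ t₀).im - sectorAngle α ħ k) with hφ
    have hcos : cos θ < cos φ := by
      rw [← Real.cos_abs φ]
      exact Real.cos_lt_cos_of_nonneg_of_le_pi (abs_nonneg _) (by linarith [pi_pos]) h2
    have hcθ : 0 < cos θ := Real.cos_pos_of_mem_Ioo ⟨by linarith [pi_pos], hθ⟩
    refine ⟨?_, ?_⟩
    · rw [hq₀def, hQ, sectorCoord_re, mul_inv_cancel_left₀ hb'.ne']
      refine hγ0.trans_le ?_
      gcongr
    · obtain ⟨h3, h4⟩ := abs_lt.1 h2
      have hφm : φ ∈ Ioo (-(π / 2)) (π / 2) := ⟨by linarith, by linarith⟩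
      have ht : |tan φ| < tan θ := by
        rw [abs_lt, ← Real.tan_neg]
        exact ⟨Real.strictMonoOn_tan ⟨by linarith, by linarith⟩ hφm h3,
          Real.strictMonoOn_tan hφm ⟨by linarith, by linarith⟩ h4⟩
      have hcφ : 0 < cos φ := hcθ.trans hcos
      rw [hq₀def, hQ, sectorCoord_re, sectorCoord_im, ← hφ]
      have e : ‖ħ‖⁻¹ * (Real.exp ((α + 1) * (γ t₀).re) * sin φ) =
          (‖ħ‖⁻¹ * (Real.exp ((α + 1) * (γ t₀).re) * cos φ)) * tan φ := by
        rw [Real.tan_eq_sin_div_cos]; field_simp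
      have hp : 0 < ‖ħ‖⁻¹ * (Real.exp ((α + 1) * (γ t₀).re) * cos φ) := by positivity
      rw [e, abs_mul, abs_of_pos hp, mul_comm]
      exact mul_lt_mul_of_pos_right ht hp
  have hd0 : (α + 1 : ℂ) ≠ 0 := ofReal_add_one_ne_zero hα
  have hdn : ‖(α + 1 : ℂ)‖ = α + 1 := by
    rw [← ofReal_one, ← Complex.ofReal_add, norm_real,
      norm_of_nonneg hα1.le]
  have hball : ∀ s : ℝ, 0 ≤ s → ∀ z ∈ closedBall (q₀ + s * (α + 1)) (κ * (s * ‖(α + 1 : ℂ)‖)),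
      q₀.re + s * ((α + 1) / 2) ≤ z.re ∧ z ∈ Ω := fun s hs z hz => by
    rw [mem_closedBall_iff_norm, hdn] at hz
    have hre := (abs_le.1 ((abs_re_le_norm _).trans hz)).1
    have him := abs_le.1 ((abs_im_le_norm _).trans hz)
    have e1 : (z - (q₀ + s * (α + 1))).re = z.re - (q₀.re + s * (α + 1)) := by simp
    have e2 : (z - (q₀ + s * (α + 1))).im = z.im - q₀.im := by simp
    rw [e1] at hre
    rw [e2] at him
    have hsα : 0 ≤ s * (α + 1) := by positivity
    have k1 : κ * (s * (α + 1)) ≤ 1 / 2 * (s * (α + 1)) := by gcongr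
    have k2 : κ * (s * (α + 1)) ≤ M / 2 * (s * (α + 1)) := by gcongr
    have k3 : q₀.re + s * ((α + 1) / 2) ≤ z.re := by linarith
    refine ⟨k3, lt_of_lt_of_le hq₀.1 (mul_le_mul_of_nonneg_left (by linarith) hb'.le), ?_⟩
    · obtain ⟨h1, h2⟩ := abs_lt.1 hq₀.2
      have k4 := mul_le_mul_of_nonneg_left k3 hM.le
      have k5 : M * (q₀.re + s * ((α + 1) / 2)) = M * q₀.re + M / 2 * (s * (α + 1)) := by ring
      rw [k5] at k4
      rw [abs_lt]
      constructor <;> linarith [him.1, him.2]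
  obtain ⟨c, h0, hc, hseg, hS, hq⟩ := h.exists_horizontal hτ hΩ hT hTD
    (Z := sectorInv α ħ k) (Z' := fun q => ((α + 1) * q)⁻¹)
    (fun q hq => hasDerivAt_sectorInv hb k (hΩre q hq)) hΩT hd0 hκ0 (by linarith) (q₀ := q₀)
    (fun q hq => by
      have h1 := hnear _ (hΩT hq)
      have hq0 : q ≠ 0 := fun h0 => by simpa [h0] using hΩre q hq
      simp only [hu, hQinv q hq] at h1
      refine le_trans (le_of_eq ?_) h1
      congr 2
      field_simp) (fun s hs z hz => (hball s hs z hz).2) hγ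
    (sectorInv_sectorCoord hα hb k (hγT.2.trans (by linarith [pi_pos])))
  have hcT : ∀ t ∈ I, c t ∈ T := fun t ht => by
    obtain ⟨q, hq1, hq2⟩ := hq t ht
    rw [hq2]
    exact hΩT (hball _ (hτ.nonneg t ht) q hq1).2
  have hcQ : ∀ t ∈ I, q₀.re + τ t * ((α + 1) / 2) ≤ ‖Q (c t)‖ := fun t ht => by
    obtain ⟨q, hq1, hq2⟩ := hq t ht
    obtain ⟨k1, k2⟩ := hball _ (hτ.nonneg t ht) q hq1
    rw [hq2, hQinv q k2]
    exact k1.trans (re_le_norm q)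
  refine ⟨c, hτ, h0, hc, hseg, hS, ⟨?_, π - 2 * θ, by linarith, ?_⟩, ?_⟩
  · have h1 : Tendsto (fun t => q₀.re + τ t * ((α + 1) / 2)) l atTop :=
      tendsto_atTop_add_const_left _ _ (hτ.tendsto.atTop_mul_const (by positivity))
    have h2 : Tendsto (fun t => ‖Q (c t)‖) l atTop := by
      refine tendsto_atTop_mono' _ ?_ h1
      filter_upwards [hτ.eventually] with t ht using hcQ t ht
    have h3 : Tendsto (fun t => Real.log (‖ħ‖ * ‖Q (c t)‖) / (α + 1)) l atTop :=
      (Real.tendsto_log_atTop.comp (h2.const_mul_atTop hb')).atTop_div_const hα1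
    refine h3.congr fun t => ?_
    rw [hQ, norm_sectorCoord, mul_inv_cancel_left₀ hb'.ne', Real.log_exp,
      mul_div_cancel_left₀ _ hα1.ne']
  · filter_upwards [hτ.eventually] with t ht
    have h1 := hcT t ht
    rw [hTdef, argStrip_eq hα] at h1
    have e : (c t).im - ħ.arg / (α + 1) - k * π / (α + 1) =
      (c t).im - sectorAngle α ħ k := by rw [sectorAngle]; ring
    rw [e]
    exact h1.2.le
  · have hfc := forcingConst_pos hα (s := 1 / 3) (by norm_num)
    set η := min q₀.re ((α + 1) / 2) with hη
    have hη0 : 0 < η := lt_min (hΩre _ hq₀) (by positivity)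
    refine h.integrableOn_of_horizontal hτ hc (fun t ht => hTD (hcT t ht)) hS
      (K := forcingConst α (1 / 3) * 2 * (η⁻¹) ^ 2) (by positivity) fun t ht => ?_
    have hτt := hτ.nonneg t ht
    have hQt : η * (1 + τ t) ≤ ‖Q (c t)‖ := by
      refine le_trans ?_ (hcQ t ht)
      have h1 := min_le_left q₀.re ((α + 1) / 2)
      have h2 := mul_le_mul_of_nonneg_left (min_le_right q₀.re ((α + 1) / 2)) hτt
      rw [← hη] at h1 h2
      linarith
    have hQpos : 0 < ‖Q (c t)‖ := norm_pos_iff.2 (hQ0 _)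
    have hm : ‖Q (c t)‖ / 2 ≤ ‖exp (c t) * ρ (c t)‖ := by
      have h1 := hnear _ (hcT t ht)
      have h2 := norm_sub_norm_le (1 : ℂ) (1 - u (c t))
      rw [sub_sub_cancel, norm_one, norm_sub_rev] at h2
      have h3 : ‖u (c t)‖ = ‖exp (c t) * ρ (c t)‖ / ‖Q (c t)‖ := by
        simp only [hu]
        rw [norm_div, norm_mul (ε : ℂ), norm_real, norm_eq_abs, hεn, one_mul]
      rw [h3] at h2
      have h4 : 1 / 2 ≤ ‖exp (c t) * ρ (c t)‖ / ‖Q (c t)‖ := by linarith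
      rw [le_div_iff₀ hQpos] at h4
      linarith
    refine (norm_forcing_le_infty hα hν hb (h.sq (hTD (hcT t ht)))
      ((hR _ (hcT t ht).1.le).trans (by gcongr; linarith))).trans ?_
    have e : Real.exp (-(α + 1) * (c t).re) = (‖ħ‖ * ‖Q (c t)‖)⁻¹ := by
      rw [hQ, norm_sectorCoord, mul_inv_cancel_left₀ hb'.ne', ← Real.exp_neg, neg_mul]
    rw [e]
    calc ‖ħ‖ * forcingConst α (1 / 3) * (‖ħ‖ * ‖Q (c t)‖)⁻¹
        = forcingConst α (1 / 3) * 2 * (‖Q (c t)‖ / 2) * ((‖Q (c t)‖) ^ 2)⁻¹ := by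
          field_simp
      _ ≤ forcingConst α (1 / 3) * 2 * ‖exp (c t) * ρ (c t)‖ *
          ((η * (1 + τ t)) ^ 2)⁻¹ := by gcongr
      _ = _ := by rw [mul_pow, mul_inv]; ring

/-! ### Assembling horizontal and vertical trajectories -/

theorem IsStaircase.piecewiseSmooth {V : ℂ → ℂ} (h : IsAction V D ρ S)
    (hc : IsStaircase S D γ c (Ioo 0 1)) : PiecewiseSmooth c := by
  obtain ⟨P, hP⟩ := hc.pieces
  refine ⟨P, fun a b ha hab hb hx => ?_⟩
  have hsub : Icc a b ⊆ Ioo 0 1 := fun x hx => ⟨ha.trans_le hx.1, hx.2.trans_lt hb⟩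
  exact h.contDiffOn_of_comp (hc.continuousOn.mono hsub)
    (fun t ht => hc.segment t (hsub ht) (right_mem_segment _ _ _)) (hP a b hab hsub hx).1

theorem IsStaircase.isTrajectoryConcatenation {V : ℂ → ℂ} (h : IsAction V D ρ S)
    (hc : IsStaircase S D γ c (Ioo 0 1)) : IsTrajectoryConcatenation c fun t => ρ (c t) := by
  have hcD : MapsTo c (Ioo 0 1) D := fun t ht => hc.segment t ht (right_mem_segment _ _ _)
  have hps := hc.piecewiseSmooth h
  have hincr : ∀ s ∈ Ioo (0 : ℝ) 1, ∀ t ∈ Ioo (0 : ℝ) 1,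
      actionIncr c (fun t => ρ (c t)) s t = S (c t) - S (c s) := fun s hs t ht => by
    rcases le_total s t with hst | hst
    · exact h.actionIncr_eq hps hcD hs.1 hst ht.2
    · have := h.actionIncr_eq hps hcD ht.1 hst hs.2
      rw [actionIncr] at this ⊢
      rw [intervalIntegral.integral_symm, this, neg_sub]
  obtain ⟨P, hP⟩ := hc.pieces
  refine ⟨P, fun a b ha hab hb hx => ?_⟩
  have hsub : Icc a b ⊆ Ioo 0 1 := fun x hx => ⟨ha.trans_le hx.1, hx.2.trans_lt hb⟩
  refine (hP a b hab hsub hx).2.imp (fun h1 s hs t ht => ?_) fun h1 s hs t ht => ?_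
  · rw [hincr s (hsub hs) t (hsub ht), sub_im, h1 s hs t ht, sub_self]
  · rw [hincr s (hsub hs) t (hsub ht), sub_re, h1 s hs t ht, sub_self]

/-- A curve in `D` along which `Re S` increases, ending at both sides in half-planes or half-strips
from which there are horizontal trajectories to the boundary points, is homotopic to an admissible
concatenation of horizontal and vertical trajectories. -/
theorem IsAction.hasTrajectoryRealization (hα : 0 < α)
    (h : IsAction (reducedPotential α ν ħ) D ρ S) {A B : ℝ} (hA : 0 < A) (hAB : A < B)
    (hB : B < 1) (hh : Homotopic α ν ħ p q c₀ γ) (hγ : ContinuousOn γ (Ioo 0 1))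
    (hγD : MapsTo γ (Ioo 0 1) D) (hp : TendsToBoundary α ħ (𝓝[>] (0 : ℝ)) γ p)
    (hq : TendsToBoundary α ħ (𝓝[<] (1 : ℝ)) γ q)
    (hmono : StrictMonoOn (fun t => (S (γ t)).re) (Ioo 0 1))
    {τ₁ τ₂ : ℝ → ℝ} {c₁ c₂ : ℝ → ℂ}
    (h₁ : IsTail α ν ħ D ρ S γ p (Ioc 0 A) (𝓝[>] 0) 0 A A (-1) τ₁ c₁)
    (h₂ : IsTail α ν ħ D ρ S γ q (Ico B 1) (𝓝[<] 1) B 1 B 1 τ₂ c₂) :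
    HasTrajectoryRealization α ν ħ p q c₀ := by
  have hsub : Icc A B ⊆ Ioo (0 : ℝ) 1 := fun t ht => ⟨hA.trans_le ht.1, ht.2.trans_lt hB⟩
  obtain ⟨c, hc, cA, cB, hlt⟩ := h.exists_staircase hAB (hγ.mono hsub) (hγD.mono_left hsub)
    (hmono.mono hsub)
  obtain ⟨c', hc', e₁, e₂⟩ := h₁.isStaircase.glue hc (right_mem_Ioc.2 hA) (left_mem_Icc.2 hAB.le)
    (fun t ht => ht.2) (fun t ht => ht.1) (h₁.base.trans cA.symm) fun s hs t ht hst heq => by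
      have k1 := h₁.isStaircase.mono hs (right_mem_Ioc.2 hA) hs.2
      have k2 := hlt t ht hst
      simp only [h₁.base, heq] at k1
      linarith
  rw [Ioc_union_Icc_eq_Ioc hA hAB.le] at hc'
  have hBmem : B ∈ Ioc 0 B := right_mem_Ioc.2 (hA.trans hAB)
  have c'B : c' B = γ B := by rw [e₂ (right_mem_Icc.2 hAB.le), cB]
  obtain ⟨C, hC, E₁, E₂⟩ := hc'.glue h₂.isStaircase hBmem (left_mem_Ico.2 hB)
    (fun t ht => ht.2) (fun t ht => ht.1) (c'B.trans h₂.base.symm) fun s hs t ht hst heq => by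
      have k1 := hc'.mono hs hBmem hs.2
      have k2 := h₂.clock.strictMono (left_mem_Ico.2 hB) ht hst
      have k3 := congrArg Complex.re (h₂.action t ht)
      rw [add_re, ofReal_re] at k3
      simp only [c'B, heq, h₂.clock.zero] at k1 k2
      linarith
  rw [Ioc_union_Ico_eq_Ioo (hA.trans hAB) hB] at hC
  have F₁ : EqOn C c₁ (Ioc 0 A) := fun t ht => by
    rw [E₁ ⟨ht.1, ht.2.trans hAB.le⟩, e₁ ht]
  have hCD : MapsTo C (Ioo 0 1) D := fun t ht => hC.segment t ht (right_mem_segment _ _ _)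
  have hps := hC.piecewiseSmooth h
  have start : TendsToBoundary α ħ (𝓝[>] (0 : ℝ)) C p :=
    h₁.tendsTo.congr' (by filter_upwards [Ioc_mem_nhdsGT hA] with t ht using (F₁ ht).symm)
  have finish : TendsToBoundary α ħ (𝓝[<] (1 : ℝ)) C q :=
    h₂.tendsTo.congr' (by filter_upwards [Ico_mem_nhdsLT hB] with t ht using (E₂ ht).symm)
  set φ : (ℝ → ℂ) → ℝ → ℝ := fun c t => ‖forcing (potential α ν ħ)
    (reducedPotential α ν ħ) (c t) (ρ (c t))‖ * ‖velocity c t‖ with hφ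
  have hcongr : ∀ {c : ℝ → ℂ} {a b : ℝ}, EqOn C c (Ioo a b) → IntegrableOn (φ c) (Ioo a b) →
      IntegrableOn (φ C) (Ioo a b) := fun {c a b} he hi =>
    hi.congr_fun (fun t ht => by
      have : velocity c t = velocity C t := Filter.EventuallyEq.deriv_eq (by
        filter_upwards [isOpen_Ioo.mem_nhds ht] with s hs using by rw [he hs])
      simp only [hφ]
      rw [this, he ht]) measurableSet_Ioo
  have hint : IntegrableOn (φ C) (Ioo 0 1) := by
    have i₁ := hcongr (fun t ht => F₁ ⟨ht.1, ht.2.le⟩) h₁.integrable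
    have i₂ := hcongr (fun t ht => E₂ ⟨ht.1.le, ht.2⟩) h₂.integrable
    have i₃ : IntegrableOn (φ C) (Icc A B) := by
      obtain ⟨W, hW⟩ := h.branch
      have hF := (hW.isWKBLift hCD).continuousOn_forcing (U := potential α ν ħ)
        (differentiable_potential α ν ħ).continuous
        (differentiable_coverDeriv_reducedPotential α ν ħ) hC.continuousOn
      have hv := (hps.intervalIntegrable_velocity (hsub (left_mem_Icc.2 hAB.le))
        (hsub (right_mem_Icc.2 hAB.le))).norm
      have := hv.continuousOn_mul (g := fun t => ‖forcing (potential α ν ħ)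
        (reducedPotential α ν ħ) (C t) (ρ (C t))‖)
        (by rw [uIcc_of_le hAB.le]; exact (hF.mono hsub).norm)
      exact (intervalIntegrable_iff_integrableOn_Icc_of_le hAB.le).1 this
    refine ((i₁.union i₃).union i₂).mono_set fun t ht => ?_
    rcases lt_or_ge t A with h1 | h1
    · exact Or.inl (Or.inl ⟨ht.1, h1⟩)
    rcases le_or_gt t B with h2 | h2
    · exact Or.inl (Or.inr ⟨h1, h2⟩)
    · exact Or.inr ⟨h2, ht.2⟩
  have hlev : Tendsto (fun t => (S (C t)).re) (𝓝[<] 1) atTop := by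
    refine (tendsto_atTop_add_const_left _ (S (γ B)).re h₂.clock.tendsto).congr' ?_
    filter_upwards [Ico_mem_nhdsLT hB] with t ht
    rw [E₂ ht, h₂.action t ht, add_re, ofReal_re, one_mul]
  obtain ⟨hadm, hmon⟩ := h.isAdmissible hps hCD
    (fun s hs t ht hst => hC.inj hs ht (by simp only [hst])) start finish hint hC.mono hlev
  refine ⟨C, _, hadm, hh.trans hα (Homotopic.of_segment hα hγ hC.continuousOn (fun t ht a ha => ?_)
    hp start hq finish), hmon, hC.isTrajectoryConcatenation h⟩
  refine h.ne_zero (hC.segment t ht ?_)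
  rw [segment_eq_image']
  exact ⟨a, ha, by simp⟩

end

section

/-! ### Square roots of numbers in a sector -/

/-- A sum of vectors in a sector of opening `φ < π` with one side on the positive real axis. -/
theorem cone_bounds {P Q₁ Q₂ φ φ₁ φ₂ ε : ℝ} (hP : 0 ≤ P) (hQ₁ : 0 ≤ Q₁) (hQ₂ : 0 ≤ Q₂)
    (hφ : φ < π) (h₁ : φ₁ ∈ Icc 0 φ) (h₂ : φ₂ ∈ Icc 0 φ) (hε : ε = 1 ∨ ε = -1) {z : ℂ}
    (hz : z = P + Q₁ * exp ((ε * φ₁ : ℝ) * I) +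
      Q₂ * exp ((ε * φ₂ : ℝ) * I)) :
    (0 ≤ z.re ∨ sin φ * ‖z‖ ≤ |z.im|) ∧ cos (φ / 2) * (P + Q₁ + Q₂) ≤ ‖z‖ := by
  have hφ0 : 0 ≤ φ := h₁.1.trans h₁.2
  have hre : z.re = P + Q₁ * cos φ₁ + Q₂ * cos φ₂ := by
    rw [hz]
    simp only [add_re, ofReal_re, re_ofReal_mul, Complex.exp_ofReal_mul_I_re]
    rcases hε with rfl | rfl <;> simp
  have him : z.im = ε * (Q₁ * sin φ₁ + Q₂ * sin φ₂) := by
    rw [hz]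
    simp only [add_im, ofReal_im, im_ofReal_mul, Complex.exp_ofReal_mul_I_im]
    rcases hε with rfl | rfl
    · simp
    · simp; ring
  have hε1 : |ε| = 1 := by rcases hε with rfl | rfl <;> simp
  have hε2 : ε * ε = 1 := by rcases hε with rfl | rfl <;> norm_num
  set y := Q₁ * sin φ₁ + Q₂ * sin φ₂ with hy
  have hs₁ : 0 ≤ sin φ₁ := Real.sin_nonneg_of_nonneg_of_le_pi h₁.1 (h₁.2.trans hφ.le)
  have hs₂ : 0 ≤ sin φ₂ := Real.sin_nonneg_of_nonneg_of_le_pi h₂.1 (h₂.2.trans hφ.le)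
  have hy0 : 0 ≤ y := by positivity
  have hsφ : 0 ≤ sin φ := Real.sin_nonneg_of_nonneg_of_le_pi hφ0 hφ.le
  constructor
  · rw [or_iff_not_imp_left, not_le]
    intro hneg
    rw [him, abs_mul, hε1, one_mul, abs_of_nonneg hy0]
    -- the argument of `z` is at most `φ`
    have hside : 0 ≤ sin φ * z.re - cos φ * y := by
      have e : sin φ * z.re - cos φ * y = P * sin φ +
          Q₁ * sin (φ - φ₁) + Q₂ * sin (φ - φ₂) := by
        rw [hre, hy, Real.sin_sub, Real.sin_sub]; ring
      rw [e]
      have k₁ : 0 ≤ sin (φ - φ₁) :=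
        Real.sin_nonneg_of_nonneg_of_le_pi (by linarith [h₁.2]) (by linarith [h₁.1])
      have k₂ : 0 ≤ sin (φ - φ₂) :=
        Real.sin_nonneg_of_nonneg_of_le_pi (by linarith [h₂.2]) (by linarith [h₂.1])
      positivity
    have hn : ‖z‖ ^ 2 = z.re ^ 2 + y ^ 2 := by
      rw [sq_norm, normSq_apply, him]
      linear_combination (y ^ 2) * hε2
    have h1 : -(sin φ * z.re) ≤ -cos φ * y := by linarith
    have h0 : 0 ≤ -(sin φ * z.re) := by nlinarith
    have h2 : (sin φ * z.re) ^ 2 ≤ (cos φ * y) ^ 2 := by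
      have := pow_le_pow_left₀ h0 h1 2
      nlinarith
    refine le_of_sq_le_sq ?_ hy0
    rw [mul_pow, hn]
    nlinarith [Real.sin_sq_add_cos_sq φ]
  · have e : P * cos (φ / 2) + Q₁ * cos (φ₁ - φ / 2) + Q₂ * cos (φ₂ - φ / 2) =
        z.re * cos (φ / 2) + y * sin (φ / 2) := by
      rw [hre, hy, Real.cos_sub, Real.cos_sub]; ring
    have hc : ∀ {ψ}, ψ ∈ Icc 0 φ → cos (φ / 2) ≤ cos (ψ - φ / 2) := fun {ψ} hψ => by
      rw [← Real.cos_abs (ψ - φ / 2)]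
      refine Real.cos_le_cos_of_nonneg_of_le_pi (abs_nonneg _) (by linarith) ?_
      rw [abs_le]
      constructor <;> linarith [hψ.1, hψ.2]
    have h1 := mul_le_mul_of_nonneg_left (hc h₁) hQ₁
    have h2 := mul_le_mul_of_nonneg_left (hc h₂) hQ₂
    have hn : ‖z‖ ^ 2 = z.re ^ 2 + y ^ 2 := by
      rw [sq_norm, normSq_apply, him]
      linear_combination (y ^ 2) * hε2
    have h3 : z.re * cos (φ / 2) + y * sin (φ / 2) ≤ ‖z‖ := by
      refine le_of_sq_le_sq ?_ (norm_nonneg _)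
      rw [hn]
      nlinarith [Real.sin_sq_add_cos_sq (φ / 2),
        sq_nonneg (z.re * sin (φ / 2) - y * cos (φ / 2))]
    linarith

/-- A square root of a number away from the negative axis is away from the imaginary axis. -/
theorem abs_re_ge_of_sq {u z : ℂ} {μ : ℝ} (hμ0 : 0 ≤ μ) (hμ1 : μ ≤ 1) (hu : u ^ 2 = z)
    (h : 0 ≤ z.re ∨ μ * ‖z‖ ≤ |z.im|) : μ / 2 * ‖u‖ ≤ |u.re| := by
  have hn : ‖u‖ ^ 2 = u.re ^ 2 + u.im ^ 2 := by
    rw [sq_norm, normSq_apply]; ring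
  rcases h with h | h
  · rw [← hu, pow_two, mul_re] at h
    refine le_of_sq_le_sq ?_ (abs_nonneg _)
    rw [sq_abs, mul_pow, hn]
    have : (μ / 2) ^ 2 ≤ 1 / 4 := by nlinarith
    nlinarith [sq_nonneg u.re, sq_nonneg u.im]
  · rw [← hu, norm_pow, pow_two u, mul_im] at h
    have h1 : |u.re * u.im + u.im * u.re| = 2 * (|u.re| * |u.im|) := by
      rw [mul_comm u.im u.re, ← two_mul, abs_mul, abs_of_pos two_pos, abs_mul]
    rw [h1] at h
    have h2 := abs_im_le_norm u
    rcases (norm_nonneg u).eq_or_lt with h0 | h0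
    · rw [← h0, mul_zero]; exact abs_nonneg _
    · have h3 : |u.re| * |u.im| ≤ |u.re| * ‖u‖ := by gcongr
      have h4 : μ / 2 * ‖u‖ * ‖u‖ ≤ |u.re| * ‖u‖ := by nlinarith
      exact le_of_mul_le_mul_right h4 h0

theorem re_div_ge {u ħ : ℂ} {μ : ℝ} (hμ0 : 0 ≤ μ) (hb : ħ ≠ 0) (hu : μ / 2 * ‖u‖ ≤ u.re)
    (h1 : 3 / 4 * ‖ħ‖ ≤ ħ.re) (h2 : |ħ.im| ≤ μ / 8 * ‖ħ‖) :
    μ / 4 * (‖u‖ / ‖ħ‖) ≤ (u / ħ).re := by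
  have hb' := norm_pos_iff.2 hb
  rw [Complex.div_re, Complex.normSq_eq_norm_sq, ← add_div, mul_div_assoc', div_le_div_iff₀ hb'
    (by positivity)]
  have h3 : -(‖u‖ * (μ / 8 * ‖ħ‖)) ≤ u.im * ħ.im := by
    have : |u.im * ħ.im| ≤ ‖u‖ * (μ / 8 * ‖ħ‖) := by
      rw [abs_mul]; gcongr; exact abs_im_le_norm u
    exact (abs_le.1 this).1
  have h4 : μ / 2 * ‖u‖ * (3 / 4 * ‖ħ‖) ≤ u.re * ħ.re :=
    mul_le_mul hu h1 (by positivity) ((by positivity : 0 ≤ μ / 2 * ‖u‖).trans hu)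
  nlinarith

theorem arg_bounds {ħ : ℂ} {η : ℝ} (hη : η ≤ 1 / 2) (h : |ħ.arg| ≤ η) :
    3 / 4 * ‖ħ‖ ≤ ħ.re ∧ |ħ.im| ≤ η * ‖ħ‖ := by
  have h0 := norm_nonneg ħ
  rw [← Complex.norm_mul_cos_arg ħ, ← Complex.norm_mul_sin_arg ħ, abs_mul,
    abs_of_nonneg h0, mul_comm, mul_comm η]
  have h1 := Real.one_sub_sq_div_two_le_cos (x := ħ.arg)
  have h2 := Real.abs_sin_le_abs (x := ħ.arg)
  have h3 : ħ.arg ^ 2 ≤ (1 / 2) ^ 2 := by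
    rw [← sq_abs]; gcongr; exact h.trans hη
  constructor
  · gcongr; linarith
  · gcongr; exact h2.trans h

theorem re_pos_of_isPreconnected {X : Type*} [TopologicalSpace X] {T : Set X} {u : X → ℂ}
    (hT : IsPreconnected T) (hu : ContinuousOn u T) (h1 : ∀ x ∈ T, (u x).re ≠ 0) {x₀ : X}
    (hx₀ : x₀ ∈ T) (h0 : 0 < (u x₀).re) : ∀ x ∈ T, 0 < (u x).re := by
  intro x hx
  by_contra! hle
  obtain ⟨ξ, hξ, hξ0⟩ := hT.intermediate_value hx hx₀
    (continuous_re.comp_continuousOn hu) ⟨hle, h0.le⟩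
  exact h1 ξ hξ hξ0

/-! ### Curves consisting of horizontal and vertical lines in the logarithmic plane -/

variable {α ν : ℝ} {ħ : ℂ} {p q : BoundaryPoint} {D : Set ℂ} {ρ S : ℂ → ℂ} {γ c₀ : ℝ → ℂ}
  {J : Set ℝ}

/-- `Re S` grows along a curve of direction `e` on which `ħ e y √V` lies in a sector of the right
half-plane. -/
theorem IsAction.strictMonoOn_of_direction (h : IsAction (reducedPotential α ν ħ) D ρ S)
    (hJ : Convex ℝ J) (hγ : ContinuousOn γ J) (hD : MapsTo γ J D) {f f' : ℝ → ℝ} {e : ℂ} {m₀ : ℝ}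
    (hm₀ : 0 < m₀) (hf : ContinuousOn f J) (hfd : ∀ t ∈ interior J, HasDerivAt f (f' t) t)
    (hd : ∀ t ∈ interior J, HasDerivAt γ (f' t * e) t) (hf' : ∀ t ∈ interior J, 0 < f' t)
    (hm : ∀ t ∈ J, m₀ ≤ (e * (exp (γ t) * ρ (γ t))).re) :
    MonotoneOn (fun t => (S (γ t)).re - m₀ * f t) J ∧ StrictMonoOn (fun t => (S (γ t)).re) J := by
  have hSc : ContinuousOn (fun t => (S (γ t)).re) J := fun t ht =>
    continuous_re.continuousAt.comp_continuousWithinAt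
      ((h.deriv_S _ (hD ht)).continuousAt.comp_continuousWithinAt (hγ t ht))
  have hder : ∀ t ∈ interior J, HasDerivAt (fun t => (S (γ t)).re)
      (f' t * (e * (exp (γ t) * ρ (γ t))).re) t := fun t ht =>
    (h.deriv_re (hD (interior_subset ht)) (hd t ht)).congr_deriv (by
      rw [← re_ofReal_mul]; congr 1; ring)
  have hmono : MonotoneOn (fun t => (S (γ t)).re - m₀ * f t) J := by
    refine monotoneOn_of_hasDerivWithinAt_nonneg hJ (hSc.sub (continuousOn_const.mul hf))
      (fun t ht => ((hder t ht).sub ((hfd t ht).const_mul m₀)).hasDerivWithinAt) fun t ht => ?_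
    have := mul_le_mul_of_nonneg_left (hm t (interior_subset ht)) (hf' t ht).le
    linarith
  refine ⟨hmono, ?_⟩
  refine strictMonoOn_of_hasDerivWithinAt_pos hJ hSc
    (fun t ht => (hder t ht).hasDerivWithinAt) fun t ht => ?_
  exact mul_pos (hf' t ht) (hm₀.trans_le (hm t (interior_subset ht)))

/-- The integral of the forcing term over a horizontal line on which the terms of `symbol` do not
cancel. The bound is uniform since `N ≤ N' / 2` for `N = symbolSize`. -/
theorem integral_forcing_horizontal_le (hα : 0 < α) (hν : 0 ≤ ν) (hb : ħ ≠ 0) {a b : ℝ}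
    (hab : a < b) {r : ℝ → ℂ} {f f' : ℝ → ℝ} {ε v s : ℝ} (hε : ε = 1 ∨ ε = -1)
    (hmeas : AEStronglyMeasurable (forcingDensity α ν ħ γ r) (volume.restrict (Ioo a b)))
    (hr : ∀ t ∈ Ioo a b, r t ^ 2 = reducedPotential α ν ħ (γ t))
    (hγ : ∀ t ∈ Ioo a b, γ t = (ε * f t : ℝ) + (v : ℂ) * I)
    (hfd : ∀ t ∈ Ioo a b, HasDerivAt f (f' t) t) (hf' : ∀ t ∈ Ioo a b, 0 < f' t) (hs : 0 < s)
    (hg : ∀ t ∈ Ioo a b, s * (1 + symbolSize α ν (γ t).re) ≤ ‖symbol α ν (γ t)‖) :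
    IntegrableOn (fun t => ‖forcing (potential α ν ħ) (reducedPotential α ν ħ) (γ t) (r t)‖ *
      ‖velocity γ t‖) (Ioo a b) ∧
    ∫ t in Ioo a b, ‖forcing (potential α ν ħ) (reducedPotential α ν ħ) (γ t) (r t)‖ *
      ‖velocity γ t‖ ≤ ‖ħ‖ * forcingConst α s := by
  have hfc := forcingConst_pos hα hs
  set N : ℝ → ℝ := symbolSize α ν with hN
  have hN0 : ∀ x, 0 ≤ N x := symbolSize_nonneg hν
  have hNd : ∀ x, HasDerivAt N ((2 * α + 2) * Real.exp ((2 * α + 2) * x) +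
      2 * (ν * Real.exp (2 * x))) x := fun x => by
    have := (((hasDerivAt_id x).const_mul (2 * α + 2)).exp).add
      ((((hasDerivAt_id x).const_mul 2).exp).const_mul ν)
    exact this.congr_deriv (by simp; ring)
  have hN2 : ∀ x, 2 * N x ≤ (2 * α + 2) * Real.exp ((2 * α + 2) * x) +
      2 * (ν * Real.exp (2 * x)) := fun x => by
    simp only [hN, symbolSize]
    nlinarith [exp_pos ((2 * α + 2) * x)]
  have hre : ∀ t ∈ Ioo a b, (γ t).re = ε * f t := fun t ht => by rw [hγ t ht]; simp
  set k : ℝ → ℝ := fun x => (sqrt (1 + N x))⁻¹ with hk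
  have hkd : ∀ x, HasDerivAt k (-(((2 * α + 2) * Real.exp ((2 * α + 2) * x) +
      2 * (ν * Real.exp (2 * x))) / (2 * sqrt (1 + N x))) / sqrt (1 + N x) ^ 2) x :=
    fun x => (((hNd x).const_add 1).sqrt (by linarith [hN0 x])).inv
      (Real.sqrt_ne_zero'.2 (by linarith [hN0 x]))
  have hk01 : ∀ x, k x ∈ Icc (0 : ℝ) 1 := fun x =>
    ⟨inv_nonneg.2 (Real.sqrt_nonneg _), inv_le_one_of_one_le₀ (Real.one_le_sqrt.2
      (by linarith [hN0 x]))⟩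
  -- the primitive `-(1 + N)^(-1/2)` dominates, since `2 N ≤ N'`
  set G : ℝ → ℝ := fun t => (1 + ε) / 2 - ε * k (ε * f t) with hG
  have hε2 : ε * ε = 1 := by rcases hε with rfl | rfl <;> norm_num
  have hGd : ∀ t ∈ Ioo a b, ∃ G', HasDerivAt G G' t ∧ N (ε * f t) /
      ((1 + N (ε * f t)) * sqrt (1 + N (ε * f t))) * f' t ≤ G' := fun t ht => by
    have h1 := ((hkd (ε * f t)).comp t ((hfd t ht).const_mul ε)).const_mul ε
    refine ⟨_, h1.const_sub _, ?_⟩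
    set x := ε * f t
    have hx := hN0 x
    have hsq : sqrt (1 + N x) ^ 2 = 1 + N x := Real.sq_sqrt (by linarith)
    have hsp : 0 < sqrt (1 + N x) := Real.sqrt_pos.2 (by linarith)
    rw [hsq]
    set N' := (2 * α + 2) * Real.exp ((2 * α + 2) * x) + 2 * (ν * Real.exp (2 * x))
    have e : -(ε * (-(N' / (2 * sqrt (1 + N x))) / (1 + N x) * (ε * f' t))) =
        (ε * ε) * (N' / 2 / ((1 + N x) * sqrt (1 + N x)) * f' t) := by
      field_simp
    rw [e, hε2, one_mul]
    have := hf' t ht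
    gcongr
    linarith [hN2 x]
  have hGm : MonotoneOn G (Ioo a b) := by
    refine monotoneOn_of_deriv_nonneg (convex_Ioo a b) (fun t ht => ?_) (fun t ht => ?_)
      fun t ht => ?_
    · obtain ⟨G', h1, -⟩ := hGd t ht
      exact h1.continuousAt.continuousWithinAt
    · rw [interior_Ioo] at ht
      obtain ⟨G', h1, -⟩ := hGd t ht
      exact h1.differentiableAt.differentiableWithinAt
    · rw [interior_Ioo] at ht
      obtain ⟨G', h1, h2⟩ := hGd t ht
      rw [h1.deriv]
      refine le_trans ?_ h2
      have := hf' t ht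
      have := hN0 (ε * f t)
      positivity
  refine integrableOn_of_le_deriv (G := G) (E := ∅) hab countable_empty
    (by simpa only [forcingDensity, norm_mul] using hmeas.norm)
    (fun t _ => mul_nonneg (norm_nonneg _) (norm_nonneg _))
    hGm (fun t _ => ?_) (fun t _ => ?_) (by positivity) fun t ht => ?_
  · obtain ⟨h0, h1⟩ := hk01 (ε * f t)
    rcases hε with rfl | rfl <;> simp only [hG] <;> linarith
  · obtain ⟨h0, h1⟩ := hk01 (ε * f t)
    rcases hε with rfl | rfl <;> simp only [hG] <;> linarith
  · have ht := ht.1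
    obtain ⟨G', h1, h2⟩ := hGd t ht
    have hd : HasDerivAt γ ((ε * f' t : ℝ) : ℂ) t := by
      refine (((((hfd t ht).const_mul ε).ofReal_comp).add_const ((v : ℂ) * I))
        ).congr_of_eventuallyEq ?_
      filter_upwards [isOpen_Ioo.mem_nhds ht] with x hx using hγ x hx
    have hεn : ‖((ε * f' t : ℝ) : ℂ)‖ = f' t := by
      rw [norm_real, norm_eq_abs, abs_mul, abs_of_pos (hf' t ht)]
      rcases hε with rfl | rfl <;> simp
    have hF := norm_forcing_le hα hν hb (hr t ht) hs (hg t ht)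
    show ‖_‖ * ‖velocity γ t‖ ≤ _
    rw [h1.deriv, velocity_eq hd, norm_mul (exp _), ← mul_assoc, ← norm_mul, hεn]
    refine (mul_le_mul_of_nonneg_right hF (hf' t ht).le).trans ?_
    rw [hre t ht, mul_assoc]
    gcongr

end

section

variable {α ν : ℝ} {ħ : ℂ} {p q : BoundaryPoint} {D : Set ℂ} {ρ S : ℂ → ℂ} {γ c₀ : ℝ → ℂ}

/-- A curve `γ` along which `Re S` increases yields both the trajectory realization and the bound
for the end-point value of its homotopy class. -/
theorem IsAction.realization_and_value (hα : 0 < α) (hν : 0 ≤ ν) (hb : ħ ≠ 0)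
    (hre : ‖ħ‖ ≤ 2 * ħ.re) (h : IsAction (reducedPotential α ν ħ) D ρ S) {A B : ℝ}
    (hA : 0 < A) (hAB : A < B) (hB : B < 1) (hp0 : p ≠ .zero)
    (hh : Homotopic α ν ħ p q c₀ γ) (hγ : PiecewiseSmooth γ)
    (hγD : MapsTo γ (Ioo 0 1) D) (hp : TendsToBoundary α ħ (𝓝[>] (0 : ℝ)) γ p)
    (hq : TendsToBoundary α ħ (𝓝[<] (1 : ℝ)) γ q)
    (hmono : StrictMonoOn (fun t => (S (γ t)).re) (Ioo 0 1))
    (hlev : Tendsto (fun t => (S (γ t)).re) (𝓝[<] 1) atTop)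
    (hint : IntegrableOn (fun t => ‖forcing (potential α ν ħ) (reducedPotential α ν ħ) (γ t)
      (ρ (γ t))‖ * ‖velocity γ t‖) (Ioo 0 1)) {m : ℝ}
    (hm : ∫ t in Ioo 0 1, ‖forcing (potential α ν ħ) (reducedPotential α ν ħ) (γ t)
      (ρ (γ t))‖ * ‖velocity γ t‖ ≤ m)
    (hsign : q = .zero → ∃ᶠ t in 𝓝[<] (1 : ℝ), (exp (γ t) * ρ (γ t)).re ≤ 0)
    {τ₁ τ₂ : ℝ → ℝ} {c₁ c₂ : ℝ → ℂ}
    (h₁ : IsTail α ν ħ D ρ S γ p (Ioc 0 A) (𝓝[>] 0) 0 A A (-1) τ₁ c₁)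
    (h₂ : IsTail α ν ħ D ρ S γ q (Ico B 1) (𝓝[<] 1) B 1 B 1 τ₂ c₂) :
    HasTrajectoryRealization α ν ħ p q c₀ ∧
      ∃ z, IsEndpointValue α ν ħ p q c₀ z ∧ ‖z - 1‖ ≤ m * Real.exp (4 * m) := by
  refine ⟨h.hasTrajectoryRealization hα hA hAB hB hh hγ.continuousOn hγD hp hq hmono h₁ h₂, ?_⟩
  obtain ⟨hadm, hmon⟩ := h.isAdmissible hγ hγD (fun s hs t ht hst =>
    hmono.injOn hs ht (by simp only [hst])) hp hq hint hmono.monotoneOn hlev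
  obtain ⟨z, hz, hzm⟩ := hadm.exists_isEndpointValue hα
    (fun p l f hf => exists_isBoundaryChart hα hν hb hre p l f hf) hp0 hsign hh
  refine ⟨z, hz, (hzm 0 m hmon hm).trans_eq ?_⟩
  rw [mul_zero, Real.exp_zero]
  ring_nf

/-! ### The symbol on lines -/

theorem symbol_polar (α ν x v : ℝ) :
    symbol α ν (x + v * I) =
      (Real.exp ((2 * α + 2) * x) : ℝ) * exp (((2 * α + 2) * v : ℝ) * I) -
        (ν * Real.exp (2 * x) : ℝ) * exp ((2 * v : ℝ) * I) + 1 := by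
  have e1 : (2 * α + 2) * ((x : ℂ) + v * I) =
      (((2 * α + 2) * x : ℝ) : ℂ) + (((2 * α + 2) * v : ℝ) : ℂ) * I := by
    push_cast; ring
  have e2 : 2 * ((x : ℂ) + v * I) = ((2 * x : ℝ) : ℂ) + ((2 * v : ℝ) : ℂ) * I := by
    push_cast; ring
  rw [symbol, e1, e2, exp_add, exp_add, ← Complex.ofReal_exp, ← Complex.ofReal_exp]
  push_cast
  ring

theorem symbol_re (α ν x v : ℝ) : (symbol α ν (x + v * I)).re =
    Real.exp ((2 * α + 2) * x) * cos ((2 * α + 2) * v) -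
      ν * Real.exp (2 * x) * cos (2 * v) + 1 := by
  rw [symbol_polar, add_re, sub_re, re_ofReal_mul, re_ofReal_mul,
    Complex.exp_ofReal_mul_I_re, Complex.exp_ofReal_mul_I_re, Complex.one_re]

theorem symbol_im (α ν x v : ℝ) : (symbol α ν (x + v * I)).im =
    Real.exp ((2 * α + 2) * x) * sin ((2 * α + 2) * v) -
      ν * Real.exp (2 * x) * sin (2 * v) := by
  rw [symbol_polar, add_im, sub_im, im_ofReal_mul, im_ofReal_mul,
    Complex.exp_ofReal_mul_I_im, Complex.exp_ofReal_mul_I_im, Complex.one_im, add_zero]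

/-- On a line where the three terms of the symbol lie in a sector of opening less than `π` they do
not cancel, and the symbol stays away from the negative axis. -/
theorem symbol_cone (hν : 0 ≤ ν) {v ε φ φ₁ φ₂ : ℝ} (hφ : φ < π) (hε : ε = 1 ∨ ε = -1)
    (h₁ : φ₁ ∈ Icc 0 φ) (h₂ : φ₂ ∈ Icc 0 φ) (n m : ℤ)
    (e₁ : (2 * α + 2) * v = ε * φ₁ + n * (2 * π))
    (e₂ : 2 * v + π = ε * φ₂ + m * (2 * π)) (x : ℝ) :
    (0 ≤ (symbol α ν (x + v * I)).re ∨
      sin φ * ‖symbol α ν (x + v * I)‖ ≤ |(symbol α ν (x + v * I)).im|) ∧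
    cos (φ / 2) * (1 + symbolSize α ν x) ≤ ‖symbol α ν (x + v * I)‖ := by
  have k₁ : exp (((2 * α + 2) * v : ℝ) * I) =
      exp ((ε * φ₁ : ℝ) * I) := by
    rw [e₁]
    refine Complex.exp_eq_exp_iff_exists_int.2 ⟨n, ?_⟩
    push_cast; ring
  have k₂ : -exp ((2 * v : ℝ) * I) = exp ((ε * φ₂ : ℝ) * I) := by
    have : 2 * v = ε * φ₂ + m * (2 * π) - π := by linarith
    rw [this]
    have h3 : ((ε * φ₂ : ℝ) : ℂ) * I = ((ε * φ₂ + m * (2 * π) - π : ℝ) : ℂ) *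
        I + π * I + (-m : ℤ) * (2 * π * I) := by
      push_cast; ring
    rw [h3, exp_add, exp_add, Complex.exp_int_mul_two_pi_mul_I,
      Complex.exp_pi_mul_I]
    ring
  have := cone_bounds (P := 1) (Q₁ := Real.exp ((2 * α + 2) * x)) (Q₂ := ν * Real.exp (2 * x))
    zero_le_one (exp_pos _).le (by positivity) hφ h₁ h₂ hε
    (z := symbol α ν (x + v * I)) (by
      rw [symbol_polar, ← k₁, ← k₂]; push_cast; ring)
  rwa [add_assoc, ← symbolSize] at this

theorem norm_symbol_sub_le (hα : 0 < α) (hν : 0 ≤ ν) (x v w : ℝ) :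
    ‖symbol α ν (x + v * I) - symbol α ν (x + w * I)‖ ≤
      (2 * α + 2) * |v - w| * symbolSize α ν x := by
  have key : ∀ c : ℝ, 0 ≤ c → ‖exp ((c * v : ℝ) * I) -
      exp ((c * w : ℝ) * I)‖ ≤ c * |v - w| := fun c hc => by
    have e : exp ((c * v : ℝ) * I) - exp ((c * w : ℝ) * I) =
        exp ((c * w : ℝ) * I) *
          (exp (I * ((c * (v - w) : ℝ) : ℂ)) - 1) := by
      rw [mul_sub, ← exp_add, mul_one]
      congr 2
      push_cast; ring
    rw [e, norm_mul, Complex.norm_exp_ofReal_mul_I, one_mul]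
    refine (Real.norm_exp_I_mul_ofReal_sub_one_le).trans_eq ?_
    rw [norm_eq_abs, abs_mul, abs_of_nonneg hc]
  rw [symbol_polar, symbol_polar, add_sub_add_right_eq_sub, sub_sub_sub_comm, ← mul_sub, ← mul_sub,
    symbolSize]
  refine (norm_sub_le _ _).trans ?_
  rw [norm_mul, norm_mul, norm_real, norm_real,
    norm_of_nonneg (exp_pos _).le, norm_of_nonneg (by positivity)]
  have h1 := key (2 * α + 2) (by positivity)
  have h2 := key 2 zero_le_two
  have h3 : 2 * |v - w| ≤ (2 * α + 2) * |v - w| := by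
    gcongr; linarith
  have h4 := mul_le_mul_of_nonneg_left h1 (exp_pos ((2 * α + 2) * x)).le
  have h5 := mul_le_mul_of_nonneg_left (h2.trans h3) (by positivity : 0 ≤ ν * Real.exp (2 * x))
  linarith

theorem sectorCoord_line (hα : 0 < α) (hb : ħ ≠ 0) (k : ℤ) (x v : ℝ) :
    ħ * sectorCoord α ħ k (x + v * I) =
      (Real.exp ((α + 1) * x) : ℝ) * exp (((α + 1) * v - k * π : ℝ) * I) := by
  have hb' : (‖ħ‖ : ℂ) ≠ 0 := ofReal_ne_zero.2 (norm_ne_zero_iff.2 hb)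
  have h1 := Complex.norm_mul_exp_arg_mul_I ħ
  have e : ((α + 1) * ((x : ℂ) + v * I - sectorAngle α ħ k * I)) =
      (((α + 1) * x : ℝ) : ℂ) + (((α + 1) * v - k * π : ℝ) : ℂ) * I +
        -(ħ.arg * I) := by
    have := ofReal_add_one_ne_zero hα
    rw [sectorAngle]; push_cast; field_simp; ring
  rw [sectorCoord, e, exp_add, exp_add, exp_neg, ← Complex.ofReal_exp]
  conv_lhs => enter [1]; rw [← h1]
  have := exp_ne_zero (ħ.arg * I)
  push_cast
  field_simp

theorem line_re (x v : ℝ) : ((x : ℂ) + (v : ℂ) * I).re = x := by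
  rw [add_re, ofReal_re, re_ofReal_mul, I_re, mul_zero, add_zero]

theorem line_im (x v : ℝ) : ((x : ℂ) + (v : ℂ) * I).im = v := by
  rw [add_im, ofReal_im, im_ofReal_mul, I_im, mul_one, zero_add]

/-- Bounds for `y √V` in the direction `e` along a line on which `e² g` stays away from the negative
axis. -/
theorem IsAction.direction_bound (h : IsAction (reducedPotential α ν ħ) D ρ S) (hb : ħ ≠ 0)
    {μ s : ℝ} (hμ : 0 < μ) (hμ1 : μ ≤ 1) (hs : 0 < s) (hs1 : s ≤ 1)
    (hre : 3 / 4 * ‖ħ‖ ≤ ħ.re) (him : |ħ.im| ≤ μ / 8 * ‖ħ‖) {T : Set ℝ}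
    (hT : IsPreconnected T) {ζ : ℝ → ℂ} (hζ : ContinuousOn ζ T) (hD : MapsTo ζ T D) {e : ℂ}
    (hcone : ∀ x ∈ T, 0 ≤ (e ^ 2 * symbol α ν (ζ x)).re ∨
      μ * ‖e ^ 2 * symbol α ν (ζ x)‖ ≤ |(e ^ 2 * symbol α ν (ζ x)).im|)
    (hg : ∀ x ∈ T, s ≤ ‖e ^ 2 * symbol α ν (ζ x)‖) {x₀ : ℝ} (hx₀ : x₀ ∈ T)
    (h0 : 0 ≤ (ħ * (e * (exp (ζ x₀) * ρ (ζ x₀)))).re) :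
    ∀ x ∈ T, 0 < (ħ * (e * (exp (ζ x) * ρ (ζ x)))).re ∧
      μ / 4 * (s / ‖ħ‖) ≤ (e * (exp (ζ x) * ρ (ζ x))).re := by
  set u : ℝ → ℂ := fun x => ħ * (e * (exp (ζ x) * ρ (ζ x))) with hu
  have husq : ∀ x ∈ T, u x ^ 2 = e ^ 2 * symbol α ν (ζ x) := fun x hx => by
    rw [← sq_mul_eq_symbol hb (h.sq (hD hx)), hu]; ring
  have hun : ∀ x ∈ T, s ≤ ‖u x‖ := fun x hx => by
    have h1 := hg x hx
    rw [← husq x hx, norm_pow] at h1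
    nlinarith [norm_nonneg (u x)]
  have hure : ∀ x ∈ T, μ / 2 * ‖u x‖ ≤ |(u x).re| := fun x hx =>
    abs_re_ge_of_sq hμ.le hμ1 (husq x hx) (hcone x hx)
  have hune : ∀ x ∈ T, (u x).re ≠ 0 := fun x hx h0 => by
    have h1 := hure x hx
    rw [h0, abs_zero] at h1
    have : 0 < μ / 2 * ‖u x‖ := mul_pos (by positivity) (hs.trans_le (hun x hx))
    linarith
  intro x hx
  have hpos : 0 < (u x).re := re_pos_of_isPreconnected hT
    (continuousOn_const.mul (continuousOn_const.mul (hζ.cexp.mul (h.continuousOn.comp hζ hD))))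
    hune hx₀ (lt_of_le_of_ne h0 (hune x₀ hx₀).symm) x hx
  refine ⟨hpos, ?_⟩
  have h1 := hure x hx
  rw [abs_of_pos hpos] at h1
  have h2 := re_div_ge hμ.le hb h1 hre him
  rw [hu, mul_div_cancel_left₀ _ hb] at h2
  refine le_trans ?_ h2
  gcongr
  exact hun x hx

theorem exists_sq_eq_re_nonneg {w : ℂ} (hw : w ≠ 0) (c : ℂ) :
    ∃ r, r ^ 2 = w ∧ 0 ≤ (c * r).re := by
  rcases le_total 0 (c * csqrt w).re with h | h
  · exact ⟨_, csqrt_sq hw, h⟩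
  · refine ⟨-csqrt w, by rw [neg_sq, csqrt_sq hw], ?_⟩
    rw [mul_neg, neg_re]; linarith

/-- Far out on a line `arg y = v` in the Stokes sector at `∞_k` there are horizontal trajectories to
`∞_k`. -/
theorem IsAction.exists_tail_line (hα : 0 < α) (hν : 0 ≤ ν) (hb : ħ ≠ 0) (k : ℤ)
    (h : IsAction (reducedPotential α ν ħ) D ρ S) {v θ X : ℝ} (hθ : θ < π / 2)
    (hv : |(α + 1) * v - k * π| + |ħ.arg| < θ) (hD : argStrip α ħ k θ X ⊆ D) :
    ∃ X', ∀ {I : Set ℝ} {l : Filter ℝ} {a b t₀ ε : ℝ} {τ : ℝ → ℝ}, IsClock I l a b t₀ ε τ →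
      ∀ x : ℝ → ℝ, (∀ t ∈ I, γ t = x t + v * Complex.I) → (∀ t ∈ I, X' < x t) →
        0 ≤ (ħ * (ε * (exp (γ t₀) * ρ (γ t₀)))).re →
        ∃ c, IsTail α ν ħ D ρ S γ (.infty k) I l a b t₀ ε τ c := by
  have hα1 : 0 < α + 1 := by linarith
  have hθ0 : 0 < θ := lt_of_le_of_lt (by positivity) hv
  have htan : 0 < tan θ := Real.tan_pos_of_pos_of_lt_pi_div_two hθ0 hθ
  have hcos : 0 < cos θ := Real.cos_pos_of_mem_Ioo ⟨by linarith [pi_pos], hθ⟩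
  have hlog : Real.log (cos θ) / (α + 1) ≤ 0 :=
    div_nonpos_of_nonpos_of_nonneg (Real.log_nonpos hcos.le (cos_le_one θ)) hα1.le
  set κ := min (min (1 / 2) (tan θ / 2)) (cos θ) with hκ
  have hκ0 : 0 < κ := lt_min (lt_min (by norm_num) (by positivity)) hcos
  obtain ⟨R, hR0, hR⟩ := exists_le_exp hα ν (half_pos hκ0)
  have hX : ∀ ζ ∈ argStrip α ħ k θ (max X R), ζ ∈ D := fun ζ hζ =>
    hD ⟨(le_max_left _ _).trans_lt hζ.1, hζ.2⟩
  refine ⟨max X R - Real.log (cos θ) / (α + 1), fun {I l a b t₀ ε τ} hτ x hγ hx hsign => ?_⟩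
  set ψ := (α + 1) * v - k * π with hψ
  have hψθ : |ψ| < θ := by linarith [abs_nonneg ħ.arg]
  have hcψ : cos θ < cos ψ := by
    rw [← Real.cos_abs ψ]
    exact Real.cos_lt_cos_of_nonneg_of_le_pi (abs_nonneg _) (by linarith [pi_pos]) hψθ
  refine exists_tail_infty hα hν hb k h hτ (R := max X R) hθ0 hθ hκ0
    ((min_le_left _ _).trans (min_le_left _ _)) ((min_le_left _ _).trans (min_le_right _ _))
    (fun y hy => hR y ((le_max_right _ _).trans hy)) hX (fun t ht => ?_) ?_ ?_ hsign
  · rw [hγ t ht]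
    refine ⟨?_, ?_⟩
    · rw [line_re]; linarith [hx t ht]
    · have e : (α + 1) * (v - sectorAngle α ħ k) = ψ - ħ.arg := by
        rw [sectorAngle, hψ]; field_simp; ring
      rw [line_im, e]
      exact (abs_sub _ _).trans_lt hv
  · rw [hγ t₀ hτ.mem, line_re]
    conv_rhs => rw [← Real.exp_log hcos]
    rw [← Real.exp_add, Real.exp_lt_exp]
    have h3 := mul_lt_mul_of_pos_left (hx t₀ hτ.mem) hα1
    rw [mul_sub, mul_div_cancel₀ _ hα1.ne'] at h3
    linarith
  · rw [hγ t₀ hτ.mem, sectorCoord_line hα hb, ← hψ, norm_mul, Complex.norm_exp_ofReal_mul_I,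
      norm_real, norm_of_nonneg (exp_pos _).le, re_ofReal_mul,
      Complex.exp_ofReal_mul_I_re, mul_one, mul_comm]
    have : κ ≤ cos θ := min_le_right _ _
    exact mul_lt_mul_of_pos_left (by linarith) (exp_pos _)

end

section

/-! ### The classes of curves from `∞_{±1}` to `0` -/

variable {α ν : ℝ} {ħ : ℂ} {D : Set ℂ} {ρ S : ℂ → ℂ}

theorem exists_Ioc_of_tendsto {f : ℝ → ℝ} (hf : Tendsto f (𝓝[>] 0) atTop) (X : ℝ) :
    ∃ A > 0, A < 1 / 2 ∧ ∀ t ∈ Ioc 0 A, X < f t := by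
  obtain ⟨u, hu, hu'⟩ := mem_nhdsGT_iff_exists_Ioc_subset.1 (hf.eventually_gt_atTop X)
  have hu0 : 0 < u := hu
  refine ⟨min u (1 / 3), by positivity, (min_le_right _ _).trans_lt (by norm_num), fun t ht =>
    hu' ⟨ht.1, ht.2.trans (min_le_left _ _)⟩⟩

theorem exists_Ico_of_tendsto {f : ℝ → ℝ} (hf : Tendsto f (𝓝[<] 1) atTop) (X : ℝ) :
    ∃ B > 1 / 2, B < 1 ∧ ∀ t ∈ Ico B 1, X < f t := by
  obtain ⟨u, hu, hu'⟩ := mem_nhdsLT_iff_exists_Ico_subset.1 (hf.eventually_gt_atTop X)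
  have hu0 : u < 1 := hu
  refine ⟨max u (2 / 3), lt_of_lt_of_le (by norm_num) (le_max_right _ _),
    max_lt hu0 (by norm_num), fun t ht => hu' ⟨(le_max_left _ _).trans ht.1, ht.2⟩⟩

theorem tendsto_one_sub_inv : Tendsto (fun t : ℝ => (1 - t)⁻¹) (𝓝[<] 1) atTop := by
  have := (isClock_finish (B := 0) zero_lt_one).tendsto
  simpa using tendsto_atTop_add_const_right _ 1 this

theorem tendsto_rayCurve_zero :
    Tendsto (fun t : ℝ => 1 / t - 1 / (1 - t)) (𝓝[>] 0) atTop := by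
  have h : Tendsto (fun t : ℝ => -(1 / (1 - t))) (𝓝[>] 0) (𝓝 (-(1 / (1 - 0)))) :=
    (ContinuousAt.neg (ContinuousAt.div (by fun_prop) (by fun_prop) (by norm_num))).tendsto.mono_left
      nhdsWithin_le_nhds
  simpa [sub_eq_add_neg] using tendsto_inv_nhdsGT_zero.atTop_add h

theorem tendsto_rayCurve_one :
    Tendsto (fun t : ℝ => 1 / (1 - t) - 1 / t) (𝓝[<] 1) atTop := by
  have h : Tendsto (fun t : ℝ => -(1 / t)) (𝓝[<] 1) (𝓝 (-(1 / 1))) :=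
    (ContinuousAt.neg (ContinuousAt.div (by fun_prop) (by fun_prop) (by norm_num))).tendsto.mono_left
      nhdsWithin_le_nhds
  simpa [sub_eq_add_neg] using tendsto_one_sub_inv.atTop_add h

theorem tendsTo_infty_of_im (hα : 0 < α) {β : Type} {l : Filter β} {f : β → ℂ} {k : ℤ} {v b : ℝ}
    (hf : Tendsto (fun x => (f x).re) l atTop) (him : ∀ᶠ x in l, |(α + 1) * ((f x).im - v)| ≤ b)
    (hv : |(α + 1) * v - k * π| + b + |ħ.arg| < π / 2) :
    TendsToBoundary α ħ l f (.infty k) := by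
  have hα1 : 0 < α + 1 := by linarith
  refine ⟨hf, π - 2 * (|(α + 1) * v - k * π| + b + |ħ.arg|), by linarith, ?_⟩
  filter_upwards [him] with x hx
  have e : (f x).im - ħ.arg / (α + 1) - k * π / (α + 1) =
      (((α + 1) * v - k * π) + (α + 1) * ((f x).im - v) - ħ.arg) / (α + 1) := by
    field_simp; ring
  have e2 : (π - (π - 2 * (|(α + 1) * v - k * π| + b + |ħ.arg|))) /
      (2 * α + 2) = (|(α + 1) * v - k * π| + b + |ħ.arg|) / (α + 1) := by
    rw [show 2 * α + 2 = 2 * (α + 1) by ring]; field_simp; ring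
  rw [e, e2, abs_div, abs_of_pos hα1]
  gcongr
  refine (abs_sub _ _).trans ?_
  have := abs_add_le ((α + 1) * v - k * π) ((α + 1) * ((f x).im - v))
  linarith

theorem piecewiseSmooth_rayCurve (k : ℤ) : PiecewiseSmooth (rayCurve α k) := by
  refine ⟨∅, fun a b ha _ hb _ => ?_⟩
  have h0 : ∀ x ∈ Icc a b, x ≠ 0 := fun x hx => (ha.trans_le hx.1).ne'
  have h1 : ∀ x ∈ Icc a b, 1 - x ≠ 0 := fun x hx => (sub_pos.2 (hx.2.trans_lt hb)).ne'
  unfold rayCurve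
  refine ContDiffOn.add (ofRealCLM.contDiff.comp_contDiffOn ?_) contDiffOn_const
  exact (contDiffOn_const.div contDiffOn_id h0).sub
    (contDiffOn_const.div (contDiffOn_const.sub contDiffOn_id) h1)

/-- The opening of a sector which contains the terms of the symbol on the ray
`arg y = ± π / (α + 1)`. -/
def rayOpening (α : ℝ) : ℝ := max |2 * (π / (α + 1)) - π| (π / 2)

theorem rayOpening_lt (hα : 0 < α) : rayOpening α < π := by
  have hπ := pi_pos
  have h1 : 0 < π / (α + 1) := by positivity
  have h2 : π / (α + 1) < π := div_lt_self hπ (by linarith)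
  refine max_lt (abs_lt.2 ⟨by linarith, by linarith⟩) (by linarith)

theorem symbol_cone_ray (hα : 0 < α) (hν : 0 ≤ ν) {k : ℤ} (hk : k = 1 ∨ k = -1) (x : ℝ) :
    (0 ≤ (symbol α ν (x + (k * π / (α + 1) : ℝ) * I)).re ∨ sin (rayOpening α) *
      ‖symbol α ν (x + (k * π / (α + 1) : ℝ) * I)‖ ≤
        |(symbol α ν (x + (k * π / (α + 1) : ℝ) * I)).im|) ∧
    cos (rayOpening α / 2) * (1 + symbolSize α ν x) ≤
      ‖symbol α ν (x + (k * π / (α + 1) : ℝ) * I)‖ := by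
  have hα1 : α + 1 ≠ 0 := by positivity
  set ψ := 2 * (π / (α + 1)) - π with hψ
  have hle : |ψ| ≤ rayOpening α := le_max_left _ _
  have h0 : (0 : ℝ) ∈ Icc 0 (rayOpening α) := ⟨le_rfl, (abs_nonneg _).trans hle⟩
  have h2 : |ψ| ∈ Icc 0 (rayOpening α) := ⟨abs_nonneg _, hle⟩
  have e1 : ∀ k : ℝ, (2 * α + 2) * (k * π / (α + 1)) = k * (2 * π) := fun k => by
    field_simp
  have hkr : (k : ℝ) = 1 ∨ (k : ℝ) = -1 := by rcases hk with rfl | rfl <;> simp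
  obtain ⟨ε, hε, hεψ⟩ : ∃ ε : ℝ, (ε = 1 ∨ ε = -1) ∧ ε * |ψ| = k * ψ := by
    rcases abs_cases ψ with ⟨h, -⟩ | ⟨h, -⟩
    · exact ⟨k, hkr, by rw [h]⟩
    · exact ⟨-k, by rcases hkr with h | h <;> rw [h] <;> simp, by rw [h]; ring⟩
  rcases hk with rfl | rfl
  · refine symbol_cone hν (rayOpening_lt hα) hε h0 h2 1 1 ?_ ?_ x
    · rw [e1]; simp
    · rw [hεψ, hψ]; push_cast; ring
  · refine symbol_cone hν (rayOpening_lt hα) hε h0 h2 (-1) 0 ?_ ?_ x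
    · rw [e1]; simp
    · rw [hεψ, hψ]; push_cast; ring

/-- A domain containing the ray `arg y = k π / (α + 1)` and a neighbourhood of `0`. -/
def rayDomain (α : ℝ) (k : ℤ) (η R : ℝ) : Set ℂ :=
  {ζ | ζ.re < -R} ∪ {ζ | |ζ.im - k * π / (α + 1)| < η}

theorem isOpen_rayDomain (k : ℤ) (η R : ℝ) : IsOpen (rayDomain α k η R) :=
  (isOpen_lt continuous_re continuous_const).union
    (isOpen_lt (by fun_prop) continuous_const)

theorem starConvex_rayDomain (k : ℤ) {η R : ℝ} (hη : 0 < η) {x : ℝ} (hx : x < -R) :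
    StarConvex ℝ ((x : ℂ) + (k * π / (α + 1) : ℝ) * I) (rayDomain α k η R) := by
  have h2 : Convex ℝ {ζ : ℂ | |ζ.im - k * π / (α + 1)| < η} := by
    have : {ζ : ℂ | |ζ.im - k * π / (α + 1)| < η} =
        {ζ | k * π / (α + 1) - η < ζ.im} ∩ {ζ | ζ.im < k * π / (α + 1) + η} := by
      ext ζ
      simp only [mem_ofPred_eq, mem_inter_iff, abs_lt]
      constructor
      · rintro ⟨h1, h2⟩; exact ⟨by linarith, by linarith⟩
      · rintro ⟨h1, h2⟩; exact ⟨by linarith, by linarith⟩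
    rw [this]
    exact (convex_halfSpace_im_gt _).inter (convex_halfSpace_im_lt _)
  refine StarConvex.union ((convex_halfSpace_re_lt _).starConvex ?_) (h2.starConvex ?_)
  · rw [mem_ofPred_eq, line_re]; exact hx
  · rw [mem_ofPred_eq, line_im, sub_self, abs_zero]; exact hη

/-- The half-width of the strip around the ray `arg y = ± π / (α + 1)` in which the potential has no
zeros. -/
def rayWidth (α : ℝ) : ℝ := cos (rayOpening α / 2) / (2 * (2 * α + 2))

theorem cos_rayOpening_pos (hα : 0 < α) : 0 < cos (rayOpening α / 2) := by
  have h2 := rayOpening_lt hα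
  have h1 : π / 2 ≤ rayOpening α := le_max_right _ _
  exact Real.cos_pos_of_mem_Ioo ⟨by linarith [pi_pos], by linarith⟩

theorem sin_rayOpening_pos (hα : 0 < α) : 0 < sin (rayOpening α) := by
  have h1 : π / 2 ≤ rayOpening α := le_max_right _ _
  exact Real.sin_pos_of_pos_of_lt_pi (by linarith [pi_pos]) (rayOpening_lt hα)

theorem rayWidth_pos (hα : 0 < α) : 0 < rayWidth α :=
  div_pos (cos_rayOpening_pos hα) (by positivity)

/-- On the ray `|g| ≥ s (1 + N)`; within `rayWidth` of it `g` changes by at most `s N / 2`. -/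
theorem symbol_ne_zero_of_mem_rayDomain (hα : 0 < α) (hν : 0 ≤ ν) {k : ℤ} (hk : k = 1 ∨ k = -1)
    {R : ℝ} (hR : ∀ x ≤ -R, symbolSize α ν x ≤ 1 / 8) {ζ : ℂ}
    (hζ : ζ ∈ rayDomain α k (rayWidth α) R) : symbol α ν ζ ≠ 0 := by
  rcases hζ with h | h
  · have h1 := (norm_symbol_sub_one_le (α := α) hν ζ).trans (hR _ (le_of_lt h))
    intro h0
    rw [h0, zero_sub, norm_neg, norm_one] at h1
    norm_num at h1
  · have h1 := (symbol_cone_ray hα hν hk ζ.re).2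
    have h2 := norm_symbol_sub_le hα hν ζ.re ζ.im (k * π / (α + 1))
    rw [Complex.re_add_im] at h2
    intro h0
    rw [h0, zero_sub, norm_neg] at h2
    have hN := symbolSize_nonneg (α := α) hν ζ.re
    have hs := cos_rayOpening_pos hα
    have h' : |ζ.im - k * π / (α + 1)| < rayWidth α := h
    have h3 : (2 * α + 2) * |ζ.im - k * π / (α + 1)| ≤ cos (rayOpening α / 2) / 2 := by
      have := mul_le_mul_of_nonneg_left h'.le (by positivity : 0 ≤ 2 * α + 2)
      refine this.trans_eq ?_
      rw [rayWidth]; field_simp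
    have h4 := mul_le_mul_of_nonneg_right h3 hN
    have h5 := mul_nonneg hs.le hN
    nlinarith

theorem realization_and_value_ray (hα : 0 < α) (hν : 0 ≤ ν) (hb : ħ ≠ 0) {k : ℤ}
    (hk : k = 1 ∨ k = -1)
    (harg : |ħ.arg| ≤ min (sin (rayOpening α) / 8) ((α + 1) * rayWidth α / 4)) :
    HasTrajectoryRealization α ν ħ (.infty k) .zero (rayCurve α k) ∧
      ∃ z, IsEndpointValue α ν ħ (.infty k) .zero (rayCurve α k) z ∧
        ‖z - 1‖ ≤ ‖ħ‖ * forcingConst α (cos (rayOpening α / 2)) *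
          Real.exp (4 * (‖ħ‖ * forcingConst α (cos (rayOpening α / 2)))) := by
  have hα1 : 0 < α + 1 := by linarith
  have hb' := norm_pos_iff.2 hb
  have hπ := Real.pi_gt_three
  have hη := rayWidth_pos hα
  have hs := cos_rayOpening_pos hα
  have hs1 := cos_le_one (rayOpening α / 2)
  have hμ := sin_rayOpening_pos hα
  have hμ1 := Real.sin_le_one (rayOpening α)
  set η := rayWidth α with hηdef
  set s := cos (rayOpening α / 2) with hsdef
  set μ := sin (rayOpening α) with hμdef
  have hηs : (α + 1) * η = s / 4 := by rw [hηdef, rayWidth]; field_simp; ring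
  have harg1 := harg.trans (min_le_left _ _)
  have harg2 := harg.trans (min_le_right _ _)
  obtain ⟨hre, him⟩ := arg_bounds (by linarith) harg1
  obtain ⟨R, hR0, hR⟩ := exists_symbolSize_zero_le hα ν (show (0 : ℝ) < 1 / 8 by norm_num)
  set θ := k * π / (α + 1) with hθ
  have hθα : (α + 1) * θ = k * π := by rw [hθ]; field_simp
  set z₀ : ℂ := ((-R - 1 : ℝ) : ℂ) + (θ : ℝ) * I with hz₀
  set D := rayDomain α k η R with hD
  have hgD : ∀ ζ ∈ D, symbol α ν ζ ≠ 0 := fun ζ hζ =>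
    symbol_ne_zero_of_mem_rayDomain hα hν hk hR hζ
  have hline : ∀ x : ℝ, (x : ℂ) + (θ : ℝ) * I ∈ D := fun x => Or.inr (by
    rw [mem_ofPred_eq, line_im, ← hθ, sub_self, abs_zero]; exact hη)
  obtain ⟨ρ₀, hρ₀, hpos₀⟩ := exists_sq_eq_re_nonneg
    ((reducedPotential_ne_zero_iff hb z₀).2 (hgD z₀ (hline _))) (ħ * (-1 * exp z₀))
  obtain ⟨ρ, S, hS, hρz⟩ := exists_isAction (differentiable_reducedPotential α ν ħ)
    (differentiable_coverDeriv_reducedPotential α ν ħ) (isOpen_rayDomain k η R)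
    (hline (-R - 1)) (starConvex_rayDomain k hη (by linarith))
    (fun ζ hζ => (reducedPotential_ne_zero_iff hb ζ).2 (hgD ζ hζ)) hρ₀
  have hcone := symbol_cone_ray hα hν hk
  rw [← hθ, ← hsdef, ← hμdef] at hcone
  have hbound := hS.direction_bound hb hμ hμ1 hs hs1 hre him isPreconnected_univ
    (ζ := fun x => x + (θ : ℝ) * I) (by fun_prop) (fun x _ => hline x) (e := -1)
    (fun x _ => by rw [neg_one_sq, one_mul]; exact (hcone x).1)
    (fun x _ => by
      rw [neg_one_sq, one_mul]
      refine le_trans ?_ (hcone x).2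
      exact le_mul_of_one_le_right hs.le (by linarith [symbolSize_nonneg (α := α) hν x]))
    (mem_univ (-R - 1)) (by
      rw [hρz]
      convert hpos₀ using 2
      rw [hz₀]; ring)
  have hm : ∀ x : ℝ, μ / 4 * (s / ‖ħ‖) ≤
      ((-1 : ℂ) * (exp (x + (θ : ℝ) * I) * ρ (x + (θ : ℝ) * I))).re :=
    fun x => (hbound x (mem_univ x)).2
  have hm₀ : 0 < μ / 4 * (s / ‖ħ‖) := by positivity
  -- the ray, parametrized so that `Re S` increases
  set f : ℝ → ℝ := fun t => 1 / (1 - t) - 1 / t with hf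
  have hγ : ∀ t, rayCurve α k t = ((-1 * f t : ℝ) : ℂ) + (θ : ℝ) * I := fun t => by
    rw [rayCurve, hf]; congr 2; ring
  have hγ' : ∀ t, rayCurve α k t = ((1 / t - 1 / (1 - t) : ℝ) : ℂ) + (θ : ℝ) * I :=
    fun t => rfl
  have hfd : ∀ t ∈ Ioo (0 : ℝ) 1, HasDerivAt f (1 / (1 - t) ^ 2 + 1 / t ^ 2) t := fun t ht => by
    have h0 : t ≠ 0 := ht.1.ne'
    have h1 : 1 - t ≠ 0 := (sub_pos.2 ht.2).ne'
    have := (((hasDerivAt_id t).const_sub 1).inv h1).sub ((hasDerivAt_id t).inv h0)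
    simp only [hf, one_div]
    exact this.congr_deriv (by simp only [id]; field_simp; ring)
  have hf' : ∀ t ∈ Ioo (0 : ℝ) 1, 0 < 1 / (1 - t) ^ 2 + 1 / t ^ 2 := fun t ht => by
    have h0 := ht.1
    have h1 := sub_pos.2 ht.2
    positivity
  have hγD : MapsTo (rayCurve α k) (Ioo 0 1) D := fun t _ => by rw [hγ]; exact hline _
  have hps := piecewiseSmooth_rayCurve (α := α) k
  obtain ⟨hmono', hmono⟩ := hS.strictMonoOn_of_direction (convex_Ioo 0 1) hps.continuousOn hγD
    (f := f) (f' := fun t => 1 / (1 - t) ^ 2 + 1 / t ^ 2) (e := -1) hm₀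
    (fun t ht => (hfd t ht).continuousAt.continuousWithinAt) (by rw [interior_Ioo]; exact hfd)
    (by
      rw [interior_Ioo]
      intro t ht
      have := (((hfd t ht).const_mul (-1)).ofReal_comp).add_const ((θ : ℂ) * I)
      refine (this.congr_of_eventuallyEq (Eventually.of_forall hγ)).congr_deriv ?_
      push_cast; ring)
    (by rw [interior_Ioo]; exact hf') (fun t _ => by rw [hγ]; exact hm _)
  have hlev : Tendsto (fun t => (S (rayCurve α k t)).re) (𝓝[<] 1) atTop := by
    have h1 := tendsto_atTop_add_const_left (𝓝[<] (1 : ℝ))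
      ((S (rayCurve α k (1 / 2))).re - μ / 4 * (s / ‖ħ‖) * f (1 / 2))
      (tendsto_rayCurve_one.const_mul_atTop hm₀)
    refine tendsto_atTop_mono' _ ?_ h1
    filter_upwards [Ioo_mem_nhdsLT (show (1 / 2 : ℝ) < 1 by norm_num)] with t ht
    have := hmono' (a := 1 / 2) (b := t) ⟨by norm_num, by norm_num⟩
      ⟨by linarith [ht.1], ht.2⟩ ht.1.le
    simp only at this
    linarith
  have hargb : |ħ.arg| < 1 / 2 := lt_of_le_of_lt harg1 (by linarith)
  have hp : TendsToBoundary α ħ (𝓝[>] (0 : ℝ)) (rayCurve α k) (.infty k) := by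
    refine tendsTo_infty_of_im hα (v := θ) (b := 0) ?_ (Eventually.of_forall fun t => ?_) ?_
    · refine tendsto_rayCurve_zero.congr fun t => ?_
      rw [hγ', line_re]
    · rw [hγ', line_im]; simp
    · rw [hθα, sub_self, abs_zero]; linarith
  have hq : TendsToBoundary α ħ (𝓝[<] (1 : ℝ)) (rayCurve α k) .zero := by
    refine (tendsto_neg_atTop_atBot.comp tendsto_rayCurve_one).congr fun t => ?_
    rw [hγ, line_re, neg_one_mul]; rfl
  obtain ⟨W, hW⟩ := hS.branch
  have hmeas := hps.aestronglyMeasurable_forcingDensity (hW.isWKBLift hγD)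
  obtain ⟨hint, hintm⟩ := integral_forcing_horizontal_le hα hν hb zero_lt_one (ε := -1) (v := θ)
    (γ := rayCurve α k) (r := fun t => ρ (rayCurve α k t)) (Or.inr rfl) hmeas
    (fun t ht => hS.sq (hγD ht)) (fun t _ => hγ t) hfd hf' hs
    (fun t _ => by
      rw [hγ, line_re]
      exact (hcone (-1 * f t)).2)
  -- the horizontal trajectory at `∞_k`
  set a := (α + 1) * η / 2 with ha
  have ha0 : 0 < a := by positivity
  have haπ : a < π / 2 := by rw [ha, hηs]; linarith
  have hv : (α + 1) * (θ - sectorAngle α ħ k) = -ħ.arg := by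
    rw [mul_sub, hθα, sectorAngle]; field_simp; ring
  obtain ⟨X, hX⟩ := hS.exists_tail_line hα hν hb k (γ := rayCurve α k) (v := θ) (θ := a) (X := 0)
    haπ (by rw [hθα, sub_self, abs_zero]; linarith [mul_pos hα1 hη]) (fun ζ hζ => Or.inr (by
      have h1 : |(α + 1) * (ζ.im - sectorAngle α ħ k)| < a := hζ.2
      have e : ζ.im - k * π / (α + 1) =
          ((α + 1) * (ζ.im - sectorAngle α ħ k) + ħ.arg) / (α + 1) := by
        rw [← hθ, eq_div_iff hα1.ne']
        linarith
      show |ζ.im - k * π / (α + 1)| < η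
      rw [e, abs_div, abs_of_pos hα1, div_lt_iff₀ hα1]
      refine (abs_add_le _ _).trans_lt ?_
      linarith [mul_pos hα1 hη]))
  obtain ⟨A, hA0, hA1, hA⟩ := exists_Ioc_of_tendsto tendsto_rayCurve_zero X
  obtain ⟨c₁, hc₁⟩ := hX (isClock_start hA0) _ (fun t _ => hγ' t) hA (by
    have := (hbound (1 / A - 1 / (1 - A)) (mem_univ _)).1.le
    rw [hγ']
    push_cast at this ⊢
    exact this)
  -- the horizontal trajectory at `0`
  obtain ⟨B, hB0, hB1, hB⟩ := exists_Ico_of_tendsto tendsto_rayCurve_one R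
  obtain ⟨c₂, hc₂⟩ := exists_tail_zero hα hν hb (by linarith) hS (γ := rayCurve α k)
    (isClock_finish hB1) hR0.le hR subset_union_left (fun t ht => by
      have := hB t ht
      show (rayCurve α k t).re < -R
      rw [hγ', line_re]; linarith)
    (by
      have := (hbound (1 / B - 1 / (1 - B)) (mem_univ _)).1.le
      rw [hγ']
      rw [neg_one_mul] at this
      push_cast at this ⊢
      simpa only [neg_mul, mul_neg, one_mul] using this)
  exact hS.realization_and_value hα hν hb (by linarith) hA0 (by linarith) hB1 (by simp)
    (Homotopic.refl hps.continuousOn (fun t ht => hS.ne_zero (hγD ht)) hp hq) hps hγD hp hq hmono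
    hlev hint hintm (fun _ => (Eventually.of_forall fun t => by
      have := hm (-1 * f t)
      rw [← hγ, neg_one_mul, neg_re] at this
      linarith).frequently) hc₁ hc₂

end

section

/-! ### Zeros of the symbol in the sector `|arg y| < π / (α + 1)` -/

variable {α ν : ℝ} {ħ : ℂ}

theorem nuStar_pos (hα : 0 < α) : 0 < nuStar α := by unfold nuStar; positivity

theorem log_nuStar (hα : 0 < α) :
    Real.log (nuStar α) = Real.log (α + 1) - α / (α + 1) * Real.log α := by
  rw [nuStar, Real.log_div (by positivity) (by positivity), Real.log_rpow hα]

/-- `sin (n w) ≤ n sin w` as long as `n w ≤ 2 π`, by the concavity of `sin` on `[0, π]`. -/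
theorem sin_mul_lt {n w : ℝ} (hn : 1 < n) (hw : 0 < w) (hw1 : w < π)
    (hw2 : n * w ≤ 2 * π) : sin (n * w) < n * sin w := by
  have hs := Real.sin_pos_of_pos_of_lt_pi hw hw1
  have hn0 : 0 < n := by linarith
  rcases lt_or_ge π (n * w) with h | h
  · have h1 : sin (n * w) ≤ 0 := by
      rw [← Real.sin_sub_two_pi]
      exact Real.sin_nonpos_of_nonpos_of_neg_pi_le (by linarith) (by linarith)
    exact h1.trans_lt (by positivity)
  · have hc := strictConcaveOn_sin_Icc.2
      (show (0 : ℝ) ∈ Icc 0 π from ⟨le_rfl, pi_pos.le⟩)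
      (show n * w ∈ Icc 0 π from ⟨by positivity, h⟩) (by positivity)
      (sub_pos.2 (inv_lt_one_of_one_lt₀ hn)) (inv_pos.2 hn0) (by ring)
    simp only [smul_eq_mul, Real.sin_zero, mul_zero, zero_add, inv_mul_cancel_left₀ hn0.ne'] at hc
    rwa [← div_eq_inv_mul, div_lt_iff₀' hn0] at hc

/-- A zero at `y = e^(x + i v)` would make the three terms of the symbol a triangle with angles
determined by `v`; the law of sines then computes `ν`, and the concavity of `sin` shows that this
value is smaller than `ν_*`. -/
theorem symbol_ne_zero_of_pos (hα : 0 < α) (hν : nuStar α ≤ ν) (x : ℝ) {v : ℝ} (hv : 0 < v)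
    (hv1 : v < π / (α + 1)) : symbol α ν (x + v * I) ≠ 0 := by
  intro h0
  have hα1 : 0 < α + 1 := by linarith
  have hν0 : 0 < ν := (nuStar_pos hα).trans_le hν
  have hπ := pi_pos
  have hre := symbol_re α ν x v
  have him := symbol_im α ν x v
  rw [h0] at hre him
  rw [Complex.zero_re] at hre
  rw [Complex.zero_im] at him
  set φ := (2 * α + 2) * v with hφ
  have hφ0 : 0 < φ := by positivity
  have hφ2 : φ < 2 * π := by
    rw [lt_div_iff₀ hα1] at hv1; rw [hφ]; linarith
  have hr0 : 0 < 2 * α * v := by positivity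
  have hrφ : φ - 2 * v = 2 * α * v := by rw [hφ]; ring
  have e1 : Real.exp ((2 * α + 2) * x) * sin (2 * α * v) = sin (2 * v) := by
    rw [← hrφ, Real.sin_sub]
    linear_combination sin (2 * v) * hre - cos (2 * v) * him
  have e2 : ν * Real.exp (2 * x) * sin (2 * α * v) = sin φ := by
    rw [← hrφ, Real.sin_sub]
    linear_combination sin φ * hre - cos φ * him
  have hA := exp_pos ((2 * α + 2) * x)
  have hB : 0 < ν * Real.exp (2 * x) := by positivity
  -- all the angles are smaller than `π`
  have hneg : ∀ {w : ℝ}, π ≤ w → w < 2 * π → sin w ≤ 0 := fun h1 h2 => by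
    rw [← Real.sin_sub_two_pi]
    exact Real.sin_nonpos_of_nonpos_of_neg_pi_le (by linarith) (by linarith)
  have hr1 : 2 * α * v < π := by
    by_contra! h
    have h1 := hneg h (by linarith)
    have h2 := Real.sin_pos_of_pos_of_lt_pi (x := 2 * v) (by linarith) (by linarith)
    rw [← e1] at h2
    exact absurd (pos_of_mul_pos_right h2 hA.le) (by linarith)
  have hsr := Real.sin_pos_of_pos_of_lt_pi hr0 hr1
  have hsp : 0 < sin (2 * v) := e1 ▸ mul_pos hA hsr
  have hsφ : 0 < sin φ := e2 ▸ mul_pos hB hsr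
  have hφ1 : φ < π := by
    by_contra! h
    linarith [hneg h hφ2]
  have c1 : sin φ < (α + 1) * sin (2 * v) := by
    have e : φ = (α + 1) * (2 * v) := by rw [hφ]; ring
    rw [e] at hφ2 ⊢
    exact sin_mul_lt (by linarith) (by linarith) (by linarith) hφ2.le
  have c2 : sin φ < (α + 1) / α * sin (2 * α * v) := by
    have e : φ = (α + 1) / α * (2 * α * v) := by rw [hφ]; field_simp
    rw [e] at hφ2 ⊢
    exact sin_mul_lt (by rw [lt_div_iff₀ hα]; linarith) hr0 hr1 hφ2.le
  have l1 := Real.log_lt_log hsφ c1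
  have l2 := Real.log_lt_log hsφ c2
  rw [log_mul (by positivity) hsp.ne'] at l1
  rw [log_mul (by positivity) hsr.ne', Real.log_div (by positivity) hα.ne'] at l2
  have m1 := congrArg Real.log e1
  have m2 := congrArg Real.log e2
  rw [log_mul hA.ne' hsr.ne', Real.log_exp] at m1
  rw [log_mul hB.ne' hsr.ne', log_mul hν0.ne' (exp_pos _).ne', Real.log_exp] at m2
  have hl := Real.log_le_log (nuStar_pos hα) hν
  rw [log_nuStar hα] at hl
  have k : α / (α + 1) * Real.log α * (α + 1) = α * Real.log α := by field_simp
  have l3 := mul_lt_mul_of_pos_left l2 hα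
  have hl' := mul_le_mul_of_nonneg_right hl hα1.le
  nlinarith

theorem symbol_conj (α ν : ℝ) (x v : ℝ) : symbol α ν (x + (-v : ℝ) * I) =
    (starRingEnd ℂ) (symbol α ν (x + v * I)) := by
  refine Complex.ext ?_ ?_
  · rw [Complex.conj_re, symbol_re, symbol_re]; simp
  · rw [conj_im, symbol_im, symbol_im]; simp; ring

theorem symbol_ne_zero_of_abs_lt (hα : 0 < α) (hν : nuStar α ≤ ν) {ζ : ℂ} (h0 : ζ.im ≠ 0)
    (h1 : |ζ.im| < π / (α + 1)) : symbol α ν ζ ≠ 0 := by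
  rw [← Complex.re_add_im ζ]
  rcases lt_or_gt_of_ne h0 with h | h
  · rw [abs_of_neg h] at h1
    have := symbol_ne_zero_of_pos hα hν ζ.re (neg_pos.2 h) h1
    rw [← neg_neg ζ.im, symbol_conj]
    exact (map_ne_zero _).2 this
  · rw [abs_of_pos h] at h1
    exact symbol_ne_zero_of_pos hα hν ζ.re h h1

/-- The logarithm of the point `y_* = α^(-1/(2α+2))`. -/
def minPoint (α : ℝ) : ℝ := -Real.log α / (2 * α + 2)

theorem exp_minPoint (hα : 0 < α) : Real.exp ((2 * α + 2) * minPoint α) = α⁻¹ := by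
  rw [minPoint, mul_div_cancel₀ _ (by positivity), Real.exp_neg, Real.exp_log hα]

theorem nuStar_mul_exp (hα : 0 < α) :
    nuStar α * Real.exp (2 * minPoint α) = 1 + α⁻¹ := by
  rw [← Real.exp_log (nuStar_pos hα), log_nuStar hα, ← Real.exp_add]
  have e : Real.log (α + 1) - α / (α + 1) * Real.log α + 2 * minPoint α =
      Real.log (α + 1) - Real.log α := by
    rw [minPoint]; field_simp; ring
  rw [e, Real.exp_sub, Real.exp_log hα, Real.exp_log (by linarith)]
  field_simp

theorem symbol_ofReal (α ν x : ℝ) : symbol α ν x = (Real.exp (2 * x) *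
    (Real.exp (2 * α * x) + Real.exp (-2 * x) - ν) : ℝ) := by
  rw [symbol]
  push_cast
  have h1 : exp ((2 * α + 2) * x) = exp (2 * x) * exp (2 * α * x) := by
    rw [← exp_add]; congr 1; ring
  have h2 : exp (2 * x) * exp (-2 * x) = 1 := by
    rw [← exp_add, ← Complex.exp_zero]; congr 1; ring
  linear_combination h1 - h2

theorem exp_add_exp_minPoint (hα : 0 < α) :
    Real.exp (2 * α * minPoint α) + Real.exp (-2 * minPoint α) = nuStar α := by
  have h1 := exp_minPoint hα
  have h2 := nuStar_mul_exp hα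
  have h3 := exp_pos (2 * minPoint α)
  have e1 : Real.exp ((2 * α + 2) * minPoint α) =
      Real.exp (2 * α * minPoint α) * Real.exp (2 * minPoint α) := by
    rw [← Real.exp_add]; congr 1; ring
  have e2 : Real.exp (-2 * minPoint α) * Real.exp (2 * minPoint α) = 1 := by
    rw [← Real.exp_add, ← Real.exp_zero]; congr 1; ring
  refine mul_right_cancel₀ h3.ne' ?_
  linarith [e1, e2, h1, h2, add_mul (Real.exp (2 * α * minPoint α)) (Real.exp (-2 * minPoint α))
    (Real.exp (2 * minPoint α))]

/-- The sector `|arg y| < π / (α + 1)`, widened near infinity and slit along the parts of the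
positive axis from the zeros of the potential to `0` and `∞`. -/
def crossingDomain (α ν c : ℝ) : Set ℂ :=
  {ζ | |ζ.im| < π / (α + 1) ∨ c * |ζ.im| < ζ.re - minPoint α} \
    {ζ | ζ.im = 0 ∧ ν ≤ Real.exp (2 * α * ζ.re) + Real.exp (-2 * ζ.re)}

theorem isOpen_crossingDomain (c : ℝ) : IsOpen (crossingDomain α ν c) := by
  have h1 : IsOpen ({ζ : ℂ | |ζ.im| < π / (α + 1)} ∪
      {ζ | c * |ζ.im| < ζ.re - minPoint α}) :=
    (isOpen_lt (by fun_prop) (by fun_prop)).union (isOpen_lt (by fun_prop) (by fun_prop))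
  have h2 : IsClosed ({ζ : ℂ | ζ.im = 0} ∩
      {ζ | ν ≤ Real.exp (2 * α * ζ.re) + Real.exp (-2 * ζ.re)}) :=
    (isClosed_eq Complex.continuous_im continuous_const).inter
      (isClosed_le continuous_const (by fun_prop))
  exact h1.sdiff h2

theorem mem_crossingDomain_of_re_eq (hα : 0 < α) (hν : nuStar α < ν) (c : ℝ) {v : ℝ}
    (hv : |v| < π / (α + 1)) : (minPoint α : ℂ) + v * I ∈ crossingDomain α ν c := by
  refine ⟨Or.inl (by rwa [line_im]), fun h => ?_⟩
  have h2 := h.2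
  rw [line_re, exp_add_exp_minPoint hα] at h2
  linarith

theorem starConvex_crossingDomain (hα : 0 < α) (hν : nuStar α < ν) (c : ℝ) :
    StarConvex ℝ (minPoint α : ℂ) (crossingDomain α ν c) := by
  rw [starConvex_iff_forall_pos (by
    simpa using mem_crossingDomain_of_re_eq hα hν c (v := 0) (by rw [abs_zero]; positivity))]
  rintro ζ ⟨h1, h2⟩ a b ha hb hab
  set x := minPoint α
  have hre : (a • (x : ℂ) + b • ζ).re = a * x + b * ζ.re := by simp
  have him : (a • (x : ℂ) + b • ζ).im = b * ζ.im := by simp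
  have ha1 : a = 1 - b := by linarith
  have hba : |b * ζ.im| = b * |ζ.im| := by rw [abs_mul, abs_of_pos hb]
  refine ⟨?_, ?_⟩
  · rw [mem_ofPred_eq, hre, him, hba]
    rcases h1 with h1 | h1
    · left
      nlinarith [abs_nonneg ζ.im]
    · right
      rw [ha1]
      nlinarith [mul_lt_mul_of_pos_left h1 hb]
  · rintro ⟨h3, h4⟩
    rw [him, mul_eq_zero, or_iff_right hb.ne'] at h3
    rw [hre] at h4
    have h5 : Real.exp (2 * α * ζ.re) + Real.exp (-2 * ζ.re) < ν := by
      by_contra! h; exact h2 ⟨h3, h⟩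
    have key : ∀ k : ℝ, Real.exp (k * (a * x + b * ζ.re)) ≤
        a * Real.exp (k * x) + b * Real.exp (k * ζ.re) := fun k => by
      have := convexOn_exp.2 (mem_univ (k * x)) (mem_univ (k * ζ.re)) ha.le hb.le hab
      simp only [smul_eq_mul] at this
      rwa [show k * (a * x + b * ζ.re) = a * (k * x) + b * (k * ζ.re) by ring]
    have h6 := key (2 * α)
    have h7 := key (-2)
    have h8 : a * Real.exp (2 * α * x) + a * Real.exp (-2 * x) = a * nuStar α := by
      rw [← mul_add, exp_add_exp_minPoint hα]
    have h9 := mul_lt_mul_of_pos_left hν ha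
    have h10 := mul_lt_mul_of_pos_left h5 hb
    have h11 : a * ν + b * ν = ν := by rw [← add_mul, hab, one_mul]
    linarith

theorem exists_symbol_ne_zero_of_mem_crossingDomain (hα : 0 < α) (hν : nuStar α ≤ ν) :
    ∃ c > 0, ∀ ζ ∈ crossingDomain α ν c, symbol α ν ζ ≠ 0 := by
  have hθ : 0 < π / (α + 1) := by positivity
  obtain ⟨R, hR0, hR⟩ := exists_le_exp hα ν (show (0 : ℝ) < 1 / 2 by norm_num)
  refine ⟨(R + |minPoint α|) / (π / (α + 1)), by positivity, ?_⟩
  rintro ζ ⟨h1, h2⟩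
  rcases lt_or_ge |ζ.im| (π / (α + 1)) with h3 | h3
  · by_cases h4 : ζ.im = 0
    · rw [← Complex.re_add_im ζ, h4, Complex.ofReal_zero, zero_mul, add_zero, symbol_ofReal,
        ofReal_ne_zero]
      refine mul_ne_zero (exp_pos _).ne' fun h => h2 ⟨h4, by linarith⟩
    · exact symbol_ne_zero_of_abs_lt hα hν h4 h3
  · have h4 := h1.resolve_left h3.not_gt
    have h5 : R + |minPoint α| ≤ (R + |minPoint α|) / (π / (α + 1)) * |ζ.im| := by
      rw [div_mul_eq_mul_div, le_div_iff₀ hθ]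
      gcongr
    have h6 := norm_symbolError_le ((nuStar_pos hα).le.trans hν)
      (hR ζ.re (by linarith [neg_abs_le (minPoint α)]))
    rw [symbol_eq]
    refine mul_ne_zero (exp_ne_zero _) fun h => ?_
    rw [eq_neg_of_add_eq_zero_right h, norm_neg, norm_one] at h6
    norm_num at h6

theorem argStrip_subset_crossingDomain (hα : 0 < α) {c : ℝ} (hc : 0 < c) {k : ℤ}
    (hk : k = 1 ∨ k = -1) {a : ℝ} (ha : a + |ħ.arg| < π) :
    argStrip α ħ k a (minPoint α + c * (2 * (π / (α + 1)))) ⊆ crossingDomain α ν c := by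
  rintro ζ ⟨h1, h2⟩
  have hα1 : 0 < α + 1 := by linarith
  have e : (α + 1) * (ζ.im - sectorAngle α ħ k) = (α + 1) * ζ.im - k * π - ħ.arg := by
    rw [sectorAngle]; field_simp; ring
  rw [e] at h2
  have h3 : |(α + 1) * ζ.im - k * π| < π := by
    have := abs_add_le ((α + 1) * ζ.im - k * π - ħ.arg) ħ.arg
    rw [sub_add_cancel] at this
    linarith
  obtain ⟨h4, h5⟩ := abs_lt.1 h3
  have h6 : |ζ.im| < 2 * (π / (α + 1)) := by
    rw [← mul_lt_mul_iff_of_pos_left hα1, ← abs_of_pos hα1, ← abs_mul, abs_of_pos hα1,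
      mul_left_comm, mul_div_cancel₀ _ hα1.ne', abs_lt]
    rcases hk with rfl | rfl <;> push_cast at h4 h5 <;> constructor <;> linarith
  refine ⟨Or.inr ?_, fun h => ?_⟩
  · have := mul_lt_mul_of_pos_left h6 hc
    linarith
  · have h7 : ζ.im = 0 := h.1
    rw [h7] at h4 h5
    rcases hk with rfl | rfl <;> push_cast at h4 h5 <;> linarith

end

section

variable {α ν : ℝ} {ħ : ℂ}

/-- On the arc `|y| = y_*` with `0 ≤ v = arg y ≤ v₁` the imaginary part of `-g` grows like
`sin (2 v)`, and the real part is positive near the real axis; the gap between `ν` and `ν_*` enters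
through `s₁ = ν_* / ν₁`. -/
theorem symbol_arc_aux (hα : 0 < α) {ν₁ : ℝ} (hν₁ : nuStar α < ν₁) (hν : ν₁ ≤ ν) {v : ℝ}
    (hv0 : 0 ≤ v) (hv1 : v < π / (α + 1)) (hv2 : v < π / 2) :
    (ν * Real.exp (2 * minPoint α)) * ((1 - nuStar α / ν₁) * sin (2 * v)) ≤
      (-symbol α ν (minPoint α + v * I)).im ∧
    (ν * Real.exp (2 * minPoint α)) * (cos (2 * v) - nuStar α / ν₁) ≤
      (-symbol α ν (minPoint α + v * I)).re := by
  have hα1 : 0 < α + 1 := by linarith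
  have hs := nuStar_pos hα
  have hb := exp_pos (2 * minPoint α)
  have e1 := exp_minPoint hα
  have e2 := nuStar_mul_exp hα
  have hle : nuStar α ≤ nuStar α / ν₁ * ν := by
    rw [div_mul_eq_mul_div, le_div_iff₀ (by linarith)]
    gcongr
  have hle' := mul_le_mul_of_nonneg_right hle hb.le
  have hsin0 : 0 ≤ sin (2 * v) :=
    Real.sin_nonneg_of_nonneg_of_le_pi (by linarith) (by linarith)
  rw [neg_im, neg_re, symbol_im, symbol_re, e1]
  constructor
  · have h1 : sin ((2 * α + 2) * v) ≤ (α + 1) * sin (2 * v) := by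
      rcases eq_or_lt_of_le hv0 with rfl | hv0
      · simp
      · rw [show (2 * α + 2) * v = (α + 1) * (2 * v) by ring]
        rw [lt_div_iff₀ hα1] at hv1
        exact (sin_mul_lt (by linarith) (by linarith) (by linarith) (by linarith)).le
    have h2 := mul_le_mul_of_nonneg_left h1 (inv_pos.2 hα).le
    have h3 : α⁻¹ * ((α + 1) * sin (2 * v)) = (1 + α⁻¹) * sin (2 * v) := by
      field_simp
    rw [h3, ← e2] at h2
    have h4 := mul_le_mul_of_nonneg_right hle' hsin0
    linarith
  · have h1 := mul_le_mul_of_nonneg_left (cos_le_one ((2 * α + 2) * v)) (inv_pos.2 hα).le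
    linarith

/-- The argument of the corners of the crossing path, chosen in `(θ / 2, min θ (π / 2))` for
`θ = π / (α + 1)`. -/
def cornerAngle (α : ℝ) : ℝ :=
  (π / (α + 1) / 2 + min (π / (α + 1)) (π / 2)) / 2

theorem cornerAngle_mem (hα : 0 < α) : π / (α + 1) / 2 < cornerAngle α ∧
    cornerAngle α < π / (α + 1) ∧ cornerAngle α < π / 2 := by
  have h1 : 0 < π / (α + 1) := by positivity
  have h2 : π / (α + 1) < π := div_lt_self pi_pos (by linarith)
  have h3 : π / (α + 1) / 2 < min (π / (α + 1)) (π / 2) :=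
    lt_min (by linarith) (by linarith)
  have h4 := min_le_left (π / (α + 1)) (π / 2)
  have h5 := min_le_right (π / (α + 1)) (π / 2)
  unfold cornerAngle
  refine ⟨by linarith, by linarith, by linarith⟩

/-- A constant for the arc of the crossing path. -/
def arcConst (α ν₁ : ℝ) : ℝ :=
  (1 - nuStar α / ν₁) ^ 2 * cos (cornerAngle α) ^ 2 / 2

theorem arcConst_pos (hα : 0 < α) {ν₁ : ℝ} (hν₁ : nuStar α < ν₁) : 0 < arcConst α ν₁ := by
  have h1 : nuStar α / ν₁ < 1 := (div_lt_one ((nuStar_pos hα).trans hν₁)).2 hν₁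
  obtain ⟨h2, h3, h4⟩ := cornerAngle_mem hα
  have h5 : 0 < π / (α + 1) := by positivity
  have := Real.cos_pos_of_mem_Ioo (x := cornerAngle α) ⟨by linarith, h4⟩
  have : 0 < 1 - nuStar α / ν₁ := by linarith
  unfold arcConst; positivity

/-- On the arc `-g` stays away from the negative axis and its terms do not cancel. -/
theorem symbol_cone_arc (hα : 0 < α) {ν₁ : ℝ} (hν₁ : nuStar α < ν₁) (hν : ν₁ ≤ ν) {v : ℝ}
    (hv : |v| ≤ cornerAngle α) :
    (0 ≤ (-symbol α ν (minPoint α + v * I)).re ∨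
      arcConst α ν₁ * ‖symbol α ν (minPoint α + v * I)‖ ≤
        |(symbol α ν (minPoint α + v * I)).im|) ∧
    arcConst α ν₁ / 2 * (1 + symbolSize α ν (minPoint α)) ≤
      ‖symbol α ν (minPoint α + v * I)‖ := by
  wlog hv0 : 0 ≤ v generalizing v
  · have := this (v := -v) (by rwa [abs_neg]) (by linarith)
    rw [symbol_conj] at this
    simpa only [neg_re, Complex.conj_re, conj_im, abs_neg, RCLike.norm_conj]
      using this
  rw [abs_of_nonneg hv0] at hv
  obtain ⟨h2, h3, h4⟩ := cornerAngle_mem hα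
  obtain ⟨him, hre⟩ := symbol_arc_aux hα hν₁ hν hv0 (hv.trans_lt h3) (hv.trans_lt h4)
  have hn := nuStar_pos hα
  have hs1 : nuStar α / ν₁ < 1 := (div_lt_one (hn.trans hν₁)).2 hν₁
  have hs0 : 0 < nuStar α / ν₁ := div_pos hn (hn.trans hν₁)
  have hκ := arcConst_pos hα hν₁
  have hc0 : 0 < cos (cornerAngle α) := Real.cos_pos_of_mem_Ioo ⟨by linarith, h4⟩
  have hc1 := cos_le_one (cornerAngle α)
  have hcv : cos (cornerAngle α) ≤ cos v :=
    Real.cos_le_cos_of_nonneg_of_le_pi hv0 (by linarith) hv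
  set s₁ := nuStar α / ν₁
  set κ := arcConst α ν₁ with hκdef
  set g := symbol α ν (minPoint α + v * I)
  have hP : 0 < ν * Real.exp (2 * minPoint α) := mul_pos (by linarith) (exp_pos _)
  have hsize : 1 + symbolSize α ν (minPoint α) ≤ 2 * (ν * Real.exp (2 * minPoint α)) := by
    have e2 := nuStar_mul_exp hα
    have := mul_le_mul_of_nonneg_right (hν₁.le.trans hν) (exp_pos (2 * minPoint α)).le
    rw [symbolSize, exp_minPoint hα]
    linarith
  set P := ν * Real.exp (2 * minPoint α)
  have hgN := norm_symbol_le (α := α) (by linarith : 0 ≤ ν) (minPoint α + v * I)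
  rw [line_re] at hgN
  have hc2 : cos (cornerAngle α) ^ 2 ≤ 1 := by nlinarith
  have hκ2 : κ ≤ (1 - s₁) / 2 := by
    rw [hκdef, arcConst]
    have : (1 - s₁) ^ 2 ≤ 1 - s₁ := by nlinarith
    nlinarith [mul_le_mul this hc2 (by positivity) (by linarith)]
  have hre' := re_le_norm (-g)
  have him' := (le_abs_self _).trans (abs_im_le_norm (-g))
  rw [norm_neg] at hre' him'
  -- near the real axis `Re (-g)` is positive, further away `Im (-g)` is large
  rcases le_or_gt ((1 + s₁) / 2) (cos (2 * v)) with h | h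
  · have h5 : P * κ ≤ P * (cos (2 * v) - s₁) := by gcongr; linarith
    exact ⟨Or.inl ((mul_pos hP hκ).le.trans (h5.trans hre)), by nlinarith⟩
  · have hsin1 := Real.sin_le_one (2 * v)
    have hsin0 : 0 ≤ sin (2 * v) :=
      Real.sin_nonneg_of_nonneg_of_le_pi (by linarith) (by linarith)
    have hsq := Real.sin_sq_add_cos_sq (2 * v)
    have hcos : cos (2 * v) = 2 * cos v ^ 2 - 1 := Real.cos_two_mul v
    have hcv2 : cos (cornerAngle α) ^ 2 ≤ cos v ^ 2 := by gcongr
    -- `sin² = (1 - cos) (1 + cos)`, and both factors are bounded below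
    have h6 : (1 - s₁) / 2 * (2 * cos (cornerAngle α) ^ 2) ≤ sin (2 * v) := by
      have := mul_le_mul (by linarith : (1 - s₁) / 2 ≤ 1 - cos (2 * v))
        (by linarith : 2 * cos (cornerAngle α) ^ 2 ≤ 1 + cos (2 * v)) (by positivity)
        (by linarith)
      nlinarith
    have h7 : 2 * κ ≤ (1 - s₁) * sin (2 * v) := by
      have := mul_le_mul_of_nonneg_left h6 (by linarith : 0 ≤ 1 - s₁)
      rw [hκdef, arcConst]
      linarith
    have h8 := (mul_le_mul_of_nonneg_left h7 hP.le).trans him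
    refine ⟨Or.inr ?_, by nlinarith⟩
    rw [← abs_neg, ← neg_im]
    refine le_trans ?_ (le_abs_self _)
    nlinarith

/-- The opening of a sector which contains the terms of the symbol on the lines
`arg y = ± cornerAngle`. -/
def cornerOpening (α : ℝ) : ℝ :=
  max (2 * π - (2 * α + 2) * cornerAngle α) (π - 2 * cornerAngle α)

theorem cornerOpening_mem (hα : 0 < α) : 0 < cornerOpening α ∧ cornerOpening α < π := by
  obtain ⟨h2, h3, h4⟩ := cornerAngle_mem hα
  have hα1 : 0 < α + 1 := by linarith
  have h5 : 0 < π / (α + 1) := by positivity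
  rw [div_div, div_lt_iff₀ (by positivity)] at h2
  exact ⟨lt_max_of_lt_right (by linarith), max_lt (by linarith) (by nlinarith)⟩

theorem symbol_cone_corner (hα : 0 < α) (hν : 0 ≤ ν) {v : ℝ}
    (hv : v = cornerAngle α ∨ v = -cornerAngle α) (x : ℝ) :
    (0 ≤ (symbol α ν (x + v * I)).re ∨ sin (cornerOpening α) *
      ‖symbol α ν (x + v * I)‖ ≤ |(symbol α ν (x + v * I)).im|) ∧
    cos (cornerOpening α / 2) * (1 + symbolSize α ν x) ≤
      ‖symbol α ν (x + v * I)‖ := by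
  obtain ⟨h2, h3, h4⟩ := cornerAngle_mem hα
  have hα1 : 0 < α + 1 := by linarith
  rw [lt_div_iff₀ hα1] at h3
  have i1 : 2 * π - (2 * α + 2) * cornerAngle α ∈ Icc 0 (cornerOpening α) :=
    ⟨by linarith, le_max_left _ _⟩
  have i2 : π - 2 * cornerAngle α ∈ Icc 0 (cornerOpening α) :=
    ⟨by linarith, le_max_right _ _⟩
  rcases hv with rfl | rfl
  · exact symbol_cone hν (cornerOpening_mem hα).2 (Or.inr rfl) i1 i2 1 1 (by push_cast; ring)
      (by push_cast; ring) x
  · exact symbol_cone hν (cornerOpening_mem hα).2 (Or.inl rfl) i1 i2 (-1) 0 (by push_cast; ring)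
      (by push_cast; ring) x

end

section

/-! ### The class of curves from `∞_1` to `∞_{-1}` -/

variable {α ν : ℝ} {ħ : ℂ} {D : Set ℂ} {ρ S : ℂ → ℂ}

/-- The path which comes from infinity on `arg y = cornerAngle`, turns on the circle `|y| = y_*` and
goes back to infinity on `arg y = -cornerAngle`; in the variable `log y`. -/
def crossingPath (α t : ℝ) : ℂ :=
  ((minPoint α + max (1 / t - 3) 0 + max (1 / (1 - t) - 3) 0 : ℝ) : ℂ) +
    ((cornerAngle α * max (-1) (min 1 (3 - 6 * t)) : ℝ) : ℂ) * I

theorem crossingPath_left {t : ℝ} (h0 : 0 < t) (h1 : t ≤ 1 / 3) : crossingPath α t =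
    ((minPoint α - 3 + 1 / t : ℝ) : ℂ) + (cornerAngle α : ℂ) * I := by
  have e1 : 3 ≤ 1 / t := by rw [le_div_iff₀ h0]; linarith
  have e2 : 1 / (1 - t) ≤ 3 := by rw [div_le_iff₀ (by linarith)]; linarith
  rw [crossingPath, max_eq_left (by linarith : 0 ≤ 1 / t - 3),
    max_eq_right (by linarith : 1 / (1 - t) - 3 ≤ 0), min_eq_left (by linarith),
    max_eq_right (by norm_num)]
  push_cast; ring

theorem crossingPath_mid {t : ℝ} (h0 : 1 / 3 ≤ t) (h1 : t ≤ 2 / 3) : crossingPath α t =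
    (minPoint α : ℂ) + ((cornerAngle α * (3 - 6 * t) : ℝ) : ℂ) * I := by
  have e1 : 1 / t ≤ 3 := by rw [div_le_iff₀ (by linarith)]; linarith
  have e2 : 1 / (1 - t) ≤ 3 := by rw [div_le_iff₀ (by linarith)]; linarith
  rw [crossingPath, max_eq_right (by linarith : 1 / t - 3 ≤ 0),
    max_eq_right (by linarith : 1 / (1 - t) - 3 ≤ 0), min_eq_right (by linarith),
    max_eq_right (by linarith), add_zero, add_zero]

theorem crossingPath_right {t : ℝ} (h0 : 2 / 3 ≤ t) (h1 : t < 1) : crossingPath α t =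
    ((minPoint α - 3 + 1 / (1 - t) : ℝ) : ℂ) + ((-cornerAngle α : ℝ) : ℂ) * I := by
  have e1 : 1 / t ≤ 3 := by rw [div_le_iff₀ (by linarith)]; linarith
  have e2 : 3 ≤ 1 / (1 - t) := by rw [le_div_iff₀ (by linarith)]; linarith
  rw [crossingPath, max_eq_right (by linarith : 1 / t - 3 ≤ 0),
    max_eq_left (by linarith : 0 ≤ 1 / (1 - t) - 3), min_eq_right (by linarith),
    max_eq_left (by linarith)]
  push_cast; ring

theorem hasDerivAt_one_div_one_sub {t : ℝ} (h : t < 1) :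
    HasDerivAt (fun t : ℝ => 1 / (1 - t)) (1 / (1 - t) ^ 2) t := by
  have := ((hasDerivAt_id t).const_sub 1).inv (sub_pos.2 h).ne'
  simp only [one_div]
  exact this.congr_deriv (by simp)

theorem hasDerivAt_one_div' {t : ℝ} (h : 0 < t) :
    HasDerivAt (fun t : ℝ => 1 / t) (-(1 / t ^ 2)) t := by
  simpa using hasDerivAt_inv h.ne'

theorem piecewiseSmooth_crossingPath : PiecewiseSmooth (crossingPath α) := by
  refine ⟨{1 / 3, 2 / 3}, fun a b ha hab hb hP => ?_⟩
  have h1 := hP (1 / 3) (by simp)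
  have h2 := hP (2 / 3) (by simp)
  rw [mem_Ioo, not_and, not_lt] at h1 h2
  have line : ∀ {f : ℝ → ℝ} {v : ℝ}, ContDiffOn ℝ ∞ f (Icc a b) →
      ContDiffOn ℝ ∞ (fun t => (f t : ℂ) + (v : ℂ) * I) (Icc a b) := fun hf =>
    (ofRealCLM.contDiff.comp_contDiffOn hf).add contDiffOn_const
  rcases le_or_gt b (1 / 3) with hb3 | hb3
  · exact (line (contDiffOn_const.add (contDiffOn_const.div contDiffOn_id fun x hx =>
      (ha.trans_le hx.1).ne'))).congr fun t ht =>
        crossingPath_left (ha.trans_le ht.1) (ht.2.trans hb3)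
  have ha3 : 1 / 3 ≤ a := by
    by_contra! h; exact absurd (h1 h) (by linarith)
  rcases le_or_gt b (2 / 3) with hb4 | hb4
  · refine ContDiffOn.congr (f := fun t => (minPoint α : ℂ) +
      ((cornerAngle α * (3 - 6 * t) : ℝ) : ℂ) * I) (ContDiffOn.add contDiffOn_const
      (ContDiffOn.mul (ofRealCLM.contDiff.comp_contDiffOn ?_) contDiffOn_const))
      fun t ht => crossingPath_mid (ha3.trans ht.1) (ht.2.trans hb4)
    exact contDiffOn_const.mul (by fun_prop)
  · have ha4 : 2 / 3 ≤ a := by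
      by_contra! h; exact absurd (h2 h) (by linarith)
    exact (line (contDiffOn_const.add (contDiffOn_const.div (contDiffOn_const.sub contDiffOn_id)
      fun x hx => (sub_pos.2 (hx.2.trans_lt hb)).ne'))).congr fun t ht =>
        crossingPath_right (ha4.trans ht.1) (ht.2.trans_lt hb)

theorem crossingPath_re_ge {t : ℝ} :
    minPoint α - 3 + 1 / t ≤ (crossingPath α t).re ∧
      minPoint α - 3 + 1 / (1 - t) ≤ (crossingPath α t).re := by
  rw [crossingPath, line_re]
  constructor <;> linarith [le_max_left (1 / t - 3) 0, le_max_left (1 / (1 - t) - 3) 0,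
    le_max_right (1 / t - 3) 0, le_max_right (1 / (1 - t) - 3) 0]

theorem tendsto_const_add_one_div (c : ℝ) : Tendsto (fun t : ℝ => c + 1 / t) (𝓝[>] 0) atTop := by
  simpa using tendsto_atTop_add_const_left _ c tendsto_inv_nhdsGT_zero

theorem tendsto_const_add_one_div_one_sub (c : ℝ) :
    Tendsto (fun t : ℝ => c + 1 / (1 - t)) (𝓝[<] 1) atTop := by
  simpa using tendsto_atTop_add_const_left _ c tendsto_one_sub_inv

theorem crossingCurve_re (t : ℝ) : (crossingCurve α t).re =
    minPoint α + (1 - 2 * t) ^ 2 / (4 * t * (1 - t)) := line_re _ _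

theorem crossingCurve_im (t : ℝ) : (crossingCurve α t).im = (1 - 2 * t) * π / (α + 1) :=
  line_im _ _

theorem continuousOn_crossingCurve : ContinuousOn (crossingCurve α) (Ioo 0 1) := by
  unfold crossingCurve
  refine ContinuousOn.add (Complex.continuous_ofReal.comp_continuousOn (continuousOn_const.add
    (ContinuousOn.div (by fun_prop) (by fun_prop) fun t ht => ?_))) (by fun_prop)
  have := ht.1
  have := sub_pos.2 ht.2
  positivity

theorem crossingCurve_tendsTo (hα : 0 < α) (hb : |ħ.arg| < π / 4) :
    TendsToBoundary α ħ (𝓝[>] (0 : ℝ)) (crossingCurve α) (.infty 1) ∧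
      TendsToBoundary α ħ (𝓝[<] (1 : ℝ)) (crossingCurve α) (.infty (-1)) := by
  have hα1 : α + 1 ≠ 0 := by positivity
  have hπ := pi_pos
  have e : ∀ t ∈ Ioo (0 : ℝ) 1, (crossingCurve α t).re =
      minPoint α - 1 + 1 / 4 * (1 / t + 1 / (1 - t)) := fun t ht => by
    have := ht.1.ne'
    have := (sub_pos.2 ht.2).ne'
    rw [crossingCurve_re]
    field_simp; ring
  constructor
  · refine tendsTo_infty_of_im hα (v := π / (α + 1)) (b := π / 4) ?_ ?_ ?_
    · refine tendsto_atTop_mono' _ ?_ (tendsto_atTop_add_const_left _ (minPoint α - 1)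
        ((tendsto_const_add_one_div 0).const_mul_atTop (show (0 : ℝ) < 1 / 4 by norm_num)))
      filter_upwards [Ioo_mem_nhdsGT zero_lt_one] with t ht
      have := one_div_pos.2 (sub_pos.2 ht.2)
      rw [e t ht]; linarith
    · filter_upwards [Ioo_mem_nhdsGT (show (0 : ℝ) < 1 / 8 by norm_num)] with t ht
      rw [crossingCurve_im, show (α + 1) * ((1 - 2 * t) * π / (α + 1) - π / (α + 1)) =
        -(2 * t * π) by field_simp; ring, abs_neg,
        abs_of_nonneg (by have := ht.1; positivity)]
      nlinarith [ht.2]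
    · rw [mul_div_cancel₀ _ hα1]; simp; linarith
  · refine tendsTo_infty_of_im hα (v := -(π / (α + 1))) (b := π / 4) ?_ ?_ ?_
    · refine tendsto_atTop_mono' _ ?_ (tendsto_atTop_add_const_left _ (minPoint α - 1)
        ((tendsto_const_add_one_div_one_sub 0).const_mul_atTop (show (0 : ℝ) < 1 / 4 by norm_num)))
      filter_upwards [Ioo_mem_nhdsLT zero_lt_one] with t ht
      have := one_div_pos.2 ht.1
      rw [e t ht]; linarith
    · filter_upwards [Ioo_mem_nhdsLT (show (7 / 8 : ℝ) < 1 by norm_num)] with t ht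
      rw [crossingCurve_im, show (α + 1) * ((1 - 2 * t) * π / (α + 1) - -(π / (α + 1))) =
        2 * (1 - t) * π by field_simp; ring,
        abs_of_nonneg (by have := sub_pos.2 ht.2; positivity)]
      nlinarith [ht.1]
    · rw [mul_neg, mul_div_cancel₀ _ hα1]; simp; linarith

theorem cornerAngle_sub_pi (hα : 0 < α) : |(α + 1) * cornerAngle α - π| < π / 2 := by
  have hα1 : 0 < α + 1 := by linarith
  obtain ⟨h2, h3, h4⟩ := cornerAngle_mem hα
  rw [div_div, div_lt_iff₀ (by positivity)] at h2
  rw [lt_div_iff₀ hα1] at h3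
  rw [abs_lt]
  constructor <;> linarith

theorem crossingPath_tendsTo (hα : 0 < α)
    (hb : |(α + 1) * cornerAngle α - π| + |ħ.arg| < π / 2) :
    TendsToBoundary α ħ (𝓝[>] (0 : ℝ)) (crossingPath α) (.infty 1) ∧
      TendsToBoundary α ħ (𝓝[<] (1 : ℝ)) (crossingPath α) (.infty (-1)) := by
  constructor
  · refine tendsTo_infty_of_im hα (v := cornerAngle α) (b := 0)
      (tendsto_atTop_mono (fun t => crossingPath_re_ge.1) (tendsto_const_add_one_div _)) ?_
      (by simpa using hb)
    filter_upwards [Ioo_mem_nhdsGT (show (0 : ℝ) < 1 / 3 by norm_num)] with t ht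
    rw [crossingPath_left ht.1 ht.2.le, line_im]; simp
  · refine tendsTo_infty_of_im hα (v := -cornerAngle α) (b := 0)
      (tendsto_atTop_mono (fun t => crossingPath_re_ge.2) (tendsto_const_add_one_div_one_sub _)) ?_
      (by
        rw [← abs_neg] at hb
        convert hb using 2
        push_cast
        rw [add_zero]; congr 1; ring)
    filter_upwards [Ioo_mem_nhdsLT (show (2 / 3 : ℝ) < 1 by norm_num)] with t ht
    rw [crossingPath_right ht.1.le ht.2, line_im]; simp

/-- Both curves stay in the upper half of the sector before `t = 1 / 2`, in the lower half
afterwards, and cross the positive axis at `y_*`, so that the segments joining them contain no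
turning point. -/
theorem homotopic_crossingPath (hα : 0 < α) (hν : nuStar α < ν) (hb0 : ħ ≠ 0)
    (hb : |(α + 1) * cornerAngle α - π| + |ħ.arg| < π / 2)
    (hb1 : |ħ.arg| < π / 4) :
    Homotopic α ν ħ (.infty 1) (.infty (-1)) (crossingCurve α) (crossingPath α) := by
  have hα1 : 0 < α + 1 := by linarith
  have hπ := pi_pos
  obtain ⟨h2, h3, h4⟩ := cornerAngle_mem hα
  have hθ : 0 < π / (α + 1) := by positivity
  have hc0 : 0 < cornerAngle α := by linarith
  obtain ⟨c₁, c₂⟩ := crossingCurve_tendsTo (ħ := ħ) hα hb1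
  obtain ⟨d₁, d₂⟩ := crossingPath_tendsTo hα hb
  refine Homotopic.of_segment hα continuousOn_crossingCurve piecewiseSmooth_crossingPath.continuousOn
    (fun t ht a ha => ?_) c₁ d₁ c₂ d₂
  rw [reducedPotential_ne_zero_iff hb0]
  set w := crossingCurve α t + (a : ℂ) * (crossingPath α t - crossingCurve α t) with hw
  have him : w.im = (1 - a) * ((1 - 2 * t) * (π / (α + 1))) +
      a * (cornerAngle α * max (-1) (min 1 (3 - 6 * t))) := by
    rw [hw, add_im, im_ofReal_mul, sub_im, crossingCurve_im, crossingPath,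
      line_im]
    ring
  have ht0 := ht.1
  have ht1 := ht.2
  have comb : ∀ {x y : ℝ}, 0 < x → 0 < y → 0 < (1 - a) * x + a * y := fun {x y} hx hy => by
    rcases eq_or_lt_of_le ha.1 with h | h
    · rw [← h]; linarith
    · have := mul_nonneg (sub_nonneg.2 ha.2) hx.le
      have := mul_pos h hy
      linarith
  have hm1 : max (-1) (min 1 (3 - 6 * t)) ≤ 1 := max_le (by norm_num) (min_le_left _ _)
  have hm2 : -1 ≤ max (-1) (min 1 (3 - 6 * t)) := le_max_left _ _
  have hlt : |w.im| < π / (α + 1) := by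
    have l1 : 0 < (1 - a) * ((2 * t) * (π / (α + 1))) +
      a * (π / (α + 1) - cornerAngle α * max (-1) (min 1 (3 - 6 * t))) :=
        comb (by positivity) (by nlinarith)
    have l2 : 0 < (1 - a) * ((2 - 2 * t) * (π / (α + 1))) +
      a * (π / (α + 1) + cornerAngle α * max (-1) (min 1 (3 - 6 * t))) :=
        comb (mul_pos (by linarith) hθ) (by nlinarith)
    rw [him, abs_lt]
    constructor <;> linarith
  rcases lt_trichotomy t (1 / 2) with h | h | h
  · refine symbol_ne_zero_of_abs_lt hα hν.le (ne_of_gt ?_) hlt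
    rw [him]
    exact comb (mul_pos (by linarith) hθ)
      (mul_pos hc0 (lt_max_of_lt_right (lt_min one_pos (by linarith))))
  · have e : w = (minPoint α : ℝ) := by
      rw [hw, crossingPath_mid (by rw [h]; norm_num) (by rw [h]; norm_num), crossingCurve, h,
        minPoint]
      norm_num
    rw [e, symbol_ofReal, exp_add_exp_minPoint hα, ofReal_ne_zero]
    exact mul_ne_zero (exp_pos _).ne' (by linarith)
  · refine symbol_ne_zero_of_abs_lt hα hν.le (ne_of_lt ?_) hlt
    rw [him, ← neg_pos]
    have := comb (x := (2 * t - 1) * (π / (α + 1)))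
      (y := cornerAngle α * -max (-1) (min 1 (3 - 6 * t))) (mul_pos (by linarith) hθ)
      (mul_pos hc0 (neg_pos.2 (max_lt (by norm_num) (min_lt_of_right_lt (by linarith)))))
    linarith

theorem integrableOn_Ioo_trans {φ : ℝ → ℝ} {a b c K₁ K₂ : ℝ} (hab : a < b) (hbc : b < c)
    (h₁ : IntegrableOn φ (Ioo a b) ∧ ∫ t in Ioo a b, φ t ≤ K₁)
    (h₂ : IntegrableOn φ (Ioo b c) ∧ ∫ t in Ioo b c, φ t ≤ K₂) :
    IntegrableOn φ (Ioo a c) ∧ ∫ t in Ioo a c, φ t ≤ K₁ + K₂ := by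
  obtain ⟨i₁, k₁⟩ := h₁
  obtain ⟨i₂, k₂⟩ := h₂
  rw [← intervalIntegrable_iff_integrableOn_Ioo_of_le hab.le] at i₁
  rw [← intervalIntegrable_iff_integrableOn_Ioo_of_le hbc.le] at i₂
  rw [← integral_Ioc_eq_integral_Ioo, ← intervalIntegral.integral_of_le hab.le] at k₁
  rw [← integral_Ioc_eq_integral_Ioo, ← intervalIntegral.integral_of_le hbc.le] at k₂
  rw [← intervalIntegrable_iff_integrableOn_Ioo_of_le (hab.trans hbc).le,
    ← integral_Ioc_eq_integral_Ioo, ← intervalIntegral.integral_of_le (hab.trans hbc).le,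
    ← intervalIntegral.integral_add_adjacent_intervals i₁ i₂]
  exact ⟨i₁.trans i₂, add_le_add k₁ k₂⟩

end

section

variable {α ν ν₁ : ℝ} {ħ : ℂ} {D : Set ℂ} {ρ S : ℂ → ℂ}

/-- The symbol stays away from the negative axis along the crossing path by this sine. -/
def crossingSin (α ν₁ : ℝ) : ℝ := min (arcConst α ν₁) (sin (cornerOpening α))

/-- The terms of the symbol do not cancel along the crossing path by this factor. -/
def crossingGap (α ν₁ : ℝ) : ℝ := min (arcConst α ν₁ / 2) (cos (cornerOpening α / 2))

theorem crossingSin_mem (hα : 0 < α) (hν₁ : nuStar α < ν₁) :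
    0 < crossingSin α ν₁ ∧ crossingSin α ν₁ ≤ 1 := by
  obtain ⟨h1, h2⟩ := cornerOpening_mem hα
  exact ⟨lt_min (arcConst_pos hα hν₁) (Real.sin_pos_of_pos_of_lt_pi h1 h2),
    (min_le_right _ _).trans (Real.sin_le_one _)⟩

theorem crossingGap_mem (hα : 0 < α) (hν₁ : nuStar α < ν₁) :
    0 < crossingGap α ν₁ ∧ crossingGap α ν₁ ≤ 1 := by
  obtain ⟨h1, h2⟩ := cornerOpening_mem hα
  exact ⟨lt_min (half_pos (arcConst_pos hα hν₁))
    (Real.cos_pos_of_mem_Ioo ⟨by linarith, by linarith⟩),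
    (min_le_right _ _).trans (cos_le_one _)⟩

theorem crossing_cone_corner (hα : 0 < α) (hν : 0 ≤ ν) {v : ℝ}
    (hv : v = cornerAngle α ∨ v = -cornerAngle α) (x : ℝ) :
    (0 ≤ (symbol α ν (x + v * I)).re ∨ crossingSin α ν₁ *
      ‖symbol α ν (x + v * I)‖ ≤ |(symbol α ν (x + v * I)).im|) ∧
    crossingGap α ν₁ * (1 + symbolSize α ν x) ≤ ‖symbol α ν (x + v * I)‖ := by
  obtain ⟨h1, h2⟩ := symbol_cone_corner hα hν hv x
  have hN := symbolSize_nonneg (α := α) hν x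
  refine ⟨h1.imp_right fun h => le_trans ?_ h, le_trans ?_ h2⟩
  · gcongr; exact min_le_right _ _
  · gcongr; exact min_le_right _ _

theorem crossing_cone_arc (hα : 0 < α) (hν₁ : nuStar α < ν₁) (hν : ν₁ ≤ ν) {v : ℝ}
    (hv : |v| ≤ cornerAngle α) :
    (0 ≤ (-symbol α ν (minPoint α + v * I)).re ∨
      crossingSin α ν₁ * ‖symbol α ν (minPoint α + v * I)‖ ≤
        |(symbol α ν (minPoint α + v * I)).im|) ∧
    crossingGap α ν₁ * (1 + symbolSize α ν (minPoint α)) ≤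
      ‖symbol α ν (minPoint α + v * I)‖ := by
  obtain ⟨h1, h2⟩ := symbol_cone_arc hα hν₁ hν hv
  have hN := symbolSize_nonneg (α := α) (((nuStar_pos hα).trans hν₁).le.trans hν) (minPoint α)
  refine ⟨h1.imp_right fun h => le_trans ?_ h, le_trans ?_ h2⟩
  · gcongr; exact min_le_left _ _
  · gcongr; exact min_le_left _ _

/-- At the point `ζ` the real part of the action grows in the direction `e` at least at the rate
`m₀`, and so does its leading part in `ħ`. -/
def ActionGrows (ħ : ℂ) (ρ : ℂ → ℂ) (m₀ : ℝ) (e ζ : ℂ) : Prop :=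
  0 < (ħ * (e * (exp ζ * ρ ζ))).re ∧ m₀ ≤ (e * (exp ζ * ρ ζ)).re

/-- A branch of the action whose real part increases along all three parts of the crossing path. On
the arc `u = -i ħ y √V` has positive real part and `u² = -g`; the sign of `Im (-g)` at the corners
is that of `Im u`, so that `-ħ y √V = -i u` at the first corner and `ħ y √V = i u` at the second
one have positive real part. -/
theorem exists_crossingAction (hα : 0 < α) (hν₁ : nuStar α < ν₁) (hν : ν₁ ≤ ν) (hb : ħ ≠ 0)
    (hre : 3 / 4 * ‖ħ‖ ≤ ħ.re) (him : |ħ.im| ≤ crossingSin α ν₁ / 8 * ‖ħ‖) :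
    ∃ c > 0, ∃ ρ S, IsAction (reducedPotential α ν ħ) (crossingDomain α ν c) ρ S ∧
      ∃ m₀ > 0,
        (∀ v : ℝ, |v| ≤ cornerAngle α →
          ActionGrows ħ ρ m₀ (-I) (minPoint α + v * I)) ∧
        (∀ x : ℝ, ActionGrows ħ ρ m₀ (-1) (x + (cornerAngle α : ℝ) * I)) ∧
        ∀ x : ℝ, ActionGrows ħ ρ m₀ 1 (x + (-cornerAngle α : ℝ) * I) := by
  have hν' : nuStar α < ν := hν₁.trans_le hν
  have hν0 : 0 < ν := (nuStar_pos hα).trans hν'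
  obtain ⟨hμ, hμ1⟩ := crossingSin_mem hα hν₁
  obtain ⟨hs, hs1⟩ := crossingGap_mem hα hν₁
  obtain ⟨c2, c3, c4⟩ := cornerAngle_mem hα
  have hb' := norm_pos_iff.2 hb
  have hθ : 0 < π / (α + 1) := by positivity
  obtain ⟨c, hc, hne⟩ := exists_symbol_ne_zero_of_mem_crossingDomain hα hν'.le
  set v₁ := cornerAngle α with hv₁
  have hv0 : 0 < v₁ := by linarith
  have hmem := fun {v : ℝ} => mem_crossingDomain_of_re_eq hα hν' c (v := v)
  have hz₀ : (minPoint α : ℂ) ∈ crossingDomain α ν c := by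
    simpa using hmem (v := 0) (by rwa [abs_zero])
  obtain ⟨ρ₀, hρ₀, hpos₀⟩ := exists_sq_eq_re_nonneg
    ((reducedPotential_ne_zero_iff hb _).2 (hne _ hz₀))
    (ħ * (-I * exp (minPoint α)))
  obtain ⟨ρ, S, hS, hρz⟩ := exists_isAction (differentiable_reducedPotential α ν ħ)
    (differentiable_coverDeriv_reducedPotential α ν ħ) (isOpen_crossingDomain c) hz₀
    (starConvex_crossingDomain hα hν' c)
    (fun ζ hζ => (reducedPotential_ne_zero_iff hb ζ).2 (hne ζ hζ)) hρ₀
  have hI : (-I) ^ 2 = -1 := by rw [neg_sq, I_sq]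
  have hle : ∀ {x w : ℝ}, crossingGap α ν₁ * (1 + symbolSize α ν x) ≤ w → crossingGap α ν₁ ≤ w :=
    fun {x w} h => le_trans (le_mul_of_one_le_right hs.le
      (by linarith [symbolSize_nonneg (α := α) hν0.le x])) h
  have harc := hS.direction_bound hb hμ hμ1 hs hs1 hre him
    (isPreconnected_Icc : IsPreconnected (Icc (-v₁) v₁))
    (ζ := fun v => minPoint α + v * I) (by fun_prop)
    (fun v hv => hmem ((abs_le.2 hv).trans_lt c3)) (e := -I)
    (fun v hv => by
      rw [hI, neg_one_mul, norm_neg]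
      have := (crossing_cone_arc hα hν₁ hν (abs_le.2 hv)).1
      rwa [neg_im, abs_neg])
    (fun v hv => by
      rw [hI, neg_one_mul, norm_neg]
      exact hle (crossing_cone_arc hα hν₁ hν (abs_le.2 hv)).2)
    (x₀ := 0) ⟨by linarith, hv0.le⟩ (by
      convert hpos₀ using 2
      rw [Complex.ofReal_zero, zero_mul, add_zero, hρz]; ring)
  have hline : ∀ v : ℝ, v ≠ 0 → |v| < π / (α + 1) → ∀ x : ℝ,
      (x : ℂ) + v * I ∈ crossingDomain α ν c := fun v hv hv' x =>
    ⟨Or.inl (by rwa [line_im]), fun h => hv (by simpa only [line_im] using h.1)⟩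
  have hlines : ∀ v : ℝ, (v = v₁ ∨ v = -v₁) → ∀ e : ℂ, e ^ 2 = 1 →
      0 ≤ (ħ * (e * (exp (minPoint α + v * I) *
        ρ (minPoint α + v * I)))).re → ∀ x : ℝ,
      ActionGrows ħ ρ (crossingSin α ν₁ / 4 * (crossingGap α ν₁ / ‖ħ‖)) e
        (x + v * I) := by
    intro v hv e he h0 x
    have habs : |v| = v₁ := by rcases hv with rfl | rfl <;> simp [abs_of_pos hv0]
    exact hS.direction_bound hb hμ hμ1 hs hs1 hre him isPreconnected_univ
      (ζ := fun x => x + v * I) (by fun_prop)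
      (fun x _ => hline v (abs_pos.1 (habs ▸ hv0)) (habs ▸ c3) x) (e := e)
      (fun x _ => by rw [he, one_mul]; exact (crossing_cone_corner hα hν0.le hv x).1)
      (fun x _ => by rw [he, one_mul]; exact hle (crossing_cone_corner hα hν0.le hv x).2)
      (mem_univ (minPoint α)) h0 x (mem_univ x)
  set u : ℝ → ℂ := fun v => ħ * (-I *
    (exp (minPoint α + v * I) * ρ (minPoint α + v * I))) with hu
  have husq : ∀ v ∈ Icc (-v₁) v₁, 2 * ((u v).re * (u v).im) =
      (-symbol α ν (minPoint α + v * I)).im := fun v hv => by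
    have h1 := sq_mul_eq_symbol hb (hS.sq (hmem ((abs_le.2 hv).trans_lt c3)))
    rw [← h1, show ∀ w : ℂ, -(ħ * w) ^ 2 = ħ * (-I * w) * (ħ * (-I * w))
      from fun w => by linear_combination (ħ * w) ^ 2 * -I_sq]
    show _ = (u v * u v).im
    rw [mul_im (u v) (u v)]
    ring
  have i1 : v₁ ∈ Icc (-v₁) v₁ := ⟨by linarith, le_rfl⟩
  have i2 : -v₁ ∈ Icc (-v₁) v₁ := ⟨le_rfl, by linarith⟩
  have hIm : 0 < (-symbol α ν (minPoint α + v₁ * I)).im := by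
    refine lt_of_lt_of_le ?_ (symbol_arc_aux hα hν₁ hν hv0.le c3 c4).1
    have h1 : nuStar α / ν₁ < 1 := (div_lt_one ((nuStar_pos hα).trans hν₁)).2 hν₁
    have h2 := Real.sin_pos_of_pos_of_lt_pi (x := 2 * v₁) (by linarith) (by linarith)
    have h3 : 0 < 1 - nuStar α / ν₁ := by linarith
    positivity
  refine ⟨c, hc, ρ, S, hS, crossingSin α ν₁ / 4 * (crossingGap α ν₁ / ‖ħ‖), by positivity,
    fun v hv => harc v (abs_le.1 hv), hlines v₁ (Or.inl rfl) (-1) (by norm_num) ?_,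
    hlines (-v₁) (Or.inr rfl) 1 (by norm_num) ?_⟩
  · have h1 := husq v₁ i1
    have h2 : 0 < (u v₁).im := by
      by_contra! h
      have := mul_nonpos_of_nonneg_of_nonpos (harc v₁ i1).1.le h
      linarith
    rw [show ∀ w : ℂ, ħ * (-1 * w) = ħ * (-I * w) * -I from fun w => by
      linear_combination (-ħ * w) * I_sq]
    show 0 ≤ (u v₁ * -I).re
    simpa using h2.le
  · have h1 := husq (-v₁) i2
    rw [symbol_conj, ← map_neg, conj_im] at h1
    have h2 : (u (-v₁)).im < 0 := by
      by_contra! h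
      have := mul_nonneg (harc (-v₁) i2).1.le h
      linarith
    rw [show ∀ w : ℂ, ħ * (1 * w) = ħ * (-I * w) * I from fun w => by
      linear_combination (ħ * w) * I_sq]
    show 0 ≤ (u (-v₁) * I).re
    simpa using h2.le

/-- The forcing term along the crossing path; the three terms are the contributions of the two lines
and of the arc. -/
theorem integral_forcing_crossingPath_le (hα : 0 < α) (hν₁ : nuStar α < ν₁) (hν : ν₁ ≤ ν)
    (hb : ħ ≠ 0) {r : ℝ → ℂ}
    (hmeas : AEStronglyMeasurable (forcingDensity α ν ħ (crossingPath α) r)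
      (volume.restrict (Ioo 0 1)))
    (hr : ∀ t ∈ Ioo (0 : ℝ) 1, r t ^ 2 = reducedPotential α ν ħ (crossingPath α t)) :
    IntegrableOn (fun t => ‖forcing (potential α ν ħ) (reducedPotential α ν ħ)
      (crossingPath α t) (r t)‖ * ‖velocity (crossingPath α) t‖) (Ioo 0 1) ∧
    ∫ t in Ioo 0 1, ‖forcing (potential α ν ħ) (reducedPotential α ν ħ)
      (crossingPath α t) (r t)‖ * ‖velocity (crossingPath α) t‖ ≤
        ‖ħ‖ * forcingConst α (crossingGap α ν₁) + ‖ħ‖ * forcingConst α (crossingGap α ν₁) * 4 +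
          ‖ħ‖ * forcingConst α (crossingGap α ν₁) := by
  have hν0 : 0 < ν := ((nuStar_pos hα).trans hν₁).trans_le hν
  obtain ⟨hs, hs1⟩ := crossingGap_mem hα hν₁
  have hfc := forcingConst_pos hα hs
  obtain ⟨c2, c3, c4⟩ := cornerAngle_mem hα
  have hv0 : 0 < cornerAngle α := by
    have : 0 < π / (α + 1) := by positivity
    linarith
  have s1 : Ioo (0 : ℝ) (1 / 3) ⊆ Ioo 0 1 := Ioo_subset_Ioo le_rfl (by norm_num)
  have s2 : Ioo (1 / 3 : ℝ) (2 / 3) ⊆ Ioo 0 1 := Ioo_subset_Ioo (by norm_num) (by norm_num)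
  have s3 : Ioo (2 / 3 : ℝ) 1 ⊆ Ioo 0 1 := Ioo_subset_Ioo (by norm_num) le_rfl
  have hcorner := fun {v : ℝ} hv x => (crossing_cone_corner (ν₁ := ν₁) (v := v) hα hν0.le hv x).2
  refine integrableOn_Ioo_trans (b := 2 / 3) (by norm_num) (by norm_num)
    (integrableOn_Ioo_trans (b := 1 / 3) (by norm_num) (by norm_num) ?_ ?_) ?_
  · refine integral_forcing_horizontal_le hα hν0.le hb (by norm_num) (ε := -1) (v := cornerAngle α)
      (f := fun t => 3 - minPoint α - 1 / t) (f' := fun t => 1 / t ^ 2) (Or.inr rfl)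
      (hmeas.mono_set s1) (fun t ht => hr t (s1 ht)) (fun t ht => ?_) (fun t ht => ?_)
      (fun t ht => by have := ht.1; positivity) hs (fun t ht => ?_)
    · rw [crossingPath_left ht.1 ht.2.le]
      congr 2; ring
    · exact ((hasDerivAt_one_div' ht.1).const_sub _).congr_deriv (neg_neg _)
    · rw [crossingPath_left ht.1 ht.2.le, line_re]
      exact hcorner (Or.inl rfl) _
  · have hG : ∀ t : ℝ, HasDerivAt (fun t : ℝ => 3 * t - 1) 3 t := fun t => by
      simpa using ((hasDerivAt_id t).const_mul 3).sub_const 1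
    refine integrableOn_of_le_deriv (G := fun t => 3 * t - 1) (E := ∅) (by norm_num)
      countable_empty (by simpa only [forcingDensity, norm_mul] using (hmeas.mono_set s2).norm)
      (fun t _ => mul_nonneg (norm_nonneg _) (norm_nonneg _))
      (fun x _ y _ hxy => by simp only; linarith) (fun t ht => by linarith [ht.1])
      (fun t ht => by linarith [ht.2]) (by positivity) fun t ht => ?_
    have ht := ht.1
    have hd : HasDerivAt (crossingPath α) (((cornerAngle α * -6 : ℝ) : ℂ) * I) t := by
      have h1 : HasDerivAt (fun t : ℝ => cornerAngle α * (3 - 6 * t)) (cornerAngle α * -6) t := by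
        simpa using (((hasDerivAt_id t).const_mul 6).const_sub 3).const_mul (cornerAngle α)
      refine ((h1.ofReal_comp.mul_const I).const_add
        (minPoint α : ℂ)).congr_of_eventuallyEq ?_
      filter_upwards [isOpen_Ioo.mem_nhds ht] with x hx using crossingPath_mid hx.1.le hx.2.le
    have hn : ‖((cornerAngle α * -6 : ℝ) : ℂ) * I‖ ≤ 12 := by
      rw [norm_mul, Complex.norm_I, mul_one, norm_real, norm_eq_abs, abs_mul,
        abs_of_pos hv0, abs_neg, abs_of_pos (by norm_num)]
      linarith [Real.pi_le_four]
    have hF := norm_forcing_le hα hν0.le hb (hr t (s2 ht)) hs (by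
      rw [crossingPath_mid ht.1.le ht.2.le, line_re]
      refine (crossing_cone_arc hα hν₁ hν ?_).2
      rw [abs_mul, abs_of_pos hv0]
      exact mul_le_of_le_one_right hv0.le (abs_le.2 ⟨by linarith [ht.2], by linarith [ht.1]⟩))
    have hN := symbolSize_nonneg (α := α) hν0.le (crossingPath α t).re
    have hq : symbolSize α ν (crossingPath α t).re / ((1 + symbolSize α ν (crossingPath α t).re) *
        sqrt (1 + symbolSize α ν (crossingPath α t).re)) ≤ 1 := by
      have h1 : 1 ≤ sqrt (1 + symbolSize α ν (crossingPath α t).re) :=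
        Real.one_le_sqrt.2 (by linarith)
      rw [div_le_one (by positivity)]
      nlinarith
    rw [(hG t).deriv, velocity_eq hd, norm_mul (exp _), ← mul_assoc, ← norm_mul]
    calc _ ≤ ‖ħ‖ * forcingConst α (crossingGap α ν₁) * 1 * 12 := by
          refine mul_le_mul (hF.trans ?_) hn (norm_nonneg _) (by positivity)
          gcongr
      _ = _ := by ring
  · refine integral_forcing_horizontal_le hα hν0.le hb (by norm_num) (ε := 1) (v := -cornerAngle α)
      (f := fun t => minPoint α - 3 + 1 / (1 - t)) (f' := fun t => 1 / (1 - t) ^ 2) (Or.inl rfl)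
      (hmeas.mono_set s3) (fun t ht => hr t (s3 ht)) (fun t ht => ?_) (fun t ht => ?_)
      (fun t ht => by have := sub_pos.2 ht.2; positivity) hs (fun t ht => ?_)
    · rw [crossingPath_right ht.1.le ht.2, one_mul]
    · exact (hasDerivAt_one_div_one_sub ht.2).const_add _
    · rw [crossingPath_right ht.1.le ht.2, line_re]
      exact hcorner (Or.inr rfl) _

end

section

variable {α ν ν₁ : ℝ} {ħ : ℂ} {D : Set ℂ} {ρ S : ℂ → ℂ}

theorem realization_and_value_crossing (hα : 0 < α) (hν₁ : nuStar α < ν₁) (hν : ν₁ ≤ ν)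
    (hb : ħ ≠ 0) (harg : |ħ.arg| ≤ min (crossingSin α ν₁ / 8)
      ((π / 2 - |(α + 1) * cornerAngle α - π|) / 4)) :
    HasTrajectoryRealization α ν ħ (.infty 1) (.infty (-1)) (crossingCurve α) ∧
      ∃ z, IsEndpointValue α ν ħ (.infty 1) (.infty (-1)) (crossingCurve α) z ∧
        ‖z - 1‖ ≤ ‖ħ‖ * (6 * forcingConst α (crossingGap α ν₁)) *
          Real.exp (4 * (‖ħ‖ * (6 * forcingConst α (crossingGap α ν₁)))) := by
  have hα1 : 0 < α + 1 := by linarith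
  have hν' : nuStar α < ν := hν₁.trans_le hν
  have hν0 : 0 < ν := (nuStar_pos hα).trans hν'
  have hπ := Real.pi_gt_three
  have hμ1 := (crossingSin_mem hα hν₁).2
  have harg1 := harg.trans (min_le_left _ _)
  have harg2 := harg.trans (min_le_right _ _)
  have hτ := cornerAngle_sub_pi hα
  have hτ0 := abs_nonneg ((α + 1) * cornerAngle α - π)
  obtain ⟨hre, him⟩ := arg_bounds (by linarith) harg1
  obtain ⟨c, hc, ρ, S, hS, m₀, hm₀, hmid, hup, hlo⟩ := exists_crossingAction hα hν₁ hν hb hre him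
  obtain ⟨c2, c3, c4⟩ := cornerAngle_mem hα
  have hv0 : 0 < cornerAngle α := by
    have : 0 < π / (α + 1) := by positivity
    linarith
  have habs : ∀ {t : ℝ}, 1 / 3 ≤ t → t ≤ 2 / 3 → |cornerAngle α * (3 - 6 * t)| ≤ cornerAngle α :=
    fun {t} h0 h1 => by
      rw [abs_mul, abs_of_pos hv0]
      exact mul_le_of_le_one_right hv0.le (abs_le.2 ⟨by linarith, by linarith⟩)
  have hγD : MapsTo (crossingPath α) (Ioo 0 1) (crossingDomain α ν c) := by
    have hline : ∀ {v : ℝ}, v ≠ 0 → |v| < π / (α + 1) → ∀ x : ℝ,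
        (x : ℂ) + v * I ∈ crossingDomain α ν c := fun {v} hv hv' x =>
      ⟨Or.inl (by rwa [line_im]), fun h => hv (by simpa only [line_im] using h.1)⟩
    intro t ht
    rcases le_total t (1 / 3) with h | h
    · rw [crossingPath_left ht.1 h]
      exact hline hv0.ne' (by rwa [abs_of_pos hv0]) _
    rcases le_total t (2 / 3) with h' | h'
    · rw [crossingPath_mid h h']
      exact mem_crossingDomain_of_re_eq hα hν' c ((habs h h').trans_lt c3)
    · rw [crossingPath_right h' ht.2]
      exact hline (neg_ne_zero.2 hv0.ne') (by rwa [abs_neg, abs_of_pos hv0]) _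
  have hps := piecewiseSmooth_crossingPath (α := α)
  have s1 : Ioc (0 : ℝ) (1 / 3) ⊆ Ioo 0 1 := fun t ht => ⟨ht.1, ht.2.trans_lt (by norm_num)⟩
  have s2 : Icc (1 / 3 : ℝ) (2 / 3) ⊆ Ioo 0 1 := fun t ht =>
    ⟨lt_of_lt_of_le (by norm_num) ht.1, ht.2.trans_lt (by norm_num)⟩
  have s3 : Ico (2 / 3 : ℝ) 1 ⊆ Ioo 0 1 := fun t ht => ⟨lt_of_lt_of_le (by norm_num) ht.1, ht.2⟩
  -- `Re S` increases on the first line, on the arc, and on the second line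
  have m1 := (hS.strictMonoOn_of_direction (convex_Ioc 0 (1 / 3)) (hps.continuousOn.mono s1)
    (hγD.mono_left s1) (f := fun t => -(1 / t)) (f' := fun t => 1 / t ^ 2) (e := -1) hm₀
    (fun t ht => ((hasDerivAt_one_div' ht.1).neg).continuousAt.continuousWithinAt)
    (by
      rw [interior_Ioc]
      exact fun t ht => ((hasDerivAt_one_div' ht.1).neg).congr_deriv (neg_neg _))
    (by
      rw [interior_Ioc]
      intro t ht
      refine ((((hasDerivAt_one_div' ht.1).const_add (minPoint α - 3)).ofReal_comp.add_const
        ((cornerAngle α : ℂ) * I)).congr_of_eventuallyEq ?_).congr_deriv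
          (by push_cast; ring)
      filter_upwards [isOpen_Ioo.mem_nhds ht] with x hx using crossingPath_left hx.1 hx.2.le)
    (by rw [interior_Ioc]; exact fun t ht => by have := ht.1; positivity)
    (fun t ht => by rw [crossingPath_left ht.1 ht.2]; exact (hup _).2)).2
  have m2 := (hS.strictMonoOn_of_direction (convex_Icc (1 / 3) (2 / 3)) (hps.continuousOn.mono s2)
    (hγD.mono_left s2) (f := fun t => cornerAngle α * (6 * t))
    (f' := fun _ => cornerAngle α * 6) (e := -I) hm₀ (by fun_prop)
    (fun t _ => by simpa using ((hasDerivAt_id t).const_mul 6).const_mul (cornerAngle α))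
    (by
      rw [interior_Icc]
      intro t ht
      have h1 : HasDerivAt (fun t : ℝ => cornerAngle α * (3 - 6 * t)) (cornerAngle α * -6) t := by
        simpa using (((hasDerivAt_id t).const_mul 6).const_sub 3).const_mul (cornerAngle α)
      refine (((h1.ofReal_comp.mul_const I).const_add
        (minPoint α : ℂ)).congr_of_eventuallyEq ?_).congr_deriv (by push_cast; ring)
      filter_upwards [isOpen_Ioo.mem_nhds ht] with x hx using crossingPath_mid hx.1.le hx.2.le)
    (fun _ _ => by positivity)
    (fun t ht => by rw [crossingPath_mid ht.1 ht.2]; exact (hmid _ (habs ht.1 ht.2)).2)).2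
  obtain ⟨m3', m3⟩ := hS.strictMonoOn_of_direction (convex_Ico (2 / 3) 1) (hps.continuousOn.mono s3)
    (hγD.mono_left s3) (f := fun t => 0 + 1 / (1 - t)) (f' := fun t => 1 / (1 - t) ^ 2) (e := 1)
    hm₀ (fun t ht =>
      ((hasDerivAt_one_div_one_sub ht.2).const_add 0).continuousAt.continuousWithinAt)
    (by
      rw [interior_Ico]
      exact fun t ht => (hasDerivAt_one_div_one_sub ht.2).const_add 0)
    (by
      rw [interior_Ico]
      intro t ht
      refine ((((hasDerivAt_one_div_one_sub ht.2).const_add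
        (minPoint α - 3)).ofReal_comp.add_const (((-cornerAngle α : ℝ) : ℂ) *
          I)).congr_of_eventuallyEq ?_).congr_deriv (mul_one _).symm
      filter_upwards [isOpen_Ioo.mem_nhds ht] with x hx using crossingPath_right hx.1.le hx.2)
    (by rw [interior_Ico]; exact fun t ht => by have := sub_pos.2 ht.2; positivity)
    (fun t ht => by rw [crossingPath_right ht.1 ht.2]; exact (hlo _).2)
  have hmono : StrictMonoOn (fun t => (S (crossingPath α t)).re) (Ioo 0 1) := by
    have h12 := m1.union m2 (c := 1 / 3) ⟨⟨by norm_num, le_rfl⟩, fun t ht => ht.2⟩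
      ⟨⟨le_rfl, by norm_num⟩, fun t ht => ht.1⟩
    rw [Ioc_union_Icc_eq_Ioc (by norm_num) (by norm_num)] at h12
    have h123 := h12.union m3 (c := 2 / 3) ⟨⟨by norm_num, le_rfl⟩, fun t ht => ht.2⟩
      ⟨⟨le_rfl, by norm_num⟩, fun t ht => ht.1⟩
    rwa [Ioc_union_Ico_eq_Ioo (by norm_num) (by norm_num)] at h123
  have hlev : Tendsto (fun t => (S (crossingPath α t)).re) (𝓝[<] 1) atTop := by
    refine tendsto_atTop_mono' _ ?_ (tendsto_atTop_add_const_left _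
      ((S (crossingPath α (2 / 3))).re - m₀ * (0 + 1 / (1 - 2 / 3)))
      ((tendsto_const_add_one_div_one_sub 0).const_mul_atTop hm₀))
    filter_upwards [Ioo_mem_nhdsLT (show (2 / 3 : ℝ) < 1 by norm_num)] with t ht
    have := m3' (a := 2 / 3) (b := t) ⟨le_rfl, by norm_num⟩ ⟨ht.1.le, ht.2⟩ ht.1.le
    simp only at this
    linarith
  have hsum : |(α + 1) * cornerAngle α - π| + |ħ.arg| < π / 2 := by linarith
  obtain ⟨hp, hq⟩ := crossingPath_tendsTo hα hsum
  obtain ⟨W, hW⟩ := hS.branch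
  obtain ⟨hint, hintm⟩ := integral_forcing_crossingPath_le hα hν₁ hν hb
    (r := fun t => ρ (crossingPath α t))
    (hps.aestronglyMeasurable_forcingDensity (hW.isWKBLift hγD)) (fun t ht => hS.sq (hγD ht))
  -- an opening between that of the corners and `π / 2`, for the horizontal trajectories to `∞_{±1}`
  set a := (|(α + 1) * cornerAngle α - π| + π / 2) / 2 with ha
  obtain ⟨X₁, hX₁⟩ := hS.exists_tail_line (γ := crossingPath α) hα hν0.le hb 1 (v := cornerAngle α)
    (θ := a) (by linarith) (by rw [Int.cast_one, one_mul]; linarith)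
    (argStrip_subset_crossingDomain hα hc (Or.inl rfl) (by linarith))
  obtain ⟨X₂, hX₂⟩ := hS.exists_tail_line (γ := crossingPath α) hα hν0.le hb (-1)
    (v := -cornerAngle α) (θ := a) (by linarith) (by
      rw [show (α + 1) * -cornerAngle α - ((-1 : ℤ) : ℝ) * π =
        -((α + 1) * cornerAngle α - π) by push_cast; ring, abs_neg]
      linarith)
    (argStrip_subset_crossingDomain hα hc (Or.inr rfl) (by linarith))
  obtain ⟨A, hA0, hA1, hA⟩ := exists_Ioc_of_tendsto (tendsto_const_add_one_div (minPoint α - 3))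
    (max X₁ (minPoint α))
  obtain ⟨B, hB0, hB1, hB⟩ := exists_Ico_of_tendsto
    (tendsto_const_add_one_div_one_sub (minPoint α - 3)) (max X₂ (minPoint α))
  have hA3 : ∀ t ∈ Ioc 0 A, t ≤ 1 / 3 := fun t ht => by
    have h1 := (le_max_right _ _).trans_lt (hA t ht)
    have h2 : 3 < 1 / t := by linarith
    rw [lt_div_iff₀ ht.1] at h2
    linarith
  have hB3 : ∀ t ∈ Ico B 1, 2 / 3 ≤ t := fun t ht => by
    have h1 := (le_max_right _ _).trans_lt (hB t ht)
    have h2 : 3 < 1 / (1 - t) := by linarith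
    rw [lt_div_iff₀ (sub_pos.2 ht.2)] at h2
    linarith
  have hAm : A ∈ Ioc 0 A := ⟨hA0, le_rfl⟩
  have hBm : B ∈ Ico B 1 := ⟨le_rfl, hB1⟩
  obtain ⟨c₁, hc₁⟩ := hX₁ (isClock_start hA0) _ (fun t ht => crossingPath_left ht.1 (hA3 t ht))
    (fun t ht => (le_max_left _ _).trans_lt (hA t ht)) (by
      have := (hup (minPoint α - 3 + 1 / A)).1.le
      rw [crossingPath_left hA0 (hA3 A hAm), Complex.ofReal_neg, ofReal_one]
      exact this)
  obtain ⟨c₂, hc₂⟩ := hX₂ (isClock_finish hB1) _ (fun t ht => crossingPath_right (hB3 t ht) ht.2)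
    (fun t ht => (le_max_left _ _).trans_lt (hB t ht)) (by
      have := (hlo (minPoint α - 3 + 1 / (1 - B))).1.le
      rw [crossingPath_right (hB3 B hBm) hB1, ofReal_one]
      exact this)
  exact hS.realization_and_value hα hν0.le hb (by linarith [norm_nonneg ħ]) hA0 (by linarith) hB1
    (by simp) (homotopic_crossingPath hα hν' hb hsum (by linarith)) hps hγD hp hq hmono hlev hint
    (hintm.trans_eq (by ring)) (fun h => by simp at h) hc₁ hc₂

/-- A bound for `|arg ħ| ≤ c₀` gives a bound linear in `|ħ|`, with a constant independent of `C`,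
for `|arg ħ| ≤ C |ħ|` and small `|ħ|`. -/
theorem exists_uniform_bound {ι : Type*} {c₀ K₀ : ℝ} (hc₀ : 0 < c₀) (hK₀ : 0 < K₀)
    {P : ℂ → ι → Prop} {Q : ℂ → ι → ℂ → Prop} {N : Set ι}
    (h : ∀ ħ : ℂ, ħ ≠ 0 → |ħ.arg| ≤ c₀ → ∀ i ∈ N, P ħ i ∧
      ∃ z, Q ħ i z ∧ ‖z - 1‖ ≤ ‖ħ‖ * K₀ * Real.exp (4 * (‖ħ‖ * K₀))) :
    ∃ K : ℝ, 0 < K ∧ ∀ C : ℝ, 0 < C → ∃ δ : ℝ, 0 < δ ∧ ∀ ħ : ℂ, ħ ≠ 0 → ‖ħ‖ < δ →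
      |ħ.arg| ≤ C * ‖ħ‖ → ∀ i ∈ N, P ħ i ∧ ∃ z, Q ħ i z ∧ ‖z - 1‖ ≤ K * ‖ħ‖ := by
  refine ⟨K₀ * Real.exp (4 * K₀), by positivity, fun C hC => ⟨min 1 (c₀ / C), by positivity,
    fun ħ hb hlt harg i hi => ?_⟩⟩
  have h1 := hlt.le.trans (min_le_left _ _)
  have h2 := hlt.le.trans (min_le_right _ _)
  rw [le_div_iff₀' hC] at h2
  obtain ⟨hP, z, hz, hle⟩ := h ħ hb (harg.trans h2) i hi
  refine ⟨hP, z, hz, hle.trans ?_⟩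
  have h3 : ‖ħ‖ * K₀ ≤ K₀ := mul_le_of_le_one_left hK₀.le h1
  rw [mul_assoc, mul_comm]
  gcongr

end

end WKB

end

theorem mainTheorem12 (α : ℝ) (hα : 0 < α) :
    (∃ K : ℝ, 0 < K ∧ ∀ C : ℝ, 0 < C → ∃ δ : ℝ, 0 < δ ∧
      ∀ hbar : ℂ, hbar ≠ 0 → ‖hbar‖ < δ → |hbar.arg| ≤ C * ‖hbar‖ →
      ∀ ν : ℝ, WKB.nuStar α ≤ ν → ∀ k : ℤ, k = 1 ∨ k = -1 →
        WKB.HasTrajectoryRealization α ν hbar (.infty k) .zero (WKB.rayCurve α k) ∧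
        ∃ z : ℂ, WKB.IsEndpointValue α ν hbar (.infty k) .zero (WKB.rayCurve α k) z ∧
          ‖z - 1‖ ≤ K * ‖hbar‖) ∧
    (∀ ν₁ : ℝ, WKB.nuStar α < ν₁ →
      ∃ K : ℝ, 0 < K ∧ ∀ C : ℝ, 0 < C → ∃ δ : ℝ, 0 < δ ∧
      ∀ hbar : ℂ, hbar ≠ 0 → ‖hbar‖ < δ → |hbar.arg| ≤ C * ‖hbar‖ →
      ∀ ν : ℝ, ν₁ ≤ ν →
        WKB.HasTrajectoryRealization α ν hbar (.infty 1) (.infty (-1)) (WKB.crossingCurve α) ∧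
        ∃ z : ℂ, WKB.IsEndpointValue α ν hbar (.infty 1) (.infty (-1)) (WKB.crossingCurve α) z ∧
          ‖z - 1‖ ≤ K * ‖hbar‖) := by
  constructor
  · have hs := WKB.cos_rayOpening_pos hα
    obtain ⟨K, hK, h⟩ := WKB.exists_uniform_bound (ι := ℝ × ℤ)
      (c₀ := min (Real.sin (WKB.rayOpening α) / 8) ((α + 1) * WKB.rayWidth α / 4))
      (lt_min (div_pos (WKB.sin_rayOpening_pos hα) (by norm_num))
        (div_pos (mul_pos (by linarith) (WKB.rayWidth_pos hα)) (by norm_num)))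
      (WKB.forcingConst_pos hα hs) (N := {i | WKB.nuStar α ≤ i.1 ∧ (i.2 = 1 ∨ i.2 = -1)})
      fun hbar hb harg i hi => WKB.realization_and_value_ray (k := i.2) hα
        ((WKB.nuStar_pos hα).le.trans hi.1) hb hi.2 harg
    refine ⟨K, hK, fun C hC => ?_⟩
    obtain ⟨δ, hδ, h'⟩ := h C hC
    exact ⟨δ, hδ, fun hbar hb hlt harg ν hν k hk => h' hbar hb hlt harg (ν, k) ⟨hν, hk⟩⟩
  · intro ν₁ hν₁
    have hs := (WKB.crossingGap_mem hα hν₁).1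
    exact WKB.exists_uniform_bound
      (c₀ := min (WKB.crossingSin α ν₁ / 8)
        ((Real.pi / 2 - |(α + 1) * WKB.cornerAngle α - Real.pi|) / 4))
      (lt_min (div_pos (WKB.crossingSin_mem hα hν₁).1 (by norm_num))
        (div_pos (sub_pos.2 (WKB.cornerAngle_sub_pi hα)) (by norm_num)))
      (mul_pos (by norm_num) (WKB.forcingConst_pos hα hs)) (N := Set.Ici ν₁)
      fun hbar hb harg ν hν => WKB.realization_and_value_crossing hα hν₁ hν hb harg
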